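/- **Setting.** An instance of range-based fair $k$-center consists of a metric space $(X,d)$, an integer $k\ge 1$, a set $S\subseteq X$ of $n$ points that is partitioned into $m$ demographic groups $S_1,\dots,S_m$, and integers $0\le l_i\le u_i\le |S_i|$ with $\sum_i l_i\le k\le \sum_i u_i$. A feasible (fair) solution is a set $C\subseteq S$ with $|C|=k$ and $l_i\le |C\cap S_i|\le u_i$ for all $i$; its cost is $\max_{s\in S}\min_{c\in C}d(s,c)$, and $\mathsf{OPT}$ is the least cost of a feasible solution. A one-pass streaming algorithm is given $k$, $m$, $\varepsilon$, $(l_i)_i$, $(u_i)_i$ (but not $n$), reads the points of $S$ (with their groups) one after the other in an arbitrary order, and then outputs a set of stored points. It is a fixed program of a machine with unit-cost operations: addition, subtraction and comparison of natural numbers, field operations and comparison of real numbers, reading and writing array entries, copying stored points, reading the group of a stored point, and querying the distance of two stored points. **Theorem.** There are a one-pass streaming algorithm for range-based fair $k$-center and constants $c_1,c_2,c_3$ such that for every $0<\varepsilon\le \frac12$, for every instance and every order of the stream, the algorithm terminates and outputs a feasible solution of cost at most $(13+c_1\varepsilon)\cdot\mathsf{OPT}$, it stores at most $c_2\cdot km\,\frac{\log(1/\varepsilon)}{\varepsilon}$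 points, and its total running time is at most $c_3\cdot nk\,\frac{\log(1/\varepsilon)}{\varepsilon}$. -/

import Mathlib

namespace FairStream

/-! ### The range-based fair `k`-center problem -/

/-- The data of range-based fair `k`-center on a stream `s` of distinct points with labels in `Fin m`:
the points arrive in the (arbitrary) order of the list, `group x` is the demographic group of `x`,
`l i` and `u i` bound the number of centers taken from group `i`. -/
structure IsInstance {X : Type*} (k m : ℕ) (group : X → Fin m) (l u : Fin m → ℕ)
    (s : List X) : Prop where
  nodup : s.Nodup
  one_le_k : 1 ≤ k
  sum_l_le : ∑ i, l i ≤ k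
  le_sum_u : k ≤ ∑ i, u i
  l_le_u : ∀ i, l i ≤ u i
  u_le_group : ∀ i, u i ≤ {x | x ∈ s ∧ group x = i}.ncard

/-- `C` is a feasible solution: `k` points of the stream, between `l i` and `u i` of them
from each group `i`. -/
def IsFair {X : Type*} (k m : ℕ) (group : X → Fin m) (l u : Fin m → ℕ)
    (s : List X) (C : Finset X) : Prop :=
  (∀ x ∈ C, x ∈ s) ∧ C.card = k ∧
    ∀ i, l i ≤ {x | x ∈ C ∧ group x = i}.ncard ∧ {x | x ∈ C ∧ group x = i}.ncard ≤ u i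

/-- The `k`-center objective `max_{x ∈ s} min_{c ∈ C} d(x, c)` (for nonempty `s` and `C`). -/
noncomputable def cost {X : Type*} [MetricSpace X] (s : List X) (C : Finset X) : ℝ :=
  ⨆ x : {x : X // x ∈ s}, ⨅ c : {c : X // c ∈ C}, dist x.1 c.1

/-- The optimal value: the least cost of a feasible solution (a minimum over a finite set). -/
noncomputable def opt {X : Type*} [MetricSpace X] (k m : ℕ) (group : X → Fin m)
    (l u : Fin m → ℕ) (s : List X) : ℝ :=
  sInf {r | ∃ C : Finset X, IsFair k m group l u s C ∧ cost s C = r}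

/-! ### The machine model

A real RAM in the form of a small imperative language.  The memory consists of three-dimensional
arrays of natural numbers, of real numbers and of points.  Points are atomic: they can be copied
from one memory cell to another, one can read the group of a stored point, and one can query the
distance between two stored points; nothing else.  Natural numbers (also used as indices) have
addition, truncated subtraction and comparison, real numbers have the four field operations
and comparison.  Every node of an expression that is evaluated and every command that is executed
costs one unit of time. -/

/-- A memory address: the number of an array and three indices. -/
abbrev Addr := ℕ × ℕ × ℕ × ℕ

/-- Expressions with a natural number as value.  `load a i j h` reads the entry `[i, j, h]` of the
number array `a`, and `group a i j h` is the group of the point stored in the entry `[i, j, h]` of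
the point array `a`. -/
inductive NExp : Type
  | const (c : ℕ)
  | load (a : ℕ) (i j h : NExp)
  | group (a : ℕ) (i j h : NExp)
  | add (e f : NExp)
  | sub (e f : NExp)

/-- A reference to the array entry `arr[i, j, h]`. -/
structure Ref : Type where
  arr : ℕ
  i : NExp
  j : NExp
  h : NExp

/-- Expressions with a real number as value; `dist p q` is the distance between the two points
stored in the entries `p` and `q` of the point arrays. -/
inductive RExp : Type
  | ofNat (e : NExp)
  | load (r : Ref)
  | dist (p q : Ref)
  | add (e f : RExp)
  | sub (e f : RExp)
  | mul (e f : RExp)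
  | div (e f : RExp)

/-- Tests. -/
inductive BExp : Type
  | natLe (e f : NExp)
  | realLe (e f : RExp)
  | not (b : BExp)
  | and (b c : BExp)

/-- Commands. `setPoint p q` copies the point in `q` into `p`; `loop b c` is `while b do c`. -/
inductive Cmd : Type
  | skip
  | setNat (r : Ref) (e : NExp)
  | setReal (r : Ref) (e : RExp)
  | setPoint (p q : Ref)
  | seq (c d : Cmd)
  | ite (b : BExp) (c d : Cmd)
  | loop (b : BExp) (c : Cmd)

/-- The memory. A cell of a point array is empty (`none`) until a point is stored in it. -/
structure Mem (X : Type*) where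
  nat : Addr → ℕ
  real : Addr → ℝ
  pt : Addr → Option X

/-- The time for evaluating an expression: its number of nodes. -/
def NExp.time : NExp → ℕ
  | const _ => 1
  | load _ i j h => 1 + i.time + j.time + h.time
  | group _ i j h => 1 + i.time + j.time + h.time
  | add e f => 1 + e.time + f.time
  | sub e f => 1 + e.time + f.time

def Ref.time (r : Ref) : ℕ := 1 + r.i.time + r.j.time + r.h.time

def RExp.time : RExp → ℕ
  | ofNat e => 1 + e.time
  | load r => r.time
  | dist p q => 1 + p.time + q.time
  | add e f => 1 + e.time + f.time
  | sub e f => 1 + e.time + f.time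
  | mul e f => 1 + e.time + f.time
  | div e f => 1 + e.time + f.time

def BExp.time : BExp → ℕ
  | natLe e f => 1 + e.time + f.time
  | realLe e f => 1 + e.time + f.time
  | not b => 1 + b.time
  | and b c => 1 + b.time + c.time

section semantics

/-- The value of a natural number expression, where `lab` gives the groups of the points. -/
def NExp.eval {X : Type*} (lab : X → ℕ) (σ : Mem X) : NExp → ℕ
  | const c => c
  | load a i j h => σ.nat (a, i.eval lab σ, j.eval lab σ, h.eval lab σ)
  | group a i j h => ((σ.pt (a, i.eval lab σ, j.eval lab σ, h.eval lab σ)).map lab).getD 0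
  | add e f => e.eval lab σ + f.eval lab σ
  | sub e f => e.eval lab σ - f.eval lab σ

def Ref.addr {X : Type*} (lab : X → ℕ) (σ : Mem X) (r : Ref) : Addr :=
  (r.arr, r.i.eval lab σ, r.j.eval lab σ, r.h.eval lab σ)

/-- The distance between the contents of two cells of point arrays (`0` if one is empty). -/
noncomputable def cellDist {X : Type*} [MetricSpace X] : Option X → Option X → ℝ
  | some x, some y => Dist.dist x y
  | _, _ => 0

noncomputable def RExp.eval {X : Type*} [MetricSpace X] (lab : X → ℕ) (σ : Mem X) : RExp → ℝ
  | ofNat e => (e.eval lab σ : ℝ)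
  | load r => σ.real (r.addr lab σ)
  | dist p q => cellDist (σ.pt (p.addr lab σ)) (σ.pt (q.addr lab σ))
  | add e f => e.eval lab σ + f.eval lab σ
  | sub e f => e.eval lab σ - f.eval lab σ
  | mul e f => e.eval lab σ * f.eval lab σ
  | div e f => e.eval lab σ / f.eval lab σ

def BExp.holds {X : Type*} [MetricSpace X] (lab : X → ℕ) (σ : Mem X) : BExp → Prop
  | natLe e f => e.eval lab σ ≤ f.eval lab σ
  | realLe e f => e.eval lab σ ≤ f.eval lab σ
  | not b => ¬ b.holds lab σ
  | and b c => b.holds lab σ ∧ c.holds lab σ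

def Mem.setNat {X : Type*} (σ : Mem X) (a : Addr) (v : ℕ) : Mem X :=
  { σ with nat := Function.update σ.nat a v }

def Mem.setReal {X : Type*} (σ : Mem X) (a : Addr) (v : ℝ) : Mem X :=
  { σ with real := Function.update σ.real a v }

def Mem.setPoint {X : Type*} (σ : Mem X) (a : Addr) (x : X) : Mem X :=
  { σ with pt := Function.update σ.pt a (some x) }

/-- `Exec lab c σ t σ'`: the command `c`, started in the memory `σ`, terminates after `t` units of
time in the memory `σ'`.  Copying from an empty point cell gets stuck, so a point cell in use
never becomes empty again. -/
inductive Exec {X : Type*} [MetricSpace X] (lab : X → ℕ) : Cmd → Mem X → ℕ → Mem X → Prop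
  | skip (σ : Mem X) : Exec lab Cmd.skip σ 1 σ
  | setNat (σ : Mem X) (r : Ref) (e : NExp) :
      Exec lab (Cmd.setNat r e) σ (1 + r.time + e.time)
        (σ.setNat (r.addr lab σ) (e.eval lab σ))
  | setReal (σ : Mem X) (r : Ref) (e : RExp) :
      Exec lab (Cmd.setReal r e) σ (1 + r.time + e.time)
        (σ.setReal (r.addr lab σ) (e.eval lab σ))
  | setPoint (σ : Mem X) (p q : Ref) (x : X) (hx : σ.pt (q.addr lab σ) = some x) :
      Exec lab (Cmd.setPoint p q) σ (1 + p.time + q.time)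
        (σ.setPoint (p.addr lab σ) x)
  | seq (c d : Cmd) (σ σ' σ'' : Mem X) (t t' : ℕ) (hc : Exec lab c σ t σ')
      (hd : Exec lab d σ' t' σ'') : Exec lab (Cmd.seq c d) σ (1 + t + t') σ''
  | iteTrue (b : BExp) (c d : Cmd) (σ σ' : Mem X) (t : ℕ) (hb : b.holds lab σ)
      (hc : Exec lab c σ t σ') : Exec lab (Cmd.ite b c d) σ (1 + b.time + t) σ'
  | iteFalse (b : BExp) (c d : Cmd) (σ σ' : Mem X) (t : ℕ) (hb : ¬ b.holds lab σ)
      (hd : Exec lab d σ t σ') : Exec lab (Cmd.ite b c d) σ (1 + b.time + t) σ'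
  | loopDone (b : BExp) (c : Cmd) (σ : Mem X) (hb : ¬ b.holds lab σ) :
      Exec lab (Cmd.loop b c) σ (1 + b.time) σ
  | loopStep (b : BExp) (c : Cmd) (σ σ' σ'' : Mem X) (t t' : ℕ) (hb : b.holds lab σ)
      (hc : Exec lab c σ t σ') (hl : Exec lab (Cmd.loop b c) σ' t' σ'') :
      Exec lab (Cmd.loop b c) σ (1 + b.time + t + t') σ''

end semantics

/-! ### One-pass streaming algorithms -/

/-- A one-pass streaming algorithm: a command executed once before the stream, a command executed
for each arriving point, and a command executed after the end of the stream.  These are fixed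
programs; all the information they pass on to each other is in the memory. -/
structure StreamAlg : Type where
  init : Cmd
  step : Cmd
  finish : Cmd

/-- The cell in which an arriving point is handed to the algorithm. -/
def inputCell : Addr := (0, 0, 0, 0)

/-- The point array in which the algorithm leaves its output. -/
def outputCell (j : ℕ) : Addr := (1, j, 0, 0)

/-- The memory at the start: it holds the parameters `k`, `m`, `ε`, `l`, `u` (but not the length of
the stream), the other numbers are zero, and no point is stored. -/
noncomputable def initialMem (X : Type*) (k m : ℕ) (l u : Fin m → ℕ) (ε : ℝ) : Mem X where
  nat := fun a =>
    match a with
    | (0, 0, 0, 0) => k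
    | (0, 1, 0, 0) => m
    | (1, i, 0, 0) => if h : i < m then l ⟨i, h⟩ else 0
    | (2, i, 0, 0) => if h : i < m then u ⟨i, h⟩ else 0
    | _ => 0
  real := fun a => if a = (0, 0, 0, 0) then ε else 0
  pt := fun _ => none

/-- `Feed lab c s σ t σ'`: handing the points of `s` one after the other to the command `c` leads
from `σ` to `σ'` in total time `t`. -/
inductive Feed {X : Type*} [MetricSpace X] (lab : X → ℕ) (c : Cmd) :
    List X → Mem X → ℕ → Mem X → Prop
  | nil (σ : Mem X) : Feed lab c [] σ 0 σ
  | cons (x : X) (s : List X) (σ σ' σ'' : Mem X) (t t' : ℕ)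
      (hx : Exec lab c (σ.setPoint inputCell x) t σ') (hs : Feed lab c s σ' t' σ'') :
      Feed lab c (x :: s) σ (1 + t + t') σ''

/-- The algorithm, started in `σ`, processes the stream `s` in one pass and terminates after
`t` units of time in all with the memory `σ'`. -/
def StreamAlg.Run {X : Type*} [MetricSpace X] (A : StreamAlg) (lab : X → ℕ) (s : List X)
    (σ : Mem X) (t : ℕ) (σ' : Mem X) : Prop :=
  ∃ σ₁ σ₂ : Mem X, ∃ t₁ t₂ t₃ : ℕ, Exec lab A.init σ t₁ σ₁ ∧ Feed lab A.step s σ₁ t₂ σ₂ ∧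
    Exec lab A.finish σ₂ t₃ σ' ∧ t = t₁ + t₂ + t₃

/-- The cells that hold a point. Since cells in use never become empty
(see `StreamAlg.Run.stored_subset`), at the end of a run these are all
the cells in which a point was stored at some time of the run. -/
def Mem.stored {X : Type*} (σ : Mem X) : Set Addr := {a | σ.pt a ≠ none}

/-- The set of points in the first `k` output cells is `C`. -/
def Mem.Outputs {X : Type*} (σ : Mem X) (k : ℕ) (C : Finset X) : Prop :=
  ∀ x, x ∈ C ↔ ∃ j < k, σ.pt (outputCell j) = some x

theorem Mem.stored_subset_setPoint {X : Type*} (σ : Mem X) (a : Addr) (x : X) :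
    σ.stored ⊆ (σ.setPoint a x).stored := by
  intro b hb
  by_cases h : b = a
  · subst h; simp [Mem.stored, Mem.setPoint]
  · simpa [Mem.stored, Mem.setPoint, Function.update_of_ne h] using hb

theorem Exec.stored_subset {X : Type*} [MetricSpace X] {lab : X → ℕ} {c : Cmd} {σ σ' : Mem X}
    {t : ℕ} (h : Exec lab c σ t σ') : σ.stored ⊆ σ'.stored := by
  induction h with
  | skip => exact fun _ h => h
  | setNat => exact fun _ h => h
  | setReal => exact fun _ h => h
  | setPoint σ p q x hx => exact Mem.stored_subset_setPoint _ _ _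
  | seq _ _ _ _ _ _ _ _ _ h₁ h₂ => exact h₁.trans h₂
  | iteTrue _ _ _ _ _ _ _ _ h₁ => exact h₁
  | iteFalse _ _ _ _ _ _ _ _ h₁ => exact h₁
  | loopDone => exact fun _ h => h
  | loopStep _ _ _ _ _ _ _ _ _ _ h₁ h₂ => exact h₁.trans h₂

theorem Feed.stored_subset {X : Type*} [MetricSpace X] {lab : X → ℕ} {c : Cmd} {s : List X}
    {σ σ' : Mem X} {t : ℕ} (h : Feed lab c s σ t σ') : σ.stored ⊆ σ'.stored := by
  induction h with
  | nil => exact fun _ h => h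
  | cons x _ σ _ _ _ _ hx _ ih =>
    exact ((Mem.stored_subset_setPoint σ inputCell x).trans hx.stored_subset).trans ih

theorem StreamAlg.Run.stored_subset {X : Type*} [MetricSpace X] {A : StreamAlg} {lab : X → ℕ}
    {s : List X} {σ σ' : Mem X} {t : ℕ} (h : A.Run lab s σ t σ') : σ.stored ⊆ σ'.stored := by
  obtain ⟨_, _, _, _, _, h₁, h₂, h₃, -⟩ := h
  exact (h₁.stored_subset.trans h₂.stored_subset).trans h₃.stored_subset

/-- Execution is deterministic. -/
theorem Exec.det {X : Type*} [MetricSpace X] {lab : X → ℕ} {c : Cmd} {σ σ₁ σ₂ : Mem X}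
    {t₁ t₂ : ℕ} (h₁ : Exec lab c σ t₁ σ₁) (h₂ : Exec lab c σ t₂ σ₂) : t₁ = t₂ ∧ σ₁ = σ₂ := by
  induction h₁ generalizing t₂ σ₂ with
  | skip => cases h₂; exact ⟨rfl, rfl⟩
  | setNat => cases h₂; exact ⟨rfl, rfl⟩
  | setReal => cases h₂; exact ⟨rfl, rfl⟩
  | setPoint σ p q x hx =>
    cases h₂ with
    | setPoint _ _ _ y hy =>
      rw [hx] at hy
      cases hy
      exact ⟨rfl, rfl⟩
  | seq _ _ _ _ _ _ _ _ _ ih₁ ih₂ =>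
    cases h₂ with
    | seq _ _ _ _ _ _ _ hc hd =>
      obtain ⟨rfl, rfl⟩ := ih₁ hc
      obtain ⟨rfl, rfl⟩ := ih₂ hd
      exact ⟨rfl, rfl⟩
  | iteTrue _ _ _ _ _ _ hb _ ih =>
    cases h₂ with
    | iteTrue _ _ _ _ _ _ _ hc => obtain ⟨rfl, rfl⟩ := ih hc; exact ⟨rfl, rfl⟩
    | iteFalse _ _ _ _ _ _ hb' _ => exact absurd hb hb'
  | iteFalse _ _ _ _ _ _ hb _ ih =>
    cases h₂ with
    | iteTrue _ _ _ _ _ _ hb' _ => exact absurd hb' hb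
    | iteFalse _ _ _ _ _ _ _ hc => obtain ⟨rfl, rfl⟩ := ih hc; exact ⟨rfl, rfl⟩
  | loopDone _ _ _ hb =>
    cases h₂ with
    | loopDone => exact ⟨rfl, rfl⟩
    | loopStep _ _ _ _ _ _ _ hb' _ _ => exact absurd hb' hb
  | loopStep _ _ _ _ _ _ _ hb _ _ ih₁ ih₂ =>
    cases h₂ with
    | loopDone _ _ _ hb' => exact absurd hb hb'
    | loopStep _ _ _ _ _ _ _ _ hc hl =>
      obtain ⟨rfl, rfl⟩ := ih₁ hc
      obtain ⟨rfl, rfl⟩ := ih₂ hl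
      exact ⟨rfl, rfl⟩

end FairStream

/-! Put `R = (1 + ε) ^ J`, where `J` is least with `ε * R ≥ 1`; then `J` is of order `log (1/ε) /
ε`. Let `r` be the optimal value. The algorithm maintains `J` guesses of `r`, the `j`-th of the form
`τ = L * (1 + ε) ^ j * R ^ e` with a common base `L ≤ r`. The summary of a guess consists of pivots
at mutual distances more than `2 * τ`, each with at most one stored representative per group. Every
point seen so far lies within `α * τ`, `α = 2 + 4 * ε`, of a pivot that has a representative of the
same group, and representatives lie equally near to their pivots.

More than `k` pivots prove `τ < r`. Then `τ` is multiplied by `R`, and pivots that have become close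
are merged together with their lists of representatives. Since `R` is at least `1 / ε`, the radius
survives: `α * τ + 2 * R * τ ≤ α * R * τ` (`Grid.contract`). A guess is raised only while it is
below every packing bound, so in the end some guess lies in `[r, (1 + ε) * r]` or is at most `2 * ε
* r` (`exists_guess`).

To solve a guess, its pivots are traversed farthest-first. Let `rho s` be the covering radius of the
first `s` centers and take the least `s` with `rho s ≤ 2 * (r + α * τ)`. These centers are so far
apart that nearest optimal centers are distinct, and the group of each has a representative in the
corresponding cluster. Hence the clusters can be assigned to groups within the bounds
(`Gonz.exists_assign`). Conversely, an assignment for a prefix yields a set of representatives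
covering everything (`Gonz.cover`): for `τ` near `r` the path from a point to its pivot, to the
center, to a pivot of the cluster and to its representative has length about `2 + 6 + 3 + 2 = 13`
times `r`. Since the right prefix is unknown, the longest prefix with an assignment is computed by
augmenting paths; its `rho` is no larger. The obstruction in `Assign.not_assign` is a Hall-type
count adapted to lower bounds, upper bounds and the total `k`. Finally the chosen representatives
are completed to a fair solution from a pool of up to `k` points per group (`fillCmd_spec`).

For the time, an insertion compares the point with `O(k)` pivots per guess, and a maintenance after
every `k` insertions costs `O(k ^ 2)` per guess plus the moves of list entries. Moves go to slots of
smaller index, so the sum of slot index times list length is a potential that pays for them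
(`thinCmd_spec`). The number of raises is bounded because a traversal of the pivots of the guess `0`
brackets the packing bound: if it is far above the guesses, all of them are reset at once to a new
base, and otherwise nine raises suffice (`maintCmd_spec`). Solving a guess takes `O(k)` searches,
each linear in the size of its data, which is `O(k + n)`. No loop runs over all `m` groups, only
over those seen in the stream. -/

namespace FairStream

/-! ### Program combinators -/

/-- The scalar number variable `a`, the entry `[0, 0, 0]` of the array `a`. -/
def nv (a : ℕ) : NExp := .load a (.const 0) (.const 0) (.const 0)
def n1 (a : ℕ) (i : NExp) : NExp := .load a i (.const 0) (.const 0)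
def n2 (a : ℕ) (i j : NExp) : NExp := .load a i j (.const 0)
def n3 (a : ℕ) (i j h : NExp) : NExp := .load a i j h
def rf0 (a : ℕ) : Ref := ⟨a, .const 0, .const 0, .const 0⟩
def rf1 (a : ℕ) (i : NExp) : Ref := ⟨a, i, .const 0, .const 0⟩
def rf2 (a : ℕ) (i j : NExp) : Ref := ⟨a, i, j, .const 0⟩
def rf3 (a : ℕ) (i j h : NExp) : Ref := ⟨a, i, j, h⟩
/-- The group of the point stored in the cell `r`. -/
def grp (r : Ref) : NExp := .group r.arr r.i r.j r.h
def ltE (e f : NExp) : BExp := .not (.natLe f e)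
def ltR (e f : RExp) : BExp := .not (.realLe f e)
def inc (a : ℕ) : Cmd := .setNat (rf0 a) (.add (nv a) (.const 1))

/-- Sequential composition of a list of commands. -/
def block : List Cmd → Cmd
  | [] => .skip
  | [c] => c
  | c :: d :: cs => .seq c (block (d :: cs))

/-- `while v < e do { c; v := v + 1 }`. -/
def forUp (v : ℕ) (e : NExp) (c : Cmd) : Cmd := .loop (ltE (nv v) e) (.seq c (inc v))

section
variable {X : Type*} (lab : X → ℕ) (σ : Mem X)

@[simp] theorem nv_eval (a : ℕ) : (nv a).eval lab σ = σ.nat (a, 0, 0, 0) := rfl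
@[simp] theorem n1_eval (a i) : (n1 a i).eval lab σ = σ.nat (a, i.eval lab σ, 0, 0) := rfl
@[simp] theorem n2_eval (a i j) :
    (n2 a i j).eval lab σ = σ.nat (a, i.eval lab σ, j.eval lab σ, 0) := rfl
@[simp] theorem n3_eval (a i j h) :
    (n3 a i j h).eval lab σ = σ.nat (a, i.eval lab σ, j.eval lab σ, h.eval lab σ) := rfl
@[simp] theorem const_eval (c) : (NExp.const c).eval lab σ = c := rfl
@[simp] theorem add_eval (e f : NExp) :
    (NExp.add e f).eval lab σ = e.eval lab σ + f.eval lab σ := rfl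
@[simp] theorem sub_eval (e f : NExp) :
    (NExp.sub e f).eval lab σ = e.eval lab σ - f.eval lab σ := rfl
@[simp] theorem grp_eval (r : Ref) :
    (grp r).eval lab σ = ((σ.pt (r.addr lab σ)).map lab).getD 0 := rfl
@[simp] theorem rf0_addr (a) : (rf0 a).addr lab σ = (a, 0, 0, 0) := rfl
@[simp] theorem rf1_addr (a i) : (rf1 a i).addr lab σ = (a, i.eval lab σ, 0, 0) := rfl
@[simp] theorem rf2_addr (a i j) :
    (rf2 a i j).addr lab σ = (a, i.eval lab σ, j.eval lab σ, 0) := rfl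
@[simp] theorem rf3_addr (a i j h) :
    (rf3 a i j h).addr lab σ = (a, i.eval lab σ, j.eval lab σ, h.eval lab σ) := rfl
variable [MetricSpace X]

@[simp] theorem ofNat_eval (e) : (RExp.ofNat e).eval lab σ = (e.eval lab σ : ℝ) := rfl
@[simp] theorem load_eval (r : Ref) : (RExp.load r).eval lab σ = σ.real (r.addr lab σ) := rfl
@[simp] theorem dist_eval (p q : Ref) : (RExp.dist p q).eval lab σ =
    cellDist (σ.pt (p.addr lab σ)) (σ.pt (q.addr lab σ)) := rfl
@[simp] theorem radd_eval (e f : RExp) :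
    (RExp.add e f).eval lab σ = e.eval lab σ + f.eval lab σ := rfl
@[simp] theorem rmul_eval (e f : RExp) :
    (RExp.mul e f).eval lab σ = e.eval lab σ * f.eval lab σ := rfl
@[simp] theorem rdiv_eval (e f : RExp) :
    (RExp.div e f).eval lab σ = e.eval lab σ / f.eval lab σ := rfl
@[simp] theorem natLe_holds (e f : NExp) :
    (BExp.natLe e f).holds lab σ ↔ e.eval lab σ ≤ f.eval lab σ := Iff.rfl
@[simp] theorem realLe_holds (e f : RExp) :
    (BExp.realLe e f).holds lab σ ↔ e.eval lab σ ≤ f.eval lab σ := Iff.rfl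
@[simp] theorem not_holds (b : BExp) : (BExp.not b).holds lab σ ↔ ¬ b.holds lab σ := Iff.rfl
@[simp] theorem and_holds (b c : BExp) :
    (BExp.and b c).holds lab σ ↔ b.holds lab σ ∧ c.holds lab σ := Iff.rfl
@[simp] theorem ltE_holds (e f : NExp) :
    (ltE e f).holds lab σ ↔ e.eval lab σ < f.eval lab σ := not_le
@[simp] theorem ltR_holds (e f : RExp) :
    (ltR e f).holds lab σ ↔ e.eval lab σ < f.eval lab σ := not_le
end

@[simp] theorem nv_time (a) : (nv a).time = 4 := rfl
@[simp] theorem n1_time (a i) : (n1 a i).time = i.time + 3 := by simp [n1, NExp.time]; omega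
@[simp] theorem n2_time (a i j) : (n2 a i j).time = i.time + j.time + 2 := by
  simp [n2, NExp.time]; omega
@[simp] theorem n3_time (a i j h) : (n3 a i j h).time = i.time + j.time + h.time + 1 := by
  simp [n3, NExp.time]; omega
@[simp] theorem const_time (c) : (NExp.const c).time = 1 := rfl
@[simp] theorem add_time (e f : NExp) : (NExp.add e f).time = 1 + e.time + f.time := rfl
@[simp] theorem sub_time (e f : NExp) : (NExp.sub e f).time = 1 + e.time + f.time := rfl
@[simp] theorem grp_time (r : Ref) : (grp r).time = r.time := rfl
@[simp] theorem rf0_time (a) : (rf0 a).time = 4 := rfl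
@[simp] theorem rf1_time (a i) : (rf1 a i).time = i.time + 3 := by simp [rf1, Ref.time]; omega
@[simp] theorem rf2_time (a i j) : (rf2 a i j).time = i.time + j.time + 2 := by
  simp [rf2, Ref.time]; omega
@[simp] theorem rf3_time (a i j h) : (rf3 a i j h).time = i.time + j.time + h.time + 1 := by
  simp [rf3, Ref.time]; omega
@[simp] theorem ofNat_time (e) : (RExp.ofNat e).time = 1 + e.time := rfl
@[simp] theorem load_time (r : Ref) : (RExp.load r).time = r.time := rfl
@[simp] theorem dist_time (p q : Ref) : (RExp.dist p q).time = 1 + p.time + q.time := rfl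
@[simp] theorem radd_time (e f : RExp) : (RExp.add e f).time = 1 + e.time + f.time := rfl
@[simp] theorem rmul_time (e f : RExp) : (RExp.mul e f).time = 1 + e.time + f.time := rfl
@[simp] theorem rdiv_time (e f : RExp) : (RExp.div e f).time = 1 + e.time + f.time := rfl
@[simp] theorem natLe_time (e f : NExp) : (BExp.natLe e f).time = 1 + e.time + f.time := rfl
@[simp] theorem realLe_time (e f : RExp) : (BExp.realLe e f).time = 1 + e.time + f.time := rfl
@[simp] theorem not_time (b : BExp) : (BExp.not b).time = 1 + b.time := rfl
@[simp] theorem and_time (b c : BExp) : (BExp.and b c).time = 1 + b.time + c.time := rfl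
@[simp] theorem ltE_time (e f : NExp) : (ltE e f).time = 2 + e.time + f.time := by
  simp [ltE]; omega
@[simp] theorem ltR_time (e f : RExp) : (ltR e f).time = 2 + e.time + f.time := by
  simp [ltR]; omega

/-! ### Reading an updated memory -/

section
variable {X : Type*} (σ : Mem X) (a b : Addr)
@[simp] theorem setNat_nat (v : ℕ) :
    (σ.setNat a v).nat b = if b = a then v else σ.nat b := by
  simp [Mem.setNat, Function.update_apply]
@[simp] theorem setNat_real (v : ℕ) : (σ.setNat a v).real = σ.real := rfl
@[simp] theorem setNat_pt (v : ℕ) : (σ.setNat a v).pt = σ.pt := rfl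
@[simp] theorem setReal_real (v : ℝ) :
    (σ.setReal a v).real b = if b = a then v else σ.real b := by
  simp [Mem.setReal, Function.update_apply]
@[simp] theorem setReal_nat (v : ℝ) : (σ.setReal a v).nat = σ.nat := rfl
@[simp] theorem setReal_pt (v : ℝ) : (σ.setReal a v).pt = σ.pt := rfl
@[simp] theorem setPoint_pt (x : X) :
    (σ.setPoint a x).pt b = if b = a then some x else σ.pt b := by
  simp [Mem.setPoint, Function.update_apply]
@[simp] theorem setPoint_nat (x : X) : (σ.setPoint a x).nat = σ.nat := rfl
@[simp] theorem setPoint_real (x : X) : (σ.setPoint a x).real = σ.real := rfl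
end

/-! ### The arrays a command writes to -/

/-- These lists are read off the syntax, so whether a command can change a given array is settled by
`decide` or `simp`. Together with `Exec.frame` this takes the place of a separation logic. -/
def Cmd.wN : Cmd → List ℕ
  | setNat r _ => [r.arr]
  | seq c d => c.wN ++ d.wN
  | ite _ c d => c.wN ++ d.wN
  | loop _ c => c.wN
  | _ => []

def Cmd.wR : Cmd → List ℕ
  | setReal r _ => [r.arr]
  | seq c d => c.wR ++ d.wR
  | ite _ c d => c.wR ++ d.wR
  | loop _ c => c.wR
  | _ => []

def Cmd.wP : Cmd → List ℕ
  | setPoint r _ => [r.arr]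
  | seq c d => c.wP ++ d.wP
  | ite _ c d => c.wP ++ d.wP
  | loop _ c => c.wP
  | _ => []

/-- `Frame N R P σ σ'`: the memories `σ` and `σ'` differ at most on the number arrays in `N`,
the real arrays in `R` and the point arrays in `P`. -/
structure Frame {X : Type*} (N R P : List ℕ) (σ σ' : Mem X) : Prop where
  nat : ∀ a i, a ∉ N → σ'.nat (a, i) = σ.nat (a, i)
  real : ∀ a i, a ∉ R → σ'.real (a, i) = σ.real (a, i)
  pt : ∀ a i, a ∉ P → σ'.pt (a, i) = σ.pt (a, i)

theorem Frame.refl {X : Type*} {N R P : List ℕ} (σ : Mem X) : Frame N R P σ σ :=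
  ⟨fun _ _ _ => rfl, fun _ _ _ => rfl, fun _ _ _ => rfl⟩

theorem Frame.trans {X : Type*} {N R P N' R' P' : List ℕ} {σ σ' σ'' : Mem X}
    (h : Frame N R P σ σ') (h' : Frame N' R' P' σ' σ'') :
    Frame (N ++ N') (R ++ R') (P ++ P') σ σ'' := by
  constructor
  · intro a i ha
    simp only [List.mem_append, not_or] at ha
    rw [h'.nat a i ha.2, h.nat a i ha.1]
  · intro a i ha
    simp only [List.mem_append, not_or] at ha
    rw [h'.real a i ha.2, h.real a i ha.1]
  · intro a i ha
    simp only [List.mem_append, not_or] at ha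
    rw [h'.pt a i ha.2, h.pt a i ha.1]

theorem Frame.mono {X : Type*} {N R P N' R' P' : List ℕ} {σ σ' : Mem X}
    (h : Frame N R P σ σ') (hN : N ⊆ N') (hR : R ⊆ R') (hP : P ⊆ P') : Frame N' R' P' σ σ' :=
  ⟨fun a i ha => h.nat a i fun h' => ha (hN h'), fun a i ha => h.real a i fun h' => ha (hR h'),
    fun a i ha => h.pt a i fun h' => ha (hP h')⟩

theorem Exec.frame {X : Type*} [MetricSpace X] {lab : X → ℕ} {c : Cmd} {σ σ' : Mem X} {t : ℕ}
    (h : Exec lab c σ t σ') : Frame c.wN c.wR c.wP σ σ' := by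
  induction h with
  | skip => exact Frame.refl _
  | setNat σ r e =>
    refine ⟨fun a i ha => ?_, fun _ _ _ => rfl, fun _ _ _ => rfl⟩
    simp only [Cmd.wN, List.mem_singleton] at ha
    simp [Ref.addr, ha]
  | setReal σ r e =>
    refine ⟨fun _ _ _ => rfl, fun a i ha => ?_, fun _ _ _ => rfl⟩
    simp only [Cmd.wR, List.mem_singleton] at ha
    simp [Ref.addr, ha]
  | setPoint σ p q x hx =>
    refine ⟨fun _ _ _ => rfl, fun _ _ _ => rfl, fun a i ha => ?_⟩
    simp only [Cmd.wP, List.mem_singleton] at ha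
    simp [Ref.addr, ha]
  | seq _ _ _ _ _ _ _ _ _ h₁ h₂ => exact h₁.trans h₂
  | iteTrue _ _ _ _ _ _ _ _ h₁ =>
    exact h₁.mono (List.subset_append_left _ _) (List.subset_append_left _ _)
      (List.subset_append_left _ _)
  | iteFalse _ _ _ _ _ _ _ _ h₁ =>
    exact h₁.mono (List.subset_append_right _ _) (List.subset_append_right _ _)
      (List.subset_append_right _ _)
  | loopDone => exact Frame.refl _
  | loopStep _ _ _ _ _ _ _ _ _ _ h₁ h₂ =>
    refine (h₁.trans h₂).mono ?_ ?_ ?_ <;> simp [Cmd.wN, Cmd.wR, Cmd.wP]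

/-! ### Total correctness with time -/

/-- The command `c`, started in `σ`, terminates, and the running time and the final memory
satisfy `Q`. -/
def Runs {X : Type*} [MetricSpace X] (lab : X → ℕ) (c : Cmd) (σ : Mem X)
    (Q : ℕ → Mem X → Prop) : Prop :=
  ∃ t σ', Exec lab c σ t σ' ∧ Q t σ'

section
variable {X : Type*} [MetricSpace X] {lab : X → ℕ} {σ : Mem X} {Q Q' : ℕ → Mem X → Prop}
  {c d : Cmd}

theorem Runs.mono (h : Runs lab c σ Q) (hQ : ∀ t σ', Q t σ' → Q' t σ') : Runs lab c σ Q' := by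
  obtain ⟨t, σ', he, hq⟩ := h
  exact ⟨t, σ', he, hQ _ _ hq⟩

/-- Strengthening of a postcondition by the frame of the command. -/
theorem Runs.mono_frame (h : Runs lab c σ Q)
    (hQ : ∀ t σ', Frame c.wN c.wR c.wP σ σ' → Q t σ' → Q' t σ') : Runs lab c σ Q' := by
  obtain ⟨t, σ', he, hq⟩ := h
  exact ⟨t, σ', he, hQ _ _ he.frame hq⟩

@[simp] theorem runs_skip : Runs lab .skip σ Q ↔ Q 1 σ := by
  constructor
  · rintro ⟨t, σ', he, hq⟩; cases he; exact hq
  · exact fun h => ⟨_, _, .skip σ, h⟩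

@[simp] theorem runs_setNat (r e) : Runs lab (.setNat r e) σ Q ↔
    Q (1 + r.time + e.time) (σ.setNat (r.addr lab σ) (e.eval lab σ)) := by
  constructor
  · rintro ⟨t, σ', he, hq⟩; cases he; exact hq
  · exact fun h => ⟨_, _, .setNat σ r e, h⟩

@[simp] theorem runs_setReal (r e) : Runs lab (.setReal r e) σ Q ↔
    Q (1 + r.time + e.time) (σ.setReal (r.addr lab σ) (e.eval lab σ)) := by
  constructor
  · rintro ⟨t, σ', he, hq⟩; cases he; exact hq
  · exact fun h => ⟨_, _, .setReal σ r e, h⟩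

@[simp] theorem runs_setPoint (p q) : Runs lab (.setPoint p q) σ Q ↔
    ∃ x, σ.pt (q.addr lab σ) = some x ∧
      Q (1 + p.time + q.time) (σ.setPoint (p.addr lab σ) x) := by
  constructor
  · rintro ⟨t, σ', he, hq⟩
    cases he with
    | setPoint _ _ _ x hx => exact ⟨x, hx, hq⟩
  · rintro ⟨x, hx, h⟩
    exact ⟨_, _, .setPoint σ p q x hx, h⟩

@[simp] theorem runs_seq : Runs lab (.seq c d) σ Q ↔
    Runs lab c σ fun t σ' => Runs lab d σ' fun t' σ'' => Q (1 + t + t') σ'' := by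
  constructor
  · rintro ⟨t, σ', he, hq⟩
    cases he with
    | seq _ _ _ σ₁ _ t₁ t₂ h₁ h₂ => exact ⟨_, _, h₁, _, _, h₂, hq⟩
  · rintro ⟨_, _, h₁, _, _, h₂, hq⟩
    exact ⟨_, _, .seq _ _ _ _ _ _ _ h₁ h₂, hq⟩

@[simp] theorem runs_ite (b : BExp) : Runs lab (.ite b c d) σ Q ↔
    (b.holds lab σ → Runs lab c σ fun t σ' => Q (1 + b.time + t) σ') ∧
    (¬ b.holds lab σ → Runs lab d σ fun t σ' => Q (1 + b.time + t) σ') := by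
  constructor
  · rintro ⟨t, σ', he, hq⟩
    cases he with
    | iteTrue _ _ _ _ _ _ hb hc => exact ⟨fun _ => ⟨_, _, hc, hq⟩, fun h => absurd hb h⟩
    | iteFalse _ _ _ _ _ _ hb hc => exact ⟨fun h => absurd h hb, fun _ => ⟨_, _, hc, hq⟩⟩
  · rintro ⟨h₁, h₂⟩
    by_cases hb : b.holds lab σ
    · obtain ⟨_, _, he, hq⟩ := h₁ hb
      exact ⟨_, _, .iteTrue _ _ _ _ _ _ hb he, hq⟩
    · obtain ⟨_, _, he, hq⟩ := h₂ hb
      exact ⟨_, _, .iteFalse _ _ _ _ _ _ hb he, hq⟩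

@[simp] theorem block_singleton : block [c] = c := rfl
@[simp] theorem block_cons {cs} : block (c :: d :: cs) = .seq c (block (d :: cs)) := rfl

/-- The loop rule: `I B σ` is an invariant saying in particular that `B` units of time suffice for
the remaining iterations. -/
theorem Runs.loop {b : BExp} {Q : Mem X → Prop} (I : ℕ → Mem X → Prop)
    (hdone : ∀ B σ, I B σ → ¬ b.holds lab σ → 1 + b.time ≤ B ∧ Q σ)
    (hstep : ∀ B σ, I B σ → b.holds lab σ → Runs lab c σ fun t σ' =>
      ∃ B', 1 + b.time + t + B' ≤ B ∧ I B' σ') {B : ℕ} (h : I B σ) :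
    Runs lab (.loop b c) σ fun t σ' => t ≤ B ∧ Q σ' := by
  induction B using Nat.strong_induction_on generalizing σ with
  | _ B ih =>
    by_cases hb : b.holds lab σ
    · obtain ⟨t, σ', he, B', hB', hI⟩ := hstep B σ h hb
      obtain ⟨t', σ'', he', ht', hq⟩ := ih B' (by omega) hI
      exact ⟨_, _, .loopStep _ _ _ _ _ _ _ hb he he', by omega, hq⟩
    · obtain ⟨ht, hq⟩ := hdone B σ h hb
      exact ⟨_, _, .loopDone _ _ _ hb, ht, hq⟩

/-- The loop rule with a variant `n`; `u` is the total time of the iterations so far. -/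
theorem Runs.loop_total {b : BExp} (I : ℕ → ℕ → Mem X → Prop)
    (hstep : ∀ n u σ, I n u σ → b.holds lab σ → Runs lab c σ fun t σ' =>
      ∃ n' < n, I n' (u + (1 + b.time + t)) σ') {n : ℕ} (h : I n 0 σ) :
    Runs lab (.loop b c) σ fun t σ' =>
      ∃ n' u, t = u + (1 + b.time) ∧ ¬ b.holds lab σ' ∧ I n' u σ' := by
  have key : ∀ n u (σ : Mem X), I n u σ → Runs lab (.loop b c) σ fun t σ' =>
      ∃ n' u', t + u = u' + (1 + b.time) ∧ ¬ b.holds lab σ' ∧ I n' u' σ' := by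
    intro n
    induction n using Nat.strong_induction_on with
    | _ n ih =>
      intro u σ hI
      by_cases hb : b.holds lab σ
      · obtain ⟨t, σ', he, n', hn', hI'⟩ := hstep n u σ hI hb
        obtain ⟨t', σ'', he', n'', u', hu', hb', hI''⟩ := ih n' hn' _ σ' hI'
        exact ⟨_, _, .loopStep _ _ _ _ _ _ _ hb he he', n'', u', by omega, hb', hI''⟩
      · exact ⟨_, _, .loopDone _ _ _ hb, n, u, by omega, hb, hI⟩
  exact (key n 0 σ h).mono fun t σ' ⟨n', u', h1, h2⟩ => ⟨n', u', by omega, h2⟩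

/-- The rule for counting loops; `u` is the total time of the iterations so far. -/
theorem Runs.forUp_total {v : ℕ} {e : NExp} (N : ℕ) (I : ℕ → ℕ → Mem X → Prop)
    (hv : v ∉ c.wN) (he : ∀ i u σ, I i u σ → e.eval lab σ = N)
    (hstep : ∀ i u σ, i < N → σ.nat (v, 0, 0, 0) = i → I i u σ → Runs lab c σ fun t σ' =>
      I (i + 1) (u + t) (σ'.setNat (v, 0, 0, 0) (i + 1)))
    (h0 : σ.nat (v, 0, 0, 0) = 0) (h : I 0 0 σ) :
    Runs lab (FairStream.forUp v e c) σ fun t σ' =>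
      ∃ u, t ≤ u + (N + 1) * (e.time + 20) ∧ σ'.nat (v, 0, 0, 0) = N ∧ I N u σ' := by
  have key : ∀ d i u (σ : Mem X), i + d = N → σ.nat (v, 0, 0, 0) = i → I i u σ →
      Runs lab (FairStream.forUp v e c) σ fun t σ' =>
      ∃ u', t + u ≤ u' + (d + 1) * (e.time + 20) ∧ σ'.nat (v, 0, 0, 0) = N ∧ I N u' σ' := by
    intro d
    induction d with
    | zero =>
      intro i u σ hi hvi hI
      refine ⟨_, _, .loopDone _ _ _ ?_, u, ?_, ?_, ?_⟩
      · simp only [ltE_holds, nv_eval, hvi, he i u σ hI]; omega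
      · simp only [ltE_time, nv_time]; omega
      · omega
      · have : i = N := by omega
        exact this ▸ hI
    | succ d ih =>
      intro i u σ hi hvi hI
      obtain ⟨t, σ', he', hI'⟩ := hstep i u σ (by omega) hvi hI
      have hv' : σ'.nat (v, 0, 0, 0) = i := by rw [he'.frame.nat v _ hv, hvi]
      have hinc : Exec lab (inc v) σ' 11 (σ'.setNat (v, 0, 0, 0) (i + 1)) := by
        have := Exec.setNat (lab := lab) σ' (rf0 v) (.add (nv v) (.const 1))
        simpa [inc, hv'] using this
      obtain ⟨t', σ'', he'', u', hu', hN, hI''⟩ := ih (i + 1) (u + t) _ (by omega) (by simp) hI'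
      refine ⟨_, _, .loopStep _ _ _ _ _ _ _ ?_ (.seq _ _ _ _ _ _ _ he' hinc) he'', u', ?_, hN,
        hI''⟩
      · simp only [ltE_holds, nv_eval, hvi, he i u σ hI]; omega
      · have : (d + 1 + 1) * (e.time + 20) = (d + 1) * (e.time + 20) + (e.time + 20) := by ring
        simp only [ltE_time, nv_time]; omega
  exact (key N 0 0 σ (by omega) h0 h).mono fun t σ' ⟨u', h1, h2⟩ => ⟨u', by omega, h2⟩

/-- The rule for counting loops whose iterations take time at most `T`. -/
theorem Runs.forUp {v : ℕ} {e : NExp} (N T : ℕ) (I : ℕ → Mem X → Prop)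
    (hv : v ∉ c.wN) (he : ∀ i σ, I i σ → e.eval lab σ = N)
    (hstep : ∀ i σ, i < N → σ.nat (v, 0, 0, 0) = i → I i σ → Runs lab c σ fun t σ' =>
      t ≤ T ∧ I (i + 1) (σ'.setNat (v, 0, 0, 0) (i + 1)))
    (h0 : σ.nat (v, 0, 0, 0) = 0) (h : I 0 σ) :
    Runs lab (FairStream.forUp v e c) σ fun t σ' =>
      t ≤ (N + 1) * (T + e.time + 20) ∧ σ'.nat (v, 0, 0, 0) = N ∧ I N σ' := by
  refine (Runs.forUp_total N (fun i u σ => I i σ ∧ u ≤ i * T) hv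
    (fun i u σ h => he i σ h.1) ?_ h0 ⟨h, by simp⟩).mono ?_
  · rintro i u σ hi hvi ⟨hI, hu⟩
    refine (hstep i σ hi hvi hI).mono ?_
    rintro t σ' ⟨ht, hI'⟩
    exact ⟨hI', by rw [Nat.add_mul]; omega⟩
  · rintro t σ' ⟨u, ht, hN, hI, hu⟩
    refine ⟨?_, hN, hI⟩
    have : (N + 1) * (T + e.time + 20) = N * T + T + (N + 1) * (e.time + 20) := by ring
    omega
end

end FairStream

namespace FairStream

/-! ### Distances between cells -/

section
variable {X : Type*} [MetricSpace X]
@[simp] theorem cellDist_some (x y : X) : cellDist (some x) (some y) = dist x y := rfl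
theorem cellDist_comm (a b : Option X) : cellDist a b = cellDist b a := by
  cases a <;> cases b <;> simp [cellDist, dist_comm]
theorem cellDist_triangle (a c : Option X) (b : X) :
    cellDist a c ≤ cellDist a (some b) + cellDist (some b) c := by
  cases a <;> cases c <;> simp [cellDist, dist_triangle]
end

/-! ### Commands that work on one row of the arrays -/

/-- All writes to the number arrays `N`, the real arrays `R` and the point arrays `P` have the
scalar `v` as first index. -/
def Cmd.Rowwise (v : ℕ) (N R P : List ℕ) : Cmd → Prop
  | setNat r _ => r.arr ∈ N → r.i = nv v
  | setReal r _ => r.arr ∈ R → r.i = nv v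
  | setPoint r _ => r.arr ∈ P → r.i = nv v
  | seq c d => c.Rowwise v N R P ∧ d.Rowwise v N R P
  | ite _ c d => c.Rowwise v N R P ∧ d.Rowwise v N R P
  | loop _ c => c.Rowwise v N R P
  | skip => True

/-- The command never writes the variable `v`, so all its writes to the listed arrays hit the row
that `v` names at the start. This protects the summaries of the other guesses, which share their
arrays with the current one; a frame by whole arrays cannot express it. -/
theorem Exec.row {X : Type*} [MetricSpace X] {lab : X → ℕ} {c : Cmd} {σ σ' : Mem X} {t v : ℕ}
    {N R P : List ℕ} (h : Exec lab c σ t σ') (hr : c.Rowwise v N R P) (hv : v ∉ c.wN) :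
    ∀ j, j ≠ σ.nat (v, 0, 0, 0) → (∀ a ∈ N, ∀ i, σ'.nat (a, j, i) = σ.nat (a, j, i)) ∧
      (∀ a ∈ R, ∀ i, σ'.real (a, j, i) = σ.real (a, j, i)) ∧
      (∀ a ∈ P, ∀ i, σ'.pt (a, j, i) = σ.pt (a, j, i)) := by
  induction h with
  | skip => exact fun _ _ => ⟨fun _ _ _ => rfl, fun _ _ _ => rfl, fun _ _ _ => rfl⟩
  | setNat σ r e =>
    refine fun j hj => ⟨fun a ha i => ?_, fun _ _ _ => rfl, fun _ _ _ => rfl⟩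
    simp only [Ref.addr, setNat_nat]
    rw [if_neg]
    rintro h
    simp only [Prod.mk.injEq] at h
    rw [hr (h.1 ▸ ha)] at h
    exact hj h.2.1
  | setReal σ r e =>
    refine fun j hj => ⟨fun _ _ _ => rfl, fun a ha i => ?_, fun _ _ _ => rfl⟩
    simp only [Ref.addr, setReal_real]
    rw [if_neg]
    rintro h
    simp only [Prod.mk.injEq] at h
    rw [hr (h.1 ▸ ha)] at h
    exact hj h.2.1
  | setPoint σ p q x hx =>
    refine fun j hj => ⟨fun _ _ _ => rfl, fun _ _ _ => rfl, fun a ha i => ?_⟩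
    simp only [Ref.addr, setPoint_pt]
    rw [if_neg]
    rintro h
    simp only [Prod.mk.injEq] at h
    rw [hr (h.1 ▸ ha)] at h
    exact hj h.2.1
  | seq _ _ _ _ _ _ _ hc _ h₁ h₂ =>
    intro j hj
    simp only [Cmd.wN, List.mem_append, not_or] at hv
    obtain ⟨a₁, a₂, a₃⟩ := h₁ hr.1 hv.1 j hj
    obtain ⟨b₁, b₂, b₃⟩ := h₂ hr.2 hv.2 j (by rwa [hc.frame.nat v _ hv.1])
    exact ⟨fun a ha i => by rw [b₁ a ha, a₁ a ha], fun a ha i => by rw [b₂ a ha, a₂ a ha],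
      fun a ha i => by rw [b₃ a ha, a₃ a ha]⟩
  | iteTrue _ _ _ _ _ _ _ _ h₁ =>
    simp only [Cmd.wN, List.mem_append, not_or] at hv
    exact h₁ hr.1 hv.1
  | iteFalse _ _ _ _ _ _ _ _ h₁ =>
    simp only [Cmd.wN, List.mem_append, not_or] at hv
    exact h₁ hr.2 hv.2
  | loopDone => exact fun _ _ => ⟨fun _ _ _ => rfl, fun _ _ _ => rfl, fun _ _ _ => rfl⟩
  | loopStep _ _ _ _ _ _ _ _ hc _ h₁ h₂ =>
    intro j hj
    obtain ⟨a₁, a₂, a₃⟩ := h₁ hr hv j hj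
    obtain ⟨b₁, b₂, b₃⟩ := h₂ hr hv j (by rwa [hc.frame.nat v _ hv])
    exact ⟨fun a ha i => by rw [b₁ a ha, a₁ a ha], fun a ha i => by rw [b₂ a ha, a₂ a ha],
      fun a ha i => by rw [b₃ a ha, a₃ a ha]⟩

/-! ### The data of one guess -/

/-- The summary kept for one guess `tau` of the optimal value: `cnt` pivots; the pivot `piv s`
carries the list `lst s 0, …, lst s (len s - 1)` of groups that have a representative
`rep s g` near it; `mark s` is the characteristic function of the list. -/
structure ClassView (X : Type*) where
  cnt : ℕ
  tau : ℝ
  piv : ℕ → Option X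
  len : ℕ → ℕ
  lst : ℕ → ℕ → ℕ
  mark : ℕ → ℕ → ℕ
  rep : ℕ → ℕ → Option X

/-- The summary of the `j`-th guess in the memory. -/
def Mem.view {X : Type*} (σ : Mem X) (j : ℕ) : ClassView X where
  cnt := σ.nat (8, j, 0, 0)
  tau := σ.real (2, j, 0, 0)
  piv s := σ.pt (2, j, s, 0)
  len s := σ.nat (9, j, s, 0)
  lst s p := σ.nat (10, j, s, p)
  mark s g := σ.nat (11, j, s, g)
  rep s g := σ.pt (3, j, s, g)

section
variable {X : Type*} (σ : Mem X) (j : ℕ)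

theorem Frame.view {N R P : List ℕ} {σ σ' : Mem X} (h : Frame N R P σ σ')
    (h8 : 8 ∉ N) (h9 : 9 ∉ N) (h10 : 10 ∉ N) (h11 : 11 ∉ N) (hR : 2 ∉ R) (hP : 2 ∉ P)
    (hP' : 3 ∉ P) (j : ℕ) : σ'.view j = σ.view j := by
  simp only [Mem.view, h.nat 8 _ h8, h.nat 9 _ h9, h.nat 10 _ h10, h.nat 11 _ h11,
    h.real 2 _ hR, h.pt 2 _ hP, h.pt 3 _ hP']

theorem Exec.view_ne [MetricSpace X] {lab : X → ℕ} {c : Cmd} {σ σ' : Mem X} {t : ℕ}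
    (h : Exec lab c σ t σ') (hr : c.Rowwise 12 [8, 9, 10, 11] [2] [2, 3]) (hv : 12 ∉ c.wN)
    {j : ℕ} (hj : j ≠ σ.nat (12, 0, 0, 0)) : σ'.view j = σ.view j := by
  obtain ⟨h₁, h₂, h₃⟩ := h.row hr hv j hj
  simp only [Mem.view, h₁ 8 (by simp), h₁ 9 (by simp), h₁ 10 (by simp), h₁ 11 (by simp),
    h₂ 2 (by simp), h₃ 2 (by simp), h₃ 3 (by simp)]

theorem Runs.mono_row [MetricSpace X] {lab : X → ℕ} {c : Cmd} {σ : Mem X}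
    {Q Q' : ℕ → Mem X → Prop} (h : Runs lab c σ Q)
    (hr : c.Rowwise 12 [8, 9, 10, 11] [2] [2, 3]) (hv : 12 ∉ c.wN)
    (hQ : ∀ t σ', Frame c.wN c.wR c.wP σ σ' →
      (∀ j, j ≠ σ.nat (12, 0, 0, 0) → σ'.view j = σ.view j) → Q t σ' → Q' t σ') :
    Runs lab c σ Q' := by
  obtain ⟨t, σ', he, hq⟩ := h
  exact ⟨t, σ', he, hQ _ _ he.frame (fun j hj => he.view_ne hr hv hj) hq⟩

@[simp] theorem view_setNat_cnt (v : ℕ) :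
    (σ.setNat (8, j, 0, 0) v).view j = { σ.view j with cnt := v } := by
  simp [Mem.view]

@[simp] theorem view_setReal_tau (v : ℝ) :
    (σ.setReal (2, j, 0, 0) v).view j = { σ.view j with tau := v } := by
  simp [Mem.view]

@[simp] theorem view_setPoint_piv (s : ℕ) (x : X) : (σ.setPoint (2, j, s, 0) x).view j =
    { σ.view j with piv := fun a => if a = s then some x else (σ.view j).piv a } := by
  simp [Mem.view]

@[simp] theorem view_setNat_len (s v : ℕ) : (σ.setNat (9, j, s, 0) v).view j =
    { σ.view j with len := fun a => if a = s then v else (σ.view j).len a } := by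
  simp [Mem.view]

@[simp] theorem view_setNat_lst (s p v : ℕ) : (σ.setNat (10, j, s, p) v).view j =
    { σ.view j with
      lst := fun a b => if a = s ∧ b = p then v else (σ.view j).lst a b } := by
  simp [Mem.view]

@[simp] theorem view_setNat_mark (s g v : ℕ) : (σ.setNat (11, j, s, g) v).view j =
    { σ.view j with
      mark := fun a b => if a = s ∧ b = g then v else (σ.view j).mark a b } := by
  simp [Mem.view]

@[simp] theorem view_setPoint_rep (s g : ℕ) (x : X) : (σ.setPoint (3, j, s, g) x).view j =
    { σ.view j with
      rep := fun a b => if a = s ∧ b = g then some x else (σ.view j).rep a b } := by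
  simp [Mem.view]

theorem view_setNat {a : ℕ} (i : ℕ × ℕ × ℕ) (v : ℕ) (h8 : a ≠ 8) (h9 : a ≠ 9) (h10 : a ≠ 10)
    (h11 : a ≠ 11) : (σ.setNat (a, i) v).view j = σ.view j := by
  simp [Mem.view, h8.symm, h9.symm, h10.symm, h11.symm]

theorem view_setReal {a : ℕ} (i : ℕ × ℕ × ℕ) (v : ℝ) (h2 : a ≠ 2) :
    (σ.setReal (a, i) v).view j = σ.view j := by
  simp [Mem.view, h2.symm]

theorem view_setPoint {a : ℕ} (i : ℕ × ℕ × ℕ) (x : X) (h2 : a ≠ 2) (h3 : a ≠ 3) :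
    (σ.setPoint (a, i) x).view j = σ.view j := by
  simp [Mem.view, h2.symm, h3.symm]

theorem setNat_setNat (a : Addr) (v w : ℕ) :
    (σ.setNat a v).setNat a w = σ.setNat a w := by
  simp [Mem.setNat]

end

/-- Adds the representative `y` of the group `g` to the slot `i`, if the slot has none. -/
def ClassView.addRep {X : Type*} (V : ClassView X) (i g : ℕ) (y : X) : ClassView X :=
  if V.mark i g = 0 then
    { V with
      rep := fun a b => if a = i ∧ b = g then some y else V.rep a b
      mark := fun a b => if a = i ∧ b = g then 1 else V.mark a b
      lst := fun a b => if a = i ∧ b = V.len i then g else V.lst a b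
      len := fun a => if a = i then V.len i + 1 else V.len a }
  else V

/-- Moves the last entry `g`, with the representative `y`, of the slot `s` to the slot `i`. -/
def ClassView.pop {X : Type*} (V : ClassView X) (s i g : ℕ) (y : X) : ClassView X :=
  ClassView.addRep
    { V with
      len := fun a => if a = s then V.len s - 1 else V.len a
      mark := fun a b => if a = s ∧ b = g then 0 else V.mark a b } i g y

/-- Makes `x` the next pivot. -/
def ClassView.newPivot {X : Type*} (V : ClassView X) (x : X) : ClassView X :=
  { V with
    cnt := V.cnt + 1
    piv := fun a => if a = V.cnt then some x else V.piv a }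

/-- Adds the point in the cell `src`, of group `g`, to the slot `i` of the guess `jj`. -/
def addRepCmd (src : Ref) : Cmd :=
  .ite (.natLe (n3 11 (nv 12) (nv 14) (nv 16)) (.const 0))
    (block [.setPoint (rf3 3 (nv 12) (nv 14) (nv 16)) src,
      .setNat (rf3 11 (nv 12) (nv 14) (nv 16)) (.const 1),
      .setNat (rf3 10 (nv 12) (nv 14) (n2 9 (nv 12) (nv 14))) (nv 16),
      .setNat (rf2 9 (nv 12) (nv 14)) (.add (n2 9 (nv 12) (nv 14)) (.const 1))])
    .skip

/-- Finds the first pivot within `2 * tau` of the point in the cell `src`; if there is none, the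
point becomes a pivot. -/
def placeCmd (src : Ref) : Cmd :=
  block [.setNat (rf0 14) (.const 0),
    .loop (.and (ltE (nv 14) (n1 8 (nv 12)))
        (ltR (.mul (.ofNat (.const 2)) (.load (rf1 2 (nv 12))))
          (.dist (rf2 2 (nv 12) (nv 14)) src))) (inc 14),
    .ite (.natLe (n1 8 (nv 12)) (nv 14))
      (block [.setPoint (rf2 2 (nv 12) (nv 14)) src,
        .setNat (rf1 8 (nv 12)) (.add (n1 8 (nv 12)) (.const 1))])
      .skip]

/-- Moves the representatives of the slot `s` to the slot `i`. -/
def transferCmd : Cmd :=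
  .loop (ltE (.const 0) (n2 9 (nv 12) (nv 13)))
    (block [.setNat (rf2 9 (nv 12) (nv 13)) (.sub (n2 9 (nv 12) (nv 13)) (.const 1)),
      .setNat (rf0 16) (n3 10 (nv 12) (nv 13) (n2 9 (nv 12) (nv 13))),
      .setNat (rf3 11 (nv 12) (nv 13) (nv 16)) (.const 0),
      addRepCmd (rf3 3 (nv 12) (nv 13) (nv 16))])

/-- Merges the pivots of the guess `jj` that are within `2 * tau` of each other. -/
def thinCmd : Cmd :=
  block [.setNat (rf0 15) (n1 8 (nv 12)), .setNat (rf1 8 (nv 12)) (.const 0),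
    .setNat (rf0 13) (.const 0),
    forUp 13 (nv 15)
      (block [placeCmd (rf2 2 (nv 12) (nv 13)),
        .ite (ltE (nv 14) (nv 13)) transferCmd .skip])]

/-- Inserts the arriving point into the summary of the guess `jj`. -/
def insertCmd : Cmd :=
  block [placeCmd (rf0 0), .setNat (rf0 16) (grp (rf0 0)), addRepCmd (rf0 0)]

section
variable {X : Type*} [MetricSpace X] {lab : X → ℕ} {σ : Mem X}

theorem addRepCmd_spec {src : Ref} {y : X} (hy : σ.pt (src.addr lab σ) = some y)
    (ht : src.time ≤ 20) :
    Runs lab (addRepCmd src) σ fun t σ' => t ≤ 200 ∧ σ'.view (σ.nat (12, 0, 0, 0)) =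
      (σ.view (σ.nat (12, 0, 0, 0))).addRep (σ.nat (14, 0, 0, 0)) (σ.nat (16, 0, 0, 0)) y := by
  simp only [addRepCmd, runs_ite]
  constructor
  · intro h
    simp only [natLe_holds, n3_eval, nv_eval, const_eval, nonpos_iff_eq_zero] at h
    simp only [block_cons, block_singleton, runs_seq, runs_setPoint, runs_setNat]
    refine ⟨y, hy, ?_⟩
    constructor
    · simp; omega
    · simp [ClassView.addRep]
      rw [if_pos (by exact h)]
      simp [Mem.view]
      rfl
  · intro h
    simp only [natLe_holds, n3_eval, nv_eval, const_eval, nonpos_iff_eq_zero] at h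
    simp only [runs_skip]
    refine ⟨by simp, ?_⟩
    simp only [ClassView.addRep]
    rw [if_neg (by exact h)]

/-- The command changes the search variable before it reads `src`; `hsrc` guarantees that the
address of `src` does not depend on that variable. In both outcomes the variable ends at the slot
responsible for the point. -/
theorem placeCmd_spec {src : Ref} {x : X} (hx : σ.pt (src.addr lab σ) = some x)
    (hsrc : ∀ v, src.addr lab (σ.setNat (14, 0, 0, 0) v) = src.addr lab σ)
    (ht : src.time ≤ 20) {V : ClassView X} (hV : σ.view (σ.nat (12, 0, 0, 0)) = V) :
    Runs lab (placeCmd src) σ fun t σ' => t ≤ 200 * (V.cnt + 2) ∧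
      ((σ'.nat (14, 0, 0, 0) < V.cnt ∧
          cellDist (V.piv (σ'.nat (14, 0, 0, 0))) (some x) ≤ 2 * V.tau ∧
          σ'.view (σ.nat (12, 0, 0, 0)) = V) ∨
        (σ'.nat (14, 0, 0, 0) = V.cnt ∧ (∀ i < V.cnt, 2 * V.tau < cellDist (V.piv i) (some x)) ∧
          σ'.view (σ.nat (12, 0, 0, 0)) = V.newPivot x)) := by
  set jj := σ.nat (12, 0, 0, 0) with hjj
  have hcnt : σ.nat (8, jj, 0, 0) = V.cnt := by rw [← hV]; rfl
  have htau : σ.real (2, jj, 0, 0) = V.tau := by rw [← hV]; rfl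
  have hpiv : ∀ i, σ.pt (2, jj, i, 0) = V.piv i := by rw [← hV]; intro; rfl
  simp only [placeCmd, block_cons, block_singleton, runs_seq, runs_setNat]
  -- During the search only the search variable changes, so the invariant can name the memory
  -- exactly; the pivots passed so far are all too far away.
  refine Runs.mono (Runs.loop (Q := fun σ' => ∃ i ≤ V.cnt, σ' = σ.setNat (14, 0, 0, 0) i ∧
      (∀ i' < i, 2 * V.tau < cellDist (V.piv i') (some x)) ∧
      (i < V.cnt → cellDist (V.piv i) (some x) ≤ 2 * V.tau))
    (B := (V.cnt + 1) * 100)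
    (fun B σ' => ∃ i ≤ V.cnt, σ' = σ.setNat (14, 0, 0, 0) i ∧
      (∀ i' < i, 2 * V.tau < cellDist (V.piv i') (some x)) ∧ B = (V.cnt - i + 1) * 100)
    ?_ ?_ ?_) ?_
  · rintro B σ' ⟨i, hi, rfl, hlt, rfl⟩ hb
    refine ⟨?_, i, hi, rfl, hlt, ?_⟩
    · simp
      omega
    · intro hi'
      by_contra hcon
      apply hb
      simp [hsrc, hx, ← hjj, hcnt, htau, hpiv, hi', lt_of_not_ge hcon]
  · rintro B σ' ⟨i, hi, rfl, hlt, rfl⟩ hb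
    simp [hsrc, hx, ← hjj, hcnt, htau, hpiv] at hb
    simp only [inc, runs_setNat]
    refine ⟨(V.cnt - (i + 1) + 1) * 100, ?_, i + 1, hb.1, ?_, ?_, rfl⟩
    · simp
      omega
    · simp [setNat_setNat]
    · intro i' hi'
      rcases Nat.lt_succ_iff_lt_or_eq.1 hi' with h | rfl
      · exact hlt i' h
      · exact hb.2
  · exact ⟨0, Nat.zero_le _, rfl, by simp, rfl⟩
  · rintro t σ' ⟨htt, i, hi, rfl, hlt, hle⟩
    have hview : ∀ v, (σ.setNat (14, 0, 0, 0) v).view jj = V := fun v => by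
      rw [view_setNat _ _ _ _ (by decide) (by decide) (by decide) (by decide), hV]
    rw [runs_ite]
    constructor
    · intro hb
      simp [← hjj, hcnt] at hb
      have hi' : i = V.cnt := le_antisymm hi hb
      subst hi'
      simp only [runs_seq, runs_setPoint, runs_setNat]
      refine ⟨x, by rw [hsrc]; exact hx, ?_, Or.inr ⟨?_, hlt, ?_⟩⟩
      · simp
        omega
      · simp
      · simp [← hjj, hview, hcnt, ClassView.newPivot]
    · intro hb
      simp [← hjj, hcnt] at hb
      simp only [runs_skip]
      refine ⟨?_, Or.inl ⟨by simpa using hb, by simpa using hle hb, hview _⟩⟩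
      simp
      omega
end
end FairStream

namespace FairStream

/-! ### Correctness of a summary -/

/-- The invariant while the pivots of a summary are merged.  The pivots before `V.cnt` are the
current ones, at the guess `V.tau`; the slots in `[s, N)` still belong to the previous guess
`τo`.  All stored points belong to `S`, and the points of `pre` are covered. -/
structure ThinInv {X : Type*} [MetricSpace X] (lab : X → ℕ) (S pre : Set X) (α τo : ℝ) (s N : ℕ)
    (V : ClassView X) : Prop where
  piv : ∀ i, (i < V.cnt ∨ (s ≤ i ∧ i < N)) → ∃ p ∈ S, V.piv i = some p
  sep : ∀ i j, i < j → j < V.cnt → 2 * V.tau < cellDist (V.piv i) (V.piv j)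
  rep : ∀ i p, p < V.len i → ∃ y ∈ S, V.rep i (V.lst i p) = some y ∧ lab y = V.lst i p ∧
    cellDist (V.piv i) (some y) ≤ if i < V.cnt then α * V.tau else α * τo
  mark : ∀ i g, V.mark i g ≠ 0 → ∃ p < V.len i, V.lst i p = g
  empty : ∀ i, V.cnt ≤ i → (i < s ∨ N ≤ i) → V.len i = 0
  cov : ∀ x ∈ pre, ∃ i, V.mark i (lab x) ≠ 0 ∧
    cellDist (V.piv i) (some x) ≤ if i < V.cnt then α * V.tau else α * τo

/-- The summary `V` of the points `pre` is correct. -/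
def ClassInv {X : Type*} [MetricSpace X] (lab : X → ℕ) (S pre : Set X) (α : ℝ) (V : ClassView X) :
    Prop :=
  ThinInv lab S pre α 0 0 0 V

/-- Only cells with slots below `M` and groups below `m` are used. -/
def ClassView.Box {X : Type*} (V : ClassView X) (M m : ℕ) : Prop :=
  (∀ a, V.piv a ≠ none → a < M) ∧ ∀ a g, V.rep a g ≠ none → a < M ∧ g < m

theorem ClassView.Box.addRep {X : Type*} {V : ClassView X} {M m i g : ℕ} (h : V.Box M m)
    (hi : i < M) (hg : g < m) (y : X) : (V.addRep i g y).Box M m := by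
  unfold ClassView.addRep
  split_ifs with h0
  · refine ⟨h.1, fun a b hab => ?_⟩
    dsimp only at hab
    split_ifs at hab with h1
    · rw [h1.1, h1.2]; exact ⟨hi, hg⟩
    · exact h.2 a b hab
  · exact h

theorem ClassView.Box.pop {X : Type*} {V : ClassView X} {M m i g : ℕ} (h : V.Box M m)
    (hi : i < M) (hg : g < m) (s : ℕ) (y : X) : (V.pop s i g y).Box M m := by
  have h' : ClassView.Box { V with
      len := fun a => if a = s then V.len s - 1 else V.len a
      mark := fun a b => if a = s ∧ b = g then 0 else V.mark a b } M m := h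
  exact h'.addRep hi hg y

theorem ClassView.Box.newPivot {X : Type*} {V : ClassView X} {M m : ℕ} (h : V.Box M m)
    (hi : V.cnt < M) (y : X) : (V.newPivot y).Box M m := by
  refine ⟨fun a ha => ?_, h.2⟩
  simp only [ClassView.newPivot] at ha
  split_ifs at ha with h1
  · omega
  · exact h.1 a ha

/-- The lists of representatives are correct, and the representatives satisfy `P`. -/
structure RepsOK {X : Type*} (lab : X → ℕ) (P : ℕ → X → Prop) (V : ClassView X) : Prop where
  rep : ∀ i p, p < V.len i → ∃ y, V.rep i (V.lst i p) = some y ∧ lab y = V.lst i p ∧ P i y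
  mark : ∀ i g, V.mark i g ≠ 0 → ∃ p < V.len i, V.lst i p = g

section
variable {X : Type*} {lab : X → ℕ} {P : ℕ → X → Prop} {V : ClassView X}

theorem addRep_mark_self (i g : ℕ) (y : X) : (V.addRep i g y).mark i g ≠ 0 := by
  unfold ClassView.addRep
  split_ifs with h
  · simp
  · exact h

theorem addRep_fields (i g : ℕ) (y : X) : (V.addRep i g y).cnt = V.cnt ∧
    (V.addRep i g y).tau = V.tau ∧ (V.addRep i g y).piv = V.piv := by
  unfold ClassView.addRep
  split_ifs <;> simp

theorem addRep_len_le (i g : ℕ) (y : X) (a : ℕ) :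
    (V.addRep i g y).len a ≤ if a = i then V.len a + 1 else V.len a := by
  unfold ClassView.addRep
  by_cases ha : a = i
  · subst ha; by_cases h : V.mark a g = 0 <;> simp [h]
  · split_ifs <;> simp [ha]

theorem addRep_len_ne {i a : ℕ} (g : ℕ) (y : X) (ha : a ≠ i) :
    (V.addRep i g y).len a = V.len a := by
  unfold ClassView.addRep
  split_ifs <;> simp [ha]

theorem addRep_mark_mono {i g a b : ℕ} {y : X} (h : V.mark a b ≠ 0) :
    (V.addRep i g y).mark a b ≠ 0 := by
  unfold ClassView.addRep
  split_ifs with h'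
  · dsimp only; split_ifs <;> simp [h]
  · exact h

/-- The only delicate case is a list that already contains the group: its representative is
overwritten, and the old entry is then certified by the new point, which satisfies `P` as well.
Therefore no injectivity of the lists has to be carried along. -/
theorem RepsOK.addRep (h : RepsOK lab P V) {i : ℕ} {y : X} (hP : P i y) :
    RepsOK lab P (V.addRep i (lab y) y) := by
  unfold ClassView.addRep
  split_ifs with hm
  · constructor
    · intro a p hp
      dsimp only at hp ⊢
      by_cases ha : a = i
      · subst ha
        simp only [if_true, true_and] at hp ⊢
        by_cases hpl : p = V.len a
        · subst hpl
          exact ⟨y, by simp, by simp, hP⟩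
        · obtain ⟨z, hz1, hz2, hz3⟩ := h.rep a p (by omega)
          by_cases hg : V.lst a p = lab y
          · exact ⟨y, by simp [hg, hpl], by simp [hg, hpl], hP⟩
          · exact ⟨z, by simp [hg, hpl, hz1], by simp [hpl, hz2], hz3⟩
      · simp only [ha, if_false, false_and] at hp ⊢
        exact h.rep a p hp
    · intro a g hg
      dsimp only at hg ⊢
      by_cases ha : a = i
      · subst ha
        simp only [if_true, true_and] at hg ⊢
        by_cases hgy : g = lab y
        · exact ⟨V.len a, by omega, by simp [hgy]⟩
        · rw [if_neg hgy] at hg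
          obtain ⟨p, hp, hpg⟩ := h.mark a g hg
          exact ⟨p, by omega, by rw [if_neg (by omega), hpg]⟩
      · simp only [ha, if_false, false_and] at hg ⊢
        exact h.mark a g hg
  · exact h

/-- Removal of the last entry of a list. -/
theorem RepsOK.drop (h : RepsOK lab P V) {s : ℕ} (hs : 0 < V.len s) :
    RepsOK lab P { V with
      len := fun a => if a = s then V.len s - 1 else V.len a
      mark := fun a b => if a = s ∧ b = V.lst s (V.len s - 1) then 0 else V.mark a b } := by
  constructor
  · intro a p hp
    dsimp only at hp ⊢
    refine h.rep a p ?_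
    split_ifs at hp with ha
    · subst ha; omega
    · exact hp
  · intro a g hg
    dsimp only at hg ⊢
    split_ifs at hg with h1
    · exact absurd rfl hg
    · obtain ⟨p, hp, hpg⟩ := h.mark a g hg
      refine ⟨p, ?_, hpg⟩
      split_ifs with ha
      · subst ha
        have : p ≠ V.len a - 1 := by
          rintro rfl
          exact h1 ⟨rfl, hpg.symm⟩
        omega
      · exact hp

theorem pop_fields (s i g : ℕ) (y : X) : (V.pop s i g y).cnt = V.cnt ∧
    (V.pop s i g y).tau = V.tau ∧ (V.pop s i g y).piv = V.piv := by
  unfold ClassView.pop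
  exact addRep_fields _ _ _

theorem pop_len (s i g : ℕ) (y : X) (hne : i ≠ s) : (V.pop s i g y).len s = V.len s - 1 ∧
    (V.pop s i g y).len i ≤ V.len i + 1 ∧
    ∀ a, a ≠ s → a ≠ i → (V.pop s i g y).len a = V.len a := by
  unfold ClassView.pop
  refine ⟨?_, ?_, ?_⟩
  · rw [addRep_len_ne _ _ hne.symm]; simp
  · refine (addRep_len_le _ _ _ _).trans ?_
    simp [hne]
  · intro a ha hai
    rw [addRep_len_ne _ _ hai]; simp [ha]

end

section
variable {X : Type*} [MetricSpace X] {lab : X → ℕ} {S pre : Set X} {α τo : ℝ} {s N : ℕ}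
  {V : ClassView X}

theorem ThinInv.repsOK (h : ThinInv lab S pre α τo s N V) : RepsOK lab (fun i y => y ∈ S ∧
    cellDist (V.piv i) (some y) ≤ if i < V.cnt then α * V.tau else α * τo) V :=
  ⟨fun i p hp => by
    obtain ⟨y, h1, h2, h3, h4⟩ := h.rep i p hp
    exact ⟨y, h2, h3, h1, h4⟩, h.mark⟩

/-- A point represented through the slot `s` was within `α * τo` of the old pivot. That pivot is
within `2 * V.tau` of the pivot `i`, and `hα` says that the sum is within the radius allowed at the
new guess. -/
theorem ThinInv.pop (h : ThinInv lab S pre α τo s N V) {i : ℕ} {y : X} (hi : i < V.cnt)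
    (his : i < s) (hcs : V.cnt ≤ s) (hsN : s < N) (hl : 0 < V.len s)
    (hd : cellDist (V.piv i) (V.piv s) ≤ 2 * V.tau) (hα : α * τo + 2 * V.tau ≤ α * V.tau)
    (hy : V.rep s (V.lst s (V.len s - 1)) = some y) :
    ThinInv lab S pre α τo s N (V.pop s i (V.lst s (V.len s - 1)) y) := by
  obtain ⟨y', hy', hr', hg', hd'⟩ := h.rep s (V.len s - 1) (by omega)
  rw [hy] at hr'
  cases hr'
  rw [if_neg (by omega)] at hd'
  obtain ⟨ps, hps, hpse⟩ := h.piv s (Or.inr ⟨le_rfl, hsN⟩)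
  have hstep : ∀ x, cellDist (V.piv s) (some x) ≤ α * τo →
      cellDist (V.piv i) (some x) ≤ α * V.tau := by
    intro x hx
    have := cellDist_triangle (V.piv i) (some x) ps
    rw [← hpse] at this
    linarith
  have hR := (h.repsOK.drop hl).addRep (i := i) (y := y) ⟨hy', by rw [if_pos hi]; exact hstep y hd'⟩
  rw [← hg'] at hR ⊢
  obtain ⟨f1, f2, f3⟩ := pop_fields (V := V) s i (lab y) y
  constructor
  · rw [f1, f3]; exact h.piv
  · rw [f1, f2, f3]; exact h.sep
  · rw [f1, f2, f3]
    intro a p hp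
    obtain ⟨z, h1, h2, h3, h4⟩ := hR.rep a p hp
    exact ⟨z, h3, h1, h2, h4⟩
  · exact hR.mark
  · rw [f1]
    intro a ha hs
    unfold ClassView.pop
    rw [addRep_len_ne _ _ (by omega)]
    simpa [show a ≠ s by omega] using h.empty a ha hs
  · rw [f1, f2, f3]
    intro x hx
    obtain ⟨a, ha, hda⟩ := h.cov x hx
    unfold ClassView.pop
    -- Only points covered through the removed entry need a new slot. They get the slot `i`, whose
    -- mark for the group is set whether the entry was added or was already there.
    by_cases hax : a = s ∧ lab x = lab y
    · obtain ⟨rfl, hxy⟩ := hax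
      refine ⟨i, ?_, ?_⟩
      · rw [hxy]; exact addRep_mark_self _ _ _
      · rw [if_pos hi]
        rw [if_neg (by omega)] at hda
        exact hstep x hda
    · refine ⟨a, addRep_mark_mono ?_, hda⟩
      dsimp only
      rwa [if_neg hax]

/-- The slot `V.cnt` lies below `s`, so it has been treated and its list is empty. Overwriting its
pivot therefore harms neither a list nor a pivot that is still to be treated. -/
theorem ThinInv.newPivot (h : ThinInv lab S pre α τo s N V) {x : X} (hx : x ∈ S)
    (hs : V.cnt < s) (hsep : ∀ i < V.cnt, 2 * V.tau < cellDist (V.piv i) (some x)) :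
    ThinInv lab S pre α τo s N (V.newPivot x) := by
  have hl : V.len V.cnt = 0 := h.empty _ le_rfl (Or.inl hs)
  constructor
  · intro i hi
    by_cases hic : i = V.cnt
    · exact ⟨x, hx, by simp [ClassView.newPivot, hic]⟩
    · obtain ⟨p, hp, hpe⟩ := h.piv i (by simp only [ClassView.newPivot] at hi; omega)
      exact ⟨p, hp, by simp [ClassView.newPivot, hic, hpe]⟩
  · intro i j hij hj
    simp only [ClassView.newPivot] at hj ⊢
    rw [if_neg (by omega)]
    by_cases hjc : j = V.cnt
    · rw [if_pos hjc]; exact hsep i (by omega)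
    · rw [if_neg hjc]; exact h.sep i j hij (by omega)
  · intro i p hp
    simp only [ClassView.newPivot] at hp ⊢
    have hic : i ≠ V.cnt := by rintro rfl; omega
    rw [if_neg hic]
    obtain ⟨y, h1, h2, h3, h4⟩ := h.rep i p hp
    refine ⟨y, h1, h2, h3, ?_⟩
    have : i < V.cnt + 1 ↔ i < V.cnt := by omega
    simpa only [this] using h4
  · exact h.mark
  · intro i hi
    simp only [ClassView.newPivot] at hi ⊢
    exact h.empty i (by omega)
  · intro z hz
    obtain ⟨i, hi, hd⟩ := h.cov z hz
    have hic : i ≠ V.cnt := by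
      rintro rfl
      obtain ⟨p, hp, -⟩ := h.mark _ _ hi
      omega
    refine ⟨i, hi, ?_⟩
    simp only [ClassView.newPivot]
    rw [if_neg hic]
    have : i < V.cnt + 1 ↔ i < V.cnt := by omega
    simpa only [this] using hd

/-- The slot `s` stays where it is and becomes a slot of the new guess. -/
theorem ThinInv.newPivot_self (h : ThinInv lab S pre α τo s N V) {x : X} (hx : V.piv s = some x)
    (hcs : V.cnt = s) (hsN : s < N) (hα : α * τo ≤ α * V.tau)
    (hsep : ∀ i < V.cnt, 2 * V.tau < cellDist (V.piv i) (some x)) :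
    ThinInv lab S pre α τo (s + 1) N (V.newPivot x) := by
  subst hcs
  have hp : (V.newPivot x).piv = V.piv := by
    funext a
    simp only [ClassView.newPivot]
    split_ifs with ha
    · rw [ha, hx]
    · rfl
  have hb : ∀ i, (if i < V.cnt then α * V.tau else α * τo) ≤
      if i < V.cnt + 1 then α * V.tau else α * τo := by
    intro i
    split_ifs <;> first | exact le_rfl | exact hα | omega
  constructor
  · rw [hp]
    intro i hi
    exact h.piv i (by simp only [ClassView.newPivot] at hi; omega)
  · rw [hp]
    intro i j hij hj
    simp only [ClassView.newPivot] at hj ⊢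
    by_cases hjc : j = V.cnt
    · rw [hjc, hx]; exact hsep i (by omega)
    · exact h.sep i j hij (by omega)
  · rw [hp]
    intro i p hp
    obtain ⟨y, h1, h2, h3, h4⟩ := h.rep i p hp
    exact ⟨y, h1, h2, h3, h4.trans (hb i)⟩
  · exact h.mark
  · intro i hi hi'
    simp only [ClassView.newPivot] at hi ⊢
    exact h.empty i (by omega) (by omega)
  · rw [hp]
    intro z hz
    obtain ⟨i, hi, hd⟩ := h.cov z hz
    exact ⟨i, hi, hd.trans (hb i)⟩

/-- The emptied slot `s` is given up. -/
theorem ThinInv.succ (h : ThinInv lab S pre α τo s N V) (hl : V.len s = 0) :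
    ThinInv lab S pre α τo (s + 1) N V := by
  refine ⟨fun i hi => h.piv i (by omega), h.sep, h.rep, h.mark, fun i hi hi' => ?_, h.cov⟩
  by_cases his : i = s
  · rw [his, hl]
  · exact h.empty i hi (by omega)

/-- All pivots become old ones at the previous value of `tau`. The new value is arbitrary here,
because no pivot has to satisfy a condition at it yet. -/
theorem ClassInv.start (h : ClassInv lab S pre α V) (τ : ℝ) :
    ThinInv lab S pre α V.tau 0 V.cnt { V with cnt := 0, tau := τ } := by
  have hl : ∀ i, ¬ i < V.cnt → V.len i = 0 := fun i hi =>
    h.empty i (not_lt.1 hi) (Or.inr (Nat.zero_le _))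
  refine ⟨fun i hi => h.piv i (Or.inl (by simpa using hi)), by simp, ?_, h.mark, ?_, ?_⟩
  · intro i p hp
    obtain ⟨y, h1, h2, h3, h4⟩ := h.rep i p hp
    have : i < V.cnt := by
      by_contra hc
      have := hl i hc
      dsimp only at hp
      omega
    exact ⟨y, h1, h2, h3, by simpa [this] using h4⟩
  · intro i _ hi
    exact hl i (by simpa using hi)
  · intro x hx
    obtain ⟨i, hi, hd⟩ := h.cov x hx
    have : i < V.cnt := by
      by_contra hc
      obtain ⟨p, hp, -⟩ := h.mark _ _ hi
      have := hl i hc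
      omega
    exact ⟨i, hi, by simpa [this] using hd⟩

theorem ThinInv.finish (h : ThinInv lab S pre α τo N N V) : ClassInv lab S pre α V := by
  have hl : ∀ i, ¬ i < V.cnt → V.len i = 0 := fun i hi =>
    h.empty i (not_lt.1 hi) (by omega)
  refine ⟨fun i hi => h.piv i (by omega), h.sep, ?_, h.mark, fun i hi _ => hl i (not_lt.2 hi), ?_⟩
  · intro i p hp
    obtain ⟨y, h1, h2, h3, h4⟩ := h.rep i p hp
    have : i < V.cnt := by
      by_contra hc
      have := hl i hc
      omega
    exact ⟨y, h1, h2, h3, by simpa [this] using h4⟩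
  · intro x hx
    obtain ⟨i, hi, hd⟩ := h.cov x hx
    have : i < V.cnt := by
      by_contra hc
      obtain ⟨p, hp, -⟩ := h.mark _ _ hi
      have := hl i hc
      omega
    exact ⟨i, hi, by simpa [this] using hd⟩

/-- Insertion of a point `x` whose pivot `i` has been determined. -/
theorem ClassInv.insert (h : ClassInv lab S pre α V) {i : ℕ} {x : X} (hx : x ∈ S) (hi : i < V.cnt)
    (hd : cellDist (V.piv i) (some x) ≤ α * V.tau) :
    ClassInv lab S (insert x pre) α (V.addRep i (lab x) x) := by
  have h' : ThinInv lab S pre α 0 0 0 V := h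
  obtain ⟨f1, f2, f3⟩ := addRep_fields (V := V) i (lab x) x
  have hR : RepsOK lab (fun i y => y ∈ S ∧
      cellDist (V.piv i) (some y) ≤ if i < V.cnt then α * V.tau else α * 0) V :=
    ⟨fun i p hp => by
      obtain ⟨y, h1, h2, h3, h4⟩ := h'.rep i p hp
      exact ⟨y, h2, h3, h1, h4⟩, h'.mark⟩
  replace hR := hR.addRep (i := i) (y := x) ⟨hx, by rwa [if_pos hi]⟩
  refine ThinInv.mk ?_ ?_ ?_ hR.mark ?_ ?_
  · rw [f1, f3]
    intro a ha
    obtain ⟨p, hp, hpe⟩ := h'.piv a ha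
    exact ⟨p, hp, hpe⟩
  · rw [f1, f2, f3]; exact h'.sep
  · rw [f1, f2, f3]
    intro a p hp
    obtain ⟨z, h1, h2, h3, h4⟩ := hR.rep a p hp
    exact ⟨z, h3, h1, h2, h4⟩
  · rw [f1]
    intro a ha hs
    rw [addRep_len_ne _ _ (by omega)]
    exact h'.empty a ha hs
  · rw [f1, f2, f3]
    intro z hz
    rcases hz with rfl | hz
    · exact ⟨i, addRep_mark_self _ _ _, by rw [if_pos hi]; exact hd⟩
    · obtain ⟨a, ha, hda⟩ := h'.cov z hz
      exact ⟨a, addRep_mark_mono ha, hda⟩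

theorem ClassInv.len_eq_zero (h : ClassInv lab S pre α V) {i : ℕ} (hi : V.cnt ≤ i) : V.len i = 0 :=
  ThinInv.empty h i hi (Or.inr (Nat.zero_le _))

/-- The summary after a new pivot has been made. -/
theorem ClassInv.newPivot (h : ClassInv lab S pre α V) {x : X} (hx : x ∈ S)
    (hsep : ∀ i < V.cnt, 2 * V.tau < cellDist (V.piv i) (some x)) :
    ClassInv lab S pre α (V.newPivot x) := by
  -- With `s = N = V.cnt + 1` there are no old slots, and the first free slot counts as an emptied
  -- one; this reduces the claim to the merging invariant.
  have h' : ThinInv lab S pre α 0 (V.cnt + 1) (V.cnt + 1) V := by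
    refine ⟨fun i hi => ThinInv.piv h i (by omega), ThinInv.sep h, ThinInv.rep h, ThinInv.mark h,
      fun i hi _ => h.len_eq_zero hi, ThinInv.cov h⟩
  exact (h'.newPivot hx (Nat.lt_succ_self _) hsep).finish

end
end FairStream

/-! ### Amortized cost of merging and insertion -/

namespace FairStream

/-- A weighted number of list entries. -/
def ClassView.weight {X : Type*} (V : ClassView X) (wt : ℕ → ℕ) (M : ℕ) : ℕ :=
  ∑ a ∈ Finset.range M, wt a * V.len a

theorem ClassView.weight_addRep {X : Type*} (V : ClassView X) (wt : ℕ → ℕ) (i g : ℕ) (y : X) {M : ℕ}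
    (hi : i < M) : (V.addRep i g y).weight wt M ≤ V.weight wt M + wt i := by
  have : V.weight wt M + wt i = ∑ a ∈ Finset.range M, (wt a * V.len a +
      if a = i then wt i else 0) := by
    rw [Finset.sum_add_distrib, Finset.sum_ite_eq', if_pos (Finset.mem_range.2 hi)]
    rfl
  rw [this]
  refine Finset.sum_le_sum fun a _ => ?_
  have h := Nat.mul_le_mul_left (wt a) (addRep_len_le (V := V) i g y a)
  split_ifs at h ⊢ with ha
  · subst ha; rw [Nat.mul_add, mul_one] at h; exact h
  · exact h

section
variable {X : Type*} [MetricSpace X] {lab : X → ℕ} {σ : Mem X} {S pre : Set X} {α : ℝ}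
  {M m : ℕ}

/-- Entries are popped from the end of the list of `s` and offered to the slot `i`. One whose group
is present there is dropped, since its points are covered by the representative in `i`. The time is
linear in the length of the list, and only the slots `s` and `i` change length. -/
theorem transferCmd_spec (hlab : ∀ x, lab x < m) {τo : ℝ} {s i N : ℕ} {V : ClassView X}
    (hs : σ.nat (13, 0, 0, 0) = s) (hi : σ.nat (14, 0, 0, 0) = i)
    (hV : σ.view (σ.nat (12, 0, 0, 0)) = V) (h : ThinInv lab S pre α τo s N V)
    (hic : i < V.cnt) (his : i < s) (hcs : V.cnt ≤ s) (hsN : s < N)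
    (hd : cellDist (V.piv i) (V.piv s) ≤ 2 * V.tau) (hα : α * τo + 2 * V.tau ≤ α * V.tau)
    (hB : V.Box M m) (hiM : i < M) :
    Runs lab transferCmd σ fun t σ' => t ≤ 400 * (V.len s + 1) ∧
      ∃ V', σ'.view (σ.nat (12, 0, 0, 0)) = V' ∧ ThinInv lab S pre α τo s N V' ∧
        V'.cnt = V.cnt ∧ V'.tau = V.tau ∧ V'.len s = 0 ∧ V'.len i ≤ V.len i + V.len s ∧
        (∀ a, a ≠ s → a ≠ i → V'.len a = V.len a) ∧ V'.Box M m := by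
  set jj := σ.nat (12, 0, 0, 0) with hjj
  refine Runs.mono (Runs.loop (Q := fun σ' => ∃ V', σ'.view jj = V' ∧
      ThinInv lab S pre α τo s N V' ∧
        V'.cnt = V.cnt ∧ V'.tau = V.tau ∧ V'.len s = 0 ∧ V'.len i ≤ V.len i + V.len s ∧
        (∀ a, a ≠ s → a ≠ i → V'.len a = V.len a) ∧ V'.Box M m)
    (fun B σ' => σ'.nat (12, 0, 0, 0) = jj ∧ σ'.nat (13, 0, 0, 0) = s ∧ σ'.nat (14, 0, 0, 0) = i ∧
      ThinInv lab S pre α τo s N (σ'.view jj) ∧ (σ'.view jj).cnt = V.cnt ∧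
      (σ'.view jj).tau = V.tau ∧ (σ'.view jj).piv = V.piv ∧
      (σ'.view jj).len i + (σ'.view jj).len s ≤ V.len i + V.len s ∧
      (∀ a, a ≠ s → a ≠ i → (σ'.view jj).len a = V.len a) ∧ (σ'.view jj).Box M m ∧
      B = ((σ'.view jj).len s + 1) * 400) (B := (V.len s + 1) * 400) ?_ ?_ ?_) ?_
  · rintro B σ' ⟨h12, h13, h14, hI, hc, ht, hp, hl, hne, hBx, rfl⟩ hb
    simp [h12, h13] at hb
    have hb' : (σ'.view jj).len s = 0 := hb
    refine ⟨?_, _, rfl, hI, hc, ht, hb', by omega, hne, hBx⟩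
    simp
    omega
  · rintro B σ' ⟨h12, h13, h14, hI, hc, ht, hp, hl, hne, hBx, rfl⟩ hb
    simp [h12, h13] at hb
    have hb' : 0 < (σ'.view jj).len s := hb
    set W := σ'.view jj with hW
    obtain ⟨y, hyS, hy, hyl, hyd⟩ := hI.rep s (W.len s - 1) (by omega)
    have hlen : σ'.nat (9, jj, s, 0) = W.len s := rfl
    have hlst : ∀ p, σ'.nat (10, jj, s, p) = W.lst s p := fun _ => rfl
    have hrep : ∀ g, σ'.pt (3, jj, s, g) = W.rep s g := fun _ => rfl
    simp only [block_cons, block_singleton, runs_seq, runs_setNat]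
    refine (addRepCmd_spec (y := y) ?_ ?_).mono_frame ?_
    · simp [h12, h13, hlen, hlst, hrep, hy]
    · simp
    · rintro t σ'' hF ⟨ht', hv⟩
      have hF12 := hF.nat 12 (0, 0, 0) (by decide)
      have hF13 := hF.nat 13 (0, 0, 0) (by decide)
      have hF14 := hF.nat 14 (0, 0, 0) (by decide)
      have hv' : σ''.view jj = W.pop s i (W.lst s (W.len s - 1)) y := by
        simp [h12, h13, h14] at hv
        simp [view_setNat, hlen, hlst, ← hW] at hv
        rw [hv]
        rfl
      obtain ⟨f1, f2, f3⟩ := pop_fields (V := W) s i (W.lst s (W.len s - 1)) y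
      obtain ⟨g1, g2, g3⟩ := pop_len (V := W) s i (W.lst s (W.len s - 1)) y his.ne
      have hI' := hI.pop (i := i) (y := y) (by omega) his (by omega) hsN hb'
        (by rw [hp, ht]; exact hd) (by rw [ht]; exact hα) hy
      refine ⟨((σ''.view jj).len s + 1) * 400, ?_, ?_, ?_, ?_, ?_, ?_, ?_, ?_, ?_, ?_, ?_, rfl⟩
      · rw [hv', g1]
        simp
        omega
      · rw [hF12]; simp [h12]
      · rw [hF13]; simp [h13]
      · rw [hF14]; simp [h14]
      · rw [hv']; exact hI'
      · rw [hv', f1, hc]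
      · rw [hv', f2, ht]
      · rw [hv', f3, hp]
      · rw [hv', g1]; omega
      · intro a ha hai
        rw [hv', g3 a ha hai, hne a ha hai]
      · rw [hv']; exact hBx.pop hiM (hyl ▸ hlab y) _ _
  · exact ⟨rfl, hs, hi, by rw [hV]; exact h, by rw [hV], by rw [hV], by rw [hV], by rw [hV],
      fun _ _ _ => by rw [hV], by rw [hV]; exact hB, by rw [hV]⟩
  · rintro t σ' ⟨ht, V', h1, h2, h3, h4, h5, h6⟩
    exact ⟨by omega, V', h1, h2, h3, h4, h5, h6⟩

/-- With the weight `1` this says that merging does not increase the number of entries. With the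
weight `id` it says that moving a list from `s` to `i < s` frees at least one unit of potential per
entry. -/
theorem sum_update_two {M s i : ℕ} (hs : s < M) (hi : i < s) (f f' wt : ℕ → ℕ)
    (h0 : f' s = 0) (h1 : f' i ≤ f i + f s) (h2 : ∀ a, a ≠ s → a ≠ i → f' a = f a) :
    (∑ a ∈ Finset.range M, wt a * f' a) + wt s * f s ≤
      (∑ a ∈ Finset.range M, wt a * f a) + wt i * f s := by
  have e : ∀ g : ℕ → ℕ, ∑ a ∈ Finset.range M, wt a * g a =
      wt s * g s + (wt i * g i +
        ∑ a ∈ ((Finset.range M).erase s).erase i, wt a * g a) := by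
    intro g
    rw [← Finset.add_sum_erase _ _ (Finset.mem_range.2 hs), ← Finset.add_sum_erase (a := i)]
    simp [hi.ne, hi.trans hs]
  rw [e f, e f', h0]
  have : ∑ a ∈ ((Finset.range M).erase s).erase i, wt a * f' a =
      ∑ a ∈ ((Finset.range M).erase s).erase i, wt a * f a := by
    refine Finset.sum_congr rfl fun a ha => ?_
    simp only [Finset.mem_erase] at ha
    rw [h2 a ha.2.1 ha.1]
  rw [this]
  have := Nat.mul_le_mul_left (wt i) h1
  rw [Nat.mul_add] at this
  omega

/-- The memory already contains the new `tau`, while the old invariant holds at `τo`. New pivots are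
written in place: their number never exceeds the index of the pivot under treatment, so nothing that
is still needed is lost. The drop of `weight id` pays for the moved entries, and only the quadratic
cost of comparing pivots remains. -/
theorem thinCmd_spec (hlab : ∀ x, lab x < m) {τo : ℝ} {V : ClassView X}
    (hV : σ.view (σ.nat (12, 0, 0, 0)) = V) (h : ClassInv lab S pre α { V with tau := τo })
    (hM : V.cnt ≤ M) (hτ : 0 ≤ V.tau) (hα1 : α * τo ≤ α * V.tau)
    (hα : α * τo + 2 * V.tau ≤ α * V.tau) (hB : V.Box M m) :
    Runs lab thinCmd σ fun t σ' => ∃ V', σ'.view (σ.nat (12, 0, 0, 0)) = V' ∧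
      ClassInv lab S pre α V' ∧ V'.cnt ≤ V.cnt ∧ V'.tau = V.tau ∧ V'.Box M m ∧
      V'.weight (fun _ => 1) M ≤ V.weight (fun _ => 1) M ∧
      t + 400 * V'.weight id M ≤ 400 * V.weight id M + 2000 * (V.cnt + 2) * (V.cnt + 2) := by
  set jj := σ.nat (12, 0, 0, 0) with hjj
  have hcnt : σ.nat (8, jj, 0, 0) = V.cnt := by rw [← hV]; rfl
  have h8 : ∀ v, (σ.setNat (15, 0, 0, 0) v).nat (8, jj, 0, 0) = V.cnt := by simp [hcnt]
  simp only [thinCmd, block_cons, block_singleton, runs_seq, runs_setNat]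
  refine (Runs.forUp_total V.cnt (fun s u σ' => σ'.nat (12, 0, 0, 0) = jj ∧
    σ'.nat (15, 0, 0, 0) = V.cnt ∧ ∃ V', σ'.view jj = V' ∧
      ThinInv lab S pre α τo s V.cnt V' ∧ V'.cnt ≤ s ∧ V'.tau = V.tau ∧ V'.Box M m ∧
      V'.weight (fun _ => 1) M ≤ V.weight (fun _ => 1) M ∧
      u + 400 * V'.weight id M ≤ 400 * V.weight id M + s * (1000 * (V.cnt + 2)))
    (by decide) ?_ ?_ ?_ ?_).mono ?_
  · rintro i u σ' ⟨-, h15, -⟩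
    simpa using h15
  · rintro s u σ₁ hs h13 ⟨h12, h15, W, hW, hI, hWc, hWt, hWB, hW1, hWu⟩
    obtain ⟨p, hpS, hp⟩ := hI.piv s (Or.inr ⟨le_rfl, hs⟩)
    have hpt : σ₁.pt (2, jj, s, 0) = some p := by rw [← hp, ← hW]; rfl
    rw [runs_seq]
    refine (placeCmd_spec (x := p) (V := W) ?_ ?_ ?_ ?_).mono_frame ?_
    · simpa [h12, h13] using hpt
    · simp
    · simp
    · rw [h12, hW]
    rintro t₁ σ₂ hF ⟨ht₁, hcase⟩
    have h12' : σ₂.nat (12, 0, 0, 0) = jj := by rw [hF.nat 12 _ (by decide), h12]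
    have h13' : σ₂.nat (13, 0, 0, 0) = s := by rw [hF.nat 13 _ (by decide), h13]
    have h15' : σ₂.nat (15, 0, 0, 0) = V.cnt := by rw [hF.nat 15 _ (by decide), h15]
    rw [h12] at hcase
    have hview : ∀ (σ' : Mem X) v, (σ'.setNat (13, 0, 0, 0) v).view jj = σ'.view jj :=
      fun σ' v => view_setNat _ _ _ _ (by decide) (by decide) (by decide) (by decide)
    have hbnd : 200 * (W.cnt + 2) ≤ 200 * (V.cnt + 2) := by omega
    -- the transfer of the list of the slot `s` to the slot `i`
    have htrans : ∀ i W', σ₂.view jj = W' → ThinInv lab S pre α τo s V.cnt W' → W'.cnt ≤ s →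
        W'.tau = V.tau → W'.Box M m → W'.len = W.len → σ₂.nat (14, 0, 0, 0) = i → i < W'.cnt → i < s →
        cellDist (W'.piv i) (W'.piv s) ≤ 2 * W'.tau →
        Runs lab transferCmd σ₂ fun t σ' =>
          (σ'.setNat (13, 0, 0, 0) (s + 1)).nat (12, 0, 0, 0) = jj ∧
          (σ'.setNat (13, 0, 0, 0) (s + 1)).nat (15, 0, 0, 0) = V.cnt ∧
          ∃ V', (σ'.setNat (13, 0, 0, 0) (s + 1)).view jj = V' ∧
            ThinInv lab S pre α τo (s + 1) V.cnt V' ∧ V'.cnt ≤ s + 1 ∧ V'.tau = V.tau ∧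
            V'.Box M m ∧
            V'.weight (fun _ => 1) M ≤ V.weight (fun _ => 1) M ∧
            u + (1 + t₁ + (1 + 10 + t)) + 400 * V'.weight id M ≤
              400 * V.weight id M + (s + 1) * (1000 * (V.cnt + 2)) := by
      intro i W' hW' hI' hc' ht' hB' hl' h14 hi his hd
      refine (transferCmd_spec hlab (τo := τo) (N := V.cnt) h13' h14 (by rw [h12', hW']) hI' hi his hc'
        hs hd (by rw [ht']; exact hα) hB' (by omega)).mono_frame ?_
      rintro t σ₃ hF₃ ⟨ht, V', hv, hV', hc, htau, hls, hli, hne, hBx⟩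
      rw [h12'] at hv
      have w1 := sum_update_two (M := M) (by omega) his W'.len V'.len (fun _ => 1) hls hli hne
      have w2 := sum_update_two (M := M) (by omega) his W'.len V'.len id hls hli hne
      simp only [id, one_mul] at w1 w2
      have hw1 : W'.weight (fun _ => 1) M = W.weight (fun _ => 1) M := by
        simp only [ClassView.weight, hl']
      have hw2 : W'.weight id M = W.weight id M := by simp only [ClassView.weight, hl']
      refine ⟨?_, ?_, V', by rw [hview, hv], hV'.succ hls, by omega, by rw [htau, ht'], hBx, ?_, ?_⟩
      · simpa [h12'] using hF₃.nat 12 (0, 0, 0) (by decide)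
      · simpa [h15'] using hF₃.nat 15 (0, 0, 0) (by decide)
      · simp only [ClassView.weight, one_mul] at *
        omega
      · have hmul : (i + 1) * W'.len s ≤ s * W'.len s := Nat.mul_le_mul_right _ his
        rw [Nat.add_mul, one_mul] at hmul
        have : (s + 1) * (1000 * (V.cnt + 2)) = s * (1000 * (V.cnt + 2)) + 1000 * (V.cnt + 2) := by
          ring
        simp only [ClassView.weight, id] at *
        omega
    rw [runs_ite]
    -- The pivot of the slot `s` is close to an earlier new pivot, or it becomes a new pivot in an
    -- earlier slot, or it becomes a new pivot in its own slot. Only the first two cases require a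
    -- transfer of the list.
    rcases hcase with ⟨hi, hd, hv⟩ | ⟨hi, hsep, hv⟩
    · have his : σ₂.nat (14, 0, 0, 0) < s := by omega
      refine ⟨fun _ => ?_, fun hb => absurd ?_ hb⟩
      · exact (htrans _ W hv hI hWc hWt hWB rfl rfl hi his (by rw [hp]; exact hd)).mono
          fun t σ' hq => by simpa using hq
      · simpa [h13'] using his
    · have hW'c : (W.newPivot p).cnt = W.cnt + 1 := rfl
      by_cases his : W.cnt < s
      · refine ⟨fun _ => ?_, fun hb => absurd ?_ hb⟩
        · have hpi : (W.newPivot p).piv W.cnt = some p := by simp [ClassView.newPivot]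
          have hps : (W.newPivot p).piv s = some p := by
            simp only [ClassView.newPivot]; split_ifs <;> simp [hp]
          refine (htrans W.cnt _ hv (hI.newPivot hpS his hsep) (by omega) hWt
            (hWB.newPivot (by omega) _) rfl hi
            (by omega) his ?_).mono fun t σ' hq => by simpa using hq
          -- The slots `W.cnt` and `s` hold the same point now, so their distance is zero.
          rw [hpi, hps]
          simpa [ClassView.newPivot, hWt] using hτ
        · simpa [h13', hi] using his
      · have hcs : W.cnt = s := by omega
        refine ⟨fun hb => absurd hb ?_, fun _ => ?_⟩
        · simp [h13', hi, hcs]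
        · simp only [runs_skip]
          refine ⟨by simp [h12'], by simp [h15'], W.newPivot p, by rw [hview, hv],
            hI.newPivot_self hp hcs hs (by rw [hWt]; exact hα1) hsep, by omega, hWt,
            hWB.newPivot (by omega) _, hW1, ?_⟩
          have : (s + 1) * (1000 * (V.cnt + 2)) =
            s * (1000 * (V.cnt + 2)) + 1000 * (V.cnt + 2) := by ring
          have hw : (W.newPivot p).weight id M = W.weight id M := rfl
          simp
          omega
  · simp
  · have hv0 : (((σ.setNat (15, 0, 0, 0) V.cnt).setNat (8, jj, 0, 0) 0).setNat
        (13, 0, 0, 0) 0).view jj = { V with cnt := 0 } := by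
      rw [view_setNat _ _ _ _ (by decide) (by decide) (by decide) (by decide),
        view_setNat_cnt, view_setNat _ _ _ _ (by decide) (by decide) (by decide) (by decide), hV]
    have hst := h.start V.tau
    simp only [← hjj, rf0_addr, rf1_addr, n1_eval, nv_eval, const_eval, hcnt]
    refine ⟨by simp [← hjj], by simp, _, ?_, hst, by simp, rfl, hB, le_rfl, ?_⟩
    · simpa [← hjj] using hv0
    · simp [ClassView.weight]
  · rintro t σ' ⟨u, ht, -, -, -, V', hv, hI, hc, hτ', hBx, hw1, hwu⟩
    refine ⟨V', hv, hI.finish, hc, hτ', hBx, hw1, ?_⟩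
    simp at ht ⊢
    nlinarith

/-- An inserted point is within `2 * tau` of its pivot, which is enough because `2 ≤ α`. It adds at
most one entry, in a slot below `M`, hence at most `M` to the potential. -/
theorem insertCmd_spec (hlab : ∀ x, lab x < m) {V : ClassView X} {x : X}
    (hV : σ.view (σ.nat (12, 0, 0, 0)) = V) (h : ClassInv lab S pre α V) (hx : x ∈ S)
    (hin : σ.pt (0, 0, 0, 0) = some x) (hM : V.cnt < M) (hτ : 0 ≤ V.tau) (hα : 2 ≤ α)
    (hB : V.Box M m) :
    Runs lab insertCmd σ fun t σ' => t ≤ 200 * (V.cnt + 2) + 300 ∧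
      ∃ V', σ'.view (σ.nat (12, 0, 0, 0)) = V' ∧
      ClassInv lab S (insert x pre) α V' ∧ V'.cnt ≤ V.cnt + 1 ∧ V'.tau = V.tau ∧ V'.Box M m ∧
      V'.weight (fun _ => 1) M ≤ V.weight (fun _ => 1) M + 1 ∧
      V'.weight id M ≤ V.weight id M + M := by
  set jj := σ.nat (12, 0, 0, 0) with hjj
  rw [insertCmd, block_cons, runs_seq]
  refine (placeCmd_spec (x := x) (V := V) (by simpa using hin) (by simp) (by simp)
    (by rw [hV])).mono_frame ?_
  rintro t σ₁ hF ⟨ht, hcase⟩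
  have h12 : σ₁.nat (12, 0, 0, 0) = jj := hF.nat 12 _ (by decide)
  have hin' : σ₁.pt (0, 0, 0, 0) = some x := by rw [hF.pt 0 _ (by decide), hin]
  obtain ⟨W, hW, hWI, hWc, hWt, hWB, hWl, hiW, hiM, hd⟩ : ∃ W, σ₁.view jj = W ∧
      ClassInv lab S pre α W ∧ W.cnt ≤ V.cnt + 1 ∧ W.tau = V.tau ∧ W.Box M m ∧ W.len = V.len ∧
      σ₁.nat (14, 0, 0, 0) < W.cnt ∧ σ₁.nat (14, 0, 0, 0) < M ∧
      cellDist (W.piv (σ₁.nat (14, 0, 0, 0))) (some x) ≤ α * W.tau := by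
    rcases hcase with ⟨hi, hd, hv⟩ | ⟨hi, hsep, hv⟩
    · exact ⟨V, hv, h, by omega, rfl, hB, rfl, hi, by omega,
        hd.trans (mul_le_mul_of_nonneg_right hα hτ)⟩
    · refine ⟨_, hv, h.newPivot hx hsep, le_rfl, rfl, hB.newPivot hM _, rfl, ?_, by omega, ?_⟩
      · rw [hi]; exact Nat.lt_succ_self _
      · rw [hi]
        simp only [ClassView.newPivot, if_true, cellDist_some, dist_self]
        exact mul_nonneg (by linarith) hτ
  simp only [block_cons, block_singleton, runs_seq, runs_setNat]
  refine (addRepCmd_spec (y := x) ?_ ?_).mono ?_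
  · simpa using hin'
  · simp
  rintro t' σ₂ ⟨ht', hv⟩
  have hv' : σ₂.view jj = W.addRep (σ₁.nat (14, 0, 0, 0)) (lab x) x := by
    simpa [h12, hin', view_setNat, hW] using hv
  obtain ⟨f1, f2, f3⟩ := addRep_fields (V := W) (σ₁.nat (14, 0, 0, 0)) (lab x) x
  have hw : ∀ wt, W.weight wt M = V.weight wt M := by intro wt; simp only [ClassView.weight, hWl]
  refine ⟨?_, _, hv', hWI.insert hx hiW hd, by omega, by rw [f2, hWt],
    hWB.addRep hiM (hlab x) x, ?_, ?_⟩
  · simp; omega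
  · exact (ClassView.weight_addRep _ _ _ _ _ hiM).trans (by rw [hw])
  · exact (ClassView.weight_addRep _ _ _ _ _ hiM).trans (by rw [hw]; simp; omega)
end
end FairStream

namespace FairStream

/-! ### Farthest-first traversal of the pivots -/

/-- The distance of the `q`-th pivot of the guess `jj` to the nearest one of the first `t` pivots
of the traversal. -/
def nearDist (t q : NExp) : RExp :=
  .dist (rf2 2 (nv 12) q) (rf2 2 (nv 12) (n1 20 (n2 21 t q)))

/-- Farthest-first traversal of the pivots of the guess `jj`: `ord t` is the `t`-th center,
`rho t` its distance to the previous ones, and `near t q` the nearest one of the first `t` centers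
to the pivot `q`. -/
def gonzCmd : Cmd :=
  block [.setNat (rf0 22) (n1 8 (nv 12)), .setNat (rf0 17) (.const 0),
    forUp 17 (.add (nv 22) (.const 1)) (block
      [.setNat (rf0 18) (.const 0), .setNat (rf0 19) (.const 0),
        forUp 19 (nv 22) (.ite (.realLe (nearDist (nv 17) (nv 18)) (nearDist (nv 17) (nv 19)))
          (.setNat (rf0 18) (nv 19)) .skip),
        .setNat (rf1 20 (nv 17)) (nv 18),
        .setReal (rf1 4 (nv 17)) (nearDist (nv 17) (nv 18)),
        .setNat (rf0 19) (.const 0),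
        forUp 19 (nv 22) (.ite (.and (ltE (.const 0) (nv 17))
            (.realLe (nearDist (nv 17) (nv 19))
              (.dist (rf2 2 (nv 12) (nv 19)) (rf2 2 (nv 12) (nv 18)))))
          (.setNat (rf2 21 (.add (nv 17) (.const 1)) (nv 19)) (n2 21 (nv 17) (nv 19)))
          (.setNat (rf2 21 (.add (nv 17) (.const 1)) (nv 19)) (nv 17)))])]

/-- The first `t` steps of the farthest-first traversal of the points `P 0, …, P (T - 1)`. -/
structure Gonz {X : Type*} [MetricSpace X] (P : ℕ → Option X) (T : ℕ) (ord : ℕ → ℕ)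
    (near : ℕ → ℕ → ℕ) (rho : ℕ → ℝ) (t : ℕ) : Prop where
  ord_lt : ∀ c < t, ord c < T
  near_lt : ∀ s, 1 ≤ s → s ≤ t → ∀ q < T, near s q < s
  near_min : ∀ s, 1 ≤ s → s ≤ t → ∀ q < T, ∀ c < s,
    cellDist (P q) (P (ord (near s q))) ≤ cellDist (P q) (P (ord c))
  near_step : ∀ s, 1 ≤ s → s < t → ∀ q < T, near (s + 1) q = near s q ∨ near (s + 1) q = s
  rho_cov : ∀ s, 1 ≤ s → s < t → ∀ q < T, cellDist (P q) (P (ord (near s q))) ≤ rho s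
  rho_eq : ∀ s, 1 ≤ s → s < t → rho s = cellDist (P (ord s)) (P (ord (near s (ord s))))

section
variable {X : Type*} [MetricSpace X] {lab : X → ℕ} {σ : Mem X}

/-- The traversal that is stored in the memory. -/
def Mem.IsGonz (σ : Mem X) (j T t : ℕ) : Prop :=
  Gonz (σ.view j).piv T (fun c => σ.nat (20, c, 0, 0)) (fun s q => σ.nat (21, s, q, 0))
    (fun s => σ.real (4, s, 0, 0)) t

/-- There is one round more than pivots, so that the covering radius of all `T` centers is available
as well. The nearest centers are updated from one row of the table to the next rather than
recomputed, which keeps the time quadratic. -/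
theorem gonzCmd_spec {T : ℕ} (hT : σ.nat (8, σ.nat (12, 0, 0, 0), 0, 0) = T) (hT0 : 0 < T) :
    Runs lab gonzCmd σ fun t σ' => t ≤ 400 * (T + 2) * (T + 2) ∧ σ'.nat (22, 0, 0, 0) = T ∧
      σ'.IsGonz (σ.nat (12, 0, 0, 0)) T (T + 1) := by
  set jj := σ.nat (12, 0, 0, 0) with hjj
  rw [gonzCmd, block_cons, block_cons, block_singleton, runs_seq, runs_setNat, runs_seq,
    runs_setNat]
  have hpiv : ∀ (σ : Mem X) q, (σ.view jj).piv q = σ.pt (2, jj, q, 0) := fun _ _ => rfl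
  refine (Runs.forUp (T + 1) (300 * (T + 2)) (fun t σ' => σ'.nat (12, 0, 0, 0) = jj ∧
    σ'.nat (22, 0, 0, 0) = T ∧ σ'.IsGonz jj T t) (by decide) ?_ ?_ ?_ ?_).mono ?_
  · rintro i σ' ⟨-, h, -⟩
    simp [h]
  · rintro t σ₁ ht h17 ⟨h12, h22, hG⟩
    simp only [block_cons, block_singleton, runs_seq, runs_setNat, runs_setReal]
    -- the farthest pivot
    set D : ℕ → ℝ := fun q => cellDist (σ₁.pt (2, jj, q, 0))
      (σ₁.pt (2, jj, σ₁.nat (20, σ₁.nat (21, t, q, 0), 0, 0), 0)) with hD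
    refine (Runs.forUp T 80 (fun i σ' => Frame [18, 19] [] [] σ₁ σ' ∧
      σ'.nat (18, 0, 0, 0) < T ∧ ∀ q < i, D q ≤ D (σ'.nat (18, 0, 0, 0))) (by decide)
      ?_ ?_ ?_ ?_).mono ?_
    · rintro i σ' ⟨hF, -⟩
      simp [hF.nat 22 _ (by decide : (22 : ℕ) ∉ [18, 19]), h22]
    · rintro i σ' hi h19 ⟨hF, hb, hmax⟩
      have e12 : σ'.nat (12, 0, 0, 0) = jj := by rw [hF.nat 12 _ (by decide), h12]
      have e17 : σ'.nat (17, 0, 0, 0) = t := by rw [hF.nat 17 _ (by decide), h17]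
      have e20 : ∀ x, σ'.nat (20, x) = σ₁.nat (20, x) := fun x => hF.nat 20 _ (by decide)
      have e21 : ∀ x, σ'.nat (21, x) = σ₁.nat (21, x) := fun x => hF.nat 21 _ (by decide)
      have e2 : ∀ x, σ'.pt (2, x) = σ₁.pt (2, x) := fun x => hF.pt 2 _ (by decide)
      have hFr : ∀ σ₃ : Mem X, Frame [18, 19] [] [] σ' σ₃ → Frame [18, 19] [] [] σ₁ σ₃ :=
        fun σ₃ h => (hF.trans h).mono (by simp) (by simp) (by simp)
      rw [runs_ite]
      constructor
      · intro hle
        simp [nearDist, e12, e17, e20, e21, e2, h19] at hle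
        simp only [runs_setNat]
        refine ⟨by simp [nearDist], hFr _ ?_, by simpa [h19] using hi, ?_⟩
        · constructor <;> intro a x ha <;> simp at ha <;> simp [ha]
        · intro q hq
          simp [h19]
          rcases Nat.lt_succ_iff_lt_or_eq.1 hq with h | rfl
          · exact (hmax q h).trans hle
          · exact le_rfl
      · intro hle
        simp [nearDist, e12, e17, e20, e21, e2, h19] at hle
        simp only [runs_skip]
        refine ⟨by simp [nearDist], hFr _ ?_, by simpa using hb, ?_⟩
        · constructor <;> intro a x ha <;> simp at ha <;> simp [ha]
        · intro q hq
          simp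
          rcases Nat.lt_succ_iff_lt_or_eq.1 hq with h | rfl
          · exact hmax q h
          · exact hle.le
    · simp
    · refine ⟨?_, by simpa using hT0, by simp⟩
      constructor <;> intro a x ha <;> simp at ha <;> simp [ha]
    rintro t₂ σ₂ ⟨ht₂, -, hF, hb, hmax⟩
    set b := σ₂.nat (18, 0, 0, 0) with hbdef
    have e12 : σ₂.nat (12, 0, 0, 0) = jj := by rw [hF.nat 12 _ (by decide), h12]
    have e17 : σ₂.nat (17, 0, 0, 0) = t := by rw [hF.nat 17 _ (by decide), h17]
    have e22 : σ₂.nat (22, 0, 0, 0) = T := by rw [hF.nat 22 _ (by decide), h22]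
    have e20 : ∀ x, σ₂.nat (20, x) = σ₁.nat (20, x) := fun x => hF.nat 20 _ (by decide)
    have e21 : ∀ x, σ₂.nat (21, x) = σ₁.nat (21, x) := fun x => hF.nat 21 _ (by decide)
    have e2 : ∀ x, σ₂.pt (2, x) = σ₁.pt (2, x) := fun x => hF.pt 2 _ (by decide)
    have e4 : ∀ x, σ₂.real (4, x) = σ₁.real (4, x) := fun x => hF.real 4 _ (by decide)
    have near_lt : ∀ q < T, 0 < t → σ₁.nat (21, t, q, 0) < t := fun q hq h0 =>
      hG.near_lt t h0 le_rfl q hq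
    -- the new row of the table of nearest centers
    have e17' : (σ₂.setNat (20, t, 0, 0) b).nat (17, 0, 0, 0) = t := by simp [e17]
    simp only [rf1_addr, rf0_addr, nv_eval, const_eval, e17, ← hbdef, e17']
    set σ₃ := ((σ₂.setNat (20, t, 0, 0) b).setReal (4, t, 0, 0)
      ((nearDist (nv 17) (nv 18)).eval lab (σ₂.setNat (20, t, 0, 0) b))).setNat (19, 0, 0, 0) 0
      with hσ₃
    refine (Runs.forUp T 100 (fun i σ' => Frame [19, 21] [] [] σ₃ σ' ∧
      (∀ s q, s ≠ t + 1 → σ'.nat (21, s, q, 0) = σ₁.nat (21, s, q, 0)) ∧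
      ∀ q < i, (0 < t ∧ D q ≤ cellDist (σ₁.pt (2, jj, q, 0)) (σ₁.pt (2, jj, b, 0)) ∧
          σ'.nat (21, t + 1, q, 0) = σ₁.nat (21, t, q, 0)) ∨
        ((0 < t → cellDist (σ₁.pt (2, jj, q, 0)) (σ₁.pt (2, jj, b, 0)) < D q) ∧
          σ'.nat (21, t + 1, q, 0) = t)) (by decide) ?_ ?_ ?_ ?_).mono ?_
    · rintro i σ' ⟨hF', -⟩
      rw [nv_eval, hF'.nat 22 _ (by decide)]
      simp [hσ₃, e22]
    · rintro i σ' hi h19 ⟨hF', hold, hnew⟩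
      have f12 : σ'.nat (12, 0, 0, 0) = jj := by
        rw [hF'.nat 12 _ (by decide)]; simp [hσ₃, e12]
      have f17 : σ'.nat (17, 0, 0, 0) = t := by
        rw [hF'.nat 17 _ (by decide)]; simp [hσ₃, e17]
      have f18 : σ'.nat (18, 0, 0, 0) = b := by
        rw [hF'.nat 18 _ (by decide)]; simp [hσ₃, hbdef]
      have f20 : ∀ c, c ≠ t → σ'.nat (20, c, 0, 0) = σ₁.nat (20, c, 0, 0) := by
        intro c hc
        rw [hF'.nat 20 _ (by decide)]; simp [hσ₃, e20, hc]
      have f2 : ∀ x, σ'.pt (2, x) = σ₁.pt (2, x) := by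
        intro x
        rw [hF'.pt 2 _ (by decide)]; simp [hσ₃, e2]
      have hFr : ∀ σ₄ : Mem X, Frame [19, 21] [] [] σ' σ₄ → Frame [19, 21] [] [] σ₃ σ₄ :=
        fun σ₄ h => (hF'.trans h).mono (by simp) (by simp) (by simp)
      have hDeval : 0 < t → (nearDist (nv 17) (nv 19)).eval lab σ' = D i := by
        intro h0
        have := near_lt i hi h0
        simp [nearDist, f12, f17, h19, f2, hold t i (by omega), f20 _ (show
          σ₁.nat (21, t, i, 0) ≠ t by omega), hD]
      rw [runs_ite]
      constructor
      · intro hle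
        simp only [and_holds, ltE_holds, const_eval, nv_eval, realLe_holds, f17] at hle
        obtain ⟨h0, hle⟩ := hle
        rw [hDeval h0] at hle
        simp [f12, f18, f2, h19] at hle
        simp only [runs_setNat]
        refine ⟨by simp [nearDist], hFr _ ?_, ?_, ?_⟩
        · constructor <;> intro a x ha <;> simp at ha <;> simp [ha]
        · intro s q hs
          simp [f17, hs, hold s q hs]
        · intro q hq
          rcases Nat.lt_succ_iff_lt_or_eq.1 hq with h | rfl
          · have hqi : q ≠ i := h.ne
            simpa [f17, h19, hqi] using hnew q h
          · exact Or.inl ⟨h0, hle, by simp [f17, h19, hold t q (by omega)]⟩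
      · intro hle
        simp only [and_holds, ltE_holds, const_eval, nv_eval, realLe_holds, f17] at hle
        simp only [runs_setNat]
        refine ⟨by simp [nearDist], hFr _ ?_, ?_, ?_⟩
        · constructor <;> intro a x ha <;> simp at ha <;> simp [ha]
        · intro s q hs
          simp [f17, hs, hold s q hs]
        · intro q hq
          rcases Nat.lt_succ_iff_lt_or_eq.1 hq with h | rfl
          · have hqi : q ≠ i := h.ne
            simpa [f17, h19, hqi] using hnew q h
          · refine Or.inr ⟨fun h0 => ?_, by simp [f17, h19]⟩
            by_contra hcon
            apply hle
            refine ⟨h0, ?_⟩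
            rw [hDeval h0]
            simpa [f12, f18, f2, h19] using hcon
    · simp [hσ₃]
    · refine ⟨Frame.refl _, ?_, by simp⟩
      intro s q hs
      simp [hσ₃, e21]
    rintro t₃ σ₄ ⟨ht₃, -, hF', hold, hnew⟩
    have f20 : ∀ c, c ≠ t → σ₄.nat (20, c, 0, 0) = σ₁.nat (20, c, 0, 0) := by
      intro c hc
      rw [hF'.nat 20 _ (by decide)]; simp [hσ₃, e20, hc]
    have f20' : σ₄.nat (20, t, 0, 0) = b := by
      rw [hF'.nat 20 _ (by decide)]; simp [hσ₃]
    have f2 : ∀ x, σ₄.pt (2, x) = σ₁.pt (2, x) := by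
      intro x
      rw [hF'.pt 2 _ (by decide)]; simp [hσ₃, e2]
    have f4 : ∀ c, c ≠ t → σ₄.real (4, c, 0, 0) = σ₁.real (4, c, 0, 0) := by
      intro c hc
      rw [hF'.real 4 _ (by decide)]; simp [hσ₃, e4, hc]
    have f4' : 0 < t → σ₄.real (4, t, 0, 0) = D b := by
      intro h0
      have := near_lt b hb h0
      rw [hF'.real 4 _ (by decide)]
      simp [hσ₃, nearDist, e12, e17, e21, e20, ← hbdef, e2, hD,
        show σ₁.nat (21, t, b, 0) ≠ t by omega]
    refine ⟨?_, ?_, ?_, ?_⟩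
    · simp [nearDist] at ht₂ ht₃ ⊢
      omega
    · simp only [setNat_nat]
      rw [hF'.nat 12 _ (by decide)]
      simp [hσ₃, e12]
    · simp only [setNat_nat]
      rw [hF'.nat 22 _ (by decide)]
      simp [hσ₃, e22]
    -- the invariant of the traversal
    have hcases : ∀ q < T, (σ₄.nat (21, t + 1, q, 0) = t ∧ (0 < t →
        cellDist (σ₁.pt (2, jj, q, 0)) (σ₁.pt (2, jj, b, 0)) < D q)) ∨ (0 < t ∧
        σ₄.nat (21, t + 1, q, 0) = σ₁.nat (21, t, q, 0) ∧ σ₁.nat (21, t, q, 0) < t ∧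
        D q ≤ cellDist (σ₁.pt (2, jj, q, 0)) (σ₁.pt (2, jj, b, 0))) := by
      intro q hq
      rcases hnew q hq with ⟨h0, h1, h2⟩ | ⟨h1, h2⟩
      · exact Or.inr ⟨h0, h2, near_lt q hq h0, h1⟩
      · exact Or.inl ⟨h2, h1⟩
    have hpiv' : ∀ q, ((σ₄.setNat (17, 0, 0, 0) (t + 1)).view jj).piv q =
        σ₁.pt (2, jj, q, 0) := by intro q; simp [hpiv, f2]
    have o1 : ∀ c, (σ₄.setNat (17, 0, 0, 0) (t + 1)).nat (20, c, 0, 0) =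
        σ₄.nat (20, c, 0, 0) := by simp
    have o2 : ∀ s q, (σ₄.setNat (17, 0, 0, 0) (t + 1)).nat (21, s, q, 0) =
        σ₄.nat (21, s, q, 0) := by simp
    unfold Mem.IsGonz
    simp only [o1, o2, setNat_real]
    have hnl : ∀ s, 1 ≤ s → s ≤ t → ∀ q < T, σ₄.nat (21, s, q, 0) < s := fun s h1 h2 q hq => by
      rw [hold s q (by omega)]; exact hG.near_lt s h1 h2 q hq
    constructor
    · intro c hc
      by_cases hct : c = t
      · rw [hct, f20']; exact hb
      · rw [f20 c hct]; exact hG.ord_lt c (by omega)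
    · intro s h1 h2 q hq
      by_cases hs : s = t + 1
      · subst hs
        rcases hcases q hq with h | h <;> omega
      · exact hnl s h1 (by omega) q hq
    · intro s h1 h2 q hq c hc
      simp only [hpiv']
      by_cases hs : s = t + 1
      · subst hs
        rcases hcases q hq with ⟨h, hlt⟩ | ⟨h0, h, hlt, hle⟩
        · rw [h, f20']
          by_cases hct : c = t
          · rw [hct, f20']
          · rw [f20 c hct]
            exact (hlt (by omega)).le.trans (hG.near_min t (by omega) le_rfl q hq c (by omega))
        · rw [h, f20 _ (by omega)]
          by_cases hct : c = t
          · rw [hct, f20']; exact hle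
          · rw [f20 c hct]
            exact hG.near_min t (by omega) le_rfl q hq c (by omega)
      · have := hnl s h1 (by omega) q hq
        rw [f20 _ (by omega), f20 c (by omega), hold s q hs]
        exact hG.near_min s h1 (by omega) q hq c hc
    · intro s h1 h2 q hq
      by_cases hs : s = t
      · subst hs
        rw [hold s q (by omega)]
        rcases hcases q hq with ⟨h, -⟩ | ⟨-, h, -⟩
        · exact Or.inr h
        · exact Or.inl h
      · rw [hold s q (by omega), hold (s + 1) q (by omega)]
        exact hG.near_step s h1 (by omega) q hq
    · intro s h1 h2 q hq
      simp only [hpiv']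
      have := hnl s h1 (by omega) q hq
      rw [f20 _ (by omega), hold s q (by omega)]
      by_cases hs : s = t
      · subst hs
        rw [f4' (by omega)]
        exact hmax q hq
      · rw [f4 s hs]
        exact hG.rho_cov s h1 (by omega) q hq
    · intro s h1 h2
      simp only [hpiv']
      by_cases hs : s = t
      · subst hs
        rw [f4' (by omega), f20', f20 _ (by have := hnl s h1 le_rfl b hb; omega),
          hold s b (by omega)]
      · rw [f4 s hs, f20 s hs]
        have hos := hG.ord_lt s (by omega)
        have := hnl s h1 (by omega) _ hos
        rw [f20 _ (by omega), hold s _ (by omega)]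
        exact hG.rho_eq s h1 (by omega)
  · simp
  · refine ⟨by simp [hjj], by simp [← hjj, hT], ?_⟩
    constructor <;> intros <;> omega
  · rintro t σ' ⟨ht, -, -, h22, hG⟩
    refine ⟨?_, h22, hG⟩
    simp at ht ⊢
    nlinarith
end
end FairStream

namespace FairStream

/-! ### Maintenance: raising the guesses -/

/-- Among any `k + 1` points of `A` there are two at distance at most `2 * D`. -/
def PackBound {X : Type*} [MetricSpace X] (A : Set X) (k : ℕ) (D : ℝ) : Prop :=
  ∀ f : Fin (k + 1) → X, (∀ i, f i ∈ A) → ∃ i j, i < j ∧ dist (f i) (f j) ≤ 2 * D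

section
variable {X : Type*} [MetricSpace X] {lab : X → ℕ} {S pre : Set X} {α : ℝ} {k : ℕ}

theorem PackBound.mono {A B : Set X} {D D' : ℝ} (h : PackBound A k D) (hAB : B ⊆ A)
    (hD : D ≤ D') : PackBound B k D' := by
  intro f hf
  obtain ⟨i, j, hij, h'⟩ := h f fun i => hAB (hf i)
  exact ⟨i, j, hij, by linarith⟩

/-- If the points of `A` are within `D` of `k` centers, then `A` has no large separated subset. -/
theorem PackBound.of_cover {A : Set X} {D : ℝ} (c : ℕ → Option X)
    (h : ∀ x ∈ A, ∃ i < k, c i ≠ none ∧ cellDist (c i) (some x) ≤ D) : PackBound A k D := by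
  intro f hf
  choose g hg hg' hd using fun i => h (f i) (hf i)
  obtain ⟨i, j, hij, hgij⟩ := Fintype.exists_ne_map_eq_of_card_lt
    (fun i : Fin (k + 1) => (⟨g i, hg i⟩ : Fin k)) (by simp)
  simp only [Fin.mk.injEq] at hgij
  have key : dist (f i) (f j) ≤ 2 * D := by
    obtain ⟨y, hy⟩ := Option.ne_none_iff_exists'.1 (hg' i)
    have h1 := hd i
    have h2 := hd j
    rw [← hgij, hy] at h2
    rw [hy] at h1
    simp only [cellDist_some] at h1 h2
    have := dist_triangle_left (f i) (f j) y
    linarith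
  rcases lt_or_gt_of_ne hij with h | h
  · exact ⟨i, j, h, key⟩
  · exact ⟨j, i, h, by rwa [dist_comm]⟩

/-- A separated family of cells of length more than `k`. -/
theorem PackBound.lt_of_sep {A : Set X} {D s : ℝ} (h : PackBound A k D) {c : ℕ → Option X}
    (hc : ∀ i ≤ k, ∃ p ∈ A, c i = some p)
    (hs : ∀ i j, i < j → j ≤ k → s < cellDist (c i) (c j)) : s < 2 * D := by
  choose p hp hpc using fun i : Fin (k + 1) => hc i (Nat.lt_succ_iff.1 i.2)
  obtain ⟨i, j, hij, hd⟩ := h p hp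
  have := hs i j hij (Nat.lt_succ_iff.1 j.2)
  rw [hpc, hpc, cellDist_some] at this
  linarith

theorem PackBound.le_of_sep {A : Set X} {D s : ℝ} (h : PackBound A k D) {c : ℕ → Option X}
    (hc : ∀ i ≤ k, ∃ p ∈ A, c i = some p)
    (hs : ∀ i j, i < j → j ≤ k → s ≤ cellDist (c i) (c j)) : s ≤ 2 * D := by
  by_contra hcon
  exact hcon (h.lt_of_sep hc (s := 2 * D) fun i j hij hj => by
    have := hs i j hij hj
    linarith).false.elim

/-- Otherwise the first `k + 1` pivots would be `k + 1` points without a pair at distance at most `2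
* D`. This is the reason why a guess with too many pivots may be raised. -/
theorem ClassInv.lt_of_packBound {V : ClassView X} (h : ClassInv lab S pre α V) (hk : k < V.cnt)
    {D : ℝ} (hD : PackBound S k D) : V.tau < D := by
  have := hD.lt_of_sep (c := V.piv) (s := 2 * V.tau)
    (fun i hi => ThinInv.piv h i (Or.inl (by omega)))
    fun i j hij hj => ThinInv.sep h i j hij (by omega)
  linarith

theorem ClassInv.cov' {V : ClassView X} (h : ClassInv lab S pre α V) {x : X} (hx : x ∈ pre) :
    ∃ i < V.cnt, (∃ p ∈ S, V.piv i = some p) ∧ (∃ p < V.len i, V.lst i p = lab x) ∧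
      cellDist (V.piv i) (some x) ≤ α * V.tau := by
  obtain ⟨i, hi, hd⟩ := ThinInv.cov h x hx
  obtain ⟨p, hp, hpl⟩ := ThinInv.mark h i _ hi
  have hic : i < V.cnt := by
    by_contra hc
    have := h.len_eq_zero (not_lt.1 hc)
    omega
  exact ⟨i, hic, ThinInv.piv h i (Or.inl hic), ⟨p, hp, hpl⟩, by simpa [hic] using hd⟩

/-- At most `k` pivots cover everything with radius `α * V.tau`, so two of any `k + 1` points share
a pivot. Thus a guess without too many pivots is not far below the optimum. -/
theorem ClassInv.packBound {V : ClassView X} (h : ClassInv lab S pre α V) (hk : V.cnt ≤ k) :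
    PackBound pre k (α * V.tau) := by
  refine PackBound.of_cover V.piv fun x hx => ?_
  obtain ⟨i, hi, ⟨p, -, hp⟩, -, hd⟩ := h.cov' hx
  exact ⟨i, by omega, by simp [hp], hd⟩

section
variable {P : ℕ → Option X} {T t : ℕ} {ord : ℕ → ℕ} {near : ℕ → ℕ → ℕ} {rho : ℕ → ℝ}

/-- The center `b` is within `rho a` of one of the first `a` centers, and further centers can only
bring it closer. -/
theorem Gonz.rho_anti (h : Gonz P T ord near rho t) {a b : ℕ} (ha : 1 ≤ a) (hab : a ≤ b)
    (hb : b < t) : rho b ≤ rho a := by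
  rw [h.rho_eq b (by omega) hb]
  have hT := h.ord_lt b hb
  exact (h.near_min b (by omega) (by omega) _ hT _ (by
    have := h.near_lt a ha (by omega) _ hT; omega)).trans (h.rho_cov a ha (by omega) _ hT)

/-- When the center `b` was chosen, its distance to each earlier center was at least `rho b`, and
`rho c ≤ rho b`. -/
theorem Gonz.sep (h : Gonz P T ord near rho t) {a b c : ℕ} (hc : c < t) (hab : a < b)
    (hb : b ≤ c) : rho c ≤ cellDist (P (ord a)) (P (ord b)) := by
  refine (h.rho_anti (by omega) hb hc).trans ?_
  rw [h.rho_eq b (by omega) (by omega), cellDist_comm (P (ord a))]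
  exact h.near_min b (by omega) (by omega) _ (h.ord_lt b (by omega)) _ hab

end

/-- The first `k + 1` centers have mutual distances at least `rho k`, so half of `rho k` is a lower
bound for every packing bound. -/
theorem Mem.IsGonz.le_of_packBound {σ : Mem X} {j T : ℕ} (hG : σ.IsGonz j T (T + 1))
    (h : ClassInv lab S pre α (σ.view j)) (hT : (σ.view j).cnt = T) (hk : k ≤ T) {D : ℝ}
    (hD : PackBound S k D) : σ.real (4, k, 0, 0) ≤ 2 * D := by
  refine hD.le_of_sep (c := fun i => (σ.view j).piv (σ.nat (20, i, 0, 0))) (fun i hi => ?_)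
    fun a b hab hb => hG.sep (by omega) hab hb
  have := hG.ord_lt i (by omega)
  exact ThinInv.piv h _ (Or.inl (by omega))

/-- The first `k` centers cover the pivots with radius `rho k`, and the pivots cover the stream with
radius `α * tau`. With the preceding bound this brackets the packing bound up to the last summand.
-/
theorem Mem.IsGonz.packBound {σ : Mem X} {j T : ℕ} (hG : σ.IsGonz j T (T + 1))
    (h : ClassInv lab S pre α (σ.view j)) (hT : (σ.view j).cnt = T) (hk : k ≤ T) (hk1 : 1 ≤ k) :
    PackBound pre k (σ.real (4, k, 0, 0) + α * (σ.view j).tau) := by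
  refine PackBound.of_cover (fun i => (σ.view j).piv (σ.nat (20, i, 0, 0))) fun x hx => ?_
  obtain ⟨i, hi, ⟨p, -, hp⟩, -, hd⟩ := h.cov' hx
  have h1 := hG.near_lt k hk1 (by omega) i (by omega)
  have h2 := hG.rho_cov k hk1 (by omega) i (by omega)
  obtain ⟨q, -, hq⟩ := ThinInv.piv h (σ.nat (20, σ.nat (21, k, i, 0), 0, 0)) (Or.inl (by
    have := hG.ord_lt _ (show σ.nat (21, k, i, 0) < T + 1 by omega); omega))
  refine ⟨_, h1, by rw [hq]; simp, ?_⟩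
  refine (cellDist_triangle _ _ p).trans ?_
  rw [← hp, cellDist_comm]
  linarith

end

/-- Doubling of the guess `jj`, by the factor `R`, until it has at most `k` pivots. -/
def raiseCmd : Cmd :=
  .loop (ltE (nv 0) (n1 8 (nv 12)))
    (block [.setReal (rf1 2 (nv 12)) (.mul (.load (rf1 2 (nv 12))) (.load (rf0 1))), thinCmd])

section
variable {X : Type*} [MetricSpace X] {lab : X → ℕ} {σ : Mem X} {pre : Set X} {α R : ℝ}
  {M m k : ℕ}

/-- `τ` arises from the guess `b` by raising it by the factor `R` while it is too small. -/
def Raised (pre : Set X) (k : ℕ) (R b τ : ℝ) : Prop :=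
  ∃ e : ℕ, τ = b * R ^ e ∧ (e = 0 ∨ ∀ D, PackBound pre k D → b * R ^ (e - 1) < D)

/-- A known packing bound `D` limits the number of rounds: as long as there are more than `k` pivots
the guess is below `D`, and after `n` multiplications by `R` it is not. Entries moved in the
mergings are paid by the potential. -/
theorem raiseCmd_spec (hlab : ∀ x, lab x < m) (hR : 1 ≤ R) (hαR : α + 2 * R ≤ α * R)
    (hα : 0 ≤ α) {V : ClassView X} {n : ℕ} {D : ℝ} (hV : σ.view (σ.nat (12, 0, 0, 0)) = V)
    (hk : σ.nat (0, 0, 0, 0) = k) (hσR : σ.real (1, 0, 0, 0) = R)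
    (h : ClassInv lab pre pre α V) (hB : V.Box M m) (hM : V.cnt ≤ M) (hτ : 0 ≤ V.tau)
    (hD : PackBound pre k D) (hn : D ≤ V.tau * R ^ n) :
    Runs lab raiseCmd σ fun t σ' => ∃ V', σ'.view (σ.nat (12, 0, 0, 0)) = V' ∧
      ClassInv lab pre pre α V' ∧ V'.Box M m ∧ V'.cnt ≤ k ∧ V'.cnt ≤ V.cnt ∧
      Raised pre k R V.tau V'.tau ∧ V.tau ≤ V'.tau ∧
      V'.weight (fun _ => 1) M ≤ V.weight (fun _ => 1) M ∧
      t + 400 * V'.weight id M ≤ 400 * V.weight id M + (n + 1) * (2100 * (M + 2) * (M + 2)) := by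
  set jj := σ.nat (12, 0, 0, 0) with hjj
  obtain ⟨C, hC⟩ : ∃ C, C = 2100 * (M + 2) * (M + 2) := ⟨_, rfl⟩
  rw [← hC]
  refine (Runs.loop_total (n := n) (fun n' u σ' => σ'.nat (12, 0, 0, 0) = jj ∧
    σ'.nat (0, 0, 0, 0) = k ∧ σ'.real (1, 0, 0, 0) = R ∧ ∃ V', σ'.view jj = V' ∧
      ClassInv lab pre pre α V' ∧ V'.Box M m ∧ V'.cnt ≤ V.cnt ∧
      Raised pre k R V.tau V'.tau ∧ V.tau ≤ V'.tau ∧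
      V'.weight (fun _ => 1) M ≤ V.weight (fun _ => 1) M ∧ n' ≤ n ∧ D ≤ V'.tau * R ^ n' ∧
      u + 400 * V'.weight id M ≤ 400 * V.weight id M + (n - n') * C) ?_ ?_).mono ?_
  · rintro n' u σ₁ ⟨h12, h0, h1, V', hV', hI, hB', hc, ⟨e, he, hre⟩, hle, hw, hn'n, hn', hu⟩ hb
    have hk' : k < V'.cnt := by
      have : (σ₁.view jj).cnt = V'.cnt := by rw [hV']
      simpa [h0, h12, ← this, Mem.view] using hb
    have htau : σ₁.real (2, jj, 0, 0) = V'.tau := by rw [← hV']; rfl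
    -- With `n' = 0` the guess would have reached `D`, although more than `k` separated pivots show
    -- that it is below `D`.
    have hn0 : n' ≠ 0 := by
      rintro rfl
      have := hI.lt_of_packBound hk' hD
      simp at hn'
      linarith
    have hτ' : 0 ≤ V'.tau := hτ.trans hle
    have hmul : V'.tau ≤ V'.tau * R := le_mul_of_one_le_right hτ' hR
    simp only [block_cons, block_singleton, runs_seq, runs_setReal]
    refine (thinCmd_spec hlab (M := M) (S := pre) (pre := pre) (α := α) (τo := V'.tau)
      (V := { V' with tau := V'.tau * R }) ?_ hI (by simpa using hc.trans hM) ?_ ?_ ?_ hB').mono_frame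
      ?_
    · simp [h12, h1, htau, hV']
    · exact hτ'.trans hmul
    · exact mul_le_mul_of_nonneg_left hmul hα
    · simp only
      nlinarith
    rintro t σ₂ hF ⟨V'', hV'', hI'', hc'', ht'', hB'', hw'', hu''⟩
    refine ⟨n' - 1, by omega, ?_, ?_, ?_, V'', ?_, hI'', hB'', hc''.trans hc, ?_, ?_,
      hw''.trans hw, by omega, ?_, ?_⟩
    · rw [hF.nat 12 _ (by decide)]; exact h12
    · rw [hF.nat 0 _ (by decide)]; exact h0
    · rw [hF.real 1 _ (by decide)]; simp [h1]
    · simpa [h12] using hV''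
    -- The value before this raise was below every packing bound, by the `k + 1` separated pivots
    -- present then.
    · refine ⟨e + 1, ?_, Or.inr fun D' hD' => ?_⟩
      · rw [ht'']; simp only [he]; ring
      · have := hI.lt_of_packBound hk' hD'
        rw [he] at this
        simpa using this
    · rw [ht'']; exact hle.trans hmul
    · rw [ht'']
      have : V'.tau * R * R ^ (n' - 1) = V'.tau * R ^ n' := by
        rw [mul_assoc, ← pow_succ', Nat.sub_add_cancel (by omega)]
      simpa only [this] using hn'
    · have e1 : (n - (n' - 1)) * C = (n - n') * C + C := by
        rw [show n - (n' - 1) = (n - n') + 1 by omega]; ring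
      have e2 : ({ V' with tau := V'.tau * R } : ClassView X).weight id M = V'.weight id M := rfl
      have e3 : (V'.cnt + 2) * (V'.cnt + 2) ≤ (M + 2) * (M + 2) := by
        apply Nat.mul_le_mul <;> omega
      have e4 : 2 * 2 ≤ (M + 2) * (M + 2) := Nat.mul_le_mul (by omega) (by omega)
      simp only [e2] at hu''
      rw [Nat.mul_assoc] at hu''
      rw [e1, hC, Nat.mul_assoc]
      simp only [ltE_time, nv_time, n1_time, rf1_time, rmul_time, load_time, rf0_time]
      rw [hC, Nat.mul_assoc] at hu
      omega
  · exact ⟨rfl, hk, hσR, V, hV, h, hB, le_rfl, ⟨0, by simp, Or.inl rfl⟩, le_rfl, le_rfl, le_rfl, hn,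
      by simp⟩
  · rintro t σ' ⟨n', u, ht, hb, h12, h0, -, V', hV', hI, hB', hc, hre, hle, hw, hn'n, hn', hu⟩
    refine ⟨V', hV', hI, hB', ?_, hc, hre, hle, hw, ?_⟩
    · have : (σ'.view jj).cnt = V'.cnt := by rw [hV']
      simpa [h0, h12, ← this, Mem.view] using hb
    · have e1 : (n - n') * C ≤ n * C := Nat.mul_le_mul_right _ (Nat.sub_le _ _)
      have e4 : 2 * 2 ≤ (M + 2) * (M + 2) := Nat.mul_le_mul (by omega) (by omega)
      rw [Nat.mul_assoc] at hC
      simp only [ltE_time, nv_time, n1_time] at ht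
      rw [Nat.add_mul, Nat.one_mul]
      omega

end
end FairStream

/-! ### Maintenance with resets, and the lattice of guesses -/

namespace FairStream

/-- One step of the maintenance: resetting the guess `jj` to `p` if there is a reset, then raising
it until there are at most `k` pivots. -/
def maintBody : Cmd :=
  .seq (.ite (.natLe (.const 1) (nv 52))
    (block [.setReal (rf1 2 (nv 12)) (.load (rf0 3)), thinCmd,
      .setReal (rf0 3) (.mul (.load (rf0 3)) (.add (.ofNat (.const 1)) (.load (rf0 0))))])
    .skip) raiseCmd

/-- The maintenance, which leaves at most `k` pivots for each guess. -/
def maintCmd : Cmd :=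
  block [.setNat (rf0 12) (.const 0), gonzCmd, .setNat (rf0 52) (.const 0),
    .setReal (rf0 3) (.ofNat (.const 0)),
    .ite (.and (ltE (nv 0) (n1 8 (.const 0)))
        (.realLe (.mul (.ofNat (.const 8)) (.mul (.mul (.load (rf0 1)) (.load (rf0 1)))
          (.load (rf1 2 (.const 0))))) (.load (rf1 4 (nv 0)))))
      (block [.setNat (rf0 52) (.const 1),
        .setReal (rf0 3) (.div (.load (rf1 4 (nv 0))) (.ofNat (.const 2)))])
      .skip,
    .setNat (rf0 12) (.const 0),
    forUp 12 (nv 3) maintBody]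

/-- The guesses `τ` for the `j`-th class: `L * (1 + ε) ^ j`, raised by powers of `(1 + ε) ^ J`,
where `L` is at most the optimal value. -/
def Lattice {X : Type*} [MetricSpace X] (pre : Set X) (k : ℕ) (ε : ℝ) (J : ℕ) (L : ℝ) (j : ℕ)
    (τ : ℝ) : Prop :=
  0 ≤ L ∧ (∀ D, 0 ≤ D → PackBound pre k D → L ≤ D) ∧
    Raised pre k ((1 + ε) ^ J) (L * (1 + ε) ^ j) τ

/-- The invariant of the summary of the `j`-th guess. -/
structure ClassOK {X : Type*} [MetricSpace X] (lab : X → ℕ) (pre : Set X) (k m : ℕ) (ε : ℝ)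
    (J : ℕ) (L : ℝ) (j : ℕ) (V : ClassView X) : Prop where
  inv : ClassInv lab pre pre (2 + 4 * ε) V
  box : V.Box (2 * k) m
  tau_nonneg : 0 ≤ V.tau
  lattice : Lattice pre k ε J L j V.tau

/-- The parameters of the grid of guesses are as intended. -/
structure Grid (ε : ℝ) (J : ℕ) : Prop where
  pos : 0 < ε
  le_half : ε ≤ 1 / 2
  one_le : 1 ≤ ε * (1 + ε) ^ J

structure Mem.Params {X : Type*} (σ : Mem X) (k : ℕ) (ε : ℝ) (J : ℕ) : Prop where
  k_eq : σ.nat (0, 0, 0, 0) = k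
  J_eq : σ.nat (3, 0, 0, 0) = J
  eps_eq : σ.real (0, 0, 0, 0) = ε
  R_eq : σ.real (1, 0, 0, 0) = (1 + ε) ^ J

/-- The invariant of the summaries of all guesses, `c` insertions after the last maintenance. -/
structure Mem.Guesses {X : Type*} [MetricSpace X] (σ : Mem X) (lab : X → ℕ) (pre : Set X)
    (k m : ℕ) (ε : ℝ) (J n c : ℕ) : Prop where
  ok : ∃ L, ∀ j < J, ClassOK lab pre k m ε J L j (σ.view j)
  cnt : ∀ j < J, (σ.view j).cnt ≤ k + c
  spread : ∀ i < J, ∀ j < J, (σ.view j).tau ≤ 4 * (1 + ε) ^ J * (σ.view i).tau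
  weight : ∀ j < J, (σ.view j).weight (fun _ => 1) (2 * k) ≤ n

/-- If the second stage raises at all, its last raise is the last one of the composition; otherwise
the justification of the first stage remains. -/
theorem Raised.trans {X : Type*} [MetricSpace X] {pre : Set X} {k : ℕ} {R b τ τ' : ℝ}
    (h : Raised pre k R b τ) (h' : Raised pre k R τ τ') : Raised pre k R b τ' := by
  obtain ⟨e, rfl, he⟩ := h
  obtain ⟨e', rfl, he'⟩ := h'
  refine ⟨e + e', by ring, ?_⟩
  rcases Nat.eq_zero_or_pos e' with rfl | h0
  · simpa using he
  · refine Or.inr fun D hD => ?_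
    have := (he'.resolve_left h0.ne') D hD
    rwa [mul_assoc, ← pow_add, ← Nat.add_sub_assoc h0] at this

theorem Raised.mono {X : Type*} [MetricSpace X] {pre pre' : Set X} {k : ℕ} {R b τ : ℝ}
    (h : Raised pre k R b τ) (hp : pre ⊆ pre') : Raised pre' k R b τ := by
  obtain ⟨e, he, he'⟩ := h
  exact ⟨e, he, he'.imp id fun h D hD => h D (hD.mono hp le_rfl)⟩

theorem Lattice.mono {X : Type*} [MetricSpace X] {pre pre' : Set X} {k J j : ℕ} {ε L τ : ℝ}
    (h : Lattice pre k ε J L j τ) (hp : pre ⊆ pre') : Lattice pre' k ε J L j τ := by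
  obtain ⟨h0, hL, hr⟩ := h
  exact ⟨h0, fun D hD0 hD => hL D hD0 (hD.mono hp le_rfl), hr.mono hp⟩

theorem Grid.two_le {ε : ℝ} {J : ℕ} (h : Grid ε J) : 2 ≤ (1 + ε) ^ J := by
  have h0 := h.pos
  have h1 := h.le_half
  have h2 := h.one_le
  have : 0 < (1 + ε) ^ J := by positivity
  nlinarith

/-- The claim amounts to `2 + 4 * ε ≤ 4 * ε * (1 + ε) ^ J`, and the right side is at least `4`.
Raising by the large factor `(1 + ε) ^ J` is what permits a covering constant so close to `2`. -/
theorem Grid.contract {ε : ℝ} {J : ℕ} (h : Grid ε J) :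
    (2 + 4 * ε) + 2 * (1 + ε) ^ J ≤ (2 + 4 * ε) * (1 + ε) ^ J := by
  have h1 := h.le_half
  have h2 := h.one_le
  nlinarith

theorem Grid.J_pos {ε : ℝ} {J : ℕ} (h : Grid ε J) : 0 < J := by
  rcases Nat.eq_zero_or_pos J with rfl | h0
  · have := h.two_le; norm_num at this
  · exact h0

section
variable {X : Type*} [MetricSpace X] {lab : X → ℕ} {σ : Mem X} {pre : Set X} {ε : ℝ}
  {M m k J : ℕ}

/-- A guess overshoots a packing bound by at most the factor `(1 + ε) ^ J`: an unraised guess is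
less than this factor above the base, and a raised one was below the bound one raise earlier. -/
theorem Lattice.le {j : ℕ} {L τ D : ℝ} (hg : Grid ε J) (h : Lattice pre k ε J L j τ) (hj : j < J)
    (hD0 : 0 ≤ D) (hD : PackBound pre k D) : τ ≤ (1 + ε) ^ J * D := by
  obtain ⟨h0, hL, e, he, hr⟩ := h
  have hε := hg.pos
  have h1 : (1 + ε) ^ j ≤ (1 + ε) ^ J := pow_le_pow_right₀ (by linarith) hj.le
  rcases Nat.eq_zero_or_pos e with rfl | hpos
  · rw [he, pow_zero, mul_one, mul_comm]
    exact mul_le_mul h1 (hL D hD0 hD) h0 (by positivity)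
  · have := (hr.resolve_left hpos.ne') D hD
    have e1 : ((1 + ε) ^ J) ^ e = ((1 + ε) ^ J) ^ (e - 1) * (1 + ε) ^ J := by
      rw [← pow_succ, Nat.sub_add_cancel hpos]
    rw [he, e1, ← mul_assoc, mul_comm]
    exact mul_le_mul_of_nonneg_left this.le (by positivity)

/-- After a reset the summary is merged at the new value. This requires the new value to exceed the
old one by the factor `(1 + ε) ^ J`, as in an ordinary raise. The candidate for the next guess is
then advanced by the factor `1 + ε`. -/
theorem maintBody_spec (hlab : ∀ x, lab x < m) (hg : Grid ε J) (hP : σ.Params k ε J)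
    {V : ClassView X} {D p τ : ℝ} (hV : σ.view (σ.nat (12, 0, 0, 0)) = V)
    (h : ClassInv lab pre pre (2 + 4 * ε) V) (hB : V.Box M m) (hM : V.cnt ≤ M) (hτ0 : 0 ≤ V.tau)
    (hp : σ.real (3, 0, 0, 0) = p)
    (hτ : (1 ≤ σ.nat (52, 0, 0, 0) ∧ V.tau * (1 + ε) ^ J ≤ p ∧ τ = p) ∨
      (σ.nat (52, 0, 0, 0) = 0 ∧ τ = V.tau))
    (hD : PackBound pre k D) (hn : D ≤ τ * ((1 + ε) ^ J) ^ 9) :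
    Runs lab maintBody σ fun t σ' => ∃ V', σ'.view (σ.nat (12, 0, 0, 0)) = V' ∧
      (1 ≤ σ.nat (52, 0, 0, 0) → σ'.real (3, 0, 0, 0) = p * (1 + ε)) ∧
      ClassInv lab pre pre (2 + 4 * ε) V' ∧ V'.Box M m ∧ V'.cnt ≤ k ∧ 0 ≤ V'.tau ∧
      Raised pre k ((1 + ε) ^ J) τ V'.tau ∧
      V'.weight (fun _ => 1) M ≤ V.weight (fun _ => 1) M ∧
      t + 400 * V'.weight id M ≤ 400 * V.weight id M + 24000 * (M + 2) * (M + 2) := by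
  set jj := σ.nat (12, 0, 0, 0) with hjj
  have hR2 := hg.two_le
  have hε := hg.pos
  rw [maintBody, runs_seq, runs_ite]
  have h4 : 2 * 2 ≤ (M + 2) * (M + 2) := Nat.mul_le_mul (by omega) (by omega)
  have main : ∀ (W : ClassView X) (t₁ : ℕ) (σ₁ : Mem X), Frame maintBody.wN maintBody.wR maintBody.wP σ σ₁ →
      σ₁.view jj = W → ClassInv lab pre pre (2 + 4 * ε) W → W.Box M m → W.cnt ≤ M →
      0 ≤ W.tau → W.tau = τ → (1 ≤ σ.nat (52, 0, 0, 0) → σ₁.real (3, 0, 0, 0) = p * (1 + ε)) →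
      W.weight (fun _ => 1) M ≤ V.weight (fun _ => 1) M →
      t₁ + 400 * W.weight id M ≤ 400 * V.weight id M + 2500 * ((M + 2) * (M + 2)) →
      Runs lab raiseCmd σ₁ fun t σ' => ∃ V', σ'.view jj = V' ∧
      (1 ≤ σ.nat (52, 0, 0, 0) → σ'.real (3, 0, 0, 0) = p * (1 + ε)) ∧
      ClassInv lab pre pre (2 + 4 * ε) V' ∧ V'.Box M m ∧ V'.cnt ≤ k ∧ 0 ≤ V'.tau ∧
      Raised pre k ((1 + ε) ^ J) τ V'.tau ∧
      V'.weight (fun _ => 1) M ≤ V.weight (fun _ => 1) M ∧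
      1 + t₁ + t + 400 * V'.weight id M ≤ 400 * V.weight id M + 24000 * (M + 2) * (M + 2) := by
    intro W t₁ σ₁ hF hW hWI hWB hWc hW0 hWt h3 hw1 hwt
    have h12 : σ₁.nat (12, 0, 0, 0) = jj := hF.nat 12 _ (by decide)
    refine (raiseCmd_spec hlab (M := M) (R := (1 + ε) ^ J) (α := 2 + 4 * ε) (V := W) (n := 9) (D := D)
      (k := k) (pre := pre)
      (by linarith) hg.contract (by linarith) (by rw [h12, hW]) ?_ ?_ hWI hWB hWc hW0 hD
      (by rw [hWt]; exact hn)).mono_frame ?_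
    · rw [hF.nat 0 _ (by decide)]; exact hP.k_eq
    · rw [hF.real 1 _ (by decide)]; exact hP.R_eq
    · rintro t σ' hF' ⟨V', hV', hI, hB', hc, -, hre, hle, hw, ht⟩
      refine ⟨V', by rw [← hV', h12], fun hf => ?_, hI, hB', hc, hW0.trans hle, by rwa [← hWt],
        hw.trans hw1, ?_⟩
      · rw [hF'.real 3 _ (by decide)]; exact h3 hf
      · rw [Nat.mul_assoc] at ht ⊢
        omega
  constructor
  · intro hf
    simp only [natLe_holds, const_eval, nv_eval] at hf
    obtain ⟨-, hle, rfl⟩ := hτ.resolve_right (by omega)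
    simp only [block_cons, block_singleton, runs_seq, runs_setReal]
    have hVle : V.tau ≤ τ := (le_mul_of_one_le_right hτ0 (by linarith)).trans hle
    refine (thinCmd_spec hlab (M := M) (S := pre) (pre := pre) (α := 2 + 4 * ε) (τo := V.tau)
      (V := { V with tau := τ }) ?_ h hM (hτ0.trans hVle) ?_ ?_ hB).mono_frame ?_
    · simp [← hjj, hV, hp]
    · exact mul_le_mul_of_nonneg_left hVle (by linarith)
    -- The contraction inequality, scaled by `τ / (1 + ε) ^ J`, which is an upper bound for the old
    -- guess.
    · have hc := hg.contract
      have hRpos : 0 < (1 + ε) ^ J := by linarith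
      have h1 : V.tau ≤ τ / (1 + ε) ^ J := (le_div_iff₀ hRpos).2 hle
      have h2 : (2 + 4 * ε) * V.tau ≤ (2 + 4 * ε) * (τ / (1 + ε) ^ J) :=
        mul_le_mul_of_nonneg_left h1 (by linarith)
      have h3 := mul_le_mul_of_nonneg_right hc (show 0 ≤ τ / (1 + ε) ^ J by
        have := hτ0.trans hVle; positivity)
      have h4 : τ / (1 + ε) ^ J * (1 + ε) ^ J = τ := div_mul_cancel₀ _ hRpos.ne'
      simp only
      nlinarith
    rintro t σ₁ hF ⟨W, hW, hWI, hWc, hWt, hWB, hw1, hwt⟩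
    have hw2 : ({ V with tau := τ } : ClassView X).weight = V.weight := rfl
    simp only [hw2] at hw1 hwt
    have hF' : Frame maintBody.wN maintBody.wR maintBody.wP σ (σ₁.setReal (3, 0, 0, 0)
        (σ₁.real (3, 0, 0, 0) * (((1 : ℕ) : ℝ) + σ₁.real (0, 0, 0, 0)))) := by
      constructor
      · intro a i ha
        simp only [setReal_nat]
        rw [hF.nat a i (fun h => ha (by revert h; exact fun h => List.mem_append_left _ (by simpa [Cmd.wN] using h)))]
        simp
      · intro a i ha
        have h3 : a ≠ 3 := by rintro rfl; exact ha (by decide)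
        have h2 : a ≠ 2 := by rintro rfl; exact ha (by decide)
        simp only [setReal_real, Prod.mk.injEq, h3, false_and, if_false]
        rw [hF.real a i (fun h => ha (List.mem_append_left _ (by
          simp only [Cmd.wR, List.mem_append, block_cons, block_singleton]
          exact Or.inl (Or.inr (Or.inl h)))))]
        simp [h2]
      · intro a i ha
        simp only [setReal_pt]
        rw [hF.pt a i (fun h => ha (List.mem_append_left _ (by simpa [Cmd.wP] using h)))]
        simp
    refine main W _ _ hF' ?_ hWI hWB (hWc.trans hM) ?_ hWt ?_ hw1 ?_
    · rw [rf0_addr, view_setReal _ _ _ _ (by decide)]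
      simpa [← hjj] using hW
    · rw [hWt]; exact hτ0.trans hVle
    · intro _
      have e3 := hF.real 3 (0, 0, 0) (by decide)
      have e0 := hF.real 0 (0, 0, 0) (by decide)
      simp [hp, hP.eps_eq] at e3 e0
      simp [e3, e0]
    · have e3 : (V.cnt + 2) * (V.cnt + 2) ≤ (M + 2) * (M + 2) := by
        apply Nat.mul_le_mul <;> omega
      rw [Nat.mul_assoc] at hwt
      simp
      omega
  · intro hf
    simp only [natLe_holds, const_eval, nv_eval] at hf
    obtain ⟨h0, rfl⟩ := hτ.resolve_left (by omega)
    simp only [runs_skip]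
    refine main V _ σ (Frame.refl _) hV h hB hM hτ0 rfl (by omega) le_rfl ?_
    simp
    omega

/-- The danger is that a guess needs many raises. If the traversal of the guess `0` shows that the
packing bound is at least of the order of its value times `R ^ 2`, then all guesses are restarted
from half of `rho k`, which bounds the packing bound from both sides up to a constant. Otherwise the
packing bound is within `R ^ 9` of every guess, because the guesses are close to each other. Either
way each guess needs at most nine raises. -/
theorem maintCmd_spec (hlab : ∀ x, lab x < m) (hg : Grid ε J) (hP : σ.Params k ε J) (hk : 1 ≤ k)
    {n c : ℕ} (hG : σ.Guesses lab pre k m ε J n c) (hc : c ≤ k) (hne : pre.Nonempty) :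
    Runs lab maintCmd σ fun t σ' => σ'.Guesses lab pre k m ε J n 0 ∧
      (∀ j, J ≤ j → σ'.view j = σ.view j) ∧
      t + 400 * ∑ j ∈ Finset.range J, (σ'.view j).weight id (2 * k) ≤
        400 * ∑ j ∈ Finset.range J, (σ.view j).weight id (2 * k) +
          (J + 1) * (25000 * ((2 * k + 2) * (2 * k + 2))) := by
  have hJ := hg.J_pos
  have hR2 := hg.two_le
  have hε := hg.pos
  have hε2 := hg.le_half
  obtain ⟨L₀, hok⟩ := hG.ok
  have hok0 := hok 0 hJ
  set R := (1 + ε) ^ J with hR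
  obtain ⟨T, hT⟩ : ∃ T, T = (σ.view 0).cnt := ⟨_, rfl⟩
  have hT0 : 0 < T := by
    obtain ⟨x, hx⟩ := hne
    obtain ⟨i, hi, -⟩ := hok0.inv.cov' hx
    omega
  have hTc : T ≤ 2 * k := by have := hG.cnt 0 hJ; omega
  simp only [maintCmd, block_cons, block_singleton, runs_seq, runs_setNat]
  refine (gonzCmd_spec (T := T) (by simp [hT]; rfl) hT0).mono_frame ?_
  rintro t₁ σ₁ hF₁ ⟨ht₁, h22, hGz⟩
  have hv₁ : ∀ j, σ₁.view j = σ.view j := fun j => by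
    rw [hF₁.view (by decide) (by decide) (by decide) (by decide) (by decide) (by decide)
      (by decide)]
    exact view_setNat _ _ _ _ (by decide) (by decide) (by decide) (by decide)
  have e0 : σ₁.nat (0, 0, 0, 0) = k := by rw [hF₁.nat 0 _ (by decide)]; simpa using hP.k_eq
  have e3 : σ₁.nat (3, 0, 0, 0) = J := by rw [hF₁.nat 3 _ (by decide)]; simpa using hP.J_eq
  have r0 : σ₁.real (0, 0, 0, 0) = ε := by rw [hF₁.real 0 _ (by decide)]; exact hP.eps_eq
  have r1 : σ₁.real (1, 0, 0, 0) = R := by rw [hF₁.real 1 _ (by decide)]; exact hP.R_eq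
  have e8 : σ₁.nat (8, 0, 0, 0) = T := by rw [hT, ← hv₁]; rfl
  have r2 : σ₁.real (2, 0, 0, 0) = (σ.view 0).tau := by rw [← hv₁]; rfl
  obtain ⟨ρ, hρ⟩ : ∃ ρ, ρ = σ₁.real (4, k, 0, 0) := ⟨_, rfl⟩
  set τ0 := (σ.view 0).tau with hτ0
  have hτ0' : 0 ≤ τ0 := hok0.tau_nonneg
  have hGz' : σ₁.IsGonz 0 T (T + 1) := by simpa using hGz
  -- This and the next fact bracket the packing bound between `ρ / 2` and `ρ + (2 + 4 * ε) * τ0`.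
  have hρle : k < T → ∀ D, PackBound pre k D → ρ / 2 ≤ D := fun hkT D hD => by
    have := hGz'.le_of_packBound (by rw [hv₁]; exact hok0.inv) (by rw [hv₁, hT]) hkT.le hD
    rw [← hρ] at this
    linarith
  have hρpb : k < T → PackBound pre k (ρ + (2 + 4 * ε) * τ0) := fun hkT => by
    have := hGz'.packBound (by rw [hv₁]; exact hok0.inv) (by rw [hv₁, hT]) hkT.le hk
    rwa [← hρ, hv₁] at this
  have hατ0 : (2 + 4 * ε) * τ0 ≤ 4 * τ0 := mul_le_mul_of_nonneg_right (by linarith) hτ0'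
  -- the loop over the guesses
  have main : ∀ (σ₂ : Mem X) (t₂ : ℕ) (f : ℕ) (p D : ℝ), t₂ ≤ 200 →
      (∀ j, σ₂.view j = σ.view j) → σ₂.Params k ε J → σ₂.nat (12, 0, 0, 0) = 0 →
      σ₂.nat (52, 0, 0, 0) = f →
      σ₂.real (3, 0, 0, 0) = p → PackBound pre k D →
      ((f = 1 ∧ 0 ≤ p ∧ (∀ D, PackBound pre k D → p ≤ D) ∧
          (∀ j < J, (σ.view j).tau * R ≤ p) ∧ D ≤ p * R ^ 9) ∨
        (f = 0 ∧ ∀ j < J, D ≤ (σ.view j).tau * R ^ 9)) →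
      Runs lab (forUp 12 (nv 3) maintBody) σ₂ fun t σ' => σ'.Guesses lab pre k m ε J n 0 ∧
      (∀ j, J ≤ j → σ'.view j = σ.view j) ∧
      t + t₂ + t₁ + 400 * ∑ j ∈ Finset.range J, (σ'.view j).weight id (2 * k) ≤
        400 * ∑ j ∈ Finset.range J, (σ.view j).weight id (2 * k) +
          (J + 1) * (25000 * ((2 * k + 2) * (2 * k + 2))) := by
    intro σ₂ t₂ f p D ht₂ hv₂ hP₂ h12 h52 h3 hD hf
    -- In the case of a reset (`f = 1`) the base of the lattice changes to `p`, and the candidate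
    -- for the guess `i` is `p * (1 + ε) ^ i`; otherwise the old base `L₀` is kept.
    refine (Runs.forUp_total J (fun i u σ' => σ'.Params k ε J ∧ σ'.nat (52, 0, 0, 0) = f ∧
      (f = 1 → σ'.real (3, 0, 0, 0) = p * (1 + ε) ^ i) ∧
      (∀ j < i, ClassOK lab pre k m ε J (if f = 1 then p else L₀) j (σ'.view j) ∧
        (σ'.view j).cnt ≤ k ∧
        (σ'.view j).weight (fun _ => 1) (2 * k) ≤ n) ∧
      (∀ j, i ≤ j → σ'.view j = σ.view j) ∧
      u + 400 * ∑ j ∈ Finset.range i, (σ'.view j).weight id (2 * k) ≤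
        400 * ∑ j ∈ Finset.range i, (σ.view j).weight id (2 * k) +
          i * (24000 * ((2 * k + 2) * (2 * k + 2)))) (by decide) ?_ ?_ h12 ⟨hP₂, h52, ?_, by simp, fun j _ => hv₂ j, by simp⟩).mono ?_
    · rintro i u σ' ⟨hP', -⟩
      exact hP'.J_eq
    · rintro i u σ₃ hi h12' ⟨hP₃, hf₃, hp₃, hdone, htodo, hu⟩
      have hv₃ := htodo i le_rfl
      have hoki := hok i hi
      have hε1 : 1 ≤ (1 + ε) ^ i := one_le_pow₀ (by linarith)
      obtain ⟨q, hq⟩ : ∃ q, q = σ₃.real (3, 0, 0, 0) := ⟨_, rfl⟩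
      refine Runs.mono_row (maintBody_spec hlab hg hP₃ (V := σ.view i) (M := 2 * k) (D := D)
        (pre := pre) (p := q)
        (τ := if f = 1 then q else (σ.view i).tau)
        (by rw [h12', hv₃]) hoki.inv hoki.box (by have := hG.cnt i hi; omega) hoki.tau_nonneg
        hq.symm ?_ hD ?_) ?_ (by decide) ?_
      · rcases hf with ⟨rfl, hp0, -, hle, -⟩ | ⟨rfl, -⟩
        · refine Or.inl ⟨by omega, ?_, by simp⟩
          rw [hq, hp₃ rfl]
          exact (hle i hi).trans (le_mul_of_one_le_right hp0 hε1)
        · exact Or.inr ⟨hf₃, by simp⟩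
      · rcases hf with ⟨rfl, hp0, -, -, hle⟩ | ⟨rfl, hle⟩
        · rw [if_pos rfl, hq, hp₃ rfl]
          refine hle.trans (mul_le_mul_of_nonneg_right (le_mul_of_one_le_right hp0 hε1) ?_)
          positivity
        · simpa using hle i hi
      · simp [Cmd.Rowwise, maintBody, block, thinCmd, raiseCmd, placeCmd, transferCmd, addRepCmd,
          forUp, inc, rf0, rf1, rf2, rf3]
      rintro t σ₄ hF₄ hne₄ ⟨V', hV', h3', hI, hB, hcn, ht0, hre, hw1, hwt⟩
      rw [h12'] at hV' hne₄
      have hview : ∀ j, (σ₄.setNat (12, 0, 0, 0) (i + 1)).view j = σ₄.view j := fun j =>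
        view_setNat _ _ _ _ (by decide) (by decide) (by decide) (by decide)
      refine ⟨⟨?_, ?_, ?_, ?_⟩, ?_, ?_, ?_, ?_, ?_⟩
      · simpa using (hF₄.nat 0 _ (by decide)).trans hP₃.k_eq
      · simpa using (hF₄.nat 3 _ (by decide)).trans hP₃.J_eq
      · simpa using (hF₄.real 0 _ (by decide)).trans hP₃.eps_eq
      · simpa using (hF₄.real 1 _ (by decide)).trans hP₃.R_eq
      · simpa using (hF₄.nat 52 _ (by decide)).trans hf₃
      · intro h1
        simp only [setNat_real]
        rw [h3' (by omega), hq, hp₃ h1, mul_assoc, pow_succ]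
      · intro j hj
        rw [hview]
        rcases Nat.lt_succ_iff_lt_or_eq.1 hj with h | rfl
        · rw [hne₄ j h.ne]
          exact hdone j h
        · rw [hV']
          refine ⟨⟨hI, hB, ht0, ?_⟩, hcn, hw1.trans (hG.weight j hi)⟩
          rcases hf with ⟨rfl, hp0, hpD, -⟩ | ⟨rfl, -⟩
          · rw [if_pos rfl, hq, hp₃ rfl] at hre
            rw [if_pos rfl]
            exact ⟨hp0, fun D _ => hpD D, hre⟩
          · rw [if_neg (by decide)] at hre
            rw [if_neg (by decide)]
            obtain ⟨h0, hL, hr⟩ := hoki.lattice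
            exact ⟨h0, hL, hr.trans hre⟩
      · intro j hij
        rw [hview, hne₄ j (by omega)]
        exact htodo j (by omega)
      · simp only [hview]
        rw [Finset.sum_range_succ, Finset.sum_range_succ, hV', Nat.add_mul]
        have : ∑ j ∈ Finset.range i, (σ₄.view j).weight id (2 * k) =
            ∑ j ∈ Finset.range i, (σ₃.view j).weight id (2 * k) :=
          Finset.sum_congr rfl fun j hj => by rw [hne₄ j (Finset.mem_range.1 hj).ne]
        rw [this]
        rw [Nat.mul_assoc] at hwt
        omega
    · intro _
      simpa using h3
    · rintro t σ' ⟨u, ht, -, hP', -, -, hdone, htodo, hu⟩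
      refine ⟨⟨⟨_, fun j hj => (hdone j hj).1⟩, fun j hj => (hdone j hj).2.1, ?_,
        fun j hj => (hdone j hj).2.2⟩, htodo, ?_⟩
      · intro i hi j hj
        have hi' := hdone i hi
        -- The guess `i` has at most `k` pivots now, so `2 + 4 * ε ≤ 4` times it is a packing bound;
        -- no guess exceeds that by more than the factor `(1 + ε) ^ J`.
        have h1 := hi'.1.inv.packBound hi'.2.1
        have h2 := (hdone j hj).1.lattice.le hg hj
          (mul_nonneg (by linarith) hi'.1.tau_nonneg) h1
        refine h2.trans ?_
        have h3 : (2 + 4 * ε) * (σ'.view i).tau ≤ 4 * (σ'.view i).tau :=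
          mul_le_mul_of_nonneg_right (by linarith) hi'.1.tau_nonneg
        have := mul_le_mul_of_nonneg_left h3 (show 0 ≤ (1 + ε) ^ J by linarith)
        linarith
      · have h4 : (2 * 1 + 2) * (2 * 1 + 2) ≤ (2 * k + 2) * (2 * k + 2) := by
          apply Nat.mul_le_mul <;> omega
        have h5 : (T + 2) * (T + 2) ≤ (2 * k + 2) * (2 * k + 2) := by
          apply Nat.mul_le_mul <;> omega
        rw [Nat.mul_assoc] at ht₁
        simp only [nv_time] at ht
        rw [Nat.add_mul] at ht ⊢
        nlinarith
  rw [runs_setReal, runs_ite]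
  have hR9 : ∀ a : ℕ, a ≤ 9 → R ^ a ≤ R ^ 9 := fun a ha => pow_le_pow_right₀ (by linarith) ha
  constructor
  · intro hb
    simp only [and_holds, ltE_holds, realLe_holds] at hb
    simp [e0, e8, r1, r2, ← hρ] at hb
    obtain ⟨hkT, hle⟩ := hb
    have hRR : 8 * 2 * τ0 ≤ 8 * R * τ0 := by nlinarith
    have hRR' : 8 * R * τ0 * 2 ≤ 8 * R * τ0 * R :=
      mul_le_mul_of_nonneg_left hR2 (by positivity)
    have hρ0 : 0 ≤ ρ := le_trans (by positivity) hle
    simp only [runs_seq, runs_setNat, runs_setReal]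
    refine (main _ 120 1 (ρ / 2) (ρ + (2 + 4 * ε) * τ0) (by norm_num) ?_ ?_ ?_ ?_ ?_ (hρpb hkT)
      (Or.inl ⟨rfl, by linarith, hρle hkT, ?_, ?_⟩)).mono ?_
    · intro j
      simp [view_setNat, view_setReal, hv₁]
    · constructor <;> simp [e0, e3, r0, r1, hR]
    · simp
    · simp
    · simp [e0, ← hρ]
    · intro j hj
      -- Since `ρ / 2 ≥ 4 * R ^ 2 * τ0`, every guess is below `ρ / 2` by the factor `R` that merging
      -- requires. This explains the `8` in the test.
      have h0 : (σ.view j).tau ≤ 4 * R * τ0 := hG.spread 0 hJ j hj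
      have h1 := mul_le_mul_of_nonneg_right h0 (show 0 ≤ R by linarith)
      linarith
    · have h1 := hR9 2 (by norm_num)
      have h2 : 4 ≤ R ^ 2 := by nlinarith
      have h3 : 4 * τ0 ≤ ρ := by linarith
      have h4 : ρ / 2 * 4 ≤ ρ / 2 * R ^ 9 := mul_le_mul_of_nonneg_left (by linarith) (by linarith)
      linarith
    · rintro t σ' ⟨h1, h2, h3⟩
      refine ⟨h1, h2, ?_⟩
      simp
      omega
  · intro hb
    simp only [and_holds, ltE_holds, realLe_holds] at hb
    simp [e0, e8, r1, r2, ← hρ] at hb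
    simp only [runs_skip]
    -- Without a reset the packing bound is of the order of `τ0`: either the test on `ρ` failed, or
    -- the guess `0` has at most `k` pivots.
    obtain ⟨D, hD, hDle⟩ : ∃ D, PackBound pre k D ∧ D ≤ 9 * R ^ 2 * τ0 := by
      rcases lt_or_ge k T with hkT | hkT
      · refine ⟨_, hρpb hkT, ?_⟩
        have := hb hkT
        nlinarith [mul_nonneg hτ0' (show 0 ≤ R - 2 by linarith)]
      · refine ⟨_, hok0.inv.packBound (by omega), ?_⟩
        nlinarith [mul_nonneg hτ0' (show 0 ≤ R - 2 by linarith)]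
    refine (main _ 120 0 _ D (by norm_num) ?_ ?_ ?_ ?_ rfl hD
      (Or.inr ⟨rfl, ?_⟩)).mono ?_
    · intro j
      simp [view_setNat, view_setReal, hv₁]
    · constructor <;> simp [e0, e3, r0, r1, hR]
    · simp
    · simp
    · intro j hj
      have h1 := hG.spread j hj 0 hJ
      have hτj := (hok j hj).tau_nonneg
      have h2 : 9 * R ^ 2 * τ0 ≤ 9 * R ^ 2 * (4 * R * (σ.view j).tau) :=
        mul_le_mul_of_nonneg_left h1 (by positivity)
      -- The packing bound is at most `36 * R ^ 3` times any guess, and `36 ≤ 2 ^ 6` turns this into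
      -- the factor `R ^ 9`.
      have h6 : (2 : ℝ) ^ 6 ≤ R ^ 6 := pow_le_pow_left₀ (by norm_num) hR2 6
      have h3 : 36 * (R ^ 3 * (σ.view j).tau) ≤ R ^ 6 * (R ^ 3 * (σ.view j).tau) :=
        mul_le_mul_of_nonneg_right (by linarith) (by positivity)
      have h4 : R ^ 6 * (R ^ 3 * (σ.view j).tau) = (σ.view j).tau * R ^ 9 := by ring
      linarith
    · rintro t σ' ⟨h1, h2, h3⟩
      refine ⟨h1, h2, ?_⟩
      simp
      omega
end
end FairStream

namespace FairStream

/-! ### Processing the stream -/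

/-- Stores the arriving point in the pool, which holds up to `k` points of each group. -/
def poolCmd : Cmd :=
  block [.setNat (rf0 16) (grp (rf0 0)),
    .ite (.natLe (n1 6 (nv 16)) (.const 0))
      (block [.setNat (rf1 5 (nv 4)) (nv 16), inc 4]) .skip,
    .ite (.natLe (.add (n1 6 (nv 16)) (.const 1)) (nv 0))
      (block [.setPoint (rf2 4 (nv 16) (n1 6 (nv 16))) (rf0 0),
        .setNat (rf1 6 (nv 16)) (.add (n1 6 (nv 16)) (.const 1))]) .skip]

/-- Maintenance is run only after every `k` insertions. Between two maintenances a guess may have up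
to `2 * k` pivots, which costs only a constant factor. -/
def stepCmd : Cmd :=
  block [poolCmd, .setNat (rf0 12) (.const 0), forUp 12 (nv 3) insertCmd, inc 7,
    .ite (.natLe (nv 0) (nv 7)) (.seq maintCmd (.setNat (rf0 7) (.const 0))) .skip]

/-- Computes `J`, the number of guesses, and `(1 + ε) ^ J ≥ 1 / ε`. -/
def initCmd : Cmd :=
  .seq (.setReal (rf0 1) (.ofNat (.const 1)))
    (.loop (ltR (.mul (.load (rf0 0)) (.load (rf0 1))) (.ofNat (.const 1)))
      (.seq (.setReal (rf0 1) (.mul (.load (rf0 1)) (.add (.ofNat (.const 1)) (.load (rf0 0)))))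
        (inc 3)))

/-- The pool of the points `A`: `nat 4` is the number of groups seen, `nat 5` lists them, and
`nat 6 g` is the number of points of the group `g` in the pool, kept in `pt 4 g`. -/
structure Mem.Pool {X : Type*} (σ : Mem X) (lab : X → ℕ) (A : Set X) (k m : ℕ) : Prop where
  GL_inj : ∀ i < σ.nat (4, 0, 0, 0), ∀ j < σ.nat (4, 0, 0, 0),
    σ.nat (5, i, 0, 0) = σ.nat (5, j, 0, 0) → i = j
  GL_mem : ∀ i < σ.nat (4, 0, 0, 0), ∃ x ∈ A, lab x = σ.nat (5, i, 0, 0)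
  seen : ∀ x ∈ A, ∃ i < σ.nat (4, 0, 0, 0), σ.nat (5, i, 0, 0) = lab x
  FL_pos : ∀ x ∈ A, 0 < σ.nat (6, lab x, 0, 0)
  FL_le : ∀ g, σ.nat (6, g, 0, 0) ≤ k
  F_mem : ∀ g, ∀ p < σ.nat (6, g, 0, 0), ∃ x ∈ A, σ.pt (4, g, p, 0) = some x ∧ lab x = g
  F_inj : ∀ g, ∀ p < σ.nat (6, g, 0, 0), ∀ q < σ.nat (6, g, 0, 0),
    σ.pt (4, g, p, 0) = σ.pt (4, g, q, 0) → p = q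
  full : ∀ x ∈ A, σ.nat (6, lab x, 0, 0) = k ∨
    ∃ p < σ.nat (6, lab x, 0, 0), σ.pt (4, lab x, p, 0) = some x
  box : ∀ g p, σ.pt (4, g, p, 0) ≠ none → g < m ∧ p < k

theorem ClassInv.mono {X : Type*} [MetricSpace X] {lab : X → ℕ} {S S' pre : Set X} {α : ℝ}
    {V : ClassView X} (h : ClassInv lab S pre α V) (hS : S ⊆ S') : ClassInv lab S' pre α V := by
  refine ⟨fun i hi => ?_, ThinInv.sep h, fun i p hp => ?_, ThinInv.mark h, ThinInv.empty h,
    ThinInv.cov h⟩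
  · obtain ⟨p, hp, hp'⟩ := ThinInv.piv h i hi
    exact ⟨p, hS hp, hp'⟩
  · obtain ⟨y, hy, hy'⟩ := ThinInv.rep h i p hp
    exact ⟨y, hS hy, hy'⟩

section
variable {X : Type*} [MetricSpace X] {lab : X → ℕ} {σ : Mem X} {A : Set X} {ε : ℝ} {k m J : ℕ}

omit [MetricSpace X] in
theorem Frame.pool {N R P : List ℕ} {σ σ' : Mem X} (h : Frame N R P σ σ')
    (h4 : 4 ∉ N) (h5 : 5 ∉ N) (h6 : 6 ∉ N) (hP : 4 ∉ P) (hp : σ.Pool lab A k m) :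
    σ'.Pool lab A k m := by
  constructor <;> simp only [h.nat 4 _ h4, h.nat 5 _ h5, h.nat 6 _ h6, h.pt 4 _ hP]
  exacts [hp.1, hp.2, hp.3, hp.4, hp.5, hp.6, hp.7, hp.8, hp.9]

/-- The pool count of a group is zero exactly when the group is new, since `1 ≤ k`. This decides
without any search whether the group must be appended to the list of groups seen. -/
theorem poolCmd_spec (hlab : ∀ x, lab x < m) (hk : 1 ≤ k) (hσk : σ.nat (0, 0, 0, 0) = k) {x : X}
    (hin : σ.pt (0, 0, 0, 0) = some x) (hx : x ∉ A) (h : σ.Pool lab A k m) :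
    Runs lab poolCmd σ fun t σ' => t ≤ 200 ∧ σ'.Pool lab (insert x A) k m ∧
      σ'.nat (4, 0, 0, 0) ≤ σ.nat (4, 0, 0, 0) + 1 := by
  obtain ⟨g, hg⟩ : ∃ g, g = lab x := ⟨_, rfl⟩
  obtain ⟨G, hG⟩ : ∃ G, G = σ.nat (4, 0, 0, 0) := ⟨_, rfl⟩
  obtain ⟨c, hc⟩ : ∃ c, c = σ.nat (6, g, 0, 0) := ⟨_, rfl⟩
  have hzero : c = 0 → ∀ i < G, σ.nat (5, i, 0, 0) ≠ g := by
    intro h0 i hi hig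
    obtain ⟨y, hy, hyl⟩ := h.GL_mem i (hG ▸ hi)
    have := h.FL_pos y hy
    rw [hyl, hig, ← hc] at this
    omega
  have hpos : c ≠ 0 → ∃ i < G, σ.nat (5, i, 0, 0) = g := by
    intro h0
    obtain ⟨y, hy, -, hyl⟩ := h.F_mem g 0 (by omega)
    rw [← hyl, hG]
    exact h.seen y hy
  simp only [poolCmd, block_cons, block_singleton, runs_seq, runs_setNat]
  rw [runs_ite]
  -- the list of groups
  have main : ∀ (σ₁ : Mem X) (t₁ : ℕ), t₁ ≤ 100 → (∀ i, σ₁.nat (6, i) = σ.nat (6, i)) →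
      σ₁.pt = σ.pt → σ₁.nat (16, 0, 0, 0) = g → σ₁.nat (0, 0, 0, 0) = k →
      (∀ i < σ₁.nat (4, 0, 0, 0), ∀ j < σ₁.nat (4, 0, 0, 0),
        σ₁.nat (5, i, 0, 0) = σ₁.nat (5, j, 0, 0) → i = j) →
      (∀ i < σ₁.nat (4, 0, 0, 0), ∃ y ∈ insert x A, lab y = σ₁.nat (5, i, 0, 0)) →
      (∀ y ∈ insert x A, ∃ i < σ₁.nat (4, 0, 0, 0), σ₁.nat (5, i, 0, 0) = lab y) →
      σ₁.nat (4, 0, 0, 0) ≤ G + 1 →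
      Runs lab (.ite (.natLe (.add (n1 6 (nv 16)) (.const 1)) (nv 0))
        (.seq (.setPoint (rf2 4 (nv 16) (n1 6 (nv 16))) (rf0 0))
        (.setNat (rf1 6 (nv 16)) (.add (n1 6 (nv 16)) (.const 1)))) .skip) σ₁ fun t σ' =>
        t + t₁ ≤ 200 ∧ σ'.Pool lab (insert x A) k m ∧ σ'.nat (4, 0, 0, 0) ≤ G + 1 := by
    intro σ₁ t₁ ht₁ e6 ept e16 e0 hinj hmem hseen hG1
    rw [runs_ite]
    constructor
    · intro hb
      simp [e16, e6, e0, ← hc] at hb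
      simp only [runs_seq, runs_setPoint, runs_setNat]
      refine ⟨x, by simp [ept, hin], by simp; omega, ?_, by simpa using hG1⟩
      simp only [rf1_addr, rf2_addr, nv_eval, n1_eval, const_eval, add_eval, setPoint_nat, e16, e6,
        ← hc]
      have a6 : ∀ g', ((σ₁.setPoint (4, g, c, 0) x).setNat (6, g, 0, 0) (c + 1)).nat
          (6, g', 0, 0) = if g' = g then c + 1 else σ.nat (6, g', 0, 0) := by
        intro g'
        simp [e6]
      have a4 : ∀ g' p, ((σ₁.setPoint (4, g, c, 0) x).setNat (6, g, 0, 0) (c + 1)).pt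
          (4, g', p, 0) = if g' = g ∧ p = c then some x else σ.pt (4, g', p, 0) := by
        intro g' p
        simp [ept]
      constructor
      · simpa using hinj
      · simpa using hmem
      · simpa using hseen
      · intro y hy
        rw [a6]
        split_ifs with h1
        · omega
        · rcases hy with rfl | hy
          · exact absurd hg.symm h1
          · exact h.FL_pos y hy
      · intro g'
        rw [a6]
        split_ifs with h1
        · omega
        · exact h.FL_le g'
      · intro g' p hp
        rw [a6] at hp
        rw [a4]
        by_cases h1 : g' = g ∧ p = c
        · exact ⟨x, Or.inl rfl, by simp [h1], by rw [h1.1, hg]⟩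
        · rw [if_neg h1]
          obtain ⟨y, hy, hy'⟩ := h.F_mem g' p (by
            split_ifs at hp with h2
            · subst h2; rw [← hc]; have : p ≠ c := fun h3 => h1 ⟨rfl, h3⟩
              omega
            · exact hp)
          exact ⟨y, Or.inr hy, hy'⟩
      · intro g' p hp q hq hpq
        rw [a6] at hp hq
        rw [a4, a4] at hpq
        by_cases h1 : g' = g
        · subst h1
          simp only [if_true, true_and] at hp hq hpq
          -- The stream has no repetitions and the pool contains only earlier points, so the
          -- arriving point is not in it.
          have hnx : ∀ p < c, σ.pt (4, g', p, 0) ≠ some x := by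
            intro p hp hpx
            obtain ⟨y, hy, hy', -⟩ := h.F_mem g' p (hc ▸ hp)
            rw [hpx] at hy'
            cases hy'
            exact hx hy
          split_ifs at hpq with h1 h2 h2
          · omega
          · exact absurd hpq.symm (hnx q (by omega))
          · exact absurd hpq (hnx p (by omega))
          · exact h.F_inj g' p (by omega) q (by omega) hpq
        · simp only [h1, if_false, false_and] at hp hq hpq
          exact h.F_inj g' p hp q hq hpq
      · intro y hy
        rw [a6]
        rcases hy with rfl | hy
        · rw [← hg]
          exact Or.inr ⟨c, by simp, by rw [a4]; simp⟩
        · by_cases h1 : lab y = g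
          · have := h.full y hy
            rw [h1, ← hc] at this
            rcases this with h2 | ⟨p, hp, hpy⟩
            · omega
            · refine Or.inr ⟨p, by rw [if_pos h1]; omega, ?_⟩
              rw [a4, if_neg (by omega), h1, hpy]
          · rw [if_neg h1]
            rcases h.full y hy with h2 | ⟨p, hp, hpy⟩
            · exact Or.inl h2
            · exact Or.inr ⟨p, hp, by rw [a4, if_neg (by tauto), hpy]⟩
      · intro g' p hp
        rw [a4] at hp
        split_ifs at hp with h1
        · rw [h1.1, h1.2]; exact ⟨hg ▸ hlab x, by omega⟩
        · exact h.box g' p hp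
    · intro hb
      simp [e16, e6, e0, ← hc] at hb
      simp only [runs_skip]
      refine ⟨by simp; omega, ?_, hG1⟩
      have hck : c = k := by have := h.FL_le g; omega
      constructor
      · exact hinj
      · exact hmem
      · exact hseen
      · intro y hy
        rw [e6]
        rcases hy with rfl | hy
        · rw [← hg, ← hc]; omega
        · exact h.FL_pos y hy
      · intro g'; rw [e6]; exact h.FL_le g'
      · intro g' p hp
        rw [e6] at hp
        rw [ept]
        obtain ⟨y, hy, hy'⟩ := h.F_mem g' p hp
        exact ⟨y, Or.inr hy, hy'⟩
      · intro g'
        rw [e6, ept]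
        exact h.F_inj g'
      · intro y hy
        rw [e6, ept]
        rcases hy with rfl | hy
        · rw [← hg, ← hc]; exact Or.inl hck
        · exact h.full y hy
      · rw [ept]; exact h.box
  constructor
  · intro hb
    simp [hin, ← hg, ← hc] at hb
    simp only [inc, runs_seq, runs_setNat]
    refine (main _ 100 le_rfl ?_ (by simp) ?_ ?_ ?_ ?_ ?_ ?_).mono ?_
    · simp
    · simp [hin, hg]
    · simp [hσk]
    · intro i hi j hj hij
      simp [hin, ← hG, ← hg] at hi hj hij
      by_cases h1 : i = G <;> by_cases h2 : j = G
      · omega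
      · rw [if_pos h1, if_neg h2] at hij
        exact absurd hij.symm (hzero hb j (by omega))
      · rw [if_pos h2, if_neg h1] at hij
        exact absurd hij (hzero hb i (by omega))
      · rw [if_neg h1, if_neg h2] at hij
        exact h.GL_inj i (by omega) j (by omega) hij
    · intro i hi
      simp [← hG] at hi
      simp only [rf0_addr, rf1_addr, grp_eval, hin, Option.map_some, Option.getD_some, ← hg]
      by_cases h1 : i = G
      · exact ⟨x, Or.inl rfl, by simp [← hG, h1, hg]⟩
      · obtain ⟨y, hy, hyl⟩ := h.GL_mem i (by omega)
        exact ⟨y, Or.inr hy, by simp [← hG, h1, hyl]⟩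
    · intro y hy
      simp only [rf0_addr, rf1_addr, grp_eval, hin, Option.map_some, Option.getD_some, ← hg]
      rcases hy with rfl | hy
      · exact ⟨G, by simp [← hG], by simp [← hG, hg]⟩
      · obtain ⟨i, hi, hiy⟩ := h.seen y hy
        exact ⟨i, by simp; omega, by simp [← hG, show i ≠ G by omega, hiy]⟩
    · simp [← hG]
    · rintro t σ' ⟨ht, h1, h2⟩
      refine ⟨?_, h1, hG ▸ h2⟩
      simp
      omega
  · intro hb
    simp [hin, ← hg, ← hc] at hb
    simp only [runs_skip]
    refine (main _ 100 le_rfl ?_ (by simp) ?_ ?_ ?_ ?_ ?_ ?_).mono ?_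
    · simp
    · simp [hin, hg]
    · simp [hσk]
    · simpa using h.GL_inj
    · intro i hi
      simp at hi
      obtain ⟨y, hy, hyl⟩ := h.GL_mem i hi
      exact ⟨y, Or.inr hy, by simpa using hyl⟩
    · intro y hy
      rcases hy with rfl | hy
      · obtain ⟨i, hi, hiy⟩ := hpos hb
        exact ⟨i, by simpa [← hG] using hi, by simpa [hg] using hiy⟩
      · obtain ⟨i, hi, hiy⟩ := h.seen y hy
        exact ⟨i, by simpa using hi, by simpa using hiy⟩
    · simp; omega
    · rintro t σ' ⟨ht, h1, h2⟩
      refine ⟨?_, h1, hG ▸ h2⟩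
      simp
      omega

end
end FairStream

/-! ### The invariant of the stream and the amortized time per point -/

namespace FairStream

/-- The invariant of the streaming phase: the points of `A` have been processed, and there
were `n` of them. -/
structure Mem.Stream {X : Type*} [MetricSpace X] (σ : Mem X) (lab : X → ℕ) (A : Set X)
    (k m : ℕ) (ε : ℝ) (J n : ℕ) : Prop where
  params : σ.Params k ε J
  pool : σ.Pool lab A k m
  guesses : σ.Guesses lab A k m ε J n (σ.nat (7, 0, 0, 0))
  counter_lt : σ.nat (7, 0, 0, 0) < k
  groups_le : σ.nat (4, 0, 0, 0) ≤ n
  unused : ∀ j, J ≤ j → (σ.view j).Box 0 0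

/-- The potential of the amortized analysis. -/
def Mem.potential {X : Type*} (σ : Mem X) (k J : ℕ) : ℕ :=
  400 * ∑ j ∈ Finset.range J, (σ.view j).weight id (2 * k) +
    σ.nat (7, 0, 0, 0) * (400000 * ((J + 1) * k))

section
variable {X : Type*} [MetricSpace X] {lab : X → ℕ} {σ : Mem X} {A : Set X} {ε : ℝ} {k m J : ℕ}

omit [MetricSpace X] in
theorem Frame.params {N R P : List ℕ} {σ σ' : Mem X} (h : Frame N R P σ σ')
    (h0 : 0 ∉ N) (h3 : 3 ∉ N) (r0 : 0 ∉ R) (r1 : 1 ∉ R) (hp : σ.Params k ε J) :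
    σ'.Params k ε J := by
  constructor <;> simp only [h.nat 0 _ h0, h.nat 3 _ h3, h.real 0 _ r0, h.real 1 _ r1]
  exacts [hp.1, hp.2, hp.3, hp.4]

theorem insertAll_spec (hlab : ∀ x, lab x < m) (hg : Grid ε J) (hJ : σ.nat (3, 0, 0, 0) = J)
    {n c : ℕ} (h : σ.Guesses lab A k m ε J n c) (hc : c < k) {x : X}
    (hin : σ.pt (0, 0, 0, 0) = some x) (h12 : σ.nat (12, 0, 0, 0) = 0) :
    Runs lab (forUp 12 (nv 3) insertCmd) σ fun t σ' =>
      σ'.Guesses lab (insert x A) k m ε J (n + 1) (c + 1) ∧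
      (∀ j, J ≤ j → σ'.view j = σ.view j) ∧
      t + 400 * ∑ j ∈ Finset.range J, (σ'.view j).weight id (2 * k) ≤
        400 * ∑ j ∈ Finset.range J, (σ.view j).weight id (2 * k) + (J + 1) * (2000 * k) := by
  have hsub : A ⊆ insert x A := Set.subset_insert x A
  obtain ⟨L, hok⟩ := h.ok
  refine (Runs.forUp_total J (fun i u σ' => σ'.nat (3, 0, 0, 0) = J ∧
    σ'.pt (0, 0, 0, 0) = some x ∧
    (∀ j < i, j < J → ClassOK lab (insert x A) k m ε J L j (σ'.view j) ∧
      (σ'.view j).cnt ≤ k + (c + 1) ∧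
      (σ'.view j).tau = (σ.view j).tau ∧ (σ'.view j).weight (fun _ => 1) (2 * k) ≤ n + 1) ∧
    (∀ j, i ≤ j → σ'.view j = σ.view j) ∧
    u + 400 * ∑ j ∈ Finset.range i, (σ'.view j).weight id (2 * k) ≤
      400 * ∑ j ∈ Finset.range i, (σ.view j).weight id (2 * k) + i * (1900 * k))
    (by decide) ?_ ?_ h12 ⟨hJ, hin, by simp, by simp, by simp⟩).mono ?_
  · rintro i u σ' ⟨h3, -⟩
    exact h3
  · rintro i u σ₁ hi h12' ⟨h3, hin', hdone, htodo, hu⟩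
    have hoki := hok i hi
    have hcnt := h.cnt i hi
    have hε := hg.pos
    refine Runs.mono_row (insertCmd_spec hlab (S := insert x A) (pre := A) (α := 2 + 4 * ε)
      (M := 2 * k) (V := σ.view i) (x := x) (by rw [h12', htodo i le_rfl])
      (hoki.inv.mono hsub) (Or.inl rfl) hin' (by omega) hoki.tau_nonneg (by linarith) hoki.box)
      ?_ (by decide) ?_
    · simp [Cmd.Rowwise, insertCmd, block, placeCmd, addRepCmd, inc, rf0, rf1, rf2, rf3]
    rintro t σ₂ hF hne ⟨ht, V', hV', hI, hc', htau, hB, hw1, hwt⟩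
    rw [h12'] at hV' hne
    have hview : ∀ j, (σ₂.setNat (12, 0, 0, 0) (i + 1)).view j = σ₂.view j := fun j =>
      view_setNat _ _ _ _ (by decide) (by decide) (by decide) (by decide)
    refine ⟨?_, ?_, ?_, ?_, ?_⟩
    · simpa using (hF.nat 3 _ (by decide)).trans h3
    · simpa using (hF.pt 0 _ (by decide)).trans hin'
    · intro j hj hjJ
      rw [hview]
      rcases Nat.lt_succ_iff_lt_or_eq.1 hj with h' | rfl
      · rw [hne j h'.ne]
        exact hdone j h' hjJ
      · rw [hV']
        exact ⟨⟨hI, hB, htau ▸ hoki.tau_nonneg, htau ▸ hoki.lattice.mono hsub⟩, by omega, htau,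
          hw1.trans (Nat.succ_le_succ (h.weight j hi))⟩
    · intro j hij
      rw [hview, hne j (by omega)]
      exact htodo j (by omega)
    · simp only [hview]
      rw [Finset.sum_range_succ, Finset.sum_range_succ, hV', Nat.add_mul]
      have : ∑ j ∈ Finset.range i, (σ₂.view j).weight id (2 * k) =
          ∑ j ∈ Finset.range i, (σ₁.view j).weight id (2 * k) :=
        Finset.sum_congr rfl fun j hj => by rw [hne j (Finset.mem_range.1 hj).ne]
      rw [this]
      omega
  · rintro t σ' ⟨u, ht, -, -, -, hdone, htodo, hu⟩
    refine ⟨⟨⟨L, fun j hj => (hdone j hj hj).1⟩, fun j hj => (hdone j hj hj).2.1, ?_,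
        fun j hj => (hdone j hj hj).2.2.2⟩, htodo, ?_⟩
    · intro i hi j hj
      rw [(hdone i hi hi).2.2.1, (hdone j hj hj).2.2.1]
      exact h.spread i hi j hj
    · simp only [nv_time] at ht
      rw [Nat.add_mul] at ht ⊢
      have : J * 1 ≤ J * k := Nat.mul_le_mul_left _ (by omega)
      have e1 : J * (1900 * k) = 1900 * (J * k) := by ring
      have e2 : J * (2000 * k) = 2000 * (J * k) := by ring
      rw [e1] at hu
      rw [e2]
      omega

/-- Each step puts an amount of order `J * k` aside through the counter, besides the cost of the
insertions. When the counter reaches `k`, the savings of order `J * k ^ 2` pay for the maintenance,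
and the counter starts again from zero. -/
theorem stepCmd_spec (hlab : ∀ x, lab x < m) (hg : Grid ε J) {n : ℕ}
    (h : σ.Stream lab A k m ε J n) {x : X} (hx : x ∉ A) :
    Runs lab stepCmd (σ.setPoint inputCell x) fun t σ' =>
      σ'.Stream lab (insert x A) k m ε J (n + 1) ∧
      t + 1 + σ'.potential k J ≤ σ.potential k J + 500000 * ((J + 1) * k) := by
  have hk : 1 ≤ k := by have := h.counter_lt; omega
  obtain ⟨c, hc⟩ : ∃ c, c = σ.nat (7, 0, 0, 0) := ⟨_, rfl⟩
  have hck : c < k := hc ▸ h.counter_lt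
  have hgu := h.guesses
  rw [← hc] at hgu
  have hP0 : (σ.setPoint inputCell x).Params k ε J :=
    ⟨h.params.1, h.params.2, h.params.3, h.params.4⟩
  have hpool0 : (σ.setPoint inputCell x).Pool lab A k m := by
    have e : ∀ i, (σ.setPoint inputCell x).pt (4, i) = σ.pt (4, i) := by
      intro i; simp [inputCell]
    have hp := h.pool
    constructor <;> simp only [e, setPoint_nat]
    exacts [hp.1, hp.2, hp.3, hp.4, hp.5, hp.6, hp.7, hp.8, hp.9]
  have hv0 : ∀ j, (σ.setPoint inputCell x).view j = σ.view j := fun j =>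
    view_setPoint _ _ _ _ (by decide) (by decide)
  simp only [stepCmd, block_cons, block_singleton, runs_seq, runs_setNat]
  refine (poolCmd_spec hlab hk hP0.k_eq (by simp [inputCell]) hx hpool0).mono_frame ?_
  rintro t₁ σ₁ hF₁ ⟨ht₁, hpool₁, hG₁⟩
  have hv₁ : ∀ j, (σ₁.setNat (12, 0, 0, 0) 0).view j = σ.view j := fun j => by
    rw [view_setNat _ _ _ _ (by decide) (by decide) (by decide) (by decide),
      hF₁.view (by decide) (by decide) (by decide) (by decide) (by decide) (by decide)
      (by decide), hv0]
  have hP₁ : σ₁.Params k ε J := hF₁.params (by decide) (by decide) (by decide) (by decide) hP0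
  have hG₁' : (σ₁.setNat (12, 0, 0, 0) 0).Guesses lab A k m ε J n c := by
    constructor <;> simp only [hv₁]
    exacts [hgu.1, hgu.2, hgu.3, hgu.4]
  have h7₁ : σ₁.nat (7, 0, 0, 0) = c := by rw [hF₁.nat 7 _ (by decide), hc]; rfl
  refine (insertAll_spec hlab hg ?_ hG₁' hck (x := x) ?_ ?_).mono_frame ?_
  · simpa using hP₁.J_eq
  · simpa [inputCell] using hF₁.pt 0 (0, 0, 0) (by decide)
  · simp
  rintro t₂ σ₂ hF₂ ⟨hG₂, hun₂, ht₂⟩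
  simp only [hv₁] at ht₂ hun₂
  have h7₂ : σ₂.nat (7, 0, 0, 0) = c := by rw [hF₂.nat 7 _ (by decide)]; simpa using h7₁
  have hP₂ : σ₂.Params k ε J := hF₂.params (by decide) (by decide) (by decide) (by decide)
    ⟨by simpa using hP₁.1, by simpa using hP₁.2, hP₁.3, hP₁.4⟩
  have h4₂ : σ₂.nat (4, 0, 0, 0) ≤ n + 1 := by
    rw [hF₂.nat 4 _ (by decide)]
    have := h.groups_le
    simp at hG₁ ⊢
    omega
  have hpool₂ : σ₂.Pool lab (insert x A) k m := hF₂.pool (by decide) (by decide) (by decide)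
    (by decide) (by
      have hp := hpool₁
      constructor <;> simp
      exacts [hp.1, by simpa using hp.2, by simpa using hp.3, by simpa using hp.4, hp.5,
        by simpa using hp.6, hp.7, by simpa using hp.8, by simpa using hp.9])
  have hJk : 1 ≤ (J + 1) * k := Nat.mul_pos (Nat.succ_pos _) hk
  have e1 : (J + 1) * (2000 * k) = 2000 * ((J + 1) * k) := by ring
  rw [e1] at ht₂
  simp only [inc, runs_setNat]
  have hv₃ : ∀ j, (σ₂.setNat (7, 0, 0, 0) (c + 1)).view j = σ₂.view j := fun j =>
    view_setNat _ _ _ _ (by decide) (by decide) (by decide) (by decide)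
  have hP₃ : (σ₂.setNat (7, 0, 0, 0) (c + 1)).Params k ε J :=
    ⟨by simpa using hP₂.1, by simpa using hP₂.2, hP₂.3, hP₂.4⟩
  have hG₃ : (σ₂.setNat (7, 0, 0, 0) (c + 1)).Guesses lab (insert x A) k m ε J (n + 1) (c + 1) := by
    constructor <;> simp only [hv₃]
    exacts [hG₂.1, hG₂.2, hG₂.3, hG₂.4]
  have hpool₃ : ∀ (σ₂ : Mem X) v, σ₂.Pool lab (insert x A) k m →
      (σ₂.setNat (7, 0, 0, 0) v).Pool lab (insert x A) k m := by
    intro σ₂ v hp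
    have e : ∀ a i, a ≠ 7 → (σ₂.setNat (7, 0, 0, 0) v).nat (a, i) = σ₂.nat (a, i) := by
      intro a i ha; simp [ha]
    constructor <;> simp only [e 4 _ (by decide), e 5 _ (by decide), e 6 _ (by decide), setNat_pt]
    exacts [hp.1, hp.2, hp.3, hp.4, hp.5, hp.6, hp.7, hp.8, hp.9]
  simp only [rf0_addr, add_eval, nv_eval, const_eval, h7₂]
  rw [runs_ite]
  constructor
  · intro hb
    simp [hP₂.k_eq] at hb
    rw [runs_seq]
    refine (maintCmd_spec hlab hg hP₃ hk hG₃ (by omega) ⟨x, Or.inl rfl⟩).mono_frame ?_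
    rintro t₃ σ₄ hF₄ ⟨hG₄, hun₄, ht₃⟩
    simp only [hv₃] at hun₄ ht₃
    simp only [runs_setNat, rf0_addr, const_eval]
    have hv₅ : ∀ j, (σ₄.setNat (7, 0, 0, 0) 0).view j = σ₄.view j := fun j =>
      view_setNat _ _ _ _ (by decide) (by decide) (by decide) (by decide)
    have hP₄ : σ₄.Params k ε J := hF₄.params (by decide) (by decide) (by decide) (by decide) hP₃
    refine ⟨⟨⟨by simpa using hP₄.1, by simpa using hP₄.2, hP₄.3, hP₄.4⟩, ?_, ?_, ?_, ?_, ?_⟩, ?_⟩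
    · exact hpool₃ _ _ (hF₄.pool (by decide) (by decide) (by decide) (by decide)
        (hpool₃ _ _ hpool₂))
    · constructor <;> simp only [hv₅]
      exacts [hG₄.1, by simpa using hG₄.2, hG₄.3, hG₄.4]
    · simp; omega
    · simpa using (hF₄.nat 4 (0, 0, 0) (by decide)).trans_le (by simpa using h4₂)
    · intro j hj
      rw [hv₅, hun₄ j hj, hun₂ j hj]
      exact h.unused j hj
    -- The fixed part of the maintenance is at most what `k` steps have saved; `2 * k + 2 ≤ 4 * k`
    -- uses `1 ≤ k`.
    · have e2 : (J + 1) * (25000 * ((2 * k + 2) * (2 * k + 2))) ≤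
          k * (400000 * ((J + 1) * k)) := by
        have : (2 * k + 2) * (2 * k + 2) ≤ (4 * k) * (4 * k) :=
          Nat.mul_le_mul (by omega) (by omega)
        calc (J + 1) * (25000 * ((2 * k + 2) * (2 * k + 2)))
            ≤ (J + 1) * (25000 * ((4 * k) * (4 * k))) := by gcongr
          _ = k * (400000 * ((J + 1) * k)) := by ring
      have hkc : k = c + 1 := by omega
      have e3 : k * (400000 * ((J + 1) * k)) =
          c * (400000 * ((J + 1) * k)) + 400000 * ((J + 1) * k) := by
        nth_rw 1 [hkc]; ring
      simp only [Mem.potential, hv₅, ← hc]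
      simp
      omega
  · intro hb
    simp [hP₂.k_eq] at hb
    simp only [runs_skip]
    refine ⟨⟨hP₃, hpool₃ _ _ hpool₂, ?_, by simpa using hb, ?_, ?_⟩, ?_⟩
    · simpa using hG₃
    · simpa using h4₂
    · intro j hj
      rw [hv₃, hun₂ j hj]
      exact h.unused j hj
    · simp only [Mem.potential, hv₃, ← hc]
      simp
      rw [Nat.add_mul]
      omega

theorem feed_spec (hlab : ∀ x, lab x < m) (hg : Grid ε J) (s : List X) :
    ∀ {σ : Mem X} {A : Set X} {n : ℕ}, s.Nodup → (∀ x ∈ s, x ∉ A) → σ.Stream lab A k m ε J n →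
    ∃ t σ', Feed lab stepCmd s σ t σ' ∧ σ'.Stream lab (A ∪ {x | x ∈ s}) k m ε J (n + s.length) ∧
      t + σ'.potential k J ≤ σ.potential k J + s.length * (500000 * ((J + 1) * k)) := by
  induction s with
  | nil =>
    intro σ A n _ _ h
    exact ⟨0, σ, .nil σ, by simpa using h, by simp⟩
  | cons x s ih =>
    intro σ A n hs hA h
    obtain ⟨t, σ', he, h', ht⟩ := stepCmd_spec hlab hg h (hA x (by simp))
    obtain ⟨t', σ'', hf, h'', ht'⟩ := ih (List.nodup_cons.1 hs).2 (A := insert x A) (by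
      rintro y hy (rfl | hyA)
      · exact (List.nodup_cons.1 hs).1 hy
      · exact hA y (by simp [hy]) hyA) h'
    refine ⟨_, σ'', .cons x s _ _ _ _ _ he hf, ?_, ?_⟩
    · convert h'' using 1
      · ext y; simp; tauto
      · simp; omega
    · rw [List.length_cons, Nat.add_mul, Nat.one_mul]
      omega

/-- The number of guesses, up to a constant factor. -/
theorem exists_grid {ε : ℝ} (h0 : 0 < ε) (h1 : ε ≤ 1 / 2) : ∃ J, Grid ε J ∧
    (∀ j < J, ε * (1 + ε) ^ j < 1) ∧ (J + 1 : ℝ) ≤ 4 * (Real.log (1 / ε) / ε) := by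
  have hex : ∃ J, 1 ≤ ε * (1 + ε) ^ J := by
    obtain ⟨J, hJ⟩ := pow_unbounded_of_one_lt (1 / ε) (show 1 < 1 + ε by linarith)
    refine ⟨J, ?_⟩
    rw [div_lt_iff₀ h0] at hJ
    linarith
  have hmin : ∀ j < Nat.find hex, ε * (1 + ε) ^ j < 1 := fun j hj => not_le.1 (Nat.find_min hex hj)
  refine ⟨Nat.find hex, ⟨h0, h1, Nat.find_spec hex⟩, hmin, ?_⟩
  obtain ⟨J, hJ⟩ : ∃ J, J = Nat.find hex := ⟨_, rfl⟩
  rw [← hJ] at hmin ⊢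
  have hlog2 : 1 / 2 ≤ Real.log (1 / ε) := by
    have h2 : Real.log 2 ≤ Real.log (1 / ε) := by
      apply Real.log_le_log (by norm_num)
      rw [le_div_iff₀ h0]; linarith
    have := Real.log_two_gt_d9
    linarith
  have hdiv : 1 ≤ Real.log (1 / ε) / ε := by rw [le_div_iff₀ h0]; linarith
  rcases Nat.eq_zero_or_pos J with rfl | hpos
  · push_cast; linarith
  have h2 := hmin (J - 1) (by omega)
  have h3 : (1 + ε) ^ (J - 1) ≤ 1 / ε := by rw [le_div_iff₀ h0]; linarith
  have h4 : ((J - 1 : ℕ) : ℝ) * Real.log (1 + ε) ≤ Real.log (1 / ε) := by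
    rw [← Real.log_pow]
    exact Real.log_le_log (by positivity) h3
  -- From `log (1 + ε) ≥ ε / (1 + ε)` and `1 + ε ≤ 3 / 2`. By minimality `(1 + ε) ^ (J - 1) < 1 /
  -- ε`, so `J - 1` is at most `3 / 2` of the desired quotient, and that quotient is at least `1`.
  have h5 : 2 / 3 * ε ≤ Real.log (1 + ε) := by
    refine le_trans ?_ (Real.one_sub_inv_le_log_of_pos (by linarith))
    have h6 : 0 < 1 + ε := by linarith
    have : 1 - (1 + ε)⁻¹ = ε / (1 + ε) := by field_simp; ring
    rw [this, le_div_iff₀ h6]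
    nlinarith
  have h7 : ((J - 1 : ℕ) : ℝ) * (2 / 3 * ε) ≤ Real.log (1 / ε) :=
    (mul_le_mul_of_nonneg_left h5 (Nat.cast_nonneg _)).trans h4
  have h8 : ((J - 1 : ℕ) : ℝ) * (2 / 3) ≤ Real.log (1 / ε) / ε := by
    rw [le_div_iff₀ h0]; linarith
  have h9 : ((J - 1 : ℕ) : ℝ) = J - 1 := by rw [Nat.cast_sub hpos]; simp
  rw [h9] at h8
  linarith

theorem initCmd_spec (hg : Grid ε J) (hmin : ∀ j < J, ε * (1 + ε) ^ j < 1) (hk : 1 ≤ k)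
    {l u : Fin m → ℕ} :
    Runs lab initCmd (initialMem X k m l u ε) fun t σ' => t ≤ (J + 1) * 100 ∧
      σ'.Stream lab ∅ k m ε J 0 ∧ σ'.potential k J = 0 := by
  set σ₀ := initialMem X k m l u ε with hσ₀
  rw [initCmd, runs_seq, runs_setReal]
  refine (Runs.loop (Q := fun σ' => Frame [3] [1] [] σ₀ σ' ∧ σ'.nat (3, 0, 0, 0) = J ∧
      σ'.real (1, 0, 0, 0) = (1 + ε) ^ J) (B := (J + 1) * 50)
    (fun B σ' => ∃ j ≤ J, Frame [3] [1] [] σ₀ σ' ∧ σ'.nat (3, 0, 0, 0) = j ∧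
      σ'.real (1, 0, 0, 0) = (1 + ε) ^ j ∧ B = (J - j + 1) * 50) ?_ ?_ ?_).mono ?_
  · rintro B σ' ⟨j, hj, hF, h3, h1, rfl⟩ hb
    have h0 : σ'.real (0, 0, 0, 0) = ε := (hF.real 0 _ (by decide)).trans (by simp [hσ₀, initialMem])
    simp [h0, h1] at hb
    have : j = J := by
      by_contra hne
      have := hmin j (by omega)
      linarith
    subst this
    exact ⟨by simp, hF, h3, h1⟩
  · rintro B σ' ⟨j, hj, hF, h3, h1, rfl⟩ hb
    have h0 : σ'.real (0, 0, 0, 0) = ε := (hF.real 0 _ (by decide)).trans (by simp [hσ₀, initialMem])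
    simp [h0, h1] at hb
    have hjJ : j ≠ J := by
      rintro rfl
      have := hg.one_le
      linarith
    simp only [runs_seq, runs_setReal, inc, runs_setNat]
    refine ⟨(J - (j + 1) + 1) * 50, ?_, j + 1, by omega, (hF.trans (N' := [3]) (R' := [1]) (P' := [])
      ?_).mono (by simp) (by simp) (by simp), by simp [h3], by simp [h0, h1, pow_succ], rfl⟩
    · simp
      omega
    · constructor <;> intro a x ha <;> simp at ha <;> simp [ha]
  · refine ⟨0, Nat.zero_le _, ?_, by simp [hσ₀, initialMem], by simp, by simp⟩
    constructor <;> intro a x ha <;> simp at ha <;> simp [ha]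
  · rintro t σ' ⟨ht, hF, h3, h1⟩
    have hn : ∀ a i, 4 ≤ a → σ'.nat (a, i) = 0 := by
      intro a i ha
      rw [hF.nat a i (by simp; omega)]
      obtain ⟨i1, i2, i3⟩ := i
      rcases a with _ | _ | _ | a
      all_goals first | omega | rfl
    have hp : ∀ a, σ'.pt a = none := fun a => hF.pt a.1 a.2 (by simp)
    have hr : ∀ i, σ'.real (2, i) = 0 := by
      intro i
      rw [hF.real 2 i (by simp)]
      simp [hσ₀, initialMem]
    have hview : ∀ j, σ'.view j = ⟨0, 0, fun _ => none, fun _ => 0, fun _ _ => 0, fun _ _ => 0,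
        fun _ _ => none⟩ := by
      intro j
      simp [Mem.view, hn, hp, hr]
    refine ⟨?_, ⟨⟨?_, h3, ?_, h1⟩, ?_, ?_, ?_, ?_, ?_⟩, ?_⟩
    · simp
      omega
    · rw [hF.nat 0 _ (by simp)]; rfl
    · rw [hF.real 0 _ (by simp)]; simp [hσ₀, initialMem]
    · constructor <;> simp [hn, hp]
    · constructor
      -- Before the stream all guesses are `0`, which is the lattice with base `0`. The first reset
      -- makes the base positive; multiplication by `R` could not.
      · refine ⟨0, fun j _ => ?_⟩
        rw [hview]
        refine ⟨⟨by simp, by simp, by simp, by simp, by simp, by simp⟩, ⟨by simp, by simp⟩, le_rfl,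
          le_rfl, fun D hD _ => hD, 0, by simp, Or.inl rfl⟩
      · simp [hview]
      · simp [hview]
      · simp [hview, ClassView.weight]
    · rw [hn 7 _ (by norm_num)]; exact hk
    · rw [hn 4 _ (by norm_num)]
    · intro j _
      rw [hview]
      exact ⟨by simp, by simp⟩
    · simp [Mem.potential, hn, hview, ClassView.weight]
end
end FairStream

namespace FairStream

/-! ### Assignments of clusters to groups -/

/-- The number of indices `v < w` that are assigned to the group `g`. -/
def mcount (f : ℕ → ℕ) (w g : ℕ) : ℕ := ((Finset.range w).filter fun v => f v = g).card

/-- The number of assignments beyond the lower bounds. -/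
def surplus (l : ℕ → ℕ) (m : ℕ) (f : ℕ → ℕ) (w : ℕ) : ℕ :=
  ∑ g ∈ Finset.range m, (mcount f w g - l g)

/-- An assignment `f` of the clusters `v < w` to the groups in `N v` that can be completed to a fair
solution. -/
structure Assign (N : ℕ → ℕ → Prop) (l u : ℕ → ℕ) (k m w : ℕ) (f : ℕ → ℕ) : Prop where
  nbr : ∀ v < w, N v (f v)
  le_u : ∀ g, mcount f w g ≤ u g
  sur_le : surplus l m f w + ∑ g ∈ Finset.range m, l g ≤ k

/-- One more cluster can be assigned to the group `g`. -/
def CanAdd (l u : ℕ → ℕ) (k m : ℕ) (f : ℕ → ℕ) (w g : ℕ) : Prop :=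
  mcount f w g < l g ∨
    (mcount f w g < u g ∧ surplus l m f w + ∑ g ∈ Finset.range m, l g < k)

theorem mcount_succ (f : ℕ → ℕ) (w g : ℕ) :
    mcount f (w + 1) g = mcount f w g + if f w = g then 1 else 0 := by
  unfold mcount
  rw [Finset.range_add_one, Finset.filter_insert]
  split_ifs with h
  · rw [Finset.card_insert_of_notMem (by simp)]
  · rfl

theorem mcount_congr {f f' : ℕ → ℕ} {w : ℕ} (h : ∀ v < w, f v = f' v) (g : ℕ) :
    mcount f w g = mcount f' w g := by
  unfold mcount
  congr 1
  exact Finset.filter_congr fun v hv => by rw [h v (Finset.mem_range.1 hv)]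

theorem card_filter_eq_sum_mcount {f : ℕ → ℕ} {w m : ℕ} (hf : ∀ v < w, f v < m) (P : ℕ → Prop)
    [DecidablePred P] : ((Finset.range w).filter fun v => P (f v)).card =
      ∑ g ∈ Finset.range m, if P g then mcount f w g else 0 := by
  rw [Finset.card_eq_sum_card_fiberwise (f := f) (t := Finset.range m)]
  · refine Finset.sum_congr rfl fun g _ => ?_
    unfold mcount
    rw [Finset.filter_filter]
    split_ifs with h
    · congr 1
      refine Finset.filter_congr fun v _ => ?_
      constructor
      · exact fun h => h.2
      · rintro rfl; exact ⟨h, rfl⟩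
    · rw [Finset.card_eq_zero, Finset.filter_eq_empty_iff]
      rintro v _ ⟨h1, rfl⟩
      exact h h1
  · intro v hv
    simp only [Finset.coe_filter, Set.mem_ofPred_eq, Finset.mem_range] at hv
    simpa using hf v hv.1

theorem sum_mcount {f : ℕ → ℕ} {w m : ℕ} (hf : ∀ v < w, f v < m) :
    ∑ g ∈ Finset.range m, mcount f w g = w := by
  have := card_filter_eq_sum_mcount hf (fun _ => True)
  simpa using this.symm

/-- Changing the value at one index. -/
theorem mcount_update {f : ℕ → ℕ} {w v : ℕ} (hv : v < w) (i g : ℕ) :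
    mcount (fun x => if x = v then i else f x) w g + (if f v = g then 1 else 0) =
      mcount f w g + if i = g then 1 else 0 := by
  induction w with
  | zero => omega
  | succ w ih =>
    rw [mcount_succ, mcount_succ]
    by_cases hvw : v = w
    · subst hvw
      rw [mcount_congr (f' := f) fun x hx => if_neg hx.ne]
      simp only [if_true]
      omega
    · have := ih (by omega)
      rw [if_neg (Ne.symm hvw)]
      omega

/-- The criterion for the absence of an assignment of the first `t` clusters: `Z` is the set of
clusters and `Vis` the set of groups reached from the cluster `w`. -/
theorem Assign.not_assign {N : ℕ → ℕ → Prop} {l u : ℕ → ℕ} {k m w t : ℕ} {f f' : ℕ → ℕ}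
    (h : Assign N l u k m w f) (hN : ∀ v g, N v g → g < m) (hwt : w < t)
    {Vis Z : ℕ → Prop} (hw : Z w)
    (hV : ∀ v g, Z v → N v g → Vis g) (hc : ∀ v < w, Vis (f v) → Z v)
    (hs : ∀ g, Vis g → ¬ CanAdd l u k m f w g)
    (hsur : k ≤ surplus l m f w + ∑ g ∈ Finset.range m, l g →
      ∀ v < w, l (f v) < mcount f w (f v) → Z v) :
    ¬ Assign N l u k m t f' := by
  classical
  intro h'
  have hfm : ∀ v < w, f v < m := fun v hv => hN _ _ (h.nbr v hv)
  have hfm' : ∀ v < t, f' v < m := fun v hv => hN _ _ (h'.nbr v hv)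
  -- The assignment `f'` has to place all reached clusters in visited groups.
  have hupper : ((Finset.range (w + 1)).filter Z).card ≤
      ∑ g ∈ Finset.range m, if Vis g then mcount f' t g else 0 := by
    rw [← card_filter_eq_sum_mcount hfm']
    refine Finset.card_le_card fun v hv => ?_
    simp only [Finset.mem_filter, Finset.mem_range] at hv ⊢
    exact ⟨by omega, hV v _ hv.2 (h'.nbr v (by omega))⟩
  have hlower : ((Finset.range w).filter Z).card + 1 ≤ ((Finset.range (w + 1)).filter Z).card := by
    rw [Finset.range_add_one, Finset.filter_insert, if_pos hw,
      Finset.card_insert_of_notMem (by simp)]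
  -- If the total leaves room, every visited group is filled to its upper bound by `f`. The clusters
  -- of these groups are reached, and the cluster `w` is one too many for `f'`.
  rcases lt_or_ge (surplus l m f w + ∑ g ∈ Finset.range m, l g) k with hk | hk
  · have h1 : ((Finset.range w).filter fun v => Vis (f v)).card ≤
        ((Finset.range w).filter Z).card := by
      refine Finset.card_le_card fun v hv => ?_
      simp only [Finset.mem_filter, Finset.mem_range] at hv ⊢
      exact ⟨hv.1, hc v hv.1 hv.2⟩
    rw [card_filter_eq_sum_mcount hfm Vis] at h1
    have h2 : (∑ g ∈ Finset.range m, if Vis g then mcount f' t g else 0) ≤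
        ∑ g ∈ Finset.range m, if Vis g then mcount f w g else 0 := by
      refine Finset.sum_le_sum fun g _ => ?_
      split_ifs with hg
      · have := hs g hg
        unfold CanAdd at this
        push Not at this
        by_contra hcon
        have h3 := this.2 ((not_le.1 hcon).trans_le (h'.le_u g))
        omega
      · exact le_rfl
    omega
  -- If the total is exhausted, the clusters of groups above their lower bounds are reached too.
  -- Then the reached clusters outnumber the lower bounds of the visited groups by more than the
  -- surplus of `f`, so `f'` would have a larger surplus than the total allows.
  · have h1 : ((Finset.range w).filter fun v => Vis (f v) ∨ l (f v) < mcount f w (f v)).card ≤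
        ((Finset.range w).filter Z).card := by
      refine Finset.card_le_card fun v hv => ?_
      simp only [Finset.mem_filter, Finset.mem_range] at hv ⊢
      exact ⟨hv.1, hv.2.elim (hc v hv.1) (hsur hk v hv.1)⟩
    rw [card_filter_eq_sum_mcount hfm (fun g => Vis g ∨ l g < mcount f w g)] at h1
    have h2 : (∑ g ∈ Finset.range m, if Vis g then l g else 0) + surplus l m f w ≤
        ∑ g ∈ Finset.range m, if Vis g ∨ l g < mcount f w g then mcount f w g else 0 := by
      unfold surplus
      rw [← Finset.sum_add_distrib]
      refine Finset.sum_le_sum fun g _ => ?_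
      by_cases hg : Vis g
      · have := hs g hg
        unfold CanAdd at this
        push Not at this
        simp only [hg, true_or, if_true]
        omega
      · simp only [hg, false_or, if_false]
        split_ifs <;> omega
    have h3 : (∑ g ∈ Finset.range m, if Vis g then mcount f' t g else 0) ≤
        (∑ g ∈ Finset.range m, if Vis g then l g else 0) + surplus l m f' t := by
      unfold surplus
      rw [← Finset.sum_add_distrib]
      refine Finset.sum_le_sum fun g _ => ?_
      split_ifs <;> omega
    have := h'.sur_le
    omega

section
variable {N : ℕ → ℕ → Prop} {l u : ℕ → ℕ} {k m w g₀ : ℕ} {f f' : ℕ → ℕ}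

/-- Along an augmenting path only the count of its end `g₀` changes. If that count was below the
lower bound, the surplus stays the same; otherwise it grows by one, for which `CanAdd` provides
room. -/
theorem Assign.extend (h : Assign N l u k m w f) (hg : CanAdd l u k m f w g₀)
    (hlu : ∀ g, l g ≤ u g) (hnbr : ∀ v < w + 1, N v (f' v)) (hm : g₀ < m)
    (hc : ∀ g, mcount f' (w + 1) g = mcount f w g + if g₀ = g then 1 else 0) :
    Assign N l u k m (w + 1) f' ∧ surplus l m f' (w + 1) ≤ surplus l m f w + 1 := by
  have hsur : surplus l m f' (w + 1) ≤ surplus l m f w + if l g₀ ≤ mcount f w g₀ then 1 else 0 := by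
    have : (if l g₀ ≤ mcount f w g₀ then 1 else 0) = ∑ g ∈ Finset.range m,
        if g = g₀ then (if l g₀ ≤ mcount f w g₀ then 1 else 0) else 0 := by
      rw [Finset.sum_ite_eq', if_pos (Finset.mem_range.2 hm)]
    rw [this]
    unfold surplus
    rw [← Finset.sum_add_distrib]
    refine Finset.sum_le_sum fun g _ => ?_
    rw [hc]
    by_cases h1 : g = g₀
    · subst h1
      simp only [if_true]
      split_ifs <;> omega
    · rw [if_neg (Ne.symm h1), if_neg h1]; omega
  refine ⟨⟨hnbr, fun g => ?_, ?_⟩, hsur.trans (by split_ifs <;> omega)⟩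
  · rw [hc]
    have h1 := h.le_u g
    have h2 := hlu g
    split_ifs with h3
    · subst h3
      rcases hg with hg | hg <;> omega
    · exact h1
  · have h1 := h.sur_le
    split_ifs at hsur with h2
    · rcases hg with hg | hg
      · omega
      · omega
    · omega

/-- When the total is exhausted, a group that can still take a cluster is below its lower bound.
Shifting a unit to it from a group above its lower bound frees a unit of the total, and the next
search has more freedom. -/
theorem Assign.reroute (h : Assign N l u k m w f) (hg : CanAdd l u k m f w g₀)
    (hlu : ∀ g, l g ≤ u g) (hnbr : ∀ v < w, N v (f' v)) {g₁ : ℕ} (hm : g₁ < m)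
    (hl : l g₁ < mcount f w g₁) (hk : k ≤ surplus l m f w + ∑ g ∈ Finset.range m, l g)
    (hc : ∀ g, mcount f' w g + (if g₁ = g then 1 else 0) =
      mcount f w g + if g₀ = g then 1 else 0) :
    Assign N l u k m w f' ∧ surplus l m f' w < surplus l m f w := by
  have hg' : mcount f w g₀ < l g₀ := by
    rcases hg with hg | hg
    · exact hg
    · omega
  have hsur : surplus l m f' w + 1 ≤ surplus l m f w := by
    have : 1 = ∑ g ∈ Finset.range m, if g = g₁ then 1 else 0 := by
      rw [Finset.sum_ite_eq', if_pos (Finset.mem_range.2 hm)]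
    rw [this]
    unfold surplus
    rw [← Finset.sum_add_distrib]
    refine Finset.sum_le_sum fun g _ => ?_
    have := hc g
    by_cases h1 : g = g₁
    · subst h1
      rw [if_pos rfl] at this ⊢
      split_ifs at this with h2
      · subst h2; omega
      · omega
    · rw [if_neg (Ne.symm h1)] at this
      rw [if_neg h1]
      split_ifs at this with h2
      · subst h2; omega
      · omega
  refine ⟨⟨hnbr, fun g => ?_, ?_⟩, hsur⟩
  · have h1 := h.le_u g
    have h2 := hlu g
    have := hc g
    split_ifs at this with h3 h4 h4
    all_goals try subst h3
    all_goals try subst h4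
    all_goals omega
  · have := h.sur_le
    omega
end
end FairStream

namespace FairStream

/-! ### The clusters of a prefix of the traversal -/

/-- Lists, for each of the first `t = nat 23` centers of the traversal, the groups that have a
representative in its cluster. -/
def buildCmd : Cmd :=
  block [.setNat (rf0 36) (.const 0), forUp 36 (nv 23) (.setNat (rf1 28 (nv 36)) (.const 0)),
    .setNat (rf0 55) (.const 0),
    forUp 55 (nv 22) (block [.setNat (rf0 36) (n2 21 (nv 23) (nv 55)),
      .ite (.realLe (.dist (rf2 2 (nv 12) (nv 55)) (rf2 2 (nv 12) (n1 20 (nv 36))))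
          (.load (rf0 5)))
        (block [.setNat (rf0 56) (.const 0),
          forUp 56 (n2 9 (nv 12) (nv 55)) (block
            [.setNat (rf0 54) (n3 10 (nv 12) (nv 55) (nv 56)),
              .setNat (rf2 30 (nv 36) (n1 28 (nv 36))) (nv 54),
              .setPoint (rf2 5 (nv 36) (nv 54)) (rf3 3 (nv 12) (nv 55) (nv 54)),
              .setNat (rf1 28 (nv 36)) (.add (n1 28 (nv 36)) (.const 1))])]) .skip])]

/-- The pivot `q` belongs to the cluster of the `v`-th center, among the first `t` centers. -/
def InCluster {X : Type*} [MetricSpace X] (V : ClassView X) (ord : ℕ → ℕ) (near : ℕ → ℕ → ℕ)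
    (β : ℝ) (t v q : ℕ) : Prop :=
  q < V.cnt ∧ near t q = v ∧ cellDist (V.piv q) (V.piv (ord v)) ≤ β

/-- The group `g` has a representative in the cluster of the `v`-th center. -/
def Nbr {X : Type*} [MetricSpace X] (V : ClassView X) (ord : ℕ → ℕ) (near : ℕ → ℕ → ℕ)
    (β : ℝ) (t v g : ℕ) : Prop :=
  ∃ q p, InCluster V ord near β t v q ∧ p < V.len q ∧ V.lst q p = g

/-- The lists of groups have been computed for the representatives in `D`, of which there are `n`. -/
structure Mem.Built {X : Type*} [MetricSpace X] (σ : Mem X) (V : ClassView X) (ord : ℕ → ℕ)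
    (near : ℕ → ℕ → ℕ) (β : ℝ) (t : ℕ) (D : ℕ → ℕ → Prop) (n : ℕ) : Prop where
  lists : ∀ v < t, ∀ g, (∃ e < σ.nat (28, v, 0, 0), σ.nat (30, v, e, 0) = g) ↔
    ∃ q p, InCluster V ord near β t v q ∧ p < V.len q ∧ V.lst q p = g ∧ D q p
  points : ∀ v < t, ∀ q p, InCluster V ord near β t v q → p < V.len q → D q p →
    ∃ q' p', InCluster V ord near β t v q' ∧ p' < V.len q' ∧ V.lst q' p' = V.lst q p ∧
      σ.pt (5, v, V.lst q p, 0) = V.rep q' (V.lst q p)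
  sum_le : ∑ v ∈ Finset.range t, σ.nat (28, v, 0, 0) ≤ n

section
variable {X : Type*} {σ σ' : Mem X} {N R P : List ℕ} {a : ℕ}

theorem Frame.setNat (h : Frame N R P σ σ') (ha : a ∈ N) (i : ℕ × ℕ × ℕ) (v : ℕ) :
    Frame N R P σ (σ'.setNat (a, i) v) := by
  refine ⟨fun b j hb => ?_, h.real, h.pt⟩
  have : b ≠ a := fun h => hb (h ▸ ha)
  simpa [this] using h.nat b j hb

theorem Frame.setReal (h : Frame N R P σ σ') (ha : a ∈ R) (i : ℕ × ℕ × ℕ) (v : ℝ) :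
    Frame N R P σ (σ'.setReal (a, i) v) := by
  refine ⟨h.nat, fun b j hb => ?_, h.pt⟩
  have : b ≠ a := fun h => hb (h ▸ ha)
  simpa [this] using h.real b j hb

theorem Frame.setPoint (h : Frame N R P σ σ') (ha : a ∈ P) (i : ℕ × ℕ × ℕ) (x : X) :
    Frame N R P σ (σ'.setPoint (a, i) x) := by
  refine ⟨h.nat, h.real, fun b j hb => ?_⟩
  have : b ≠ a := fun h => hb (h ▸ ha)
  simpa [this] using h.pt b j hb

end

section
variable {X : Type*} [MetricSpace X] {lab : X → ℕ} {σ : Mem X} {S pre : Set X} {α β : ℝ}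
  {m t T : ℕ} {ord : ℕ → ℕ} {near : ℕ → ℕ → ℕ} {V : ClassView X}

theorem Mem.Built.congr {D D' : ℕ → ℕ → Prop} {n n' : ℕ} (h : σ.Built V ord near β t D n)
    (hD : ∀ v q p, v < t → InCluster V ord near β t v q → p < V.len q → (D q p ↔ D' q p))
    (hn : n ≤ n') : σ.Built V ord near β t D' n' := by
  refine ⟨fun v hv g => ?_, fun v hv q p hq hp hD' => ?_, h.sum_le.trans hn⟩
  · rw [h.lists v hv g]
    constructor
    · rintro ⟨q, p, h1, h2, h3, h4⟩
      exact ⟨q, p, h1, h2, h3, (hD v q p hv h1 h2).1 h4⟩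
    · rintro ⟨q, p, h1, h2, h3, h4⟩
      exact ⟨q, p, h1, h2, h3, (hD v q p hv h1 h2).2 h4⟩
  · exact h.points v hv q p hq hp ((hD v q p hv hq hp).2 hD')

theorem Mem.Built.of_eq {σ' : Mem X} {D : ℕ → ℕ → Prop} {n : ℕ} (h : σ.Built V ord near β t D n)
    (h28 : ∀ x, σ'.nat (28, x) = σ.nat (28, x)) (h30 : ∀ x, σ'.nat (30, x) = σ.nat (30, x))
    (h5 : ∀ x, σ'.pt (5, x) = σ.pt (5, x)) : σ'.Built V ord near β t D n := by
  constructor <;> simp only [h28, h30, h5]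
  exacts [h.1, h.2, h.3]

/-- Adding one representative to the lists. -/
theorem Mem.Built.add {σ' : Mem X} {D : ℕ → ℕ → Prop} {n v q p : ℕ}
    (h : σ.Built V ord near β t D n) (hv : v < t) (hq : InCluster V ord near β t v q)
    (hp : p < V.len q)
    (h28 : ∀ x, σ'.nat (28, x, 0, 0) = if x = v then σ.nat (28, v, 0, 0) + 1 else
      σ.nat (28, x, 0, 0))
    (h30 : ∀ x e, σ'.nat (30, x, e, 0) = if x = v ∧ e = σ.nat (28, v, 0, 0) then V.lst q p else
      σ.nat (30, x, e, 0))
    (h5 : ∀ x g, σ'.pt (5, x, g, 0) = if x = v ∧ g = V.lst q p then V.rep q (V.lst q p) else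
      σ.pt (5, x, g, 0)) :
    σ'.Built V ord near β t (fun a b => D a b ∨ (a = q ∧ b = p)) (n + 1) := by
  constructor
  · intro x hx g
    rw [h28]
    by_cases hxv : x = v
    · subst hxv
      rw [if_pos rfl]
      constructor
      · rintro ⟨e, he, hg⟩
        rw [h30] at hg
        by_cases he' : e = σ.nat (28, x, 0, 0)
        · rw [if_pos ⟨rfl, he'⟩] at hg
          exact ⟨q, p, hq, hp, hg, Or.inr ⟨rfl, rfl⟩⟩
        · rw [if_neg (by tauto)] at hg
          obtain ⟨a, b, h1, h2, h3, h4⟩ := (h.lists x hx g).1 ⟨e, by omega, hg⟩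
          exact ⟨a, b, h1, h2, h3, Or.inl h4⟩
      · rintro ⟨a, b, h1, h2, h3, h4 | ⟨rfl, rfl⟩⟩
        · obtain ⟨e, he, hg⟩ := (h.lists x hx g).2 ⟨a, b, h1, h2, h3, h4⟩
          exact ⟨e, by omega, by rw [h30, if_neg (by omega), hg]⟩
        · exact ⟨σ.nat (28, x, 0, 0), by omega, by rw [h30, if_pos ⟨rfl, rfl⟩, h3]⟩
    · rw [if_neg hxv]
      constructor
      · rintro ⟨e, he, hg⟩
        rw [h30, if_neg (by tauto)] at hg
        obtain ⟨a, b, h1, h2, h3, h4⟩ := (h.lists x hx g).1 ⟨e, he, hg⟩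
        exact ⟨a, b, h1, h2, h3, Or.inl h4⟩
      · rintro ⟨a, b, h1, h2, h3, h4 | ⟨rfl, rfl⟩⟩
        · obtain ⟨e, he, hg⟩ := (h.lists x hx g).2 ⟨a, b, h1, h2, h3, h4⟩
          exact ⟨e, he, by rw [h30, if_neg (by tauto), hg]⟩
        · exact absurd (h1.2.1.symm.trans hq.2.1) hxv
  · intro x hx a b h1 h2 h3
    by_cases hc : x = v ∧ V.lst a b = V.lst q p
    · refine ⟨q, p, by rw [hc.1]; exact hq, hp, hc.2.symm, ?_⟩
      rw [h5, if_pos hc, hc.2]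
    · rcases h3 with h3 | ⟨rfl, rfl⟩
      · obtain ⟨a', b', h4, h5', h6, h7⟩ := h.points x hx a b h1 h2 h3
        exact ⟨a', b', h4, h5', h6, by rw [h5, if_neg hc, h7]⟩
      · exact absurd ⟨h1.2.1.symm.trans hq.2.1, rfl⟩ hc
  · have : ∑ x ∈ Finset.range t, σ'.nat (28, x, 0, 0) =
        ∑ x ∈ Finset.range t, σ.nat (28, x, 0, 0) + 1 := by
      have h1 : 1 = ∑ x ∈ Finset.range t, if x = v then 1 else 0 := by
        rw [Finset.sum_ite_eq', if_pos (Finset.mem_range.2 hv)]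
      rw [h1, ← Finset.sum_add_distrib]
      refine Finset.sum_congr rfl fun x _ => ?_
      rw [h28]
      split_ifs with hx
      · rw [hx]
      · rfl
    rw [this]
    exact Nat.succ_le_succ h.sum_le

/-- Each list entry of each pivot is treated once, so the time is linear in the size of the summary.
A group may occur several times in the list of a cluster; the cell for the pair of cluster and group
then keeps the last representative, and any one of them would do. -/
theorem buildCmd_spec (hlab : ∀ x, lab x < m) (hV : σ.view (σ.nat (12, 0, 0, 0)) = V)
    (h : ClassInv lab S pre α V) (hG : Gonz V.piv T ord near (fun s => σ.real (4, s, 0, 0)) (T + 1))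
    (hord : ∀ c, σ.nat (20, c, 0, 0) = ord c) (hnear : ∀ s q, σ.nat (21, s, q, 0) = near s q)
    (hT : V.cnt = T) (h22 : σ.nat (22, 0, 0, 0) = T) (h23 : σ.nat (23, 0, 0, 0) = t)
    (h1t : 1 ≤ t) (htT : t ≤ T) (hβ : σ.real (5, 0, 0, 0) = β) :
    Runs lab buildCmd σ fun t' σ' =>
      t' ≤ 300 * (T + t + ∑ q ∈ Finset.range T, V.len q + 2) ∧
      σ'.Built V ord near β t (fun _ _ => True) (∑ q ∈ Finset.range T, V.len q) ∧
      ∀ v g, σ'.pt (5, v, g, 0) ≠ none → σ.pt (5, v, g, 0) ≠ none ∨ (v < T ∧ g < m) := by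
  set jj := σ.nat (12, 0, 0, 0) with hjj
  have hlen : ∀ q, σ.nat (9, jj, q, 0) = V.len q := by rw [← hV]; intro; rfl
  have hlst : ∀ q p, σ.nat (10, jj, q, p) = V.lst q p := by rw [← hV]; intro _ _; rfl
  have hpiv : ∀ q, σ.pt (2, jj, q, 0) = V.piv q := by rw [← hV]; intro; rfl
  have hrep : ∀ q g, σ.pt (3, jj, q, g) = V.rep q g := by rw [← hV]; intro _ _; rfl
  simp only [buildCmd, block_cons, block_singleton, runs_seq, runs_setNat]
  refine (Runs.forUp t 30 (fun i σ' => Frame [28, 36] [] [] σ σ' ∧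
    ∀ v < i, σ'.nat (28, v, 0, 0) = 0) (by decide) ?_ ?_ ?_ ?_).mono ?_
  · rintro i σ' ⟨hF, -⟩
    rw [nv_eval, hF.nat 23 _ (by decide), h23]
  · rintro i σ' hi h36 ⟨hF, hz⟩
    simp only [runs_setNat]
    refine ⟨by simp, (hF.trans (N' := [28, 36]) (R' := []) (P' := []) ?_).mono (by simp) (by simp)
      (by simp), ?_⟩
    · constructor <;> intro a x ha <;> simp at ha <;> simp [ha]
    · intro v hv
      simp [h36]
      intro hvi
      exact hz v (by omega)
  · simp
  · refine ⟨?_, by simp⟩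
    constructor <;> intro a x ha <;> simp at ha <;> simp [ha]
  rintro t₁ σ₁ ⟨ht₁, -, hF₁, hz⟩
  refine (Runs.forUp_total T (fun i u σ' => Frame [28, 30, 36, 54, 55, 56] [] [5] σ σ' ∧
    σ'.Built V ord near β t (fun q _ => q < i) (∑ q ∈ Finset.range i, V.len q) ∧
    (∀ v g, σ'.pt (5, v, g, 0) ≠ none → σ.pt (5, v, g, 0) ≠ none ∨ (v < T ∧ g < m)) ∧
    u ≤ 200 * (i + ∑ q ∈ Finset.range i, V.len q)) (by decide) ?_ ?_ ?_ ?_).mono ?_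
  · rintro i u σ' ⟨hF, -⟩
    rw [nv_eval, hF.nat 22 _ (by decide), h22]
  · rintro q u σ₂ hq h55 ⟨hF, hB, hbox, hu⟩
    have e12 : σ₂.nat (12, 0, 0, 0) = jj := hF.nat 12 _ (by decide)
    have e23 : σ₂.nat (23, 0, 0, 0) = t := (hF.nat 23 _ (by decide)).trans h23
    have e21 : ∀ s q, σ₂.nat (21, s, q, 0) = near s q := fun s q =>
      (hF.nat 21 _ (by decide)).trans (hnear s q)
    have e20 : ∀ c, σ₂.nat (20, c, 0, 0) = ord c := fun c =>
      (hF.nat 20 _ (by decide)).trans (hord c)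
    have e9 : ∀ q, σ₂.nat (9, jj, q, 0) = V.len q := fun q => (hF.nat 9 _ (by decide)).trans (hlen q)
    have e2 : ∀ q, σ₂.pt (2, jj, q, 0) = V.piv q := fun q => (hF.pt 2 _ (by decide)).trans (hpiv q)
    have e5 : σ₂.real (5, 0, 0, 0) = β := (hF.real 5 _ (by decide)).trans hβ
    obtain ⟨v, hv⟩ : ∃ v, v = near t q := ⟨_, rfl⟩
    have hvt : v < t := hv ▸ hG.near_lt t h1t (by omega) q hq
    simp only [runs_seq, runs_setNat, rf0_addr, n2_eval, nv_eval, e23, h55, e21, ← hv]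
    have hFr : ∀ (σ' : Mem X) i, Frame [28, 30, 36, 54, 55, 56] [] [5] σ σ' →
        Frame [28, 30, 36, 54, 55, 56] [] [5] σ (σ'.setNat (55, 0, 0, 0) i) := by
      intro σ' i h
      refine (h.trans (N' := [55]) (R' := []) (P' := []) ?_).mono (by simp) (by simp) (by simp)
      constructor <;> intro a x ha <;> simp at ha <;> simp [ha]
    have hBt : ∀ (σ' : Mem X) i D n, σ'.Built V ord near β t D n →
        (σ'.setNat (55, 0, 0, 0) i).Built V ord near β t D n := by
      intro σ' i D n h
      exact h.of_eq (by simp) (by simp) (by simp)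
    have hF' : Frame [28, 30, 36, 54, 55, 56] [] [5] σ (σ₂.setNat (36, 0, 0, 0) v) := by
      refine (hF.trans (N' := [36]) (R' := []) (P' := []) ?_).mono (by simp) (by simp) (by simp)
      constructor <;> intro a x ha <;> simp at ha <;> simp [ha]
    have hB' : (σ₂.setNat (36, 0, 0, 0) v).Built V ord near β t (fun q' _ => q' < q)
        (∑ q ∈ Finset.range q, V.len q) := hB.of_eq (by simp) (by simp) (by simp)
    rw [runs_ite]
    constructor
    · intro hb
      simp [e12, h55, e2, e20, e5] at hb
      have hin : InCluster V ord near β t v q := ⟨by omega, hv.symm, hb⟩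
      simp only [runs_seq, runs_setNat]
      refine (Runs.forUp (V.len q) 100 (fun p σ' => Frame [28, 30, 36, 54, 55, 56] [] [5] σ σ' ∧
        σ'.nat (36, 0, 0, 0) = v ∧ σ'.nat (55, 0, 0, 0) = q ∧
        σ'.Built V ord near β t (fun a b => a < q ∨ (a = q ∧ b < p))
          (∑ q ∈ Finset.range q, V.len q + p) ∧
        (∀ v g, σ'.pt (5, v, g, 0) ≠ none → σ.pt (5, v, g, 0) ≠ none ∨ (v < T ∧ g < m)))
        (by decide) ?_ ?_ ?_ ?_).mono ?_
      · rintro p σ' ⟨hF, h36, h55, -⟩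
        rw [n2_eval, nv_eval, nv_eval, h55, hF.nat 12 _ (by decide), ← hjj, hF.nat 9 _ (by decide),
          hlen]
      · rintro p σ₃ hp h56 ⟨hF₃, h36, h55', hB₃, hbox₃⟩
        have f12 : σ₃.nat (12, 0, 0, 0) = jj := hF₃.nat 12 _ (by decide)
        have f10 : ∀ q p, σ₃.nat (10, jj, q, p) = V.lst q p := fun q p =>
          (hF₃.nat 10 _ (by decide)).trans (hlst q p)
        have f3 : ∀ q g, σ₃.pt (3, jj, q, g) = V.rep q g := fun q p =>
          (hF₃.pt 3 _ (by decide)).trans (hrep q p)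
        obtain ⟨y, -, hy, hyl, -⟩ := ThinInv.rep h q p hp
        simp only [runs_seq, runs_setNat, runs_setPoint]
        refine ⟨y, by simp [f12, h36, h55', h56, f10, f3, hy], by simp,
          (hF₃.trans (N' := [28, 30, 54, 56]) (R' := []) (P' := [5]) ?_).mono (by simp) (by simp)
          (by simp), by simp [h36], by simp [h55'], ?_, ?_⟩
        · constructor <;> intro a x ha <;> simp at ha <;> simp [ha]
        · refine (hB₃.add (q := q) (p := p) hvt hin hp ?_ ?_ ?_).congr ?_ (by omega)
          · simp [h36]
          · simp [h36, h55', h56, f12, f10]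
          · intro x g
            simp [h36, h55', h56, f12, f10]
            rw [hy]
          · intro v' a b _ _ _
            omega
        · intro x g hx
          simp [h36, h55', h56, f12, f10] at hx
          rw [← hyl] at hx
          by_cases hxg : x = v ∧ g = lab y
          · exact Or.inr ⟨by omega, hxg.2 ▸ hlab y⟩
          · rw [if_neg hxg] at hx
            exact hbox₃ x g hx
      · simp
      · refine ⟨(hF'.trans (N' := [56]) (R' := []) (P' := []) ?_).mono (by simp) (by simp) (by simp),
          by simp, by simp [h55], ?_, by simpa using hbox⟩
        · constructor <;> intro a x ha <;> simp at ha <;> simp [ha]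
        · exact (hB.of_eq (by simp) (by simp) (by simp)).congr (fun _ _ _ _ _ _ => by simp) le_rfl
      · rintro t₃ σ₃ ⟨ht₃, -, hF₃, -, -, hB₃, hbox₃⟩
        refine ⟨hFr _ _ hF₃, (hBt _ _ _ _ hB₃).congr ?_ (by rw [Finset.sum_range_succ]),
          by simpa using hbox₃, ?_⟩
        · intro v' a b _ _ hbl
          have : a = q → b < V.len q := by rintro rfl; exact hbl
          omega
        · rw [Finset.sum_range_succ]
          simp at ht₃ ⊢
          omega
    · intro hb
      simp [e12, h55, e2, e20, e5] at hb
      simp only [runs_skip]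
      refine ⟨hFr _ _ hF', (hBt _ _ _ _ hB').congr ?_ (by rw [Finset.sum_range_succ]; omega),
        by simpa using hbox, ?_⟩
      -- The pivot is farther than `β` from its center, so it belongs to no cluster and its entries
      -- are rightly skipped.
      · rintro v' a b - hc -
        have : a ≠ q := by
          rintro rfl
          have := hc.2.2
          rw [← hc.2.1, ← hv] at this
          linarith
        omega
      · rw [Finset.sum_range_succ]
        simp
        omega
  · simp
  · refine ⟨(hF₁.trans (N' := [55]) (R' := []) (P' := []) ?_).mono (by simp) (by simp) (by simp),
      ?_, fun v g hvg => Or.inl ?_, by simp⟩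
    · constructor <;> intro a x ha <;> simp at ha <;> simp [ha]
    · constructor
      · intro v hv g
        simp [hz v hv]
      · simp
      · simp
        exact hz
    · simpa [hF₁.pt 5 _ (by decide)] using hvg
  · rintro t₂ σ₂ ⟨u, ht₂, -, hF₂, hB₂, hbox₂, hu⟩
    refine ⟨?_, hB₂.congr ?_ le_rfl, hbox₂⟩
    · simp at ht₁ ht₂ ⊢
      omega
    · rintro v q p - hc -
      simpa using hT ▸ hc.1

/-! ### Loading an assignment -/

/-- Prepares the search: computes the inverse of the assignment `nat 35` of the first `nat 24`
clusters, the sizes `nat 26` of its fibers and the surplus `nat 33`. -/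
def loadCmd : Cmd :=
  block [.setNat (rf0 57) (.const 0),
    forUp 57 (nv 4) (.seq (.setNat (rf1 26 (n1 5 (nv 57))) (.const 0))
      (.setNat (rf1 27 (n1 5 (nv 57))) (.const 0))),
    .setNat (rf0 33) (.const 0), .setNat (rf0 36) (.const 0),
    forUp 36 (nv 24) (block [.setNat (rf1 29 (nv 36)) (.const 0),
      .setNat (rf0 54) (n1 35 (nv 36)),
      .setNat (rf2 34 (nv 54) (n1 26 (nv 54))) (nv 36),
      .ite (.natLe (n1 1 (nv 54)) (n1 26 (nv 54))) (inc 33) .skip,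
      .setNat (rf1 26 (nv 54)) (.add (n1 26 (nv 54)) (.const 1))]),
    .setNat (rf1 29 (nv 24)) (.const 0)]

/-- The group `g` has been seen in the stream. -/
def Mem.Seen {X : Type*} (σ : Mem X) (g : ℕ) : Prop :=
  ∃ i < σ.nat (4, 0, 0, 0), σ.nat (5, i, 0, 0) = g

structure Mem.Loaded {X : Type*} (σ : Mem X) (l : ℕ → ℕ) (m : ℕ) (mg : ℕ → ℕ) (w : ℕ) : Prop where
  size : ∀ g, σ.Seen g → σ.nat (26, g, 0, 0) = mcount mg w g
  sur : σ.nat (33, 0, 0, 0) = surplus l m mg w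
  fiber : ∀ g, σ.Seen g → ∀ z < mcount mg w g, σ.nat (34, g, z, 0) < w ∧ mg (σ.nat (34, g, z, 0)) = g
  fiber_surj : ∀ v < w, ∃ z < mcount mg w (mg v), σ.nat (34, mg v, z, 0) = v

theorem surplus_succ {l : ℕ → ℕ} {m : ℕ} {f : ℕ → ℕ} {w : ℕ} (hm : f w < m) :
    surplus l m f (w + 1) = surplus l m f w + if l (f w) ≤ mcount f w (f w) then 1 else 0 := by
  have : (if l (f w) ≤ mcount f w (f w) then 1 else 0) = ∑ g ∈ Finset.range m,
      if g = f w then (if l (f w) ≤ mcount f w (f w) then 1 else 0) else 0 := by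
    rw [Finset.sum_ite_eq', if_pos (Finset.mem_range.2 hm)]
  rw [this]
  unfold surplus
  rw [← Finset.sum_add_distrib]
  refine Finset.sum_congr rfl fun g _ => ?_
  rw [mcount_succ]
  by_cases h1 : g = f w
  · subst h1
    simp only [if_true]
    split_ifs <;> omega
  · rw [if_neg (Ne.symm h1), if_neg h1]
    omega

/-- Only the table entries of groups seen in the stream are reset, because the time must not depend
on `m`. Nothing is known about the other entries, hence the restriction to seen groups in
`Mem.Loaded`. -/
theorem loadCmd_spec {l : ℕ → ℕ} {mg : ℕ → ℕ} {w : ℕ} (h24 : σ.nat (24, 0, 0, 0) = w)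
    (h35 : ∀ v < w, σ.nat (35, v, 0, 0) = mg v) (hl : ∀ g, σ.nat (1, g, 0, 0) = l g)
    (hseen : ∀ v < w, σ.Seen (mg v)) (hm : ∀ v < w, mg v < m) :
    Runs lab loadCmd σ fun t' σ' => t' ≤ 300 * (σ.nat (4, 0, 0, 0) + w + 2) ∧
      σ'.Loaded l m mg w ∧ (∀ v ≤ w, σ'.nat (29, v, 0, 0) = 0) ∧
      ∀ g, σ.Seen g → σ'.nat (27, g, 0, 0) = 0 := by
  simp only [loadCmd, block_cons, block_singleton, runs_seq, runs_setNat]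
  obtain ⟨G, hG⟩ : ∃ G, G = σ.nat (4, 0, 0, 0) := ⟨_, rfl⟩
  refine (Runs.forUp_total G (fun i u σ' => Frame [26, 27, 57] [] [] σ σ' ∧
    (∀ j < i, σ'.nat (26, σ.nat (5, j, 0, 0), 0, 0) = 0 ∧
      σ'.nat (27, σ.nat (5, j, 0, 0), 0, 0) = 0) ∧ u ≤ i * 50) (by decide) ?_ ?_ ?_ ?_).mono ?_
  · rintro i u σ' ⟨hF, -⟩
    rw [nv_eval, hF.nat 4 _ (by decide), hG]
  · rintro i u σ' hi h57 ⟨hF, hz, hu⟩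
    have e5 : ∀ x, σ'.nat (5, x) = σ.nat (5, x) := fun x => hF.nat 5 _ (by decide)
    simp only [runs_seq, runs_setNat]
    refine ⟨(hF.trans (N' := [26, 27, 57]) (R' := []) (P' := []) ?_).mono (by simp) (by simp)
      (by simp), ?_, ?_⟩
    · constructor <;> intro a x ha <;> simp at ha <;> simp [ha]
    · intro j hj
      simp [h57, e5]
      rcases Nat.lt_succ_iff_lt_or_eq.1 hj with h | rfl
      · exact ⟨fun _ => (hz j h).1, fun _ => (hz j h).2⟩
      · simp
    · simp
      omega
  · simp
  · refine ⟨?_, by simp⟩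
    constructor <;> intro a x ha <;> simp at ha <;> simp [ha]
  rintro t₁ σ₁ ⟨u, ht₁, -, hF₁, hz₁, hu₁⟩
  have hz : ∀ g, σ.Seen g → σ₁.nat (26, g, 0, 0) = 0 ∧ σ₁.nat (27, g, 0, 0) = 0 := by
    rintro g ⟨i, hi, rfl⟩
    exact hz₁ i (hG ▸ hi)
  refine (Runs.forUp w 150 (fun i σ' => Frame [26, 27, 29, 33, 34, 36, 54, 57] [] [] σ σ' ∧
    σ'.Loaded l m mg i ∧ (∀ v < i, σ'.nat (29, v, 0, 0) = 0) ∧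
    ∀ g, σ.Seen g → σ'.nat (27, g, 0, 0) = 0) (by decide) ?_ ?_ ?_ ?_).mono ?_
  · rintro i σ' ⟨hF, -⟩
    rw [nv_eval, hF.nat 24 _ (by decide), h24]
  · rintro i σ₂ hi h36 ⟨hF, hL, h29, h27⟩
    have e4 : ∀ x, σ₂.nat (4, x) = σ.nat (4, x) := fun x => hF.nat 4 _ (by decide)
    have e5 : ∀ x, σ₂.nat (5, x) = σ.nat (5, x) := fun x => hF.nat 5 _ (by decide)
    have e1 : ∀ g, σ₂.nat (1, g, 0, 0) = l g := fun g => (hF.nat 1 _ (by decide)).trans (hl g)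
    have e35 : σ₂.nat (35, i, 0, 0) = mg i := (hF.nat 35 _ (by decide)).trans (h35 i hi)
    have hs2 : ∀ g, σ₂.Seen g ↔ σ.Seen g := fun g => by simp only [Mem.Seen, e4, e5]
    have hsi := hseen i hi
    have e26 := hL.size _ ((hs2 _).2 hsi)
    have main : ∀ (σ₃ : Mem X) (t₃ : ℕ), t₃ ≤ 120 →
        Frame [26, 27, 29, 33, 34, 36, 54, 57] [] [] σ σ₃ →
        (∀ x, σ₃.nat (26, x) = σ₂.nat (26, x)) → σ₃.nat (54, 0, 0, 0) = mg i →
        (∀ x, σ₃.nat (27, x) = σ₂.nat (27, x)) →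
        (∀ x, σ₃.nat (29, x, 0, 0) = if x = i then 0 else σ₂.nat (29, x, 0, 0)) →
        (∀ x z, σ₃.nat (34, x, z, 0) = if x = mg i ∧ z = mcount mg i (mg i) then i else
          σ₂.nat (34, x, z, 0)) →
        σ₃.nat (33, 0, 0, 0) = surplus l m mg (i + 1) →
        Runs lab (.setNat (rf1 26 (nv 54)) (.add (n1 26 (nv 54)) (.const 1))) σ₃ fun t σ' =>
          t + t₃ ≤ 150 ∧ Frame [26, 27, 29, 33, 34, 36, 54, 57] [] [] σ
            (σ'.setNat (36, 0, 0, 0) (i + 1)) ∧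
          (σ'.setNat (36, 0, 0, 0) (i + 1)).Loaded l m mg (i + 1) ∧
          (∀ v < i + 1, (σ'.setNat (36, 0, 0, 0) (i + 1)).nat (29, v, 0, 0) = 0) ∧
          ∀ g, σ.Seen g → (σ'.setNat (36, 0, 0, 0) (i + 1)).nat (27, g, 0, 0) = 0 := by
      intro σ₃ t₃ ht₃ hF₃ f26 f54 f27 f29 f34 f33
      simp only [runs_setNat]
      have hs3 : ∀ g, (((σ₃.setNat (Ref.addr lab σ₃ (rf1 26 (nv 54))) (NExp.eval lab σ₃
          ((n1 26 (nv 54)).add (NExp.const 1)))).setNat (36, 0, 0, 0) (i + 1))).Seen g ↔ σ.Seen g := by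
        intro g
        simp [Mem.Seen, hF₃.nat 4 _ (by decide), hF₃.nat 5 _ (by decide)]
      refine ⟨by simp; omega, (hF₃.trans (N' := [26, 36]) (R' := []) (P' := []) ?_).mono (by simp)
        (by simp) (by simp), ⟨?_, ?_, ?_, ?_⟩, ?_, ?_⟩
      · constructor <;> intro a x ha <;> simp at ha <;> simp [ha]
      · intro g hg
        rw [hs3] at hg
        have := hL.size _ ((hs2 _).2 hg)
        simp [f54, f26, mcount_succ, e26, this]
        split_ifs with h1 h2 h2
        · rw [h1]
        · exact absurd h1.symm h2
        · exact absurd h2.symm h1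
        · rfl
      · simpa using f33
      · intro g hg z hz'
        rw [hs3] at hg
        rw [mcount_succ] at hz'
        simp [f34]
        by_cases h1 : g = mg i ∧ z = mcount mg i (mg i)
        · simp [h1]
        · rw [if_neg h1]
          have h2 := hL.fiber g ((hs2 _).2 hg) z (by
            split_ifs at hz' with h2
            · have : ¬ z = mcount mg i (mg i) := fun h3 => h1 ⟨h2.symm, h3⟩
              rw [h2] at this
              omega
            · exact hz')
          exact ⟨by omega, h2.2⟩
      · intro v hv
        simp only [mcount_succ]
        rcases Nat.lt_succ_iff_lt_or_eq.1 hv with h | rfl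
        · obtain ⟨z, hz', hzv⟩ := hL.fiber_surj v h
          refine ⟨z, by omega, ?_⟩
          simp [f34]
          rw [if_neg, hzv]
          rintro ⟨h1, h2⟩
          rw [h1] at hz'
          omega
        · exact ⟨mcount mg v (mg v), by simp, by simp [f34]⟩
      · intro v hv
        simp [f29]
        intro h1
        exact h29 v (by omega)
      · intro g hg
        simpa [f27] using h27 g hg
    rw [runs_seq, runs_setNat, runs_seq, runs_setNat, runs_seq, runs_setNat, runs_seq, runs_ite]
    have hsur := surplus_succ (l := l) (hm i hi)
    constructor
    · intro hb
      simp [h36, e1, e35, e26] at hb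
      rw [inc, runs_setNat]
      refine (main _ 120 le_rfl ((hF.trans (N' := [29, 33, 34, 54]) (R' := []) (P' := []) ?_).mono
        (by simp) (by simp) (by simp)) ?_ ?_ ?_ ?_ ?_ ?_).mono ?_
      · constructor <;> intro a x ha <;> simp at ha <;> simp [ha]
      · simp
      · simp [h36, e35]
      · simp
      · simp [h36]
      · simp [h36, e35, e26]
      · simp [hL.sur, hsur, hb]
      · rintro t σ' ⟨ht, h⟩
        refine ⟨?_, h⟩
        simp
        omega
    · intro hb
      simp [h36, e1, e35, e26] at hb
      rw [runs_skip]
      refine (main _ 120 le_rfl ((hF.trans (N' := [29, 33, 34, 54]) (R' := []) (P' := []) ?_).mono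
        (by simp) (by simp) (by simp)) ?_ ?_ ?_ ?_ ?_ ?_).mono ?_
      · constructor <;> intro a x ha <;> simp at ha <;> simp [ha]
      · simp
      · simp [h36, e35]
      · simp
      · simp [h36]
      · simp [h36, e35, e26]
      · simp [hL.sur, hsur, not_le.2 hb]
      · rintro t σ' ⟨ht, h⟩
        refine ⟨?_, h⟩
        simp
        omega
  · simp
  · refine ⟨(hF₁.trans (N' := [33, 36]) (R' := []) (P' := []) ?_).mono (by simp) (by simp) (by simp),
      ⟨?_, ?_, ?_, ?_⟩, by simp, ?_⟩
    · constructor <;> intro a x ha <;> simp at ha <;> simp [ha]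
    · intro g hg
      simp [Mem.Seen, hF₁.nat 4 _ (by decide), hF₁.nat 5 _ (by decide)] at hg
      simpa [mcount] using (hz g hg).1
    · simp [surplus, mcount]
    · simp [mcount]
    · simp
    · intro g hg
      simpa using (hz g hg).2
  · rintro t₂ σ₂ ⟨ht₂, -, hF₂, hL, h29, h27⟩
    have e24 : σ₂.nat (24, 0, 0, 0) = w := (hF₂.nat 24 _ (by decide)).trans h24
    refine ⟨?_, ?_, ?_, ?_⟩
    · simp at ht₁ ht₂ ⊢
      omega
    · constructor <;> simp [Mem.Seen]
      exacts [by simpa [Mem.Seen] using hL.1, hL.2, by simpa [Mem.Seen] using hL.3, hL.4]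
    · intro v hv
      simp [e24]
      intro h1
      exact h29 v (by omega)
    · intro g hg
      simpa using h27 g hg
end
end FairStream

namespace FairStream

/-! ### The search for an augmenting path -/

/-- Appends the cluster `x`, reached from `val`, to the queue. -/
def pushCmd (x val : NExp) : Cmd :=
  .ite (.natLe (n1 29 x) (.const 0))
    (block [.setNat (rf1 37 (nv 39)) x, inc 39, .setNat (rf1 29 x) (nv 39),
      .setNat (rf1 42 x) val]) .skip

/-- Starts the search with the cluster `nat 24`, and with the clusters whose reassignment would
decrease the surplus if the surplus is as large as possible. -/
def sourcesCmd : Cmd :=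
  block [.setNat (rf0 38) (.const 0), .setNat (rf0 39) (.const 0), .setNat (rf0 40) (.const 0),
    pushCmd (nv 24) (.const 0),
    .ite (.natLe (nv 0) (.add (nv 33) (nv 47)))
      (block [.setNat (rf0 36) (.const 0),
        forUp 36 (nv 24) (.ite (ltE (n1 1 (n1 35 (nv 36))) (n1 26 (n1 35 (nv 36))))
          (pushCmd (nv 36) (.const 0)) .skip)]) .skip]

/-- Visits the group `nat 54`, reached from the cluster `nat 43`. -/
def visitCmd : Cmd :=
  block [.setNat (rf1 27 (nv 54)) (.const 1), .setNat (rf1 41 (nv 54)) (nv 43),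
    .ite (.not (.and (.natLe (n1 1 (nv 54)) (n1 26 (nv 54)))
        (.not (.and (ltE (n1 26 (nv 54)) (n1 2 (nv 54))) (ltE (.add (nv 33) (nv 47)) (nv 0))))))
      (.setNat (rf0 40) (.add (nv 54) (.const 1))) .skip,
    .setNat (rf0 45) (.const 0),
    forUp 45 (n1 26 (nv 54)) (pushCmd (n2 34 (nv 54) (nv 45)) (.add (nv 54) (.const 1)))]

def bfsCmd : Cmd :=
  .loop (.and (ltE (nv 38) (nv 39)) (.natLe (nv 40) (.const 0)))
    (block [.setNat (rf0 43) (n1 37 (nv 38)), inc 38, .setNat (rf0 44) (.const 0),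
      forUp 44 (n1 28 (nv 43)) (.seq (.setNat (rf0 54) (n2 30 (nv 43) (nv 44)))
        (.ite (.natLe (n1 27 (nv 54)) (.const 0)) visitCmd .skip))])

/-- The data of the search, which do not change during the search. -/
structure Mem.Ctx {X : Type*} (σ : Mem X) (N : ℕ → ℕ → Prop) (l u : ℕ → ℕ) (k m : ℕ)
    (mg : ℕ → ℕ) (w t : ℕ) : Prop where
  k_eq : σ.nat (0, 0, 0, 0) = k
  l_eq : ∀ g, σ.nat (1, g, 0, 0) = l g
  u_eq : ∀ g, σ.nat (2, g, 0, 0) = u g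
  w_eq : σ.nat (24, 0, 0, 0) = w
  sumL_eq : σ.nat (47, 0, 0, 0) = ∑ g ∈ Finset.range m, l g
  mg_eq : ∀ v < w, σ.nat (35, v, 0, 0) = mg v
  loaded : σ.Loaded l m mg w
  lists : ∀ v < t, ∀ g, (∃ e < σ.nat (28, v, 0, 0), σ.nat (30, v, e, 0) = g) ↔ N v g
  seen : ∀ v g, N v g → σ.Seen g
  seen_lt : ∀ g, σ.Seen g → g < m
  lt : w < t
  assign : Assign N l u k m w mg

def Mem.Vis {X : Type*} (σ : Mem X) (g : ℕ) : Prop := σ.Seen g ∧ σ.nat (27, g, 0, 0) ≠ 0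

/-- The clusters at which the search starts. -/
def Source (l : ℕ → ℕ) (k m : ℕ) (mg : ℕ → ℕ) (w v : ℕ) : Prop :=
  v = w ∨ (v < w ∧ k ≤ surplus l m mg w + ∑ g ∈ Finset.range m, l g ∧
    l (mg v) < mcount mg w (mg v))

/-- The invariant of the search. -/
structure Mem.Search {X : Type*} (σ : Mem X) (N : ℕ → ℕ → Prop) (l u : ℕ → ℕ) (k m : ℕ)
    (mg : ℕ → ℕ) (w : ℕ) : Prop where
  qu_le : ∀ i < σ.nat (39, 0, 0, 0), σ.nat (37, i, 0, 0) ≤ w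
  pv_qu : ∀ i < σ.nat (39, 0, 0, 0), σ.nat (29, σ.nat (37, i, 0, 0), 0, 0) = i + 1
  qu_pv : ∀ v ≤ w, σ.nat (29, v, 0, 0) ≠ 0 → ∃ i < σ.nat (39, 0, 0, 0), σ.nat (37, i, 0, 0) = v
  pg_ok : ∀ i < σ.nat (39, 0, 0, 0), ∀ v, σ.nat (37, i, 0, 0) = v →
    (σ.nat (42, v, 0, 0) = 0 ∧ Source l k m mg w v) ∨
    ∃ g, σ.nat (42, v, 0, 0) = g + 1 ∧ σ.Vis g ∧ v < w ∧ mg v = g ∧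
      σ.nat (29, σ.nat (41, g, 0, 0), 0, 0) ≤ i
  par_ok : ∀ g, σ.Vis g → N (σ.nat (41, g, 0, 0)) g ∧ σ.nat (41, g, 0, 0) ≤ w ∧
    σ.nat (29, σ.nat (41, g, 0, 0), 0, 0) ≠ 0
  found_ok : ∀ g, σ.nat (40, 0, 0, 0) = g + 1 → σ.Vis g ∧ CanAdd l u k m mg w g

/-- No visited group can take another cluster, and its clusters have been reached. -/
def Mem.Stuck {X : Type*} (σ : Mem X) (l u : ℕ → ℕ) (k m : ℕ) (mg : ℕ → ℕ) (w : ℕ) : Prop :=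
  σ.nat (40, 0, 0, 0) = 0 → ∀ g, σ.Vis g → ¬ CanAdd l u k m mg w g ∧
    ∀ v < w, mg v = g → σ.nat (29, v, 0, 0) ≠ 0

/-- The search has advanced from `σ` to `σ'`. -/
structure Mem.Ext {X : Type*} (σ σ' : Mem X) : Prop where
  frame : Frame [27, 29, 36, 37, 38, 39, 40, 41, 42, 43, 44, 45, 54] [] [] σ σ'
  tail : σ.nat (39, 0, 0, 0) ≤ σ'.nat (39, 0, 0, 0)
  qu : ∀ i < σ.nat (39, 0, 0, 0), σ'.nat (37, i, 0, 0) = σ.nat (37, i, 0, 0)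
  pv : ∀ v, σ.nat (29, v, 0, 0) ≠ 0 → σ'.nat (29, v, 0, 0) ≠ 0
  vis : ∀ g, σ.nat (27, g, 0, 0) ≠ 0 → σ'.nat (27, g, 0, 0) ≠ 0

section
variable {X : Type*} {σ σ' σ'' : Mem X} {N : ℕ → ℕ → Prop} {l u : ℕ → ℕ} {k m w t : ℕ}
  {mg : ℕ → ℕ}

theorem Frame.self_trans {N R P : List ℕ} {σ σ' σ'' : Mem X} (h : Frame N R P σ σ')
    (h' : Frame N R P σ' σ'') : Frame N R P σ σ'' :=
  (h.trans h').mono (by simp) (by simp) (by simp)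

theorem Frame.seen {N R P : List ℕ} (h : Frame N R P σ σ') (h4 : 4 ∉ N) (h5 : 5 ∉ N) {g : ℕ} :
    σ'.Seen g ↔ σ.Seen g := by
  simp only [Mem.Seen, h.nat 4 _ h4, h.nat 5 _ h5]

theorem Mem.Ext.refl (σ : Mem X) : σ.Ext σ :=
  ⟨Frame.refl σ, le_rfl, fun _ _ => rfl, fun _ h => h, fun _ h => h⟩

theorem Mem.Ext.trans (h : σ.Ext σ') (h' : σ'.Ext σ'') : σ.Ext σ'' :=
  ⟨h.frame.self_trans h'.frame, h.tail.trans h'.tail,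
    fun i hi => (h'.qu i (hi.trans_le h.tail)).trans (h.qu i hi), fun v hv => h'.pv v (h.pv v hv),
    fun g hg => h'.vis g (h.vis g hg)⟩

theorem Mem.Ext.vis' (h : σ.Ext σ') {g : ℕ} (hg : σ.Vis g) : σ'.Vis g :=
  ⟨(h.frame.seen (by decide) (by decide)).2 hg.1, h.vis g hg.2⟩

theorem Mem.Ctx.frame (hc : σ.Ctx N l u k m mg w t)
    (hF : Frame [27, 29, 36, 37, 38, 39, 40, 41, 42, 43, 44, 45, 54] [] [] σ σ') :
    σ'.Ctx N l u k m mg w t := by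
  have hs : ∀ g, σ'.Seen g ↔ σ.Seen g := fun g => hF.seen (by decide) (by decide)
  refine ⟨?_, ?_, ?_, ?_, ?_, ?_, ⟨?_, ?_, ?_, ?_⟩, ?_, ?_, ?_, hc.lt, hc.assign⟩
  · rw [hF.nat 0 _ (by decide), hc.k_eq]
  · intro g; rw [hF.nat 1 _ (by decide), hc.l_eq]
  · intro g; rw [hF.nat 2 _ (by decide), hc.u_eq]
  · rw [hF.nat 24 _ (by decide), hc.w_eq]
  · rw [hF.nat 47 _ (by decide), hc.sumL_eq]
  · intro v hv; rw [hF.nat 35 _ (by decide), hc.mg_eq v hv]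
  · intro g hg; rw [hF.nat 26 _ (by decide), hc.loaded.size g ((hs g).1 hg)]
  · rw [hF.nat 33 _ (by decide), hc.loaded.sur]
  · intro g hg z hz; rw [hF.nat 34 _ (by decide)]; exact hc.loaded.fiber g ((hs g).1 hg) z hz
  · intro v hv
    obtain ⟨z, hz, hz'⟩ := hc.loaded.fiber_surj v hv
    exact ⟨z, hz, by rw [hF.nat 34 _ (by decide), hz']⟩
  · intro v hv g
    rw [← hc.lists v hv g]
    simp only [hF.nat 28 _ (show 28 ∉ _ by decide), hF.nat 30 _ (show 30 ∉ _ by decide)]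
  · intro v g h; exact (hs g).2 (hc.seen v g h)
  · intro g h; exact hc.seen_lt g ((hs g).1 h)

theorem Mem.Ctx.ext (hc : σ.Ctx N l u k m mg w t) (h : σ.Ext σ') : σ'.Ctx N l u k m mg w t :=
  hc.frame h.frame

/-- Every queue entry knows its own position through `pv_qu`, so no cluster occurs twice, and all
clusters in the queue are at most `w`. -/
theorem Mem.Search.tail_le (h : σ.Search N l u k m mg w) : σ.nat (39, 0, 0, 0) ≤ w + 1 := by
  have := Finset.card_le_card_of_injOn (s := Finset.range (σ.nat (39, 0, 0, 0)))
    (t := Finset.range (w + 1)) (fun i => σ.nat (37, i, 0, 0))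
    (fun i hi => by
      have := h.qu_le i (by simpa using hi)
      simp; omega)
    (fun i hi j hj hij => by
      have h1 := h.pv_qu i (by simpa using hi)
      have h2 := h.pv_qu j (by simpa using hj)
      simp only at hij
      rw [hij] at h1
      omega)
  simpa using this

/-- The search is preserved by writing to other arrays. -/
theorem Mem.Search.of_eq (h : σ.Search N l u k m mg w)
    (he : ∀ a ∈ [4, 5, 27, 29, 37, 39, 40, 41, 42], ∀ x, σ'.nat (a, x) = σ.nat (a, x)) :
    σ'.Search N l u k m mg w := by
  have hV : ∀ g, σ'.Vis g ↔ σ.Vis g := fun g => by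
    simp only [Mem.Vis, Mem.Seen, he 4 (by simp), he 5 (by simp), he 27 (by simp)]
  constructor <;> simp only [he 29 (by simp), he 37 (by simp), he 39 (by simp), he 40 (by simp),
    he 41 (by simp), he 42 (by simp), hV]
  exacts [h.1, h.2, h.3, h.4, h.5, h.6]

variable [MetricSpace X] {lab : X → ℕ}

/-- The expressions are evaluated again after parts of the queue have been written, so `hx` and `hv`
require their values to be stable under these writes. A parent group recorded for a new cluster was
visited from a cluster already in the queue; this yields the order needed to follow the path
backwards. -/
theorem pushCmd_spec (h : σ.Search N l u k m mg w) {ex ev : NExp} {x val : ℕ}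
    (hx : ∀ σ', Frame [29, 37, 39, 42] [] [] σ σ' → ex.eval lab σ' = x)
    (hv : ∀ σ', Frame [29, 37, 39, 42] [] [] σ σ' → ev.eval lab σ' = val)
    (htx : ex.time ≤ 10) (htv : ev.time ≤ 10) (hxw : x ≤ w)
    (hval : (val = 0 ∧ Source l k m mg w x) ∨ ∃ g, val = g + 1 ∧ σ.Vis g ∧ x < w ∧ mg x = g) :
    Runs lab (pushCmd ex ev) σ fun t σ' => t ≤ 100 ∧ σ'.Search N l u k m mg w ∧ σ.Ext σ' ∧
      Frame [29, 37, 39, 42] [] [] σ σ' ∧ σ'.nat (29, x, 0, 0) ≠ 0 := by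
  have hx0 := hx σ (Frame.refl _)
  rw [pushCmd, runs_ite]
  constructor
  · intro hb
    simp [hx0] at hb
    obtain ⟨T, hT⟩ : ∃ T, T = σ.nat (39, 0, 0, 0) := ⟨_, rfl⟩
    simp only [block_cons, block_singleton, runs_seq, inc, runs_setNat, rf0_addr, rf1_addr, nv_eval,
      add_eval, const_eval, hx0, ← hT]
    set σ₁ := σ.setNat (37, T, 0, 0) x with hσ₁
    have hF₁ : Frame [29, 37, 39, 42] [] [] σ σ₁ := (Frame.refl σ).setNat (by simp) _ _
    have e1 : σ₁.nat (39, 0, 0, 0) = T := by simp [hσ₁, hT]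
    simp only [e1]
    set σ₂ := σ₁.setNat (39, 0, 0, 0) (T + 1) with hσ₂
    have hF₂ : Frame [29, 37, 39, 42] [] [] σ σ₂ := hF₁.setNat (by simp) _ _
    have e2 : σ₂.nat (39, 0, 0, 0) = T + 1 := by simp [hσ₂]
    simp only [e2, hx σ₂ hF₂]
    set σ₃ := σ₂.setNat (29, x, 0, 0) (T + 1) with hσ₃
    have hF₃ : Frame [29, 37, 39, 42] [] [] σ σ₃ := hF₂.setNat (by simp) _ _
    simp only [hx σ₃ hF₃, hv σ₃ hF₃]
    have hF₄ : Frame [29, 37, 39, 42] [] [] σ (σ₃.setNat (42, x, 0, 0) val) :=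
      hF₃.setNat (by simp) _ _
    set σ₄ := σ₃.setNat (42, x, 0, 0) val with hσ₄
    have a37 : ∀ i, σ₄.nat (37, i, 0, 0) = if i = T then x else σ.nat (37, i, 0, 0) := by
      intro i; simp [hσ₄, hσ₃, hσ₂, hσ₁]
    have a39 : σ₄.nat (39, 0, 0, 0) = T + 1 := by simp [hσ₄, hσ₃, hσ₂, hσ₁]
    have a29 : ∀ i, σ₄.nat (29, i, 0, 0) = if i = x then T + 1 else σ.nat (29, i, 0, 0) := by
      intro i; simp [hσ₄, hσ₃, hσ₂, hσ₁]
    have a42 : ∀ i, σ₄.nat (42, i, 0, 0) = if i = x then val else σ.nat (42, i, 0, 0) := by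
      intro i; simp [hσ₄, hσ₃, hσ₂, hσ₁]
    have aV : ∀ g, σ₄.Vis g ↔ σ.Vis g := by
      intro g; simp [Mem.Vis, Mem.Seen, hσ₄, hσ₃, hσ₂, hσ₁]
    have a41 : ∀ i, σ₄.nat (41, i) = σ.nat (41, i) := fun i => hF₄.nat 41 _ (by decide)
    have a40 : ∀ i, σ₄.nat (40, i) = σ.nat (40, i) := fun i => hF₄.nat 40 _ (by decide)
    have hne : ∀ i < T, σ.nat (37, i, 0, 0) ≠ x := by
      intro i hi hix
      have := h.pv_qu i (hT ▸ hi)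
      rw [hix, hb] at this
      omega
    have hpar : ∀ g, σ.Vis g → σ.nat (41, g, 0, 0) ≠ x ∧
        σ.nat (29, σ.nat (41, g, 0, 0), 0, 0) ≤ T := by
      intro g hg
      obtain ⟨-, h1, h2⟩ := h.par_ok g hg
      refine ⟨fun h3 => h2 (by rw [h3, hb]), ?_⟩
      obtain ⟨i, hi, hi'⟩ := h.qu_pv _ h1 h2
      have := h.pv_qu i hi
      rw [hi'] at this
      omega
    refine ⟨by simp; omega, ⟨?_, ?_, ?_, ?_, ?_, ?_⟩, ⟨hF₄.mono (by simp) (by simp) (by simp), ?_, ?_,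
      ?_, ?_⟩, hF₄, ?_⟩
    · intro i hi
      rw [a39] at hi
      rw [a37]
      split_ifs with h1
      · exact hxw
      · exact h.qu_le i (by omega)
    · intro i hi
      rw [a39] at hi
      rw [a37]
      split_ifs with h1
      · rw [a29, if_pos rfl, h1]
      · rw [a29, if_neg (hne i (by omega))]
        exact h.pv_qu i (by omega)
    · intro v hv hpv
      rw [a29] at hpv
      rw [a39]
      by_cases h1 : v = x
      · exact ⟨T, by omega, by rw [a37, if_pos rfl, h1]⟩
      · rw [if_neg h1] at hpv
        obtain ⟨i, hi, hi'⟩ := h.qu_pv v hv hpv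
        exact ⟨i, by omega, by rw [a37, if_neg (by omega), hi']⟩
    · intro i hi v hiv
      rw [a39] at hi
      rw [a37] at hiv
      simp only [aV]
      by_cases h1 : i = T
      · rw [if_pos h1] at hiv
        subst hiv
        rw [a42, if_pos rfl]
        rcases hval with hval | ⟨g, hg1, hg2, hg3, hg4⟩
        · exact Or.inl hval
        · refine Or.inr ⟨g, hg1, hg2, hg3, hg4, ?_⟩
          rw [a41, a29, if_neg (hpar g hg2).1, h1]
          exact (hpar g hg2).2
      · rw [if_neg h1] at hiv
        have hvx : v ≠ x := hiv ▸ hne i (by omega)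
        rw [a42, if_neg hvx]
        rcases h.pg_ok i (by omega) v hiv with h2 | ⟨g, hg1, hg2, hg3, hg4, hg5⟩
        · exact Or.inl h2
        · refine Or.inr ⟨g, hg1, hg2, hg3, hg4, ?_⟩
          rw [a41, a29, if_neg (hpar g hg2).1]
          exact hg5
    · intro g hg
      rw [aV] at hg
      rw [a41, a29, if_neg (hpar g hg).1]
      exact h.par_ok g hg
    · intro g hg
      rw [a40] at hg
      rw [aV]
      exact h.found_ok g hg
    · rw [a39]; omega
    · intro i hi
      rw [a37, if_neg (by omega)]
    · intro v hv'
      rw [a29]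
      split_ifs <;> omega
    · intro g hg
      rwa [hF₄.nat 27 _ (by decide)]
    · rw [a29, if_pos rfl]; omega
  · intro hb
    simp [hx0] at hb
    simp only [runs_skip]
    exact ⟨by simp; omega, h, Mem.Ext.refl _, Frame.refl _, hb⟩

/-- The extra sources matter only when the total is exhausted: then a path from a cluster in a group
above its lower bound, to a group below it, frees a unit of the total. -/
theorem sourcesCmd_spec (hc : σ.Ctx N l u k m mg w t) (hpv : ∀ v ≤ w, σ.nat (29, v, 0, 0) = 0)
    (hvis : ∀ g, σ.Seen g → σ.nat (27, g, 0, 0) = 0) :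
    Runs lab sourcesCmd σ fun t' σ' => t' ≤ 300 * (w + 2) ∧
      Frame [29, 36, 37, 38, 39, 40, 42] [] [] σ σ' ∧ σ'.Search N l u k m mg w ∧
      σ'.nat (38, 0, 0, 0) = 0 ∧ σ'.nat (40, 0, 0, 0) = 0 ∧ (∀ g, ¬ σ'.Vis g) ∧
      ∀ v ≤ w, Source l k m mg w v → σ'.nat (29, v, 0, 0) ≠ 0 := by
  simp only [sourcesCmd, block_cons, block_singleton, runs_seq, runs_setNat]
  set σ₀ := ((σ.setNat (Ref.addr lab σ (rf0 38)) (NExp.eval lab σ (NExp.const 0))).setNat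
    (39, 0, 0, 0) 0).setNat (40, 0, 0, 0) 0 with hσ₀
  have hF₀ : Frame [29, 36, 37, 38, 39, 40, 42] [] [] σ σ₀ :=
    (((Frame.refl σ).setNat (by decide) _ _).setNat (by decide) _ _).setNat (by decide) _ _
  have hV₀ : ∀ g, ¬ σ₀.Vis g := by
    rintro g ⟨h1, h2⟩
    rw [hF₀.seen (by decide) (by decide)] at h1
    rw [hF₀.nat 27 _ (by decide), hvis g h1] at h2
    exact h2 rfl
  have hpv₀ : ∀ v ≤ w, σ₀.nat (29, v, 0, 0) = 0 := fun v hv => by simpa [hσ₀] using hpv v hv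
  have hS₀ : σ₀.Search N l u k m mg w := by
    have e39 : σ₀.nat (39, 0, 0, 0) = 0 := by simp [hσ₀]
    have e40 : σ₀.nat (40, 0, 0, 0) = 0 := by simp [hσ₀]
    refine ⟨by simp [e39], by simp [e39], fun v hv h => absurd (hpv₀ v hv) h, by simp [e39],
      fun g hg => absurd hg (hV₀ g), by simp [e40]⟩
  have hw₀ : σ₀.nat (24, 0, 0, 0) = w := by rw [hF₀.nat 24 _ (by decide), hc.w_eq]
  have hF1 : ∀ {σ₁ : Mem X}, Frame [29, 37, 39, 42] [] [] σ₀ σ₁ →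
      Frame [29, 36, 37, 38, 39, 40, 42] [] [] σ₀ σ₁ := fun h =>
    h.mono (by simp) (by simp) (by simp)
  refine (pushCmd_spec (x := w) (val := 0) hS₀ ?_ (fun _ _ => rfl) (by simp) (by simp) le_rfl
    (Or.inl ⟨rfl, Or.inl rfl⟩)).mono ?_
  · intro σ' hF
    rw [nv_eval, hF.nat 24 _ (by decide), hw₀]
  rintro t₁ σ₁ ⟨ht₁, hS₁, -, hF₁, hpw⟩
  have hFF₁ := hF₀.self_trans (hF1 hF₁)
  have e38 : σ₁.nat (38, 0, 0, 0) = 0 := by rw [hF₁.nat 38 _ (by decide)]; simp [hσ₀]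
  have e40 : σ₁.nat (40, 0, 0, 0) = 0 := by rw [hF₁.nat 40 _ (by decide)]; simp [hσ₀]
  have hV₁ : ∀ g, ¬ σ₁.Vis g := by
    intro g hg
    refine hV₀ g ⟨(hF₁.seen (by decide) (by decide)).1 hg.1, ?_⟩
    rw [← hF₁.nat 27 _ (by decide)]
    exact hg.2
  rw [runs_ite]
  have hk₁ : σ₁.nat (0, 0, 0, 0) = k := by rw [hFF₁.nat 0 _ (by decide), hc.k_eq]
  have hs₁ : σ₁.nat (33, 0, 0, 0) = surplus l m mg w := by
    rw [hFF₁.nat 33 _ (by decide), hc.loaded.sur]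
  have hl₁ : σ₁.nat (47, 0, 0, 0) = ∑ g ∈ Finset.range m, l g := by
    rw [hFF₁.nat 47 _ (by decide), hc.sumL_eq]
  constructor
  · intro hb
    simp [hk₁, hs₁, hl₁] at hb
    rw [runs_seq, runs_setNat]
    refine (Runs.forUp w 200 (fun i σ' => Frame [29, 36, 37, 38, 39, 40, 42] [] [] σ σ' ∧
      σ'.Search N l u k m mg w ∧ σ'.nat (38, 0, 0, 0) = 0 ∧ σ'.nat (40, 0, 0, 0) = 0 ∧
      (∀ g, ¬ σ'.Vis g) ∧ σ'.nat (29, w, 0, 0) ≠ 0 ∧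
      ∀ v < i, Source l k m mg w v → σ'.nat (29, v, 0, 0) ≠ 0) (by decide) ?_ ?_ ?_ ?_).mono ?_
    · rintro i σ' ⟨hF, -⟩
      rw [nv_eval, hF.nat 24 _ (by decide), hc.w_eq]
    · rintro i σ₂ hi h36 ⟨hF, hS, h38, h40, hV, hpw', hsrc⟩
      have hseen := hc.seen i _ (hc.assign.nbr i hi)
      have f35 : σ₂.nat (35, i, 0, 0) = mg i := by rw [hF.nat 35 _ (by decide), hc.mg_eq i hi]
      have f1 : σ₂.nat (1, mg i, 0, 0) = l (mg i) := by rw [hF.nat 1 _ (by decide), hc.l_eq]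
      have f26 : σ₂.nat (26, mg i, 0, 0) = mcount mg w (mg i) := by
        rw [hF.nat 26 _ (by decide), hc.loaded.size _ hseen]
      rw [runs_ite]
      constructor
      · intro hb2
        simp [h36, f35, f1, f26] at hb2
        refine (pushCmd_spec (x := i) (val := 0) hS ?_ (fun _ _ => rfl) (by simp) (by simp) hi.le
          (Or.inl ⟨rfl, Or.inr ⟨hi, hb, hb2⟩⟩)).mono ?_
        · intro σ' hF'
          rw [nv_eval, hF'.nat 36 _ (by decide), h36]
        · rintro t₃ σ₃ ⟨ht₃, hS₃, hE₃, hF₃, hp₃⟩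
          refine ⟨by simp; omega, (hF.self_trans (hF₃.mono (by simp) (by simp) (by simp))).setNat
            (by simp) _ _, hS₃.of_eq (by simp), ?_, ?_, ?_, ?_, ?_⟩
          · simpa [hF₃.nat 38 _ (by decide)] using h38
          · simpa [hF₃.nat 40 _ (by decide)] using h40
          · intro g hg
            refine hV g ?_
            simpa [Mem.Vis, Mem.Seen, hF₃.nat 4 _ (by decide), hF₃.nat 5 _ (by decide),
              hF₃.nat 27 _ (by decide)] using hg
          · simpa using hE₃.pv _ hpw'
          · intro v hv hs
            simp
            rcases Nat.lt_succ_iff_lt_or_eq.1 hv with h | rfl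
            · exact hE₃.pv _ (hsrc v h hs)
            · exact hp₃
      · intro hb2
        simp [h36, f35, f1, f26] at hb2
        rw [runs_skip]
        refine ⟨by simp, hF.setNat (by simp) _ _, hS.of_eq (by simp), by simpa using h38,
          by simpa using h40, ?_, by simpa using hpw', ?_⟩
        · intro g hg
          exact hV g (by simpa [Mem.Vis, Mem.Seen] using hg)
        · intro v hv hs
          simp
          rcases Nat.lt_succ_iff_lt_or_eq.1 hv with h | rfl
          · exact hsrc v h hs
          · rcases hs with h | h
            · omega
            · omega
    · simp
    · refine ⟨hFF₁.setNat (by decide) _ _, hS₁.of_eq (by simp), by simpa using e38, by simpa using e40,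
        ?_, by simpa using hpw, by simp⟩
      intro g hg
      exact hV₁ g (by simpa [Mem.Vis, Mem.Seen] using hg)
    · rintro t₂ σ₂ ⟨ht₂, -, hF, hS, h38, h40, hV, hpw', hsrc⟩
      refine ⟨?_, hF, hS, h38, h40, hV, ?_⟩
      · simp at ht₂ ⊢
        omega
      · intro v hv hs
        rcases hv.lt_or_eq with h | rfl
        · exact hsrc v h hs
        · exact hpw'
  · intro hb
    simp [hk₁, hs₁, hl₁] at hb
    rw [runs_skip]
    refine ⟨by simp; omega, hFF₁, hS₁, e38, e40, hV₁, ?_⟩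
    rintro v hv (rfl | ⟨-, h, -⟩)
    · exact hpw
    · omega

/-- The number of clusters of the visited groups. -/
def Mem.visited (σ : Mem X) (m : ℕ) (mg : ℕ → ℕ) (w : ℕ) : ℕ :=
  ∑ g ∈ Finset.range m, if σ.nat (27, g, 0, 0) = 0 then 0 else mcount mg w g

/-- The fiber of the group lists its clusters, so pushing them takes time proportional to their
number. Each group is visited at most once, and `visited` sums these numbers. -/
theorem visitCmd_spec (hc : σ.Ctx N l u k m mg w t) (hS : σ.Search N l u k m mg w)
    (hst : σ.Stuck l u k m mg w) {g v : ℕ} (h54 : σ.nat (54, 0, 0, 0) = g)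
    (h43 : σ.nat (43, 0, 0, 0) = v) (hv : v ≤ w) (hpv : σ.nat (29, v, 0, 0) ≠ 0) (hN : N v g)
    (hg : σ.nat (27, g, 0, 0) = 0) :
    Runs lab visitCmd σ fun t' σ' => t' ≤ 300 * (mcount mg w g + 1) ∧
      Frame [27, 29, 37, 39, 40, 41, 42, 45] [] [] σ σ' ∧
      σ'.Search N l u k m mg w ∧ σ'.Stuck l u k m mg w ∧ σ.Ext σ' ∧ σ'.nat (27, g, 0, 0) ≠ 0 ∧
      σ'.visited m mg w = σ.visited m mg w + mcount mg w g := by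
  have hseen := hc.seen v g hN
  have hgm := hc.seen_lt g hseen
  simp only [visitCmd, block_cons, block_singleton]
  rw [runs_seq, runs_setNat, runs_seq, runs_setNat, runs_seq]
  simp only [rf1_addr, nv_eval, const_eval, h54]
  set σ₁ := σ.setNat (27, g, 0, 0) 1 with hσ₁
  have f54 : σ₁.nat (54, 0, 0, 0) = g := by simp [hσ₁, h54]
  have f43 : σ₁.nat (43, 0, 0, 0) = v := by simp [hσ₁, h43]
  simp only [f54, f43]
  set σ₂ := σ₁.setNat (41, g, 0, 0) v with hσ₂
  have hF₂ : Frame [27, 29, 37, 39, 40, 41, 42, 45] [] [] σ σ₂ :=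
    ((Frame.refl σ).setNat (by simp) _ _).setNat (by simp) _ _
  have a27 : ∀ g', σ₂.nat (27, g', 0, 0) = if g' = g then 1 else σ.nat (27, g', 0, 0) := by
    intro g'; simp [hσ₂, hσ₁]
  have a41 : ∀ g', σ₂.nat (41, g', 0, 0) = if g' = g then v else σ.nat (41, g', 0, 0) := by
    intro g'; simp [hσ₂, hσ₁]
  have hV₂ : ∀ g', σ₂.Vis g' ↔ σ.Vis g' ∨ g' = g := by
    intro g'
    simp only [Mem.Vis, hF₂.seen (show 4 ∉ _ by decide) (show 5 ∉ _ by decide), a27]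
    split_ifs with h1
    · subst h1; simp [hseen]
    · simp [h1]
  have hgV : ¬ σ.Vis g := fun h => h.2 hg
  have hvisited : σ₂.visited m mg w = σ.visited m mg w + mcount mg w g := by
    have : mcount mg w g = ∑ x ∈ Finset.range m, if x = g then mcount mg w g else 0 := by
      rw [Finset.sum_ite_eq', if_pos (Finset.mem_range.2 hgm)]
    unfold Mem.visited
    rw [this, ← Finset.sum_add_distrib]
    refine Finset.sum_congr rfl fun x _ => ?_
    rw [a27]
    by_cases h1 : x = g
    · subst h1; simp [hg]
    · simp [h1]
  have hE₂ : σ.Ext σ₂ := by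
    refine ⟨hF₂.mono (by simp) (by simp) (by simp), ?_, ?_, ?_, ?_⟩
    · rw [hσ₂, hσ₁]; simp
    · intro i _; rw [hσ₂, hσ₁]; simp
    · intro x hx; rw [hσ₂, hσ₁]; simpa using hx
    · intro x hx
      rw [a27]
      split_ifs
      · omega
      · exact hx
  have hS₂ : σ₂.Search N l u k m mg w := by
    have e : ∀ a, a ≠ 27 → a ≠ 41 → ∀ x, σ₂.nat (a, x) = σ.nat (a, x) := by
      intro a h1 h2 x; simp [hσ₂, hσ₁, h1, h2]
    constructor <;> simp only [e 29 (by decide) (by decide), e 37 (by decide) (by decide),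
      e 39 (by decide) (by decide), e 40 (by decide) (by decide), e 42 (by decide) (by decide), hV₂]
    · exact hS.qu_le
    · exact hS.pv_qu
    · exact hS.qu_pv
    · intro i hi x hix
      rcases hS.pg_ok i hi x hix with h | ⟨g', h1, h2, h3, h4, h5⟩
      · exact Or.inl h
      · refine Or.inr ⟨g', h1, Or.inl h2, h3, h4, ?_⟩
        rw [a41, if_neg (by rintro rfl; exact hgV h2)]
        exact h5
    · rintro g' hg'
      rw [a41]
      split_ifs with h1
      · subst h1; exact ⟨hN, hv, hpv⟩
      · exact hS.par_ok g' (hg'.resolve_right h1)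
    · intro g' hg'
      exact ⟨Or.inl (hS.found_ok g' hg').1, (hS.found_ok g' hg').2⟩
  have main : ∀ (σ₃ : Mem X) (t₃ : ℕ), t₃ ≤ 150 → Frame [27, 29, 37, 39, 40, 41, 42, 45] [] [] σ σ₃ →
      σ₃.Search N l u k m mg w → σ.Ext σ₃ → (∀ x, σ₃.nat (27, x) = σ₂.nat (27, x)) →
      (σ₃.nat (40, 0, 0, 0) = 0 → σ.nat (40, 0, 0, 0) = 0 ∧ ¬ CanAdd l u k m mg w g) →
      Runs lab (.seq (.setNat (rf0 45) (.const 0)) (forUp 45 (n1 26 (nv 54))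
        (pushCmd (n2 34 (nv 54) (nv 45)) (.add (nv 54) (.const 1))))) σ₃ fun t' σ' =>
      t₃ + t' ≤ 300 * (mcount mg w g + 1) ∧ Frame [27, 29, 37, 39, 40, 41, 42, 45] [] [] σ σ' ∧
      σ'.Search N l u k m mg w ∧ σ'.Stuck l u k m mg w ∧ σ.Ext σ' ∧ σ'.nat (27, g, 0, 0) ≠ 0 ∧
      σ'.visited m mg w = σ.visited m mg w + mcount mg w g := by
    intro σ₃ t₃ ht₃ hF₃ hS₃ hE₃ h27 h40
    simp only [runs_seq, runs_setNat]
    refine (Runs.forUp (mcount mg w g) 110 (fun i σ' =>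
      Frame [27, 29, 37, 39, 40, 41, 42, 45] [] [] σ σ' ∧ σ'.Search N l u k m mg w ∧ σ.Ext σ' ∧
      (∀ x, σ'.nat (27, x) = σ₂.nat (27, x)) ∧ σ'.nat (40, 0, 0, 0) = σ₃.nat (40, 0, 0, 0) ∧
      ∀ z < i, σ'.nat (29, σ.nat (34, g, z, 0), 0, 0) ≠ 0) (by decide) ?_ ?_ ?_ ?_).mono ?_
    · rintro i σ' ⟨hF, -⟩
      rw [n1_eval, nv_eval, hF.nat 54 _ (by decide), h54, hF.nat 26 _ (by decide),
        hc.loaded.size g hseen]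
    · rintro i σ₄ hi h45 ⟨hF, hS', hE, h27', h40', hz⟩
      obtain ⟨hlt, hmg⟩ := hc.loaded.fiber g hseen i hi
      have hVg : σ₄.Vis g := by
        refine ⟨(hF.seen (by decide) (by decide)).2 hseen, ?_⟩
        rw [h27', a27, if_pos rfl]
        exact one_ne_zero
      refine (pushCmd_spec (x := σ.nat (34, g, i, 0)) (val := g + 1) hS' ?_ ?_ (by simp) (by simp)
        hlt.le (Or.inr ⟨g, rfl, hVg, hlt, hmg⟩)).mono ?_
      · intro σ' hF'
        rw [n2_eval, nv_eval, nv_eval, hF'.nat 54 _ (by decide), hF'.nat 45 _ (by decide),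
          hF'.nat 34 _ (by decide), h45, hF.nat 54 _ (by decide), h54, hF.nat 34 _ (by decide)]
      · intro σ' hF'
        rw [add_eval, nv_eval, hF'.nat 54 _ (by decide), hF.nat 54 _ (by decide), h54, const_eval]
      · rintro t₅ σ₅ ⟨ht₅, hS₅, hE₅, hF₅, hp₅⟩
        have hE₆ : σ₅.Ext (σ₅.setNat (45, 0, 0, 0) (i + 1)) := by
          refine ⟨(Frame.refl _).setNat (by simp) _ _, ?_, ?_, ?_, ?_⟩ <;> simp
        refine ⟨by omega, (hF.self_trans (hF₅.mono (by simp) (by simp) (by simp))).setNat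
            (by simp) _ _, hS₅.of_eq (by simp), (hE.trans hE₅).trans hE₆, ?_, ?_, ?_⟩
        · intro x
          simpa [hF₅.nat 27 _ (by decide)] using h27' x
        · simpa [hF₅.nat 40 _ (by decide)] using h40'
        · intro z hz'
          simp
          rcases Nat.lt_succ_iff_lt_or_eq.1 hz' with h | rfl
          · exact hE₅.pv _ (hz z h)
          · exact hp₅
    · simp
    · have hE₆ : σ₃.Ext (σ₃.setNat (45, 0, 0, 0) 0) := by
        refine ⟨(Frame.refl _).setNat (by simp) _ _, ?_, ?_, ?_, ?_⟩ <;> simp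
      exact ⟨hF₃.setNat (by decide) _ _, hS₃.of_eq (by simp), hE₃.trans hE₆, by simpa using h27,
        by simp, by simp⟩
    · rintro t₄ σ₄ ⟨ht₄, -, hF, hS', hE, h27', h40', hz⟩
      refine ⟨?_, hF, hS', ?_, hE, ?_, ?_⟩
      · simp at ht₄ ⊢
        omega
      · intro h0 g' hg'
        rw [h40'] at h0
        obtain ⟨h1, h2⟩ := h40 h0
        have hg2 : σ.Vis g' ∨ g' = g := by
          rw [← hV₂]
          refine ⟨(hF₂.seen (by decide) (by decide)).2 ((hF.seen (by decide) (by decide)).1 hg'.1), ?_⟩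
          rw [← h27']
          exact hg'.2
        rcases hg2 with hg2 | rfl
        · obtain ⟨h3, h4⟩ := hst h1 g' hg2
          exact ⟨h3, fun x hx hxg => hE.pv x (h4 x hx hxg)⟩
        · refine ⟨h2, fun x hx hxg => ?_⟩
          obtain ⟨z, hz', hzx⟩ := hc.loaded.fiber_surj x hx
          rw [hxg] at hz' hzx
          rw [← hzx]
          exact hz z hz'
      · rw [h27', a27, if_pos rfl]
        exact one_ne_zero
      · rw [← hvisited]
        unfold Mem.visited
        simp only [h27']
  -- The tests have no disjunction, so `CanAdd` is written with negations and conjunctions.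
  have hcan : (BExp.not (.and (.natLe (n1 1 (nv 54)) (n1 26 (nv 54)))
        (.not (.and (ltE (n1 26 (nv 54)) (n1 2 (nv 54)))
          (ltE (.add (nv 33) (nv 47)) (nv 0)))))).holds lab σ₂ ↔ CanAdd l u k m mg w g := by
    have c54 : σ₂.nat (54, 0, 0, 0) = g := by rw [hF₂.nat 54 _ (by decide), h54]
    have hc₂ := hc.ext hE₂
    have hs₂ := (hF₂.seen (by decide) (by decide)).2 hseen
    simp only [not_holds, and_holds, natLe_holds, ltE_holds, n1_eval, nv_eval, add_eval, c54,
      hc₂.l_eq, hc₂.u_eq, hc₂.loaded.size g hs₂, hc₂.loaded.sur, hc₂.sumL_eq, hc₂.k_eq, CanAdd]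
    omega
  rw [runs_ite, hcan]
  constructor
  · intro hca
    rw [runs_setNat]
    have c54 : σ₂.nat (54, 0, 0, 0) = g := by rw [hF₂.nat 54 _ (by decide), h54]
    simp only [rf0_addr, add_eval, nv_eval, const_eval, c54]
    have hE₃ : σ₂.Ext (σ₂.setNat (40, 0, 0, 0) (g + 1)) := by
      refine ⟨(Frame.refl _).setNat (by simp) _ _, ?_, ?_, ?_, ?_⟩ <;> simp
    refine (main _ 150 le_rfl (hF₂.setNat (by simp) _ _) ?_ (hE₂.trans hE₃) (by simp) (by simp)).mono ?_
    · have hV : ∀ g', (σ₂.setNat (40, 0, 0, 0) (g + 1)).Vis g' ↔ σ₂.Vis g' := by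
        intro g'; simp [Mem.Vis, Mem.Seen]
      have e : ∀ a, a ≠ 40 → ∀ x, (σ₂.setNat (40, 0, 0, 0) (g + 1)).nat (a, x) = σ₂.nat (a, x) := by
        intro a h1 x; simp [h1]
      have e40 : (σ₂.setNat (40, 0, 0, 0) (g + 1)).nat (40, 0, 0, 0) = g + 1 := by simp
      constructor <;> simp only [e 29 (by decide), e 37 (by decide), e 39 (by decide), e40,
        e 41 (by decide), e 42 (by decide), hV]
      · exact hS₂.qu_le
      · exact hS₂.pv_qu
      · exact hS₂.qu_pv
      · exact hS₂.pg_ok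
      · exact hS₂.par_ok
      -- A group found earlier may be overwritten here; any found group serves.
      · intro g' hg'
        obtain rfl : g = g' := by omega
        rw [hV₂]
        exact ⟨Or.inr rfl, hca⟩
    · rintro t₄ σ₄ ⟨ht₄, h⟩
      refine ⟨?_, h⟩
      simp
      omega
  · intro hca
    rw [runs_skip]
    refine (main _ 150 le_rfl hF₂ hS₂ hE₂ (fun _ => rfl) ?_).mono ?_
    · intro h0
      rw [hσ₂, hσ₁] at h0
      exact ⟨by simpa using h0, hca⟩
    · rintro t₄ σ₄ ⟨ht₄, h⟩
      refine ⟨?_, h⟩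
      simp
      omega
end
end FairStream

/-! ### Running time and completeness of the search -/

namespace FairStream

section
variable {X : Type*} {σ σ' σ'' : Mem X} {N : ℕ → ℕ → Prop} {l u : ℕ → ℕ} {k m w t : ℕ}
  {mg : ℕ → ℕ} 

theorem Mem.Ctx.mg_lt (hc : σ.Ctx N l u k m mg w t) : ∀ v < w, mg v < m := fun v hv =>
  hc.seen_lt _ (hc.seen v _ (hc.assign.nbr v hv))

theorem Mem.Ctx.visited_le (hc : σ.Ctx N l u k m mg w t) : σ'.visited m mg w ≤ w := by
  conv_rhs => rw [← sum_mcount hc.mg_lt]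
  refine Finset.sum_le_sum fun g _ => ?_
  split_ifs <;> omega

/-- The queue has no repetitions, so the work for the clusters taken from it is bounded by the work
for all clusters. -/
theorem Mem.Search.sum_le (hS : σ.Search N l u k m mg w) (hwt : w < t) (f : ℕ → ℕ) {h : ℕ}
    (hh : h ≤ σ.nat (39, 0, 0, 0)) :
    ∑ i ∈ Finset.range h, (f (σ.nat (37, i, 0, 0)) + 1) ≤ ∑ v ∈ Finset.range t, f v + (w + 1) := by
  have hinj : Set.InjOn (fun i => σ.nat (37, i, 0, 0)) (Finset.range h) := by
    intro i hi j hj hij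
    have h1 := hS.pv_qu i ((Finset.mem_range.1 hi).trans_le hh)
    have h2 := hS.pv_qu j ((Finset.mem_range.1 hj).trans_le hh)
    simp only at hij
    rw [hij] at h1
    omega
  have h1 : (Finset.range h).image (fun i => σ.nat (37, i, 0, 0)) ⊆ Finset.range (w + 1) := by
    intro x hx
    obtain ⟨i, hi, rfl⟩ := Finset.mem_image.1 hx
    have := hS.qu_le i ((Finset.mem_range.1 hi).trans_le hh)
    exact Finset.mem_range.2 (by omega)
  calc ∑ i ∈ Finset.range h, (f (σ.nat (37, i, 0, 0)) + 1)
      = ∑ x ∈ (Finset.range h).image (fun i => σ.nat (37, i, 0, 0)), (f x + 1) :=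
        (Finset.sum_image (f := fun x => f x + 1) hinj).symm
    _ ≤ ∑ x ∈ Finset.range (w + 1), (f x + 1) := Finset.sum_le_sum_of_subset h1
    _ = ∑ x ∈ Finset.range (w + 1), f x + (w + 1) := by simp [Finset.sum_add_distrib]
    _ ≤ _ := by
        gcongr
        exact hwt

variable [MetricSpace X] {lab : X → ℕ}

/-- The time has two parts: scanning the lists of the clusters taken from the queue, and pushing the
clusters of the visited groups. The first is bounded by all lists, the second by `w`. If nothing was
found, the queue has been exhausted, so every neighbour of a reached cluster has been visited. -/
theorem bfsCmd_spec (hc : σ.Ctx N l u k m mg w t) (hS : σ.Search N l u k m mg w)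
    (h38 : σ.nat (38, 0, 0, 0) = 0) (hV : ∀ g, ¬ σ.Vis g) :
    Runs lab bfsCmd σ fun t' σ' =>
      t' ≤ 1000 * (∑ v ∈ Finset.range t, σ.nat (28, v, 0, 0) + w + 2) ∧ σ.Ext σ' ∧
      σ'.Search N l u k m mg w ∧ σ'.Stuck l u k m mg w ∧
      (σ'.nat (40, 0, 0, 0) = 0 → ∀ v ≤ w, σ'.nat (29, v, 0, 0) ≠ 0 → ∀ g, N v g → σ'.Vis g) := by
  obtain ⟨en, hen⟩ : ∃ en : ℕ → ℕ, ∀ v, σ.nat (28, v, 0, 0) = en v := ⟨_, fun _ => rfl⟩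
  refine (Runs.loop_total (fun n T σ' => σ.Ext σ' ∧ σ'.Search N l u k m mg w ∧
    σ'.Stuck l u k m mg w ∧ ∃ h, σ'.nat (38, 0, 0, 0) = h ∧ n = w + 1 - h ∧
    h ≤ σ'.nat (39, 0, 0, 0) ∧ (∀ i < h, ∀ g, N (σ'.nat (37, i, 0, 0)) g → σ'.Vis g) ∧
    T ≤ 700 * ∑ i ∈ Finset.range h, (en (σ'.nat (37, i, 0, 0)) + 1) + 300 * σ'.visited m mg w)
    ?_ (n := w + 1) ?_).mono ?_
  · rintro n T σ₁ ⟨hE₁, hS₁, hst₁, h, h38, rfl, hh, hexp, hT⟩ hb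
    simp [h38] at hb
    have htl := hS₁.tail_le
    obtain ⟨v, hv⟩ : ∃ v, σ₁.nat (37, h, 0, 0) = v := ⟨_, rfl⟩
    have hvw : v ≤ w := hv ▸ hS₁.qu_le h hb.1
    have hpv : σ₁.nat (29, v, 0, 0) ≠ 0 := by
      rw [← hv, hS₁.pv_qu h hb.1]; omega
    simp only [block_cons, block_singleton, inc]
    rw [runs_seq, runs_setNat, runs_seq, runs_setNat, runs_seq, runs_setNat]
    simp only [rf0_addr, n1_eval, nv_eval, const_eval, add_eval, h38, hv]
    have e38 : (σ₁.setNat (43, 0, 0, 0) v).nat (38, 0, 0, 0) = h := by simp [h38]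
    simp only [e38]
    set σ₂ := ((σ₁.setNat (43, 0, 0, 0) v).setNat (38, 0, 0, 0) (h + 1)).setNat (44, 0, 0, 0) 0
      with hσ₂
    have hE₂ : σ₁.Ext σ₂ := by
      refine ⟨(((Frame.refl _).setNat (by simp) _ _).setNat (by simp) _ _).setNat (by simp) _ _,
        ?_, ?_, ?_, ?_⟩ <;> simp [hσ₂]
    have hS₂ : σ₂.Search N l u k m mg w := hS₁.of_eq (by simp [hσ₂])
    have hV₂ : ∀ g, σ₂.Vis g ↔ σ₁.Vis g := by intro g; simp [Mem.Vis, Mem.Seen, hσ₂]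
    have hst₂ : σ₂.Stuck l u k m mg w := by
      intro h0 g hg
      have := hst₁ (by simpa [hσ₂] using h0) g ((hV₂ g).1 hg)
      simpa [hσ₂] using this
    have hvis₂ : σ₂.visited m mg w = σ₁.visited m mg w := by simp [Mem.visited, hσ₂]
    have hE12 := hE₁.trans hE₂
    refine (Runs.forUp_total (en v) (fun e T' σ' => σ₂.Ext σ' ∧ σ'.Search N l u k m mg w ∧
      σ'.Stuck l u k m mg w ∧ σ'.nat (43, 0, 0, 0) = v ∧ σ'.nat (38, 0, 0, 0) = h + 1 ∧
      (∀ e' < e, σ'.Vis (σ.nat (30, v, e', 0))) ∧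
      T' + 300 * σ₂.visited m mg w ≤ 400 * e + 300 * σ'.visited m mg w) (by decide)
      ?_ ?_ ?_ ?_).mono ?_
    · rintro e T' σ' ⟨hE, -, -, h43, -⟩
      rw [n1_eval, nv_eval, h43, (hE12.trans hE).frame.nat 28 _ (by decide), hen]
    · rintro e T' σ₃ he h44 ⟨hE, hS₃, hst₃, h43, h38₃, hvis₃, hT'⟩
      have hE3 := hE12.trans hE
      obtain ⟨g, hg⟩ : ∃ g, σ.nat (30, v, e, 0) = g := ⟨_, rfl⟩
      have f30 : σ₃.nat (30, v, e, 0) = g := by rw [hE3.frame.nat 30 _ (by decide), hg]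
      have hN : N v g := (hc.lists v (by have := hc.lt; omega) g).1 ⟨e, by rw [hen]; exact he, hg⟩
      rw [runs_seq, runs_setNat]
      simp only [rf0_addr, n2_eval, nv_eval, h43, h44, f30]
      have hE₄ : σ₃.Ext (σ₃.setNat (54, 0, 0, 0) g) := by
        refine ⟨(Frame.refl _).setNat (by simp) _ _, ?_, ?_, ?_, ?_⟩ <;> simp
      have hE₅ : ∀ σ' : Mem X, σ'.Ext (σ'.setNat (44, 0, 0, 0) (e + 1)) := by
        intro σ'
        refine ⟨(Frame.refl _).setNat (by simp) _ _, ?_, ?_, ?_, ?_⟩ <;> simp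
      have hS₄ : (σ₃.setNat (54, 0, 0, 0) g).Search N l u k m mg w := hS₃.of_eq (by simp)
      have hst₄ : ∀ (σ' : Mem X) i x, i ∉ [4, 5, 27, 29, 40] → σ'.Stuck l u k m mg w →
          (σ'.setNat (i, 0, 0, 0) x).Stuck l u k m mg w := by
        intro σ' i x hi hst h0 g hg
        simp at hi
        have e : ∀ a ∈ [4, 5, 27, 29, 40], ∀ y, (σ'.setNat (i, 0, 0, 0) x).nat (a, y) =
            σ'.nat (a, y) := by
          intro a ha y
          have : a ≠ i := by rintro rfl; simp at ha; omega
          simp [this]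
        simp only [Mem.Vis, Mem.Seen, e 4 (by simp), e 5 (by simp), e 27 (by simp)] at hg
        simp only [e 29 (by simp)]
        exact hst (by rwa [e 40 (by simp)] at h0) g hg
      have hvis₄ : (σ₃.setNat (54, 0, 0, 0) g).visited m mg w = σ₃.visited m mg w := by
        simp [Mem.visited]
      have hv5 : ∀ σ' : Mem X, (σ'.setNat (44, 0, 0, 0) (e + 1)).visited m mg w =
        σ'.visited m mg w := by intro σ'; simp [Mem.visited]
      rw [runs_ite]
      constructor
      · intro hb2
        simp at hb2
        have hpv₄ : (σ₃.setNat (54, 0, 0, 0) g).nat (29, v, 0, 0) ≠ 0 :=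
          hE₄.pv _ (hE.pv _ (hE₂.pv _ hpv))
        refine (visitCmd_spec (hc.ext (hE3.trans hE₄)) hS₄ (hst₄ _ _ _ (by simp) hst₃) (by simp)
          (by simpa using h43) hvw hpv₄ hN (by simpa using hb2)).mono ?_
        rintro t₅ σ₅ ⟨ht₅, hF₅, hS₅, hst₅, hEE, h27, hvd⟩
        have hE6 := (hE₄.trans hEE).trans (hE₅ σ₅)
        refine ⟨hE.trans hE6, hS₅.of_eq (by simp), hst₄ _ _ _ (by simp) hst₅, ?_, ?_, ?_, ?_⟩
        · simpa [hF₅.nat 43 _ (by decide)] using h43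
        · simpa [hF₅.nat 38 _ (by decide)] using h38₃
        · intro e' he'
          rcases Nat.lt_succ_iff_lt_or_eq.1 he' with h1 | rfl
          · exact hE6.vis' (hvis₃ e' h1)
          · rw [hg]
            refine (hE₅ σ₅).vis' ⟨?_, h27⟩
            exact (((hE3.trans hE₄).trans hEE).frame.seen (by decide) (by decide)).2 (hc.seen v g hN)
        · rw [hv5, hvd, hvis₄]
          simp
          omega
      · intro hb2
        simp at hb2
        rw [runs_skip]
        have hE6 := hE₄.trans (hE₅ _)
        refine ⟨hE.trans hE6, hS₄.of_eq (by simp), hst₄ _ _ _ (by simp) (hst₄ _ _ _ (by simp) hst₃),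
          by simpa using h43, by simpa using h38₃, ?_, ?_⟩
        · intro e' he'
          rcases Nat.lt_succ_iff_lt_or_eq.1 he' with h1 | rfl
          · exact hE6.vis' (hvis₃ e' h1)
          · rw [hg]
            refine hE6.vis' ⟨(hE3.frame.seen (by decide) (by decide)).2 (hc.seen v g hN), ?_⟩
            omega
        · rw [hv5, hvis₄]
          simp
          omega
    · simp [hσ₂]
    · exact ⟨Mem.Ext.refl _, hS₂, hst₂, by simp [hσ₂], by simp [hσ₂], by simp, by simp⟩
    · rintro t₃ σ₃ ⟨T', ht₃, -, hE₃, hS₃, hst₃, h43, h38₃, hvis₃, hT'⟩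
      have hE23 := hE₂.trans hE₃
      refine ⟨w + 1 - (h + 1), by omega, hE₁.trans hE23, hS₃, hst₃, h + 1, h38₃, rfl,
        le_trans hb.1 hE23.tail, ?_, ?_⟩
      · intro i hi g hN
        rw [hE23.qu i (by omega)] at hN
        rcases Nat.lt_succ_iff_lt_or_eq.1 hi with h1 | rfl
        · exact hE23.vis' (hexp i h1 g hN)
        · rw [hv] at hN
          obtain ⟨e, he, hg⟩ := (hc.lists v (by have := hc.lt; omega) g).2 hN
          rw [hen] at he
          exact hg ▸ hvis₃ e he
      · have hsum : ∑ i ∈ Finset.range h, (en (σ₃.nat (37, i, 0, 0)) + 1) =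
            ∑ i ∈ Finset.range h, (en (σ₁.nat (37, i, 0, 0)) + 1) :=
          Finset.sum_congr rfl fun i hi => by
            rw [hE23.qu i ((Finset.mem_range.1 hi).trans_le hh)]
        rw [Finset.sum_range_succ, hsum, hE23.qu h hb.1, hv]
        rw [hvis₂] at hT'
        simp at ht₃ ⊢
        omega
  · exact ⟨Mem.Ext.refl _, hS, fun _ g hg => absurd hg (hV g), 0, h38, rfl, by omega, by simp, by simp⟩
  · rintro t₁ σ₁ ⟨n, T, rfl, hb, hE, hS₁, hst₁, h, h38₁, -, hh, hexp, hT⟩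
    have h1 := hS₁.sum_le hc.lt en hh
    have h2 := hc.visited_le (σ' := σ₁)
    refine ⟨?_, hE, hS₁, hst₁, ?_⟩
    · simp only [hen]
      simp
      omega
    · intro h0 v hv hpv g hN
      obtain ⟨i, hi, hiv⟩ := hS₁.qu_pv v hv hpv
      simp [h0, h38₁] at hb
      exact hexp i (by omega) g (by rwa [hiv])
end
end FairStream

namespace FairStream

/-! ### Augmenting the assignment -/

/-- Changes the assignment `nat 35` along the path to the group found by the search. -/
def augCmd : Cmd :=
  block [.setNat (rf0 53) (.sub (nv 40) (.const 1)), .setNat (rf0 58) (.const 0),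
    .loop (.natLe (nv 58) (.const 0))
      (block [.setNat (rf0 36) (n1 41 (nv 53)), .setNat (rf1 35 (nv 36)) (nv 53),
        .ite (.natLe (n1 42 (nv 36)) (.const 0)) (.setNat (rf0 58) (.const 1))
          (.setNat (rf0 53) (.sub (n1 42 (nv 36)) (.const 1)))]),
    .ite (.natLe (nv 24) (nv 36)) (inc 24) .skip]

/-- The assignment in the memory. -/
def Mem.asg {X : Type*} (σ : Mem X) (v : ℕ) : ℕ := σ.nat (35, v, 0, 0)

/-- A better assignment than `mg` is in the memory. -/
def Mem.Better {X : Type*} (σ : Mem X) (N : ℕ → ℕ → Prop) (l u : ℕ → ℕ) (k m : ℕ)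
    (mg : ℕ → ℕ) (w w' : ℕ) : Prop :=
  (w' = w + 1 ∧ Assign N l u k m (w + 1) σ.asg ∧
      surplus l m σ.asg (w + 1) ≤ surplus l m mg w + 1) ∨
    (w' = w ∧ Assign N l u k m w σ.asg ∧ surplus l m σ.asg w < surplus l m mg w)

section
variable {X : Type*} [MetricSpace X] {lab : X → ℕ} {σ : Mem X} {N : ℕ → ℕ → Prop} {l u : ℕ → ℕ}
  {k m w t : ℕ} {mg : ℕ → ℕ}

/-- The path is followed backwards from the group found: each cluster on it is moved to the next
group, and its former group is treated next. Queue positions decrease strictly along the way, so the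
walk ends at a source and meets no cluster twice. The kind of source decides between an extension
and a rerouting. -/
theorem augCmd_spec (hc : σ.Ctx N l u k m mg w t) (hS : σ.Search N l u k m mg w)
    (hlu : ∀ g, l g ≤ u g) (h40 : σ.nat (40, 0, 0, 0) ≠ 0) :
    Runs lab augCmd σ fun t' σ' => t' ≤ 100 * (w + 3) ∧ Frame [24, 35, 36, 53, 58] [] [] σ σ' ∧
      ∃ w', σ'.nat (24, 0, 0, 0) = w' ∧ σ'.Better N l u k m mg w w' := by
  obtain ⟨g₀, hg₀⟩ : ∃ g, σ.nat (40, 0, 0, 0) = g + 1 := ⟨_, (Nat.succ_pred h40).symm⟩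
  obtain ⟨hV₀, hcan⟩ := hS.found_ok g₀ hg₀
  have hVm : ∀ g, σ.Vis g → g < m := fun g h => hc.seen_lt g h.1
  obtain ⟨par, hpar⟩ : ∃ par : ℕ → ℕ, ∀ g, σ.nat (41, g, 0, 0) = par g := ⟨_, fun _ => rfl⟩
  obtain ⟨pv, hpv⟩ : ∃ pv : ℕ → ℕ, ∀ v, σ.nat (29, v, 0, 0) = pv v := ⟨_, fun _ => rfl⟩
  obtain ⟨pg, hpg⟩ : ∃ pg : ℕ → ℕ, ∀ v, σ.nat (42, v, 0, 0) = pg v := ⟨_, fun _ => rfl⟩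
  have hpar_ok : ∀ g, σ.Vis g → N (par g) g ∧ par g ≤ w ∧ pv (par g) ≠ 0 := by
    intro g hg
    have := hS.par_ok g hg
    rwa [hpar, hpv] at this
  have hpvw : ∀ v ≤ w, pv v ≤ w + 1 := by
    intro v hv
    by_cases h : pv v = 0
    · omega
    · obtain ⟨i, hi, hiv⟩ := hS.qu_pv v hv (by rwa [hpv])
      have := hS.pv_qu i hi
      rw [hiv, hpv] at this
      have := hS.tail_le
      omega
  have hstep : ∀ v ≤ w, pv v ≠ 0 → (pg v = 0 ∧ Source l k m mg w v) ∨
      ∃ g, pg v = g + 1 ∧ σ.Vis g ∧ v < w ∧ mg v = g ∧ pv (par g) < pv v := by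
    intro v hv h
    obtain ⟨i, hi, hiv⟩ := hS.qu_pv v hv (by rwa [hpv])
    have h1 := hS.pv_qu i hi
    rw [hiv, hpv] at h1
    have h2 := hS.pg_ok i hi v hiv
    simp only [hpg, hpar, hpv] at h2
    rcases h2 with h2 | ⟨g, a1, a2, a3, a4, a5⟩
    · exact Or.inl h2
    · exact Or.inr ⟨g, a1, a2, a3, a4, by omega⟩
  simp only [augCmd, block_cons, block_singleton]
  rw [runs_seq, runs_setNat, runs_seq, runs_setNat, runs_seq]
  simp only [rf0_addr, sub_eval, nv_eval, const_eval, hg₀, Nat.add_sub_cancel]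
  -- The changes of the counts telescope: relative to `mg`, the end `g₀` has gained a cluster and
  -- the current group `i` still lacks one. Clusters at positions up to `n` have not been moved yet.
  refine (Runs.loop_total (fun n T σ' => T + 100 * n ≤ 100 * (w + 1) ∧
    Frame [35, 36, 53, 58] [] [] σ σ' ∧
    ((σ'.nat (58, 0, 0, 0) = 0 ∧ ∃ i, σ'.nat (53, 0, 0, 0) = i ∧ σ.Vis i ∧ n = pv (par i) ∧
      (∀ v < w, N v (σ'.asg v)) ∧ (∀ g, mcount σ'.asg w g + (if i = g then 1 else 0) =
        mcount mg w g + if g₀ = g then 1 else 0) ∧ ∀ v < w, pv v ≤ n → σ'.asg v = mg v) ∨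
    (σ'.nat (58, 0, 0, 0) ≠ 0 ∧ (σ'.Better N l u k m mg w
      (if w ≤ σ'.nat (36, 0, 0, 0) then w + 1 else w))))) ?_ (n := pv (par g₀)) ?_).mono ?_
  · rintro n T σ₁ ⟨hT, hF, ⟨h58, i, h53, hVi, rfl, hnbr, hcnt, hun⟩ | ⟨h58, -⟩⟩ hb
    swap
    · simp at hb; exact absurd hb h58
    obtain ⟨hN, hvw, hpv0⟩ := hpar_ok i hVi
    obtain ⟨v, hv⟩ : ∃ v, par i = v := ⟨_, rfl⟩
    rw [hv] at hN hvw hpv0 hT hun ⊢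
    have f41 : ∀ g, σ₁.nat (41, g, 0, 0) = par g := fun g => by rw [hF.nat 41 _ (by decide), hpar]
    have f42 : ∀ x, σ₁.nat (42, x, 0, 0) = pg x := fun x => by rw [hF.nat 42 _ (by decide), hpg]
    rw [runs_seq, runs_setNat, runs_seq, runs_setNat]
    simp only [rf0_addr, rf1_addr, n1_eval, nv_eval, h53, f41, hv]
    have e1 : (σ₁.setNat (36, 0, 0, 0) v).nat (36, 0, 0, 0) = v := by simp
    have e2 : (σ₁.setNat (36, 0, 0, 0) v).nat (53, 0, 0, 0) = i := by simp [h53]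
    simp only [e1, e2]
    set σ₂ := (σ₁.setNat (36, 0, 0, 0) v).setNat (35, v, 0, 0) i with hσ₂
    have hF₂ : Frame [35, 36, 53, 58] [] [] σ σ₂ := (hF.setNat (by simp) _ _).setNat (by simp) _ _
    have hasg : σ₂.asg = fun x => if x = v then i else σ₁.asg x := by
      funext x; simp [Mem.asg, hσ₂]
    have c36 : σ₂.nat (36, 0, 0, 0) = v := by simp [hσ₂]
    have c42 : σ₂.nat (42, v, 0, 0) = pg v := by simp [hσ₂, f42]
    have hnbr₂ : ∀ x ≤ v, x < w + 1 → (x < w ∨ x = v) → N x (σ₂.asg x) := by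
      intro x _ hx hxv
      rw [hasg]
      by_cases h : x = v
      · simp only [h, if_true]; exact hN
      · simp only [h, if_false]; exact hnbr x (by omega)
    have hnbr₃ : ∀ x < w, N x (σ₂.asg x) := by
      intro x hx
      rw [hasg]
      by_cases h : x = v
      · simp only [h, if_true]; exact hN
      · simp only [h, if_false]; exact hnbr x hx
    have hcnt₂ : v < w → ∀ g, mcount σ₂.asg w g + (if mg v = g then 1 else 0) =
        mcount mg w g + if g₀ = g then 1 else 0 := by
      intro hvw' g
      rw [hasg]
      have h1 := mcount_update (f := σ₁.asg) hvw' i g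
      rw [hun v hvw' le_rfl] at h1
      rw [h1, hcnt]
    rw [runs_ite]
    rcases hstep v hvw hpv0 with ⟨h0, hsrc⟩ | ⟨g, hpgv, hVg, hvw', hmg, hlt⟩
    · refine ⟨fun _ => ?_, fun hb => absurd ?_ hb⟩
      swap
      · simp [c36, c42, h0]
      rw [runs_setNat]
      refine ⟨0, by omega, ?_, hF₂.setNat (by decide) _ _, Or.inr ⟨by simp, ?_⟩⟩
      · simp; omega
      · have e3 : ((σ₂.setNat (Ref.addr lab σ₂ (rf0 58)) (NExp.eval lab σ₂ (NExp.const 1))).nat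
            (36, 0, 0, 0)) = v := by simp [c36]
        have e4 : (σ₂.setNat (Ref.addr lab σ₂ (rf0 58)) (NExp.eval lab σ₂ (NExp.const 1))).asg =
            σ₂.asg := by funext x; simp [Mem.asg]
        rw [e3, Mem.Better, e4]
        rcases hsrc with rfl | ⟨hvw', hk, hl⟩
        · rw [if_pos le_rfl]
          refine Or.inl ⟨rfl, hc.assign.extend hcan hlu ?_ (hVm _ hV₀) ?_⟩
          · intro x hx
            rcases Nat.lt_succ_iff_lt_or_eq.1 hx with h1 | rfl
            · exact hnbr₃ x h1
            · rw [hasg]; simpa using hN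
          · intro g
            rw [mcount_succ, ← hcnt g, mcount_congr (f' := σ₁.asg)]
            · rw [hasg]; simp
            · intro x hx
              rw [hasg]
              simp [hx.ne]
        · rw [if_neg (by omega)]
          refine Or.inr ⟨rfl, hc.assign.reroute hcan hlu hnbr₃ (hc.mg_lt v hvw') hl hk (hcnt₂ hvw')⟩
    · refine ⟨fun hb => absurd hb ?_, fun _ => ?_⟩
      · simp [c36, c42, hpgv]
      rw [runs_setNat]
      simp only [rf0_addr, sub_eval, n1_eval, nv_eval, const_eval, c36, c42, hpgv, Nat.add_sub_cancel]
      have e4 : (σ₂.setNat (53, 0, 0, 0) g).asg = σ₂.asg := by funext x; simp [Mem.asg]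
      refine ⟨pv (par g), hlt, ?_, hF₂.setNat (by decide) _ _, Or.inl ⟨?_, g, by simp, hVg, rfl, ?_⟩⟩
      · simp; omega
      · simpa [hσ₂] using h58
      · rw [e4]
        refine ⟨hnbr₃, by rw [← hmg]; exact hcnt₂ hvw', fun x hx hxn => ?_⟩
        rw [hasg]
        have : x ≠ v := by rintro rfl; omega
        simp only [this, if_false]
        exact hun x hx (by omega)
  · obtain ⟨h1, h2, h3⟩ := hpar_ok g₀ hV₀
    have e4 : ∀ v < w, ((σ.setNat (53, 0, 0, 0) g₀).setNat (58, 0, 0, 0) 0).asg v = mg v := by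
      intro x hx
      rw [← hc.mg_eq x hx]
      simp [Mem.asg]
    refine ⟨?_, ((Frame.refl _).setNat (by decide) _ _).setNat (by decide) _ _,
      Or.inl ⟨by simp, g₀, by simp, hV₀, rfl, ?_, ?_, fun v hv _ => e4 v hv⟩⟩
    · have := hpvw _ h2
      omega
    · intro v hv
      rw [e4 v hv]
      exact hc.assign.nbr v hv
    · intro g
      rw [mcount_congr e4]
  · rintro t₁ σ₁ ⟨n, T, rfl, hb, hT, hF, ⟨h58, -⟩ | ⟨h58, hB⟩⟩
    · simp [h58] at hb
    have f24 : σ₁.nat (24, 0, 0, 0) = w := by rw [hF.nat 24 _ (by decide), hc.w_eq]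
    rw [runs_ite]
    constructor
    · intro hb
      simp [f24] at hb
      rw [if_pos hb] at hB
      rw [inc, runs_setNat]
      refine ⟨?_, (hF.mono (by simp) (by simp) (by simp)).setNat (by decide) _ _, w + 1,
        by simp [f24], ?_⟩
      · simp; omega
      · rw [Mem.Better]
        have e4 : (σ₁.setNat (Ref.addr lab σ₁ (rf0 24)) (NExp.eval lab σ₁
          ((nv 24).add (NExp.const 1)))).asg = σ₁.asg := by funext x; simp [Mem.asg]
        rw [e4]
        exact hB
    · intro hb
      simp [f24] at hb
      rw [if_neg (by omega)] at hB
      rw [runs_skip]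
      refine ⟨?_, hF.mono (by simp) (by simp) (by simp), w, f24, hB⟩
      simp; omega
end
end FairStream

namespace FairStream

/-! ### The longest prefix of the traversal with an assignment -/

/-- The clusters and the tables are rebuilt in every iteration. This is affordable, as their
construction is linear like the search itself. -/
def iterCmd : Cmd :=
  block [buildCmd, loadCmd, sourcesCmd, bfsCmd,
    .ite (.natLe (nv 40) (.const 0)) (.setNat (rf0 23) (.sub (nv 23) (.const 1))) augCmd]

/-- Computes the longest prefix of the traversal whose clusters have an assignment. -/
def matchCmd : Cmd :=
  block [.setNat (rf0 23) (nv 22), .setNat (rf0 24) (.const 0), .loop (ltE (nv 24) (nv 23)) iterCmd]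

/-- The variables of the search. -/
abbrev searchVars : List ℕ :=
  [23, 24, 26, 27, 28, 29, 30, 33, 34, 35, 36, 37, 38, 39, 40, 41, 42, 43, 44, 45, 53, 54, 55, 56,
    57, 58]

/-- The data of the search for an assignment in a guess, which do not change during the search. -/
structure Mem.Level {X : Type*} [MetricSpace X] (σ : Mem X) (lab : X → ℕ) (A : Set X)
    (l u : ℕ → ℕ) (k m : ℕ) (V : ClassView X) (ord : ℕ → ℕ) (near : ℕ → ℕ → ℕ) (rho : ℕ → ℝ)
    (α β : ℝ) : Prop where
  k_eq : σ.nat (0, 0, 0, 0) = k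
  l_eq : ∀ g, σ.nat (1, g, 0, 0) = l g
  u_eq : ∀ g, σ.nat (2, g, 0, 0) = u g
  sumL_eq : σ.nat (47, 0, 0, 0) = ∑ g ∈ Finset.range m, l g
  T_eq : σ.nat (22, 0, 0, 0) = V.cnt
  view_eq : σ.view (σ.nat (12, 0, 0, 0)) = V
  inv : ClassInv lab A A α V
  gonz : Gonz V.piv V.cnt ord near rho (V.cnt + 1)
  ord_eq : ∀ c, σ.nat (20, c, 0, 0) = ord c
  near_eq : ∀ s q, σ.nat (21, s, q, 0) = near s q
  rho_eq : ∀ s, σ.real (4, s, 0, 0) = rho s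
  beta_eq : σ.real (5, 0, 0, 0) = β
  seen : ∀ x ∈ A, σ.Seen (lab x)
  seen_lt : ∀ g, σ.Seen g → g < m

section
variable {X : Type*} [MetricSpace X] {lab : X → ℕ} {σ σ' : Mem X} {A : Set X} {l u : ℕ → ℕ}
  {k m : ℕ} {V : ClassView X} {ord : ℕ → ℕ} {near : ℕ → ℕ → ℕ} {rho : ℕ → ℝ} {α β : ℝ}

theorem Mem.Level.frame' {R P : List ℕ} (h : σ.Level lab A l u k m V ord near rho α β)
    (hF : Frame (48 :: 49 :: searchVars) R P σ σ') (hR : 2 ∉ R ∧ 4 ∉ R ∧ 5 ∉ R) (hP : 2 ∉ P ∧ 3 ∉ P) :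
    σ'.Level lab A l u k m V ord near rho α β := by
  have hs : ∀ g, σ'.Seen g ↔ σ.Seen g := fun g => hF.seen (by decide) (by decide)
  have hv : ∀ j, σ'.view j = σ.view j := fun j => hF.view (by decide) (by decide) (by decide)
    (by decide) hR.1 hP.1 hP.2 j
  constructor
  · rw [hF.nat 0 _ (by decide), h.k_eq]
  · intro g; rw [hF.nat 1 _ (by decide), h.l_eq]
  · intro g; rw [hF.nat 2 _ (by decide), h.u_eq]
  · rw [hF.nat 47 _ (by decide), h.sumL_eq]
  · rw [hF.nat 22 _ (by decide), h.T_eq]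
  · rw [hF.nat 12 _ (by decide), hv, h.view_eq]
  · exact h.inv
  · exact h.gonz
  · intro g; rw [hF.nat 20 _ (by decide), h.ord_eq]
  · intro s q; rw [hF.nat 21 _ (by decide), h.near_eq]
  · intro s; rw [hF.real 4 _ hR.2.1, h.rho_eq]
  · rw [hF.real 5 _ hR.2.2, h.beta_eq]
  · intro x hx; exact (hs _).2 (h.seen x hx)
  · intro g hg; exact h.seen_lt g ((hs g).1 hg)

theorem Mem.Level.frame {R P : List ℕ} (h : σ.Level lab A l u k m V ord near rho α β)
    (hF : Frame searchVars R P σ σ') (hR : 2 ∉ R ∧ 4 ∉ R ∧ 5 ∉ R) (hP : 2 ∉ P ∧ 3 ∉ P) :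
    σ'.Level lab A l u k m V ord near rho α β :=
  h.frame' (hF.mono (by simp) (List.Subset.refl _) (List.Subset.refl _)) hR hP

theorem Mem.Level.setBeta (h : σ.Level lab A l u k m V ord near rho α β) (β' : ℝ) :
    (σ.setReal (5, 0, 0, 0) β').Level lab A l u k m V ord near rho α β' := by
  refine ⟨h.1, h.2, h.3, h.4, h.5, ?_, h.7, h.8, h.9, h.10, ?_, by simp, h.13, h.14⟩
  · rw [view_setReal _ _ _ _ (by decide)]
    exact h.6
  · intro s
    simpa using h.11 s

theorem Mem.Level.seen_nbr (h : σ.Level lab A l u k m V ord near rho α β) {t v g : ℕ}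
    (hN : Nbr V ord near β t v g) : ∃ x ∈ A, lab x = g := by
  obtain ⟨q, p, -, hp, rfl⟩ := hN
  obtain ⟨y, hy, -, hyl, -⟩ := ThinInv.rep h.inv q p hp
  exact ⟨y, hy, hyl⟩

/-- A bound for the size of the data. -/
def Mem.size (σ : Mem X) (V : ClassView X) : ℕ :=
  V.cnt + ∑ q ∈ Finset.range V.cnt, V.len q + σ.nat (4, 0, 0, 0) + 1

theorem iterCmd_spec (hlab : ∀ x, lab x < m) (hlu : ∀ g, l g ≤ u g)
    (h : σ.Level lab A l u k m V ord near rho α β) {t w : ℕ} (h23 : σ.nat (23, 0, 0, 0) = t)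
    (h24 : σ.nat (24, 0, 0, 0) = w) (hwt : w < t) (htT : t ≤ V.cnt)
    (hA : Assign (Nbr V ord near β t) l u k m w σ.asg) :
    Runs lab iterCmd σ fun t' σ' => t' ≤ 5000 * σ.size V ∧ Frame searchVars [] [5] σ σ' ∧
      (∀ v g, σ'.pt (5, v, g, 0) ≠ none → σ.pt (5, v, g, 0) ≠ none ∨ (v < V.cnt ∧ g < m)) ∧
      ((σ'.nat (23, 0, 0, 0) = t - 1 ∧ σ'.nat (24, 0, 0, 0) = w ∧ σ'.asg = σ.asg ∧
          ∀ f, ¬ Assign (Nbr V ord near β t) l u k m t f) ∨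
        (σ'.nat (23, 0, 0, 0) = t ∧ ∃ w', σ'.nat (24, 0, 0, 0) = w' ∧
          σ'.Better (Nbr V ord near β t) l u k m σ.asg w w')) := by
  set N := Nbr V ord near β t with hN
  have hseen : ∀ v g, N v g → σ.Seen g ∧ g < m := by
    intro v g hg
    obtain ⟨x, hx, rfl⟩ := h.seen_nbr hg
    exact ⟨h.seen x hx, hlab x⟩
  simp only [iterCmd, block_cons, block_singleton]
  rw [runs_seq]
  have hrho : (fun s => σ.real (4, s, 0, 0)) = rho := funext h.rho_eq
  refine (buildCmd_spec hlab h.view_eq h.inv (T := V.cnt) (by rw [hrho]; exact h.gonz) h.ord_eq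
    h.near_eq rfl h.T_eq h23 (by omega) htT h.beta_eq).mono_frame ?_
  rintro t₁ σ₁ hF₁ ⟨ht₁, hB₁, hbox₁⟩
  have hG₁ : Frame searchVars [] [5] σ σ₁ := hF₁.mono (by decide) (by decide) (by decide)
  have h₁ := h.frame hG₁ (by decide) (by decide)
  have hasg₁ : ∀ v < w, σ₁.nat (35, v, 0, 0) = σ.asg v := fun v _ => hF₁.nat 35 _ (by decide)
  have hseen₁ : ∀ g, σ₁.Seen g ↔ σ.Seen g := fun g => hF₁.seen (by decide) (by decide)
  have hw₁ : σ₁.nat (24, 0, 0, 0) = w := by rw [hF₁.nat 24 _ (by decide), h24]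
  rw [runs_seq]
  refine (loadCmd_spec (m := m) hw₁ hasg₁ h₁.l_eq (fun v hv => (hseen₁ _).2 (hseen v _ (hA.nbr v hv)).1)
    (fun v hv => (hseen v _ (hA.nbr v hv)).2)).mono_frame ?_
  rintro t₂ σ₂ hF₂ ⟨ht₂, hL₂, hpv₂, hvis₂⟩
  have hG₂ : Frame searchVars [] [5] σ₁ σ₂ := hF₂.mono (by decide) (by decide) (by decide)
  have hP₂ : Frame loadCmd.wN [] [] σ₁ σ₂ := hF₂.mono (by simp) (by decide) (by decide)
  have h₂ := h₁.frame hG₂ (by decide) (by decide)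
  have hG12 := hG₁.self_trans hG₂
  have hseen₂ : ∀ g, σ₂.Seen g ↔ σ.Seen g := fun g => hG12.seen (by decide) (by decide)
  have hasg₂ : ∀ v, σ₂.nat (35, v, 0, 0) = σ.asg v := fun v => by
    rw [hF₂.nat 35 _ (by decide), hF₁.nat 35 _ (by decide)]; rfl
  have hc₂ : σ₂.Ctx N l u k m σ.asg w t := by
    refine ⟨h₂.k_eq, h₂.l_eq, h₂.u_eq, ?_, h₂.sumL_eq, fun v _ => hasg₂ v, hL₂, ?_, ?_, ?_, hwt, hA⟩
    · rw [hF₂.nat 24 _ (by decide), hw₁]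
    · intro v hv g
      simp only [hF₂.nat 28 _ (show 28 ∉ loadCmd.wN by decide),
        hF₂.nat 30 _ (show 30 ∉ loadCmd.wN by decide)]
      rw [hB₁.lists v hv g]
      simp only [hN, Nbr, and_true]
    · intro v g hg
      exact (hseen₂ g).2 (hseen v g hg).1
    · exact h₂.seen_lt
  rw [runs_seq]
  refine (sourcesCmd_spec hc₂ hpv₂ fun g hg => hvis₂ g ((hseen₁ g).2 ((hseen₂ g).1 hg))).mono ?_
  rintro t₃ σ₃ ⟨ht₃, hF₃, hS₃, h38, h40, hV₃, hsrc⟩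
  have hc₃ := hc₂.frame (hF₃.mono (by simp) (by simp) (by simp))
  rw [runs_seq]
  refine (bfsCmd_spec hc₃ hS₃ h38 hV₃).mono ?_
  rintro t₄ σ₄ ⟨ht₄, hE, hS₄, hst, hexp⟩
  have hc₄ := hc₃.ext hE
  have hG₃ : Frame searchVars [] [] σ₂ σ₃ := hF₃.mono (by decide) (by simp) (by simp)
  have hG₄ : Frame searchVars [] [] σ₃ σ₄ := hE.frame.mono (by decide) (by simp) (by simp)
  have hG34 := hG₃.self_trans hG₄
  have hGall : Frame searchVars [] [5] σ σ₄ :=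
    hG12.self_trans (hG34.mono (by simp) (by simp) (by simp))
  have hpt : ∀ x, σ₄.pt (5, x) = σ₁.pt (5, x) := fun x => by
    rw [hG34.pt 5 _ (by simp), hF₂.pt 5 _ (by decide)]
  have hasg₄ : σ₄.asg = σ.asg := by
    funext v
    rw [Mem.asg, hE.frame.nat 35 _ (by decide), hF₃.nat 35 _ (by decide), hasg₂]
  have hsum : ∑ v ∈ Finset.range t, σ₃.nat (28, v, 0, 0) ≤ ∑ q ∈ Finset.range V.cnt, V.len q := by
    refine le_trans (le_of_eq (Finset.sum_congr rfl fun v _ => ?_)) hB₁.sum_le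
    rw [hF₃.nat 28 _ (by decide), hF₂.nat 28 _ (by decide)]
  have hG0 : σ₁.nat (4, 0, 0, 0) = σ.nat (4, 0, 0, 0) := hF₁.nat 4 _ (by decide)
  rw [hG0] at ht₂
  rw [runs_ite]
  constructor
  · intro hb
    simp at hb
    have e23 : σ₄.nat (23, 0, 0, 0) = t := by
      rw [hE.frame.nat 23 _ (by decide), hF₃.nat 23 _ (by decide), hF₂.nat 23 _ (by decide),
        hF₁.nat 23 _ (by decide), h23]
    rw [runs_setNat]
    refine ⟨?_, hGall.setNat (by decide) _ _, ?_, Or.inl ⟨?_, ?_, ?_, ?_⟩⟩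
    · unfold Mem.size
      simp
      omega
    · intro v g hg
      exact hbox₁ v g (by rw [← hpt]; exact hg)
    · simp [e23]
    · simp [hc₄.w_eq]
    · rw [← hasg₄]; funext v; simp [Mem.asg]
    · intro f
      -- The failed search is the certificate: the clusters in the queue and the visited groups form
      -- the obstruction.
      refine hA.not_assign (fun v g hg => (hseen v g hg).2) hwt (Vis := σ₄.Vis)
        (Z := fun v => v ≤ w ∧ σ₄.nat (29, v, 0, 0) ≠ 0) ?_ ?_ ?_ ?_ ?_
      · exact ⟨le_rfl, hE.pv _ (hsrc w le_rfl (Or.inl rfl))⟩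
      · rintro v g ⟨hv, hpv⟩ hg
        exact hexp hb v hv hpv g hg
      · intro v hv hvis
        exact ⟨hv.le, (hst hb _ hvis).2 v hv rfl⟩
      · intro g hg
        exact (hst hb g hg).1
      · intro hk v hv hl
        exact ⟨hv.le, hE.pv _ (hsrc v hv.le (Or.inr ⟨hv, hk, hl⟩))⟩
  · intro hb
    simp at hb
    refine (augCmd_spec hc₄ hS₄ hlu hb).mono ?_
    rintro t₅ σ₅ ⟨ht₅, hF₅, hbet⟩
    refine ⟨?_, hGall.self_trans (hF₅.mono (by decide) (by simp) (by simp)), ?_, Or.inr ⟨?_, hbet⟩⟩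
    · unfold Mem.size
      simp
      omega
    · intro v g hg
      exact hbox₁ v g (by rw [← hpt, ← hF₅.pt 5 _ (by simp)]; exact hg)
    · rw [hF₅.nat 23 _ (by decide), hE.frame.nat 23 _ (by decide), hF₃.nat 23 _ (by decide),
        hF₂.nat 23 _ (by decide), hF₁.nat 23 _ (by decide), h23]

theorem mcount_zero (f : ℕ → ℕ) (g : ℕ) : mcount f 0 g = 0 := rfl

/-- Dropping the last center leaves the remaining clusters intact or enlarges them: a pivot whose
nearest center is an earlier one keeps that center. So an assignment survives the shortening of the
prefix. -/
theorem Nbr.pred (hG : Gonz V.piv V.cnt ord near rho (V.cnt + 1)) {t v g : ℕ} (hv : v < t)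
    (ht : t < V.cnt) (h : Nbr V ord near β (t + 1) v g) : Nbr V ord near β t v g := by
  obtain ⟨q, p, ⟨hq, hn, hd⟩, hp⟩ := h
  refine ⟨q, p, ⟨hq, ?_, hd⟩, hp⟩
  rcases hG.near_step t (by omega) (by omega) q hq with h1 | h1 <;> omega

/-- A partial assignment is never discarded: it is extended, or rerouted with smaller surplus, or
the current prefix is proved infeasible and shortened. Hence the number of searches is linear in the
number of pivots. -/
theorem matchCmd_spec (hlab : ∀ x, lab x < m) (hlu : ∀ g, l g ≤ u g)
    (hl : ∑ g ∈ Finset.range m, l g ≤ k)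
    (h : σ.Level lab A l u k m V ord near rho α β) :
    Runs lab matchCmd σ fun t' σ' => t' ≤ 30000 * ((V.cnt + 1) * σ.size V) ∧
      Frame searchVars [] [5] σ σ' ∧
      (∀ v g, σ'.pt (5, v, g, 0) ≠ none → σ.pt (5, v, g, 0) ≠ none ∨ (v < V.cnt ∧ g < m)) ∧
      ∃ t, σ'.nat (23, 0, 0, 0) = t ∧ t ≤ V.cnt ∧ Assign (Nbr V ord near β t) l u k m t σ'.asg ∧
        ∀ s, t < s → s ≤ V.cnt → ∀ f, ¬ Assign (Nbr V ord near β s) l u k m s f := by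
  simp only [matchCmd, block_cons, block_singleton]
  rw [runs_seq, runs_setNat, runs_seq, runs_setNat]
  -- In the variant `t + 2 * (V.cnt - w) + surplus`, the factor `2` compensates for the unit of
  -- surplus that an extension may create. It starts at `3 * V.cnt`.
  refine (Runs.loop_total (fun n T σ' => T + 5100 * σ.size V * n ≤ 5100 * σ.size V * (3 * V.cnt) ∧
    Frame searchVars [] [5] σ σ' ∧
    (∀ v g, σ'.pt (5, v, g, 0) ≠ none → σ.pt (5, v, g, 0) ≠ none ∨ (v < V.cnt ∧ g < m)) ∧
    ∃ t w, σ'.nat (23, 0, 0, 0) = t ∧ σ'.nat (24, 0, 0, 0) = w ∧ w ≤ t ∧ t ≤ V.cnt ∧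
      Assign (Nbr V ord near β t) l u k m w σ'.asg ∧
      (∀ s, t < s → s ≤ V.cnt → ∀ f, ¬ Assign (Nbr V ord near β s) l u k m s f) ∧
      n = t + 2 * (V.cnt - w) + surplus l m σ'.asg w) ?_ (n := 3 * V.cnt) ?_).mono ?_
  · rintro n T σ₁ ⟨hT, hF, hbox, t, w, h23, h24, hwt, htV, hA, hno, hn⟩ hb
    simp [h23, h24] at hb
    have h₁ := h.frame hF (by decide) (by decide)
    have hsz : σ₁.size V = σ.size V := by rw [Mem.size, Mem.size, hF.nat 4 _ (by decide)]
    refine (iterCmd_spec hlab hlu h₁ h23 h24 hb htV hA).mono ?_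
    rintro t₂ σ₂ ⟨ht₂, hF₂, hbox₂, hcase⟩
    rw [hsz] at ht₂
    have hs1 : 1 ≤ σ.size V := by unfold Mem.size; omega
    have time : ∀ n' < n, T + (1 + (ltE (nv 24) (nv 23)).time + t₂) + 5100 * σ.size V * n' ≤
        5100 * σ.size V * (3 * V.cnt) := by
      intro n' hn'
      have : 5100 * σ.size V * (n' + 1) ≤ 5100 * σ.size V * n := Nat.mul_le_mul_left _ hn'
      rw [Nat.mul_add] at this
      simp
      omega
    have hbox' : ∀ v g, σ₂.pt (5, v, g, 0) ≠ none → σ.pt (5, v, g, 0) ≠ none ∨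
        (v < V.cnt ∧ g < m) := by
      intro v g hg
      rcases hbox₂ v g hg with h1 | h1
      · exact hbox v g h1
      · exact Or.inr h1
    rcases hcase with ⟨h23', h24', hasg, hno'⟩ | ⟨h23', w', h24', hbet⟩
    · obtain ⟨s, rfl⟩ : ∃ s, t = s + 1 := ⟨t - 1, by omega⟩
      have hn' : s + 2 * (V.cnt - w) + surplus l m σ₂.asg w < n := by rw [hasg]; omega
      refine ⟨_, hn', time _ hn', hF.self_trans hF₂, hbox', s, w, by simpa using h23', h24', by omega,
        by omega, ⟨?_, ?_, ?_⟩, ?_, rfl⟩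
      · intro v hv
        rw [hasg]
        exact Nbr.pred h.gonz (by omega) (by omega) (hA.nbr v hv)
      · rw [hasg]; exact hA.le_u
      · rw [hasg]; exact hA.sur_le
      · intro s' hs1 hs2
        rcases (Nat.succ_le_of_lt hs1).eq_or_lt with h1 | h1
        · subst h1; exact hno'
        · exact hno s' h1 hs2
    · rcases hbet with ⟨rfl, hA', hsur⟩ | ⟨rfl, hA', hsur⟩
      · have hn' : t + 2 * (V.cnt - (w + 1)) + surplus l m σ₂.asg (w + 1) < n := by omega
        exact ⟨_, hn', time _ hn', hF.self_trans hF₂, hbox', t, w + 1, h23', h24', by omega, htV, hA',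
          hno, rfl⟩
      · have hn' : t + 2 * (V.cnt - w') + surplus l m σ₂.asg w' < n := by omega
        exact ⟨_, hn', time _ hn', hF.self_trans hF₂, hbox', t, w', h23', h24', by omega, htV, hA',
          hno, rfl⟩
  · refine ⟨by simp, ((Frame.refl _).setNat (by decide) _ _).setNat (by decide) _ _, ?_, V.cnt, 0,
      by simp [h.T_eq], by simp, by omega, le_rfl, ⟨by simp, by simp [mcount_zero], ?_⟩, ?_, ?_⟩
    · intro v g hg
      exact Or.inl (by simpa using hg)
    · simpa [surplus, mcount_zero] using hl
    · intro s h1 h2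
      omega
    · simp [surplus, mcount_zero]
      omega
  · rintro t₁ σ₁ ⟨n, T, rfl, hb, hT, hF, hbox, t, w, h23, h24, hwt, htV, hA, hno, hn⟩
    simp [h23, h24] at hb
    obtain rfl : w = t := by omega
    refine ⟨?_, hF, hbox, w, h23, htV, hA, hno⟩
    have h1 : 5100 * σ.size V * (3 * V.cnt) = 15300 * (V.cnt * σ.size V) := by ring
    have hs1 : 1 ≤ σ.size V := by unfold Mem.size; omega
    rw [h1] at hT
    simp
    rw [Nat.add_mul]
    omega

end
end FairStream

namespace FairStream

/-! ### Keeping the best solution -/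

/-- Copies the current solution. -/
def saveCmd : Cmd :=
  block [.setReal (rf0 6) (.load (rf0 7)), .setNat (rf0 48) (.const 1), .setNat (rf0 49) (nv 23),
    .setNat (rf0 36) (.const 0),
    forUp 36 (nv 23) (.setPoint (rf1 6 (nv 36)) (rf2 5 (nv 36) (n1 35 (nv 36))))]

/-- An upper bound for the cost of the current solution, except for one summand. -/
def boundExp : RExp :=
  .add (.mul (.add (.ofNat (.const 4)) (.mul (.ofNat (.const 8)) (.load (rf0 0))))
    (.load (rf1 2 (nv 12)))) (.load (rf1 4 (nv 23)))

/-- Keeps the current solution if it is better than the best one so far. -/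
def selectCmd : Cmd :=
  .ite (.natLe (.const 1) (nv 23))
    (block [buildCmd,
      .ite (.realLe (.load (rf0 5)) (.load (rf1 4 (nv 23))))
        (.setReal (rf0 7) (.add boundExp (.load (rf0 5))))
        (.setReal (rf0 7) (.add boundExp (.load (rf1 4 (nv 23))))),
      .ite (.not (.and (.natLe (.const 1) (nv 48)) (.realLe (.load (rf0 6)) (.load (rf0 7)))))
        saveCmd .skip]) .skip

/-- Solutions are compared by their guaranteed bounds, not by their costs, which cannot be computed
from the stored points. -/
def runCmd : Cmd := .seq matchCmd selectCmd

/-- The best solution so far is what it should be. -/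
def Mem.Best {X : Type*} [MetricSpace X] (σ : Mem X) (lab : X → ℕ) (A : Set X) (l u : ℕ → ℕ)
    (k m : ℕ) : Prop :=
  σ.nat (48, 0, 0, 0) ≠ 0 → ∃ t f, σ.nat (49, 0, 0, 0) = t ∧
    (∀ v < t, ∃ y ∈ A, σ.pt (6, v, 0, 0) = some y ∧ lab y = f v) ∧ (∀ g, mcount f t g ≤ u g) ∧
    surplus l m f t + ∑ g ∈ Finset.range m, l g ≤ k ∧
    ∀ x ∈ A, ∃ v < t, cellDist (σ.pt (6, v, 0, 0)) (some x) ≤ σ.real (6, 0, 0, 0)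

/-- The best solution has cost at most `E`. -/
def Mem.BestLE {X : Type*} (σ : Mem X) (E : ℝ) : Prop :=
  σ.nat (48, 0, 0, 0) ≠ 0 ∧ σ.real (6, 0, 0, 0) ≤ E

theorem Mem.BestLE.trans {X : Type*} {σ : Mem X} {E E' : ℝ} (h : σ.BestLE E) (hE : E ≤ E') :
    σ.BestLE E' :=
  ⟨h.1, h.2.trans hE⟩

theorem Mem.Best.congr {X : Type*} [MetricSpace X] {σ σ' : Mem X} {lab : X → ℕ} {A : Set X}
    {l u : ℕ → ℕ} {k m : ℕ} (h : σ.Best lab A l u k m)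
    (h48 : σ'.nat (48, 0, 0, 0) = σ.nat (48, 0, 0, 0))
    (h49 : σ'.nat (49, 0, 0, 0) = σ.nat (49, 0, 0, 0))
    (h6 : σ'.real (6, 0, 0, 0) = σ.real (6, 0, 0, 0)) (hp : ∀ x, σ'.pt (6, x) = σ.pt (6, x)) :
    σ'.Best lab A l u k m := by
  unfold Mem.Best
  simp only [h48, h49, h6, hp]
  exact h

/-- The bound for the cost of the solutions that come from the first `t` centers. -/
noncomputable def costBound (α τ β : ℝ) (rho : ℕ → ℝ) (t : ℕ) : ℝ :=
  2 * α * τ + rho t + min β (rho t)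

section
variable {X : Type*} [MetricSpace X] {lab : X → ℕ} {σ σ' : Mem X} {A : Set X} {l u : ℕ → ℕ}
  {k m : ℕ} {V : ClassView X} {ord : ℕ → ℕ} {near : ℕ → ℕ → ℕ} {rho : ℕ → ℝ} {β : ℝ}

/-- A point goes to its pivot (`α * τ`), to the center of the cluster (`rho t`), to the pivot of the
chosen representative (at most `β`, and at most `rho t`), and to that representative (`α * τ`). -/
theorem Gonz.cover {α : ℝ} {t : ℕ} (hG : Gonz V.piv V.cnt ord near rho (V.cnt + 1))
    (hI : ClassInv lab A A α V) (h1 : 1 ≤ t) (ht : t ≤ V.cnt) {f : ℕ → ℕ} {D : ℕ → ℕ → Prop}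
    {n : ℕ} (hB : σ.Built V ord near β t D n) (hD : ∀ q p, D q p)
    (hf : ∀ v < t, Nbr V ord near β t v (f v)) :
    (∀ v < t, ∃ y ∈ A, σ.pt (5, v, f v, 0) = some y ∧ lab y = f v) ∧
    ∀ x ∈ A, ∃ v < t, cellDist (σ.pt (5, v, f v, 0)) (some x) ≤ costBound α V.tau β rho t := by
  have key : ∀ v < t, ∃ q, InCluster V ord near β t v q ∧ ∃ y ∈ A, σ.pt (5, v, f v, 0) = some y ∧
      lab y = f v ∧ cellDist (V.piv q) (some y) ≤ α * V.tau := by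
    intro v hv
    obtain ⟨q, p, hq, hp, hpf⟩ := hf v hv
    obtain ⟨q', p', hq', hp', hpe, hpt⟩ := hB.points v hv q p hq hp (hD _ _)
    obtain ⟨y, hy, hyr, hyl, hd⟩ := ThinInv.rep hI q' p' hp'
    rw [hpe, hpf] at hyr hyl
    rw [hpf] at hpt
    exact ⟨q', hq', y, hy, by rw [hpt, hyr], hyl, by simpa [hq'.1] using hd⟩
  refine ⟨fun v hv => ?_, fun x hx => ?_⟩
  · obtain ⟨q, -, y, hy, hy1, hy2, -⟩ := key v hv
    exact ⟨y, hy, hy1, hy2⟩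
  · obtain ⟨i, hi, ⟨p, -, hp⟩, -, hd⟩ := hI.cov' hx
    have hv := hG.near_lt t h1 (by omega) i hi
    obtain ⟨q, ⟨hq, hqv, hqβ⟩, y, hy, hy1, -, hyd⟩ := key _ hv
    refine ⟨_, hv, ?_⟩
    rw [hy1]
    have hr1 := hG.rho_cov t h1 (by omega) i hi
    have hr2 := hG.rho_cov t h1 (by omega) q hq
    rw [hqv] at hr2
    obtain ⟨c, -, hc⟩ := ThinInv.piv hI (ord (near t i)) (Or.inl (hG.ord_lt _ (by omega)))
    obtain ⟨b, -, hb⟩ := ThinInv.piv hI q (Or.inl hq)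
    rw [hc] at hr1 hr2 hqβ
    rw [hb] at hyd hr2 hqβ
    rw [hp] at hd hr1
    simp only [cellDist_some] at *
    have hmin : dist b c ≤ min β (rho t) := le_min hqβ hr2
    have t1 := dist_triangle y b x
    have t2 := dist_triangle b c x
    have t3 := dist_triangle c p x
    rw [dist_comm y b] at t1
    rw [dist_comm c p] at t3
    unfold costBound
    linarith

theorem selectCmd_spec {ε : ℝ} (hlab : ∀ x, lab x < m)
    (h : σ.Level lab A l u k m V ord near rho (2 + 4 * ε) β) {t : ℕ}
    (hε : σ.real (0, 0, 0, 0) = ε)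
    (h23 : σ.nat (23, 0, 0, 0) = t) (ht : t ≤ V.cnt)
    (hA : Assign (Nbr V ord near β t) l u k m t σ.asg) (hB : σ.Best lab A l u k m) :
    Runs lab selectCmd σ fun t' σ' => t' ≤ 1000 * σ.size V ∧
      Frame (48 :: 49 :: searchVars) [6, 7] [5, 6] σ σ' ∧
      (∀ v g, σ'.pt (5, v, g, 0) ≠ none → σ.pt (5, v, g, 0) ≠ none ∨ (v < V.cnt ∧ g < m)) ∧
      (∀ v, σ'.pt (6, v, 0, 0) ≠ none → σ.pt (6, v, 0, 0) ≠ none ∨ v < V.cnt) ∧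
      σ'.Best lab A l u k m ∧ (∀ E, σ.BestLE E → σ'.BestLE E) ∧
      (1 ≤ t → σ'.BestLE (costBound (2 + 4 * ε) V.tau β rho t)) := by
  rw [selectCmd, runs_ite]
  constructor
  swap
  · intro hb
    simp [h23] at hb
    rw [runs_skip]
    refine ⟨?_, Frame.refl _, fun _ _ => Or.inl, fun _ => Or.inl, hB, fun _ => id, by omega⟩
    unfold Mem.size; simp; omega
  intro hb
  simp [h23] at hb
  simp only [block_cons, block_singleton]
  rw [runs_seq]
  have hrho : (fun s => σ.real (4, s, 0, 0)) = rho := funext h.rho_eq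
  refine (buildCmd_spec hlab h.view_eq h.inv (T := V.cnt) (by rw [hrho]; exact h.gonz) h.ord_eq
    h.near_eq rfl h.T_eq h23 (by omega) ht h.beta_eq).mono_frame ?_
  rintro t₁ σ₁ hF₁ ⟨ht₁, hB₁, hbox₁⟩
  have hG₁ : Frame searchVars [] [5] σ σ₁ := hF₁.mono (by decide) (by decide) (by decide)
  have h₁ := h.frame hG₁ (by decide) (by decide)
  have e23 : σ₁.nat (23, 0, 0, 0) = t := by rw [hF₁.nat 23 _ (by decide), h23]
  have e0 : σ₁.real (0, 0, 0, 0) = ε := by rw [hF₁.real 0 _ (by decide), hε]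
  have e2 : σ₁.real (2, σ₁.nat (12, 0, 0, 0), 0, 0) = V.tau := by
    rw [← h₁.view_eq]; rfl
  have hasg : ∀ v, σ₁.nat (35, v, 0, 0) = σ.asg v := fun v => by
    rw [hF₁.nat 35 _ (by decide)]; rfl
  obtain ⟨hpt, hcov⟩ := h.gonz.cover h.inv hb ht hB₁ (fun _ _ => trivial) hA.nbr
  have main : ∀ (t₂ : ℕ) (E : ℝ), t₂ ≤ 100 → E = costBound (2 + 4 * ε) V.tau β rho t →
      Runs lab (.ite (.not (.and (.natLe (.const 1) (nv 48))
        (.realLe (.load (rf0 6)) (.load (rf0 7))))) saveCmd .skip) (σ₁.setReal (7, 0, 0, 0) E)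
      fun t' σ' => t₁ + t₂ + t' + 20 ≤ 1000 * σ.size V ∧
      Frame (48 :: 49 :: searchVars) [6, 7] [5, 6] σ σ' ∧
      (∀ v g, σ'.pt (5, v, g, 0) ≠ none → σ.pt (5, v, g, 0) ≠ none ∨ (v < V.cnt ∧ g < m)) ∧
      (∀ v, σ'.pt (6, v, 0, 0) ≠ none → σ.pt (6, v, 0, 0) ≠ none ∨ v < V.cnt) ∧
      σ'.Best lab A l u k m ∧ (∀ E, σ.BestLE E → σ'.BestLE E) ∧
      (1 ≤ t → σ'.BestLE (costBound (2 + 4 * ε) V.tau β rho t)) := by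
    intro t₂ E ht₂ hE
    have hG₂ : Frame (48 :: 49 :: searchVars) [6, 7] [5, 6] σ (σ₁.setReal (7, 0, 0, 0) E) :=
      (hG₁.mono (by simp) (by simp) (by simp)).setReal (by simp) _ _
    have hp6 : ∀ x, σ₁.pt (6, x) = σ.pt (6, x) := fun x => hF₁.pt 6 _ (by decide)
    have f48 : σ₁.nat (48, 0, 0, 0) = σ.nat (48, 0, 0, 0) := hF₁.nat 48 _ (by decide)
    have f49 : σ₁.nat (49, 0, 0, 0) = σ.nat (49, 0, 0, 0) := hF₁.nat 49 _ (by decide)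
    have f6 : σ₁.real (6, 0, 0, 0) = σ.real (6, 0, 0, 0) := hF₁.real 6 _ (by decide)
    rw [runs_ite]
    constructor
    · intro hb'
      simp [f48, f6] at hb'
      simp only [saveCmd, block_cons, block_singleton]
      rw [runs_seq, runs_setReal, runs_seq, runs_setNat, runs_seq, runs_setNat, runs_seq, runs_setNat]
      simp only [rf0_addr, load_eval, const_eval, nv_eval, setReal_real, if_true]
      have g23 : (((σ₁.setReal (7, 0, 0, 0) E).setReal (6, 0, 0, 0) E).setNat (48, 0, 0, 0) 1).nat
          (23, 0, 0, 0) = t := by simp [e23]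
      rw [g23]
      set σ₃ := ((((σ₁.setReal (7, 0, 0, 0) E).setReal (6, 0, 0, 0) E).setNat (48, 0, 0, 0) 1).setNat
        (49, 0, 0, 0) t).setNat (36, 0, 0, 0) 0 with hσ₃
      have hG₃ : Frame (48 :: 49 :: searchVars) [6, 7] [5, 6] σ σ₃ :=
        (((hG₂.setReal (by simp) _ _).setNat (by simp) _ _).setNat (by simp) _ _).setNat
          (by simp) _ _
      refine (Runs.forUp t 30 (fun i σ' => Frame [36] [] [6] σ₃ σ' ∧
        (∀ v < i, σ'.pt (6, v, 0, 0) = σ₁.pt (5, v, σ.asg v, 0)) ∧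
        (∀ v, i ≤ v → σ'.pt (6, v, 0, 0) = σ₃.pt (6, v, 0, 0))) (by decide) ?_ ?_ ?_ ?_).mono ?_
      · rintro i σ' ⟨hF, -⟩
        rw [nv_eval, hF.nat 23 _ (by decide)]
        simp [hσ₃, e23]
      · rintro i σ₄ hi h36 ⟨hF, hdone, htodo⟩
        obtain ⟨y, hy, hy1, -⟩ := hpt i hi
        have c35 : σ₄.nat (35, i, 0, 0) = σ.asg i := by
          rw [hF.nat 35 _ (by decide)]; simp [hσ₃, hasg]
        have c5 : σ₄.pt (5, i, σ.asg i, 0) = some y := by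
          rw [hF.pt 5 _ (by decide)]; simp [hσ₃, hy1]
        rw [runs_setPoint]
        refine ⟨y, by simp [h36, c35, c5], by simp, ?_, ?_, ?_⟩
        · simp only [rf1_addr, nv_eval, h36]
          exact (hF.setPoint (by simp) _ _).setNat (by simp) _ _
        · intro v hv
          simp [h36]
          rcases Nat.lt_succ_iff_lt_or_eq.1 hv with h1 | rfl
          · rw [if_neg h1.ne, hdone v h1]
          · simp [hy1]
        · intro v hv
          simp [h36]
          rw [if_neg (by omega), htodo v (by omega)]
      · simp [hσ₃]
      · exact ⟨Frame.refl _, by simp, fun _ _ => rfl⟩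
      · rintro t₅ σ₅ ⟨ht₅, -, hF, hdone, htodo⟩
        have d48 : σ₅.nat (48, 0, 0, 0) = 1 := by
          rw [hF.nat 48 _ (by decide)]; simp [hσ₃]
        have d49 : σ₅.nat (49, 0, 0, 0) = t := by
          rw [hF.nat 49 _ (by decide)]; simp [hσ₃]
        have d6 : σ₅.real (6, 0, 0, 0) = E := by
          rw [hF.real 6 _ (by decide)]; simp [hσ₃]
        refine ⟨?_, hG₃.self_trans (hF.mono (by simp) (by simp) (by simp)), ?_, ?_, ?_, ?_, ?_⟩
        · simp at ht₅ ⊢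
          unfold Mem.size
          omega
        · intro v g hg
          rw [hF.pt 5 _ (by decide)] at hg
          exact hbox₁ v g (by simpa [hσ₃] using hg)
        · intro v hv
          rcases lt_or_ge v t with h1 | h1
          · exact Or.inr (h1.trans_le ht)
          · rw [htodo v h1] at hv
            exact Or.inl (by simpa [hσ₃, hp6] using hv)
        · intro _
          refine ⟨t, σ.asg, d49, ?_, hA.le_u, hA.sur_le, ?_⟩
          · intro v hv
            rw [hdone v hv]
            exact hpt v hv
          · intro x hx
            obtain ⟨v, hv, hvx⟩ := hcov x hx
            exact ⟨v, hv, by rw [hdone v hv, d6, hE]; exact hvx⟩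
        · rintro E' ⟨h1, h2⟩
          refine ⟨by rw [d48]; exact one_ne_zero, ?_⟩
          rw [d6]
          have := hb' (by omega)
          linarith
        · intro _
          exact ⟨by rw [d48]; exact one_ne_zero, by rw [d6, hE]⟩
    · intro hb'
      simp [f48, f6] at hb'
      rw [runs_skip]
      refine ⟨?_, hG₂, ?_, ?_, ?_, ?_, ?_⟩
      · unfold Mem.size
        simp
        omega
      · intro v g hg
        exact hbox₁ v g (by simpa using hg)
      · intro v hv
        exact Or.inl (by simpa [hp6] using hv)
      · exact hB.congr (by simpa using f48) (by simpa using f49) (by simpa using f6)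
          (by simpa using hp6)
      · rintro E' ⟨h1, h2⟩
        exact ⟨by simpa [f48] using h1, by simpa [f6] using h2⟩
      · intro _
        refine ⟨?_, ?_⟩
        · simp [f48]; omega
        · simp [f6]; linarith
  have fin : ∀ (t₂ : ℕ) (e : RExp), e.eval lab σ₁ = costBound (2 + 4 * ε) V.tau β rho t →
      t₂ + e.time ≤ 80 → Runs lab (.setReal (rf0 7) e) σ₁ fun t₃ σ' => Runs lab
      (.ite (.not (.and (.natLe (.const 1) (nv 48))
        (.realLe (.load (rf0 6)) (.load (rf0 7))))) saveCmd .skip) σ'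
      fun t' σ' => t₁ + (t₂ + t₃) + t' + 20 ≤ 1000 * σ.size V ∧
      Frame (48 :: 49 :: searchVars) [6, 7] [5, 6] σ σ' ∧
      (∀ v g, σ'.pt (5, v, g, 0) ≠ none → σ.pt (5, v, g, 0) ≠ none ∨ (v < V.cnt ∧ g < m)) ∧
      (∀ v, σ'.pt (6, v, 0, 0) ≠ none → σ.pt (6, v, 0, 0) ≠ none ∨ v < V.cnt) ∧
      σ'.Best lab A l u k m ∧ (∀ E, σ.BestLE E → σ'.BestLE E) ∧
      (1 ≤ t → σ'.BestLE (costBound (2 + 4 * ε) V.tau β rho t)) := by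
    intro t₂ e he ht
    rw [runs_setReal]
    exact main _ _ (by simp; omega) he
  rw [runs_seq, runs_ite]
  have hbd : boundExp.eval lab σ₁ = 2 * (2 + 4 * ε) * V.tau + rho t := by
    simp [boundExp, e0, e2, e23, h₁.rho_eq]
    left
    ring
  constructor
  · intro hb'
    simp [h₁.beta_eq, e23, h₁.rho_eq] at hb'
    refine (fin 30 _ ?_ (by simp [boundExp])).mono ?_
    · rw [radd_eval, hbd, load_eval, rf0_addr, h₁.beta_eq, costBound, min_eq_left hb']
    · intro t₃ σ₃ h3
      refine h3.mono ?_
      rintro t₄ σ₄ ⟨ht₄, h4⟩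
      refine ⟨?_, h4⟩
      simp
      omega
  · intro hb'
    simp [h₁.beta_eq, e23, h₁.rho_eq] at hb'
    refine (fin 30 _ ?_ (by simp [boundExp])).mono ?_
    · rw [radd_eval, hbd, load_eval, rf1_addr, nv_eval, e23, h₁.rho_eq, costBound,
        min_eq_right hb'.le]
    · intro t₃ σ₃ h3
      refine h3.mono ?_
      rintro t₄ σ₄ ⟨ht₄, h4⟩
      refine ⟨?_, h4⟩
      simp
      omega

/-- The prefix found is at least as long as any prefix `s` with an assignment. As `rho` is antitone,
so is `costBound`, and the bound obtained is no worse than the one for `s`. -/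
theorem runCmd_spec {ε : ℝ} (hlab : ∀ x, lab x < m) (hlu : ∀ g, l g ≤ u g)
    (hl : ∑ g ∈ Finset.range m, l g ≤ k)
    (h : σ.Level lab A l u k m V ord near rho (2 + 4 * ε) β) (hε : σ.real (0, 0, 0, 0) = ε)
    (hB : σ.Best lab A l u k m) :
    Runs lab runCmd σ fun t' σ' => t' ≤ 31001 * ((V.cnt + 1) * σ.size V) ∧
      Frame (48 :: 49 :: searchVars) [6, 7] [5, 6] σ σ' ∧
      (∀ v g, σ'.pt (5, v, g, 0) ≠ none → σ.pt (5, v, g, 0) ≠ none ∨ (v < V.cnt ∧ g < m)) ∧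
      (∀ v, σ'.pt (6, v, 0, 0) ≠ none → σ.pt (6, v, 0, 0) ≠ none ∨ v < V.cnt) ∧
      σ'.Best lab A l u k m ∧ (∀ E, σ.BestLE E → σ'.BestLE E) ∧
      ∀ s f, 1 ≤ s → s ≤ V.cnt → Assign (Nbr V ord near β s) l u k m s f →
        σ'.BestLE (costBound (2 + 4 * ε) V.tau β rho s) := by
  rw [runCmd, runs_seq]
  refine (matchCmd_spec hlab hlu hl h).mono_frame ?_
  rintro t₁ σ₁ hF₁ ⟨ht₁, hG₁, hbox₁, t, h23, ht, hA, hno⟩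
  have h₁ := h.frame hG₁ (by decide) (by decide)
  have hsz : σ₁.size V = σ.size V := by rw [Mem.size, Mem.size, hG₁.nat 4 _ (by decide)]
  have f48 : σ₁.nat (48, 0, 0, 0) = σ.nat (48, 0, 0, 0) := hG₁.nat 48 _ (by decide)
  have f49 : σ₁.nat (49, 0, 0, 0) = σ.nat (49, 0, 0, 0) := hG₁.nat 49 _ (by decide)
  have f6 : σ₁.real (6, 0, 0, 0) = σ.real (6, 0, 0, 0) := hG₁.real 6 _ (by decide)
  have hp6 : ∀ x, σ₁.pt (6, x) = σ.pt (6, x) := fun x => hG₁.pt 6 _ (by decide)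
  refine (selectCmd_spec hlab h₁ (by rw [hG₁.real 0 _ (by decide), hε]) h23 ht hA
    (hB.congr f48 f49 f6 hp6)).mono ?_
  rintro t₂ σ₂ ⟨ht₂, hG₂, hb5, hb6, hB₂, hmon, hval⟩
  refine ⟨?_, (hG₁.mono (by simp) (by simp) (by simp)).self_trans hG₂, ?_, ?_, hB₂, ?_, ?_⟩
  · rw [hsz] at ht₂
    have : 1 ≤ σ.size V := by unfold Mem.size; omega
    rw [Nat.add_mul] at ht₁ ⊢
    omega
  · intro v g hg
    rcases hb5 v g hg with h1 | h1
    · exact hbox₁ v g h1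
    · exact Or.inr h1
  · intro v hv
    simpa [hp6] using hb6 v hv
  · rintro E ⟨h1, h2⟩
    exact hmon E ⟨by rwa [f48], by rwa [f6]⟩
  · intro s f hs1 hs hAs
    have hst : s ≤ t := by
      by_contra hcon
      exact hno s (by omega) hs f hAs
    refine (hval (by omega)).trans ?_
    have := h.gonz.rho_anti hs1 hst (by omega)
    unfold costBound
    have := min_le_min_left β this
    linarith
end
end FairStream

namespace FairStream

/-! ### Comparison with an optimal solution -/

/-- `C` is a fair solution for the points `A`. -/
structure FairSet {X : Type*} (lab : X → ℕ) (A : Set X) (l u : ℕ → ℕ) (k : ℕ) (C : Finset X) :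
    Prop where
  sub : ∀ x ∈ C, x ∈ A
  card : C.card = k
  ge : ∀ g, l g ≤ (C.filter fun x => lab x = g).card
  le : ∀ g, (C.filter fun x => lab x = g).card ≤ u g

/-- The points of `A` have distance at most `r` to `C`. -/
def Covers {X : Type*} [MetricSpace X] (A : Set X) (C : Finset X) (r : ℝ) : Prop :=
  ∀ x ∈ A, ∃ c ∈ C, dist x c ≤ r

section
variable {X : Type*} [MetricSpace X] {lab : X → ℕ} {A : Set X} {l u : ℕ → ℕ} {k m J : ℕ}
  {C : Finset X} {r ε : ℝ} {V : ClassView X} {ord : ℕ → ℕ} {near : ℕ → ℕ → ℕ} {rho : ℕ → ℝ} {α β : ℝ}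

theorem PackBound.of_covers (hC : C.card = k) (h : Covers A C r) : PackBound A k r := by
  intro f hf
  choose c hc hd using fun i => h (f i) (hf i)
  obtain ⟨i, -, j, -, hij, hcij⟩ := Finset.exists_ne_map_eq_of_card_lt_of_maps_to
    (s := (Finset.univ : Finset (Fin (k + 1)))) (t := C) (f := c) (by simp [hC]) (fun i _ => hc i)
  have key : dist (f i) (f j) ≤ 2 * r := by
    have h1 := hd i
    have h2 := hd j
    rw [hcij] at h1
    have := dist_triangle_right (f i) (f j) (c j)
    linarith
  rcases hij.lt_or_gt with h1 | h1
  · exact ⟨i, j, h1, key⟩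
  · exact ⟨j, i, h1, by rwa [dist_comm]⟩

/-- Among `V.cnt + 1` centers chosen from `V.cnt` pivots two coincide, so the last separation is
zero. -/
theorem Gonz.rho_last (hG : Gonz V.piv V.cnt ord near rho (V.cnt + 1))
    (hI : ClassInv lab A A α V) : rho V.cnt ≤ 0 := by
  obtain ⟨a, ha, b, hb, hab, he⟩ := Finset.exists_ne_map_eq_of_card_lt_of_maps_to
    (s := Finset.range (V.cnt + 1)) (t := Finset.range V.cnt) (f := ord) (by simp)
    (fun i hi => by
      have := hG.ord_lt i (by simpa using hi)
      simpa using this)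
  have key : ∀ a b, a < b → b < V.cnt + 1 → ord a = ord b → rho V.cnt ≤ 0 := by
    intro a b hab hb he
    have := hG.sep (c := V.cnt) (by omega) hab (by omega)
    rw [he] at this
    obtain ⟨p, -, hp⟩ := ThinInv.piv hI (ord b) (Or.inl (hG.ord_lt b hb))
    simpa [hp] using this
  simp only [Finset.mem_range] at ha hb
  rcases hab.lt_or_gt with h | h
  · exact key a b h hb he
  · exact key b a h ha he.symm

/-- A fair solution yields an assignment of the clusters of a prefix of the traversal that
covers the pivots sufficiently well. -/
theorem Gonz.exists_assign (hG : Gonz V.piv V.cnt ord near rho (V.cnt + 1))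
    (hI : ClassInv lab A A α V) (h1 : 1 ≤ V.cnt) (hlab : ∀ x, lab x < m) (hC : FairSet lab A l u k C)
    (hr : Covers A C r) (hD : 0 ≤ r + α * V.tau) (hατ : 0 ≤ α * V.tau)
    (hβ : r + α * V.tau ≤ β ∨ rho 1 ≤ β) :
    ∃ s f, 1 ≤ s ∧ s ≤ V.cnt ∧ rho s ≤ 2 * (r + α * V.tau) ∧
      Assign (Nbr V ord near β s) l u k m s f := by
  classical
  -- The least such `s` is taken: then the first `s` centers are still at mutual distances more than
  -- `2 * (r + α * V.tau)`.
  have hex : ∃ s, 1 ≤ s ∧ rho s ≤ 2 * (r + α * V.tau) :=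
    ⟨V.cnt, h1, (hG.rho_last hI).trans (by linarith)⟩
  obtain ⟨s, hs⟩ : ∃ s, s = Nat.find hex := ⟨_, rfl⟩
  obtain ⟨hs1, hsr⟩ := hs ▸ Nat.find_spec hex
  have hsT : s ≤ V.cnt := hs ▸ Nat.find_min' hex ⟨h1, (hG.rho_last hI).trans (by linarith)⟩
  have hmin : ∀ c, 1 ≤ c → c < s → 2 * (r + α * V.tau) < rho c := by
    intro c hc hcs
    by_contra hcon
    exact Nat.find_min hex (hs ▸ hcs) ⟨hc, not_lt.1 hcon⟩
  have hpiv : ∀ v < s, ∃ p ∈ A, V.piv (ord v) = some p := fun v hv =>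
    ThinInv.piv hI _ (Or.inl (hG.ord_lt v (by omega)))
  have hsep : ∀ a b, a < s → b < s → a ≠ b →
      2 * (r + α * V.tau) < cellDist (V.piv (ord a)) (V.piv (ord b)) := by
    have key : ∀ a b, a < b → b < s →
        2 * (r + α * V.tau) < cellDist (V.piv (ord a)) (V.piv (ord b)) := fun a b hab hb =>
      (hmin (s - 1) (by omega) (by omega)).trans_le (hG.sep (by omega) hab (by omega))
    intro a b ha hb hab
    rcases hab.lt_or_gt with h | h
    · exact key a b h hb
    · rw [cellDist_comm]; exact key b a h ha
  have hcen : ∀ v, ∃ c : X, v < s → c ∈ C ∧ cellDist (V.piv (ord v)) (some c) ≤ r := by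
    intro v
    by_cases hv : v < s
    · obtain ⟨p, hp, hpe⟩ := hpiv v hv
      obtain ⟨c, hc, hd⟩ := hr p hp
      exact ⟨c, fun _ => ⟨hc, by simpa [hpe] using hd⟩⟩
    · obtain ⟨p, -⟩ := hpiv 0 (by omega)
      exact ⟨p, fun h => absurd h hv⟩
  choose c hc using hcen
  -- A common center of the solution would bring two centers of the traversal within `2 * r`.
  have hinj : ∀ a < s, ∀ b < s, c a = c b → a = b := by
    intro a ha b hb hab
    by_contra hne
    have h2 := hsep a b ha hb hne
    have h3 := cellDist_triangle (V.piv (ord a)) (V.piv (ord b)) (c a)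
    have h4 := (hc a ha).2
    have h5 := (hc b hb).2
    rw [← hab, cellDist_comm] at h5
    linarith
  have hnbr : ∀ v < s, Nbr V ord near β s v (lab (c v)) := by
    intro v hv
    obtain ⟨hcC, hcd⟩ := hc v hv
    obtain ⟨i, hi, ⟨q, -, hq⟩, ⟨p, hp, hpl⟩, hd⟩ := hI.cov' (hC.sub _ hcC)
    have hiv : cellDist (V.piv i) (V.piv (ord v)) ≤ r + α * V.tau := by
      refine (cellDist_triangle _ _ (c v)).trans ?_
      rw [cellDist_comm (some _) (V.piv (ord v))]
      linarith
    have hns := hG.near_lt s hs1 (by omega) i hi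
    -- The pivot `i` near `c v` is within `r + α * V.tau` of the center `v`; a different nearest
    -- center would be within twice that of `v`.
    have hnear : near s i = v := by
      by_contra hne
      have h2 := hsep _ _ hns hv hne
      have h3 := cellDist_triangle (V.piv (ord (near s i))) (V.piv (ord v)) q
      have h4 := hG.near_min s hs1 (by omega) i hi v hv
      rw [← hq] at h3
      rw [cellDist_comm (V.piv i)] at h4
      linarith
    refine ⟨i, p, ⟨hi, hnear, ?_⟩, hp, hpl⟩
    -- Either `β` admits the distance just found, or `β ≥ rho 1` excludes no pivot at all.
    rcases hβ with hβ | hβ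
    · exact hiv.trans hβ
    · have h2 := hG.rho_cov s hs1 (by omega) i hi
      rw [hnear] at h2
      exact h2.trans ((hG.rho_anti le_rfl hs1 (by omega)).trans hβ)
  have hcount : ∀ g, mcount (fun v => lab (c v)) s g ≤ (C.filter fun x => lab x = g).card := by
    intro g
    refine Finset.card_le_card_of_injOn c ?_ ?_
    · intro v hv
      simp only [Finset.coe_filter, Finset.mem_range, Set.mem_ofPred_eq] at hv ⊢
      exact ⟨(hc v hv.1).1, hv.2⟩
    · intro a ha b hb hab
      simp only [Finset.coe_filter, Finset.mem_range, Set.mem_ofPred_eq] at ha hb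
      exact hinj a ha.1 b hb.1 hab
  refine ⟨s, fun v => lab (c v), hs1, hsT, hsr, hnbr, fun g => (hcount g).trans (hC.le g), ?_⟩
  -- The surplus and the lower bounds add up to the sum of the maxima of counts and lower bounds,
  -- and each maximum is at most the number of points of `C` in the group.
  have hsum : ∑ g ∈ Finset.range m, (C.filter fun x => lab x = g).card = k := by
    rw [← hC.card]
    exact (Finset.card_eq_sum_card_fiberwise fun x _ => by simpa using hlab x).symm
  rw [← hsum]
  unfold surplus
  rw [← Finset.sum_add_distrib]
  refine Finset.sum_le_sum fun g _ => ?_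
  have := hcount g
  have := hC.ge g
  omega

/-- Among the guesses there is one that is slightly above `r`, or one that is much smaller. -/
theorem exists_guess (hg : Grid ε J) {L : ℝ} {τ : ℕ → ℝ}
    (h : ∀ j < J, Lattice A k ε J L j (τ j)) (hr0 : 0 ≤ r) (hr : PackBound A k r) :
    ∃ j < J, (r ≤ τ j ∧ τ j ≤ (1 + ε) * r) ∨ τ j ≤ 2 * ε * r := by
  have hJ := hg.J_pos
  have hε := hg.pos
  have hε2 := hg.le_half
  have hR2 := hg.two_le
  have h1 : (1 : ℝ) < 1 + ε := by linarith
  obtain ⟨hL0, hLr, -⟩ := h 0 hJ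
  replace hLr := hLr r hr0 hr
  -- With the base `0` every guess is `0`, which counts as much smaller than `r`.
  rcases hL0.eq_or_lt with rfl | hL0
  · obtain ⟨-, -, e, he, -⟩ := h 0 hJ
    refine ⟨0, hJ, Or.inr ?_⟩
    rw [he, zero_mul, zero_mul]
    positivity
  have hex : ∃ a : ℕ, r ≤ L * (1 + ε) ^ a := by
    obtain ⟨a, ha⟩ := pow_unbounded_of_one_lt (r / L) h1
    refine ⟨a, ?_⟩
    rw [div_lt_iff₀ hL0] at ha
    linarith
  obtain ⟨a, ha⟩ : ∃ a, a = Nat.find hex := ⟨_, rfl⟩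
  have har : r ≤ L * (1 + ε) ^ a := ha ▸ Nat.find_spec hex
  have har' : L * (1 + ε) ^ a ≤ (1 + ε) * r := by
    rcases Nat.eq_zero_or_pos a with h0 | h0
    · rw [h0, pow_zero]; nlinarith
    · have := Nat.find_min hex (m := a - 1) (by omega)
      rw [not_le] at this
      have h2 : (1 + ε) ^ a = (1 + ε) ^ (a - 1) * (1 + ε) := by
        rw [← pow_succ, Nat.sub_add_cancel h0]
      rw [h2]
      nlinarith
  -- The exponent `a` of the first lattice value above `r` is split into the residue, which selects
  -- the guess, and the quotient, which is the ideal number of raises.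
  refine ⟨a % J, Nat.mod_lt _ hJ, ?_⟩
  obtain ⟨-, -, e, he, hor⟩ := h (a % J) (Nat.mod_lt _ hJ)
  have hmod : a % J + J * (a / J) = a := Nat.mod_add_div a J
  have hpow : ∀ e, L * (1 + ε) ^ (a % J) * ((1 + ε) ^ J) ^ e = L * (1 + ε) ^ (a % J + J * e) := by
    intro e
    rw [pow_add, pow_mul, mul_assoc]
  -- The guess was never raised beyond the ideal value: before its last raise it was below `r`.
  have hlt : e ≤ a / J := by
    rcases hor with rfl | hor
    · exact Nat.zero_le _
    · have h2 := (hor r hr).trans_le har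
      rw [hpow] at h2
      have h3 := lt_of_mul_lt_mul_left h2 hL0.le
      rw [pow_lt_pow_iff_right₀ h1] at h3
      have h4 : J * (e - 1) < J * (a / J) := by linarith
      have := Nat.lt_of_mul_lt_mul_left h4
      omega
  rw [hpow] at he
  rcases hlt.eq_or_lt with rfl | hlt
  · left
    rw [he, hmod]
    exact ⟨har, har'⟩
  -- At least one raise is missing, so the guess is below `(1 + ε) * r` by the factor `(1 + ε) ^ J ≥
  -- 1 / ε`.
  · right
    have h2 : τ (a % J) * (1 + ε) ^ J ≤ (1 + ε) * r := by
      rw [he, mul_assoc, ← pow_add]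
      refine le_trans (mul_le_mul_of_nonneg_left (pow_le_pow_right₀ h1.le ?_) hL0.le) har'
      have : J * (e + 1) ≤ J * (a / J) := Nat.mul_le_mul_left _ hlt
      rw [Nat.mul_add] at this
      omega
    have hone := hg.one_le
    have h3 : 0 ≤ τ (a % J) := by rw [he]; positivity
    have h4 : τ (a % J) * 1 ≤ τ (a % J) * (ε * (1 + ε) ^ J) := mul_le_mul_of_nonneg_left hone h3
    have h5 : ε * (τ (a % J) * (1 + ε) ^ J) ≤ ε * ((1 + ε) * r) :=
      mul_le_mul_of_nonneg_left h2 hε.le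
    have h6 : ε * ((1 + ε) * r) ≤ 2 * ε * r := by
      have : (1 + ε) * r ≤ 2 * r := mul_le_mul_of_nonneg_right (by linarith) hr0
      nlinarith
    linarith

theorem costBound_near {τ : ℝ} {t : ℕ} (hε : 0 ≤ ε) (hε2 : ε ≤ 1 / 2)
    (hτ : τ ≤ (1 + ε) * r) (hr0 : 0 ≤ r) (hρ : rho t ≤ 2 * (r + (2 + 4 * ε) * τ)) :
    costBound (2 + 4 * ε) τ ((3 + 4 * ε) * τ) rho t ≤ (13 + 41 * ε) * r := by
  have h1 : min ((3 + 4 * ε) * τ) (rho t) ≤ (3 + 4 * ε) * τ := min_le_left _ _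
  -- With `α = 2 + 4 * ε` the multiples of `τ` are `2 * α`, again `2 * α` from `rho t`, and `3 + 4 *
  -- ε` from `β`. The terms in `ε` are `31 * ε + 20 * ε ^ 2`, at most `41 * ε`.
  have h2 : (11 + 20 * ε) * τ ≤ (11 + 20 * ε) * ((1 + ε) * r) :=
    mul_le_mul_of_nonneg_left hτ (by linarith)
  have h3 : ε * ε * r ≤ 1 / 2 * ε * r := by
    apply mul_le_mul_of_nonneg_right _ hr0
    nlinarith
  unfold costBound
  nlinarith

/-- For tiny `τ` no restriction by `β` is needed: the bound is about `2 * rho t`, hence about `4 *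
r`, plus a multiple of `ε * r`, and this is far below the limit. -/
theorem costBound_far {τ : ℝ} {t : ℕ} (hε2 : ε ≤ 1 / 2) (hτ0 : 0 ≤ τ)
    (hτ : τ ≤ 2 * ε * r) (hr0 : 0 ≤ r) (hρ : rho t ≤ 2 * (r + (2 + 4 * ε) * τ)) :
    costBound (2 + 4 * ε) τ β rho t ≤ (13 + 41 * ε) * r := by
  have h1 : min β (rho t) ≤ rho t := min_le_right _ _
  have h2 : (2 + 4 * ε) * τ ≤ 4 * τ := mul_le_mul_of_nonneg_right (by linarith) hτ0
  have h3 : 0 ≤ (9 - 7 * ε) * r := mul_nonneg (by linarith) hr0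
  unfold costBound
  nlinarith

end
end FairStream

namespace FairStream

/-! ### Solving all guesses -/

/-- Solves the guess `jj`, with and without a bound for the radius of the clusters. -/
def classCmd : Cmd :=
  block [gonzCmd,
    .setReal (rf0 5) (.mul (.add (.ofNat (.const 3)) (.mul (.ofNat (.const 4)) (.load (rf0 0))))
      (.load (rf1 2 (nv 12)))), runCmd,
    .setReal (rf0 5) (.load (rf1 4 (.const 1))), runCmd]

def solveCmd : Cmd :=
  block [maintCmd, .setNat (rf0 47) (.const 0), .setNat (rf0 13) (.const 0),
    forUp 13 (nv 4) (.setNat (rf0 47) (.add (nv 47) (n1 1 (n1 5 (nv 13))))),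
    .setNat (rf0 48) (.const 0), .setNat (rf0 12) (.const 0), forUp 12 (nv 3) classCmd]

/-- The data for the last phase, which do not change. -/
structure Mem.Base {X : Type*} [MetricSpace X] (σ : Mem X) (lab : X → ℕ) (A : Set X)
    (l u : ℕ → ℕ) (k m : ℕ) (ε : ℝ) : Prop where
  k_eq : σ.nat (0, 0, 0, 0) = k
  l_eq : ∀ g, σ.nat (1, g, 0, 0) = l g
  u_eq : ∀ g, σ.nat (2, g, 0, 0) = u g
  eps_eq : σ.real (0, 0, 0, 0) = ε
  seen : ∀ x ∈ A, σ.Seen (lab x)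
  seen_lt : ∀ g, σ.Seen g → g < m

section
variable {X : Type*} {lab : X → ℕ} {σ : Mem X} {A : Set X} {l : ℕ → ℕ} {k m : ℕ}

/-- A group with a positive lower bound occurs in the stream, so summing over the groups seen gives
the full sum without a loop over all `m` groups. -/
theorem Mem.Pool.sum_eq (hp : σ.Pool lab A k m) (hlab : ∀ x, lab x < m)
    (hl0 : ∀ g, l g ≠ 0 → ∃ x ∈ A, lab x = g) :
    ∑ i ∈ Finset.range (σ.nat (4, 0, 0, 0)), l (σ.nat (5, i, 0, 0)) = ∑ g ∈ Finset.range m, l g := by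
  have hinj : Set.InjOn (fun i => σ.nat (5, i, 0, 0)) (Finset.range (σ.nat (4, 0, 0, 0))) := by
    intro i hi j hj hij
    exact hp.GL_inj i (Finset.mem_range.1 hi) j (Finset.mem_range.1 hj) hij
  rw [← Finset.sum_image (f := l) hinj]
  refine Finset.sum_subset ?_ ?_
  · intro g hg
    obtain ⟨i, hi, rfl⟩ := Finset.mem_image.1 hg
    obtain ⟨x, -, hx⟩ := hp.GL_mem i (Finset.mem_range.1 hi)
    rw [← hx]
    exact Finset.mem_range.2 (hlab x)
  · intro g _ hg
    by_contra hne
    obtain ⟨x, hx, rfl⟩ := hl0 g hne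
    obtain ⟨i, hi, he⟩ := hp.seen x hx
    exact hg (Finset.mem_image.2 ⟨i, Finset.mem_range.2 hi, he⟩)

end

section
variable {X : Type*} [MetricSpace X] {lab : X → ℕ} {σ σ' : Mem X} {A : Set X} {l u : ℕ → ℕ}
  {k m J : ℕ} {V : ClassView X} {ε : ℝ}

theorem Mem.Base.frame {N R P : List ℕ} (h : σ.Base lab A l u k m ε) (hF : Frame N R P σ σ')
    (hN : 0 ∉ N ∧ 1 ∉ N ∧ 2 ∉ N ∧ 4 ∉ N ∧ 5 ∉ N) (hR : 0 ∉ R) : σ'.Base lab A l u k m ε := by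
  obtain ⟨h0, h1, h2, h4, h5⟩ := hN
  refine ⟨?_, ?_, ?_, ?_, ?_, ?_⟩
  · rw [hF.nat 0 _ h0, h.k_eq]
  · intro g; rw [hF.nat 1 _ h1, h.l_eq]
  · intro g; rw [hF.nat 2 _ h2, h.u_eq]
  · rw [hF.real 0 _ hR, h.eps_eq]
  · intro x hx; exact (hF.seen h4 h5).2 (h.seen x hx)
  · intro g hg; exact h.seen_lt g ((hF.seen h4 h5).1 hg)

/-- It is not known whether a guess is close to `r` or far below it, so both radii are tried. For `r
≤ τ` the radius `(3 + 4 * ε) * τ` admits the distance `r + α * τ`; for a small guess `rho 1` admits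
everything. -/
theorem classCmd_spec (hlab : ∀ x, lab x < m) (hlu : ∀ g, l g ≤ u g)
    (hl : ∑ g ∈ Finset.range m, l g ≤ k) (h : σ.Base lab A l u k m ε)
    (h47 : σ.nat (47, 0, 0, 0) = ∑ g ∈ Finset.range m, l g)
    (hV : σ.view (σ.nat (12, 0, 0, 0)) = V) (hI : ClassInv lab A A (2 + 4 * ε) V)
    (hc : 1 ≤ V.cnt) (hτ : 0 ≤ V.tau) (hε : 0 ≤ ε) (hε2 : ε ≤ 1 / 2) (hB : σ.Best lab A l u k m) :
    Runs lab classCmd σ fun t' σ' => t' ≤ 70000 * ((V.cnt + 1) * σ.size V) ∧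
      (∀ v g, σ'.pt (5, v, g, 0) ≠ none → σ.pt (5, v, g, 0) ≠ none ∨ (v < V.cnt ∧ g < m)) ∧
      (∀ v, σ'.pt (6, v, 0, 0) ≠ none → σ.pt (6, v, 0, 0) ≠ none ∨ v < V.cnt) ∧
      σ'.Best lab A l u k m ∧ (∀ E, σ.BestLE E → σ'.BestLE E) ∧
      ∀ C r, 0 ≤ r → FairSet lab A l u k C → Covers A C r →
        (r ≤ V.tau ∧ V.tau ≤ (1 + ε) * r) ∨ V.tau ≤ 2 * ε * r →
        σ'.BestLE ((13 + 41 * ε) * r) := by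
  simp only [classCmd, block_cons, block_singleton]
  rw [runs_seq]
  have hT : σ.nat (8, σ.nat (12, 0, 0, 0), 0, 0) = V.cnt := by rw [← hV]; rfl
  refine (gonzCmd_spec hT hc).mono_frame ?_
  rintro t₁ σ₁ hF₁ ⟨ht₁, h22, hG⟩
  have hb₁ := h.frame hF₁ (by decide) (by decide)
  have hv₁ : ∀ j, σ₁.view j = σ.view j := fun j => hF₁.view (by decide) (by decide) (by decide)
    (by decide) (by decide) (by decide) (by decide) j
  have e12 : σ₁.nat (12, 0, 0, 0) = σ.nat (12, 0, 0, 0) := hF₁.nat 12 _ (by decide)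
  have hV₁ : σ₁.view (σ₁.nat (12, 0, 0, 0)) = V := by rw [e12, hv₁, hV]
  unfold Mem.IsGonz at hG
  rw [hv₁, hV] at hG
  obtain ⟨ord, hord⟩ : ∃ ord : ℕ → ℕ, ∀ c, σ₁.nat (20, c, 0, 0) = ord c := ⟨_, fun _ => rfl⟩
  obtain ⟨near, hnear⟩ : ∃ near : ℕ → ℕ → ℕ, ∀ s q, σ₁.nat (21, s, q, 0) = near s q :=
    ⟨_, fun _ _ => rfl⟩
  obtain ⟨rho, hrho⟩ : ∃ rho : ℕ → ℝ, ∀ s, σ₁.real (4, s, 0, 0) = rho s := ⟨_, fun _ => rfl⟩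
  simp only [hord, hnear, hrho] at hG
  have hL : σ₁.Level lab A l u k m V ord near rho (2 + 4 * ε) (σ₁.real (5, 0, 0, 0)) :=
    ⟨hb₁.k_eq, hb₁.l_eq, hb₁.u_eq, by rw [hF₁.nat 47 _ (by decide), h47], h22, hV₁, hI, hG, hord,
      hnear, hrho, rfl, hb₁.seen, hb₁.seen_lt⟩
  have hB₁ : σ₁.Best lab A l u k m := hB.congr (hF₁.nat 48 _ (by decide)) (hF₁.nat 49 _ (by decide))
    (hF₁.real 6 _ (by decide)) (fun x => hF₁.pt 6 _ (by decide))
  have e2 : σ₁.real (2, σ₁.nat (12, 0, 0, 0), 0, 0) = V.tau := by rw [← hV₁]; rfl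
  rw [runs_seq, runs_setReal]
  have hβ : RExp.eval lab σ₁ (.mul (.add (.ofNat (.const 3)) (.mul (.ofNat (.const 4))
      (.load (rf0 0)))) (.load (rf1 2 (nv 12)))) = (3 + 4 * ε) * V.tau := by
    simp [hb₁.eps_eq, e2]
  rw [hβ, rf0_addr, runs_seq]
  refine (runCmd_spec hlab hlu hl (hL.setBeta _) (by simpa using hb₁.eps_eq)
    (hB₁.congr rfl rfl (by simp) (by simp))).mono ?_
  rintro t₂ σ₂ ⟨ht₂, hF₂, h5₂, h6₂, hB₂, hm₂, hE₂⟩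
  have hL₂ := (hL.setBeta ((3 + 4 * ε) * V.tau)).frame' hF₂ (by decide) (by decide)
  have e0 : σ₂.real (0, 0, 0, 0) = ε := by
    rw [hF₂.real 0 _ (by decide)]; simpa using hb₁.eps_eq
  rw [runs_seq, runs_setReal]
  have hβ₂ : RExp.eval lab σ₂ (.load (rf1 4 (.const 1))) = rho 1 := by simp [hL₂.rho_eq]
  rw [hβ₂, rf0_addr]
  refine (runCmd_spec hlab hlu hl (hL₂.setBeta _) (by simpa using e0)
    (hB₂.congr rfl rfl (by simp) (by simp))).mono ?_
  rintro t₃ σ₃ ⟨ht₃, hF₃, h5₃, h6₃, hB₃, hm₃, hE₃⟩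
  have hm₂' : ∀ E, σ₂.BestLE E → σ₃.BestLE E := fun E hE => hm₃ E ⟨hE.1, by simpa using hE.2⟩
  refine ⟨?_, ?_, ?_, hB₃, ?_, ?_⟩
  · have s1 : (σ₁.setReal (5, 0, 0, 0) ((3 + 4 * ε) * V.tau)).size V = σ.size V := by
      simp [Mem.size, hF₁.nat 4 _ (by decide : 4 ∉ gonzCmd.wN)]
    have s2 : (σ₂.setReal (5, 0, 0, 0) (rho 1)).size V = σ.size V := by
      rw [← s1]
      simp [Mem.size, hF₂.nat 4 _ (by decide)]
    rw [s1] at ht₂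
    rw [s2] at ht₃
    have hs : V.cnt + 1 ≤ σ.size V := by unfold Mem.size; omega
    have h1 : (V.cnt + 2) * (V.cnt + 2) ≤ 4 * ((V.cnt + 1) * σ.size V) := by
      calc (V.cnt + 2) * (V.cnt + 2) ≤ (2 * (V.cnt + 1)) * (2 * (V.cnt + 1)) := by
            apply Nat.mul_le_mul <;> omega
        _ = 4 * ((V.cnt + 1) * (V.cnt + 1)) := by ring
        _ ≤ _ := by gcongr
    have h2 : 1 ≤ (V.cnt + 1) * σ.size V := Nat.mul_pos (by omega) (by omega)
    rw [Nat.mul_assoc] at ht₁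
    simp
    omega
  · intro v g hg
    rcases h5₃ v g hg with h1 | h1
    · rcases h5₂ v g (by simpa using h1) with h2 | h2
      · left
        rw [← hF₁.pt 5 _ (by decide)]
        simpa using h2
      · exact Or.inr h2
    · exact Or.inr h1
  · intro v hv
    rcases h6₃ v hv with h1 | h1
    · rcases h6₂ v (by simpa using h1) with h2 | h2
      · left
        rw [← hF₁.pt 6 _ (by decide)]
        simpa using h2
      · exact Or.inr h2
    · exact Or.inr h1
  · rintro E ⟨h1, h2⟩
    refine hm₂' E (hm₂ E ⟨?_, ?_⟩)
    · rw [setReal_nat, hF₁.nat 48 _ (by decide)]; exact h1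
    · simpa [hF₁.real 6 _ (by decide)] using h2
  · intro C r hr0 hC hr hcase
    have hατ : 0 ≤ (2 + 4 * ε) * V.tau := mul_nonneg (by linarith) hτ
    rcases hcase with ⟨hn1, hn2⟩ | hfar
    · obtain ⟨s, f, hs1, hs, hsr, hA⟩ := hG.exists_assign (β := (3 + 4 * ε) * V.tau) hI hc hlab hC hr
        (by linarith) hατ (Or.inl (by linarith))
      exact (hm₂' _ (hE₂ s f hs1 hs hA)).trans (costBound_near hε hε2 hn2 hr0 hsr)
    · obtain ⟨s, f, hs1, hs, hsr, hA⟩ := hG.exists_assign (β := rho 1) hI hc hlab hC hr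
        (by linarith) hατ (Or.inr le_rfl)
      exact (hE₃ s f hs1 hs hA).trans (costBound_far hε2 hτ hfar hr0 hsr)

/-- The state after all guesses have been solved. -/
structure Mem.Solved (σ : Mem X) (lab : X → ℕ) (A : Set X) (l u : ℕ → ℕ) (k m : ℕ) (ε : ℝ) : Prop
    where
  base : σ.Base lab A l u k m ε
  pool : σ.Pool lab A k m
  best : σ.Best lab A l u k m
  bestLE : ∀ C r, 0 ≤ r → FairSet lab A l u k C → Covers A C r → σ.BestLE ((13 + 41 * ε) * r)

theorem solveCmd_spec (hlab : ∀ x, lab x < m) (hg : Grid ε J) {n : ℕ}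
    (h : σ.Stream lab A k m ε J n) (hlu : ∀ g, l g ≤ u g)
    (hl : ∑ g ∈ Finset.range m, l g ≤ k) (hl0 : ∀ g, l g ≠ 0 → ∃ x ∈ A, lab x = g)
    (h1 : ∀ g, σ.nat (1, g, 0, 0) = l g) (h2 : ∀ g, σ.nat (2, g, 0, 0) = u g) (hA : A.Nonempty)
    (hkn : k ≤ n) :
    Runs lab solveCmd σ fun t' σ' => t' ≤ σ.potential k J + (J + 1) * (2000000 * (k * n)) ∧
      (∀ v g, σ'.pt (5, v, g, 0) ≠ none → σ.pt (5, v, g, 0) ≠ none ∨ (v < k ∧ g < m)) ∧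
      (∀ v, σ'.pt (6, v, 0, 0) ≠ none → σ.pt (6, v, 0, 0) ≠ none ∨ v < k) ∧
      (∀ j < J, (σ'.view j).Box (2 * k) m) ∧ (∀ j, J ≤ j → (σ'.view j).Box 0 0) ∧
      σ'.Solved lab A l u k m ε := by
  have hk : 1 ≤ k := by have := h.counter_lt; omega
  have hε := hg.pos
  have hbase : σ.Base lab A l u k m ε := by
    refine ⟨h.params.k_eq, h1, h2, h.params.eps_eq, h.pool.seen, ?_⟩
    rintro g ⟨i, hi, rfl⟩
    obtain ⟨x, -, hx⟩ := h.pool.GL_mem i hi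
    exact hx ▸ hlab x
  simp only [solveCmd, block_cons, block_singleton]
  rw [runs_seq]
  refine (maintCmd_spec hlab hg h.params hk h.guesses h.counter_lt.le hA).mono_frame ?_
  rintro t₁ σ₁ hF₁ ⟨hG, hun, ht₁⟩
  have hb₁ := hbase.frame hF₁ (by decide) (by decide)
  have hp₁ := hF₁.pool (by decide) (by decide) (by decide) (by decide) h.pool
  have hP₁ := hF₁.params (by decide) (by decide) (by decide) (by decide) h.params
  obtain ⟨G, hG4⟩ : ∃ G, σ₁.nat (4, 0, 0, 0) = G := ⟨_, rfl⟩
  have hGn : G ≤ n := by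
    rw [← hG4, hF₁.nat 4 _ (by decide)]
    exact h.groups_le
  obtain ⟨L, hok⟩ := hG.ok
  rw [runs_seq, runs_setNat, runs_seq, runs_setNat, runs_seq]
  refine (Runs.forUp G 60 (fun i σ' => Frame [13, 47] [] [] σ₁ σ' ∧
    σ'.nat (47, 0, 0, 0) = ∑ j ∈ Finset.range i, l (σ₁.nat (5, j, 0, 0))) (by decide)
    ?_ ?_ ?_ ?_).mono ?_
  · rintro i σ' ⟨hF, -⟩
    rw [nv_eval, hF.nat 4 _ (by decide), hG4]
  · rintro i σ' hi h13 ⟨hF, h47⟩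
    rw [runs_setNat]
    refine ⟨by simp, (hF.setNat (by decide) _ _).setNat (by simp) _ _, ?_⟩
    rw [Finset.sum_range_succ, ← h47]
    simp [h13, hF.nat 5 _ (show 5 ∉ [13, 47] by decide), hF.nat 1 _ (show 1 ∉ [13, 47] by decide),
      hb₁.l_eq]
  · simp
  · exact ⟨((Frame.refl _).setNat (by decide) _ _).setNat (by decide) _ _, by simp⟩
  rintro t₂ σ₂ ⟨ht₂, -, hF₂, h47⟩
  rw [← hG4, hp₁.sum_eq hlab hl0] at h47
  have hb₂ := hb₁.frame hF₂ (by decide) (by decide)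
  have hp₂ := hF₂.pool (by decide) (by decide) (by decide) (by decide) hp₁
  have hP₂ := hF₂.params (by decide) (by decide) (by decide) (by decide) hP₁
  have hv₂ : ∀ j, σ₂.view j = σ₁.view j := fun j => hF₂.view (by decide) (by decide) (by decide)
    (by decide) (by decide) (by decide) (by decide) j
  rw [runs_seq, runs_setNat, runs_seq, runs_setNat]
  simp only [rf0_addr, const_eval]
  set σ₃ := (σ₂.setNat (48, 0, 0, 0) 0).setNat (12, 0, 0, 0) 0 with hσ₃
  have hF₃ : Frame [12, 48] [] [] σ₂ σ₃ := ((Frame.refl _).setNat (by simp) _ _).setNat (by simp) _ _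
  have hb₃ := hb₂.frame hF₃ (by decide) (by decide)
  have hp₃ := hF₃.pool (by decide) (by decide) (by decide) (by decide) hp₂
  have hP₃ := hF₃.params (by decide) (by decide) (by decide) (by decide) hP₂
  have hv₃ : ∀ j, σ₃.view j = σ₁.view j := fun j => (hF₃.view (by decide) (by decide) (by decide)
    (by decide) (by decide) (by decide) (by decide) j).trans (hv₂ j)
  have hp13 : ∀ a, σ₃.pt a = σ₁.pt a := fun a => by
    rw [hF₃.pt a.1 a.2 (by simp), hF₂.pt a.1 a.2 (by simp)]
  refine (Runs.forUp J (70000 * ((k + 1) * (k + n + n + 1)))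
    (fun i σ' => σ'.Base lab A l u k m ε ∧ σ'.Pool lab A k m ∧ σ'.nat (3, 0, 0, 0) = J ∧
      σ'.nat (4, 0, 0, 0) = G ∧
      σ'.nat (47, 0, 0, 0) = ∑ g ∈ Finset.range m, l g ∧ (∀ j, σ'.view j = σ₁.view j) ∧
      (∀ v g, σ'.pt (5, v, g, 0) ≠ none → σ.pt (5, v, g, 0) ≠ none ∨ (v < k ∧ g < m)) ∧
      (∀ v, σ'.pt (6, v, 0, 0) ≠ none → σ.pt (6, v, 0, 0) ≠ none ∨ v < k) ∧
      σ'.Best lab A l u k m ∧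
      ∀ j < i, ∀ C r, 0 ≤ r → FairSet lab A l u k C → Covers A C r →
        (r ≤ (σ₁.view j).tau ∧ (σ₁.view j).tau ≤ (1 + ε) * r) ∨ (σ₁.view j).tau ≤ 2 * ε * r →
        σ'.BestLE ((13 + 41 * ε) * r)) (by decide) ?_ ?_ ?_ ?_).mono ?_
  · rintro i σ' ⟨-, -, h3, -⟩
    exact h3
  · rintro i σ₄ hi h12 ⟨hb₄, hp₄, h3, h4, h47₄, hv₄, h5, h6, hB, hE⟩
    have hoki := hok i hi
    have hcnt : (σ₁.view i).cnt ≤ k := hG.cnt i hi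
    have hc1 : 1 ≤ (σ₁.view i).cnt := by
      obtain ⟨x, hx⟩ := hA
      obtain ⟨q, hq, -⟩ := hoki.inv.cov' hx
      omega
    refine (classCmd_spec hlab hlu hl hb₄ h47₄ (V := σ₁.view i) (by rw [h12, hv₄]) hoki.inv hc1
      hoki.tau_nonneg hε.le hg.le_half hB).mono_frame ?_
    rintro t₅ σ₅ hF₅ ⟨ht₅, h5₅, h6₅, hB₅, hm₅, hE₅⟩
    have hview : ∀ j, (σ₅.setNat (12, 0, 0, 0) (i + 1)).view j = σ₅.view j := fun j =>
      view_setNat _ _ _ _ (by decide) (by decide) (by decide) (by decide)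
    have hF12 : Frame [12] [] [] σ₅ (σ₅.setNat (12, 0, 0, 0) (i + 1)) :=
      (Frame.refl _).setNat (by simp) _ _
    have hsz : σ₄.size (σ₁.view i) ≤ k + n + n + 1 := by
      have hw := hG.weight i hi
      have hlen : ∑ q ∈ Finset.range (σ₁.view i).cnt, (σ₁.view i).len q ≤ n := by
        refine le_trans ?_ hw
        unfold ClassView.weight
        simp only [one_mul]
        exact Finset.sum_le_sum_of_subset (Finset.range_subset_range.2 (by omega))
      unfold Mem.size
      omega
    refine ⟨ht₅.trans ?_, (hb₄.frame hF₅ (by decide) (by decide)).frame hF12 (by decide) (by decide),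
      hF12.pool (by decide) (by decide) (by decide) (by decide)
        (hF₅.pool (by decide) (by decide) (by decide) (by decide) hp₄), ?_, ?_, ?_, ?_, ?_, ?_, ?_, ?_⟩
    · gcongr
    · simpa [hF₅.nat 3 _ (show 3 ∉ classCmd.wN by decide)] using h3
    · simpa [hF₅.nat 4 _ (show 4 ∉ classCmd.wN by decide)] using h4
    · simpa [hF₅.nat 47 _ (show 47 ∉ classCmd.wN by decide)] using h47₄
    · intro j
      rw [hview, hF₅.view (by decide) (by decide) (by decide) (by decide) (by decide) (by decide)
        (by decide), hv₄]
    · intro v g hvg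
      rcases h5₅ v g (by simpa using hvg) with a | a
      · exact h5 v g a
      · exact Or.inr ⟨by omega, a.2⟩
    · intro v hv
      rcases h6₅ v (by simpa using hv) with a | a
      · exact h6 v a
      · exact Or.inr (by omega)
    · exact hB₅.congr (by simp) (by simp) (by simp) (by simp)
    · have hset : ∀ E, σ₅.BestLE E → (σ₅.setNat (12, 0, 0, 0) (i + 1)).BestLE E := fun E h =>
        ⟨by simpa using h.1, h.2⟩
      intro j hj C r hr0 hC hr hcase
      rcases Nat.lt_succ_iff_lt_or_eq.1 hj with a | rfl
      · exact hset _ (hm₅ _ (hE j a C r hr0 hC hr hcase))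
      · exact hset _ (hE₅ C r hr0 hC hr hcase)
  · simp [hσ₃]
  · refine ⟨hb₃, hp₃, hP₃.J_eq, ?_, ?_, hv₃, ?_, ?_, ?_, by simp⟩
    · rw [hF₃.nat 4 _ (by decide), hF₂.nat 4 _ (by decide), hG4]
    · rw [hF₃.nat 47 _ (by decide), h47]
    · intro v g hvg
      left
      rwa [hp13, hF₁.pt 5 _ (by decide)] at hvg
    · intro v hv
      left
      rwa [hp13, hF₁.pt 6 _ (by decide)] at hv
    · intro h48
      exact absurd (by simp [hσ₃]) h48
  · rintro t₄ σ₄ ⟨ht₄, -, hb₄, hp₄, -, -, -, hv₄, h5, h6, hB, hE⟩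
    refine ⟨?_, h5, h6, ?_, ?_, hb₄, hp₄, hB, ?_⟩
    · have e1 : k * k ≤ k * n := Nat.mul_le_mul_left _ hkn
      have e2 : 1 * n ≤ k * n := Nat.mul_le_mul_right _ hk
      have e3 : (2 * k + 2) * (2 * k + 2) ≤ 16 * (k * n) := by
        calc (2 * k + 2) * (2 * k + 2) ≤ (4 * k) * (4 * k) := by apply Nat.mul_le_mul <;> omega
          _ = 16 * (k * k) := by ring
          _ ≤ _ := by omega
      have e4 : (k + 1) * (k + n + n + 1) ≤ 8 * (k * n) := by
        calc (k + 1) * (k + n + n + 1) ≤ (2 * k) * (4 * n) := by apply Nat.mul_le_mul <;> omega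
          _ = 8 * (k * n) := by ring
      have e5 : (J + 1) * (25000 * ((2 * k + 2) * (2 * k + 2))) ≤ (J + 1) * (400000 * (k * n)) := by
        apply Nat.mul_le_mul_left; omega
      have e6 : (J + 1) * (70000 * ((k + 1) * (k + n + n + 1)) + (nv 3).time + 20) ≤
          (J + 1) * (600000 * (k * n)) := by
        apply Nat.mul_le_mul_left
        simp only [nv_time]
        omega
      have e7 : (G + 1) * (60 + (nv 4).time + 20) ≤ (J + 1) * (200 * (k * n)) := by
        calc (G + 1) * (60 + (nv 4).time + 20) ≤ 200 * (k * n) := by simp only [nv_time]; omega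
          _ = 1 * (200 * (k * n)) := (one_mul _).symm
          _ ≤ _ := Nat.mul_le_mul_right _ (by omega)
      have e8 : 1 * (k * n) ≤ (J + 1) * (k * n) := Nat.mul_le_mul_right _ (by omega)
      have e9 : (J + 1) * (25000 * ((2 * k + 2) * (2 * k + 2))) ≤ 400000 * ((J + 1) * (k * n)) := by
        refine e5.trans (le_of_eq (by ring))
      have e10 : (J + 1) * (600000 * (k * n)) = 600000 * ((J + 1) * (k * n)) := by ring
      have e11 : (J + 1) * (200 * (k * n)) = 200 * ((J + 1) * (k * n)) := by ring
      have e12 : (J + 1) * (2000000 * (k * n)) = 2000000 * ((J + 1) * (k * n)) := by ring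
      rw [e10] at e6
      rw [e11] at e7
      rw [e12]
      have hpot : 400 * ∑ j ∈ Finset.range J, (σ.view j).weight id (2 * k) ≤ σ.potential k J :=
        Nat.le_add_right _ _
      simp only [nv_time, rf0_time, const_time] at ht₄ ht₂ e6 e7 ⊢
      omega
    · intro j hj
      rw [hv₄]
      exact (hok j hj).box
    · intro j hj
      rw [hv₄, hun j hj]
      exact h.unused j hj
    · intro C r hr0 hC hr
      -- The value `r` is itself a packing bound, so the lattice of guesses can be compared with it;
      -- the best bound over all guesses is at most that of the guess `j`.
      obtain ⟨j, hj, hcase⟩ := exists_guess hg (fun j hj => (hok j hj).lattice) hr0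
        (PackBound.of_covers hC.card hr)
      exact hE j hj C r hr0 hC hr hcase

end
end FairStream

namespace FairStream

/-! ### Completing the best solution to a fair one -/

/-- Appends the point in the cell `src` to the output, unless the output has `k` points, or it
contains the point, or it has enough points of the group according to the array `a`. -/
def tryAddCmd (src : Ref) (a : ℕ) : Cmd :=
  .ite (.and (ltE (nv 50) (nv 0)) (ltE (n1 51 (grp src)) (n1 a (grp src))))
    (block [.setNat (rf0 46) (.const 0),
      .loop (.and (ltE (nv 46) (nv 50)) (ltR (.ofNat (.const 0)) (.dist (rf1 1 (nv 46)) src)))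
        (inc 46),
      .ite (ltE (nv 46) (nv 50)) .skip
        (block [.setPoint (rf1 1 (nv 50)) src,
          .setNat (rf1 51 (grp src)) (.add (n1 51 (grp src)) (.const 1)), inc 50])])
    .skip

def fillPoolCmd (a : ℕ) : Cmd :=
  .seq (.setNat (rf0 14) (.const 0)) (forUp 14 (nv 4) (.seq (.setNat (rf0 13) (.const 0))
    (forUp 13 (n1 6 (n1 5 (nv 14))) (tryAddCmd (rf2 4 (n1 5 (nv 14)) (nv 13)) a))))

def fillCmd : Cmd :=
  block [.setNat (rf0 45) (.const 0), forUp 45 (nv 49) (tryAddCmd (rf1 6 (nv 45)) 2),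
    fillPoolCmd 1, fillPoolCmd 2]

/-- The number of points of the group `g`. -/
def groupCard {X : Type*} (lab : X → ℕ) (C : Finset X) (g : ℕ) : ℕ :=
  (C.filter fun x => lab x = g).card

/-- The output consists of the points of `C`. -/
structure Mem.Out {X : Type*} (σ : Mem X) (lab : X → ℕ) (C : Finset X) : Prop where
  tot : σ.nat (50, 0, 0, 0) = C.card
  mem : σ.Outputs C.card C
  oc : ∀ g, σ.nat (51, g, 0, 0) = groupCard lab C g
  empty : ∀ j, σ.pt (1, j, 0, 0) = none ↔ C.card ≤ j

/-- `C'` arises from `C` by adding points of `P` within the bounds `k` and `cap`. -/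
structure Grow {X : Type*} (lab : X → ℕ) (cap : ℕ → ℕ) (k : ℕ) (P : Set X) (C C' : Finset X) :
    Prop where
  sub : C ⊆ C'
  mem : ∀ y ∈ C', y ∈ C ∨ y ∈ P
  card : C'.card ≤ max C.card k
  count : ∀ g, groupCard lab C' g ≤ max (groupCard lab C g) (cap g)

/-- The point `x` is in `C` or cannot be added. -/
def Tried {X : Type*} (lab : X → ℕ) (cap : ℕ → ℕ) (k : ℕ) (C : Finset X) (x : X) : Prop :=
  x ∈ C ∨ k ≤ C.card ∨ cap (lab x) ≤ groupCard lab C (lab x)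

section
variable {X : Type*} {lab : X → ℕ} {cap l u : ℕ → ℕ} {k m : ℕ} {P P' : Set X} {C C' C'' : Finset X}
  {x : X}

theorem groupCard_mono (h : C ⊆ C') (g : ℕ) : groupCard lab C g ≤ groupCard lab C' g :=
  Finset.card_le_card (Finset.filter_subset_filter _ h)

theorem sum_groupCard (hlab : ∀ x, lab x < m) (C : Finset X) :
    ∑ g ∈ Finset.range m, groupCard lab C g = C.card :=
  (Finset.card_eq_sum_card_fiberwise fun x _ => Finset.mem_coe.2 (Finset.mem_range.2 (hlab x))).symm

theorem Grow.refl : Grow lab cap k P C C :=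
  ⟨subset_rfl, fun _ h => .inl h, le_max_left _ _, fun _ => le_max_left _ _⟩

theorem Grow.trans (h : Grow lab cap k P C C') (h' : Grow lab cap k P C' C'') :
    Grow lab cap k P C C'' := by
  refine ⟨h.sub.trans h'.sub, fun y hy => ?_, ?_, fun g => ?_⟩
  · rcases h'.mem y hy with a | a
    · exact h.mem y a
    · exact .inr a
  · have := h.card; have := h'.card; omega
  · have := h.count g; have := h'.count g; omega

theorem Grow.mono (h : Grow lab cap k P C C') (hP : P ⊆ P') : Grow lab cap k P' C C' :=
  ⟨h.sub, fun y hy => (h.mem y hy).imp_right fun a => hP a, h.card, h.count⟩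

theorem Tried.mono (h : Tried lab cap k C x) (hC : C ⊆ C') : Tried lab cap k C' x :=
  h.imp (fun a => hC a) (Or.imp (fun a => a.trans (Finset.card_le_card hC))
    fun a => a.trans (groupCard_mono hC _))

variable {σ σ' : Mem X} {A : Set X} {n : ℕ}

theorem Mem.Out.congr (h : σ.Out lab C) (h50 : σ'.nat (50, 0, 0, 0) = σ.nat (50, 0, 0, 0))
    (h51 : ∀ g, σ'.nat (51, g, 0, 0) = σ.nat (51, g, 0, 0))
    (h1 : ∀ j, σ'.pt (1, j, 0, 0) = σ.pt (1, j, 0, 0)) : σ'.Out lab C := by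
  refine ⟨by rw [h50, h.tot], ?_, fun g => by rw [h51, h.oc], fun j => by rw [h1, h.empty j]⟩
  intro x
  simp only [outputCell, h1]
  exact h.mem x

/-- The occupied cells of the pool hold distinct points of the stream, so scanning the pool takes at
most as many iterations as there are points. -/
theorem Mem.Pool.sum_FL_le (hp : σ.Pool lab A k m) {S : Finset X}
    (hS : ∀ x ∈ A, x ∈ S) :
    ∑ i ∈ Finset.range (σ.nat (4, 0, 0, 0)), σ.nat (6, σ.nat (5, i, 0, 0), 0, 0) ≤ S.card := by
  have h1 := Finset.card_sigma (Finset.range (σ.nat (4, 0, 0, 0)))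
    fun i => Finset.range (σ.nat (6, σ.nat (5, i, 0, 0), 0, 0))
  simp only [Finset.card_range] at h1
  rw [← h1, ← Finset.card_map (Function.Embedding.some : X ↪ Option X)]
  refine Finset.card_le_card_of_injOn (fun q => σ.pt (4, σ.nat (5, q.1, 0, 0), q.2, 0)) ?_ ?_
  · rintro ⟨i, p⟩ hq
    simp only [Finset.coe_sigma, Set.mem_sigma_iff, Finset.coe_range, Set.mem_Iio] at hq
    obtain ⟨x, hx, hx', -⟩ := hp.F_mem _ p hq.2
    simp [hx', hS x hx]
  · rintro ⟨i, p⟩ hq ⟨j, q⟩ hq' he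
    simp only [Finset.coe_sigma, Set.mem_sigma_iff, Finset.coe_range, Set.mem_Iio] at hq hq' he
    obtain ⟨x, -, hx, hxl⟩ := hp.F_mem _ p hq.2
    obtain ⟨y, -, hy, hyl⟩ := hp.F_mem _ q hq'.2
    rw [hx, hy] at he
    cases he
    obtain rfl := hp.GL_inj i hq.1 j hq'.1 (hxl.symm.trans hyl)
    rw [hp.F_inj _ p hq.2 q hq'.2 (hx.trans hy.symm)]

variable [MetricSpace X]

/-- Points have no equality test; a distance that is not positive stands in for it. The conditions
on `src` make its address insensitive to the writes that precede its uses. -/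
theorem tryAddCmd_spec {src : Ref} {a : ℕ} (h : σ.Out lab C) (hx : σ.pt (src.addr lab σ) = some x)
    (hs : ∀ i, src.addr lab (σ.setNat (46, 0, 0, 0) i) = src.addr lab σ)
    (hs' : ∀ i, src.addr lab ((σ.setNat (46, 0, 0, 0) i).setPoint (1, C.card, 0, 0) x) =
      src.addr lab σ) (h1 : src.arr ≠ 1)
    (ht : src.time ≤ 20) (hk : σ.nat (0, 0, 0, 0) = k)
    (hc : ∀ g, σ.nat (a, g, 0, 0) = cap g) :
    Runs lab (tryAddCmd src a) σ fun t σ' => t ≤ 300 * (k + 1) ∧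
      ∃ C', σ'.Out lab C' ∧ Grow lab cap k {x} C C' ∧ Tried lab cap k C' x := by
  classical
  rw [tryAddCmd, runs_ite]
  have hb : (BExp.and (ltE (nv 50) (nv 0)) (ltE (n1 51 (grp src)) (n1 a (grp src)))).holds lab σ ↔
      C.card < k ∧ groupCard lab C (lab x) < cap (lab x) := by
    simp [h.tot, hk, hx, h.oc, hc]
  rw [hb]
  refine ⟨?_, ?_⟩
  swap
  · intro hn
    rw [runs_skip]
    refine ⟨by simp; omega, C, h, .refl, ?_⟩
    rcases not_and_or.1 hn with a | a
    · exact .inr (.inl (not_lt.1 a))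
    · exact .inr (.inr (not_lt.1 a))
  rintro ⟨hCk, hcap⟩
  simp only [block_cons, block_singleton]
  rw [runs_seq, runs_setNat, runs_seq]
  refine (Runs.loop (Q := fun σ' => ∃ i ≤ C.card, σ' = σ.setNat (46, 0, 0, 0) i ∧
      (∀ j < i, σ.pt (1, j, 0, 0) ≠ some x) ∧ (i < C.card → σ.pt (1, i, 0, 0) = some x))
    (B := (C.card + 1) * 100)
    (fun B σ' => ∃ i ≤ C.card, σ' = σ.setNat (46, 0, 0, 0) i ∧ (∀ j < i, σ.pt (1, j, 0, 0) ≠ some x) ∧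
      B = (C.card - i + 1) * 100) ?_ ?_ ⟨0, by omega, by simp, by simp, by simp⟩).mono ?_
  · rintro B σ' ⟨i, hi, rfl, hj, rfl⟩ hb
    refine ⟨by simp; omega, i, hi, rfl, hj, fun hic => ?_⟩
    simp [h.tot, hic, hs, hx] at hb
    cases hp : σ.pt (1, i, 0, 0) with
    | none =>
      have := (h.empty i).1 hp
      omega
    | some y =>
      rw [hp, cellDist_some] at hb
      rw [dist_le_zero.1 hb]
  · rintro B σ' ⟨i, hi, rfl, hj, rfl⟩ hb
    simp [h.tot, hs, hx] at hb
    rw [inc, runs_setNat]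
    refine ⟨(C.card - (i + 1) + 1) * 100, by simp; omega, i + 1, by omega, ?_, ?_, rfl⟩
    · simp [setNat_setNat]
    · intro j hj'
      rcases Nat.lt_succ_iff_lt_or_eq.1 hj' with a | rfl
      · exact hj j a
      · intro he
        rw [he, cellDist_some, dist_self] at hb
        exact lt_irrefl _ hb.2
  rintro t₁ σ₁ ⟨ht₁, i, hi, rfl, hj, hij⟩
  rw [runs_ite]
  have hb' : (ltE (nv 46) (nv 50)).holds lab (σ.setNat (46, 0, 0, 0) i) ↔ i < C.card := by
    simp [h.tot]
  rw [hb']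
  refine ⟨fun hic => ?_, fun hic => ?_⟩
  · rw [runs_skip]
    refine ⟨by simp; omega, C, h.congr (by simp) (by simp) (by simp), .refl, .inl ?_⟩
    exact (h.mem x).2 ⟨i, hic, hij hic⟩
  obtain rfl : i = C.card := by omega
  have hxC : x ∉ C := fun hxC => by
    obtain ⟨j, hjC, hjx⟩ := (h.mem x).1 hxC
    exact hj j hjC hjx
  rw [runs_seq, runs_setPoint]
  have hne : src.addr lab σ ≠ (1, C.card, 0, 0) := fun he => h1 (congrArg Prod.fst he)
  refine ⟨x, by rw [hs]; exact hx, ?_⟩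
  rw [runs_seq, runs_setNat, inc, runs_setNat]
  have hcard : (insert x C).card = C.card + 1 := Finset.card_insert_of_notMem hxC
  have hgc : ∀ g, groupCard lab (insert x C) g = groupCard lab C g + if lab x = g then 1 else 0 := by
    intro g
    unfold groupCard
    rw [Finset.filter_insert]
    split_ifs with hg
    · exact Finset.card_insert_of_notMem (by simp [hxC])
    · rfl
  have e1 : (rf1 1 (nv 50)).addr lab (σ.setNat (46, 0, 0, 0) C.card) = (1, C.card, 0, 0) := by
    simp [h.tot]
  have e2 : (grp src).eval lab ((σ.setNat (46, 0, 0, 0) C.card).setPoint (1, C.card, 0, 0) x) =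
      lab x := by
    simp [hs', hne, hx]
  refine ⟨?_, insert x C, ⟨?_, ?_, ?_, ?_⟩, ⟨Finset.subset_insert _ _, ?_, ?_, ?_⟩,
    .inl (Finset.mem_insert_self _ _)⟩
  · simp
    omega
  · simp [e1, e2, hcard, h.tot]
  · intro y
    rw [hcard, Finset.mem_insert, h.mem y]
    simp only [outputCell, e1, setNat_pt, setPoint_pt, Prod.mk.injEq]
    constructor
    · rintro (rfl | ⟨j, hj', hy⟩)
      · exact ⟨C.card, by omega, by simp⟩
      · exact ⟨j, by omega, by simpa [hj'.ne] using hy⟩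
    · rintro ⟨j, hj', hy⟩
      rcases Nat.lt_succ_iff_lt_or_eq.1 hj' with a | rfl
      · exact .inr ⟨j, a, by simpa [a.ne] using hy⟩
      · simp at hy
        exact .inl hy.symm
  · intro g
    rw [hgc]
    by_cases hg : lab x = g
    · subst hg
      simp [e1, e2, h.oc]
    · simp [e1, e2, h.oc, hg, Ne.symm hg]
  · intro j
    rw [hcard]
    by_cases hj' : j = C.card
    · simp [e1, hj']
    · simp [e1, h.empty j, hj']
      omega
  · intro y hy
    rcases Finset.mem_insert.1 hy with rfl | hy
    · exact .inr rfl
    · exact .inl hy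
  · omega
  · intro g
    rw [hgc]
    split_ifs with hg
    · subst hg; omega
    · omega

theorem fillPoolCmd_spec {a : ℕ} (h : σ.Out lab C) (hp : σ.Pool lab A k m)
    (hk : σ.nat (0, 0, 0, 0) = k) (hc : ∀ g, σ.nat (a, g, 0, 0) = cap g)
    (ha : a ∉ (fillPoolCmd a).wN)
    (hn : ∑ i ∈ Finset.range (σ.nat (4, 0, 0, 0)), σ.nat (6, σ.nat (5, i, 0, 0), 0, 0) ≤ n) :
    Runs lab (fillPoolCmd a) σ fun t σ' => t ≤ 2000 * ((k + 1) * (n + 1)) ∧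
      ∃ C', σ'.Out lab C' ∧ Grow lab cap k A C C' ∧
        ∀ i < σ.nat (4, 0, 0, 0), ∀ p < σ.nat (6, σ.nat (5, i, 0, 0), 0, 0), ∀ x,
          σ.pt (4, σ.nat (5, i, 0, 0), p, 0) = some x → Tried lab cap k C' x := by
  obtain ⟨W, hW⟩ : ∃ W, W = [14, 13, 46, 51, 50] := ⟨_, rfl⟩
  have hw : ∀ b ∈ (tryAddCmd (rf2 4 (n1 5 (nv 14)) (nv 13)) a).wN, b ∈ W := by
    rw [hW]
    simp [tryAddCmd, Cmd.wN, inc, rf0, rf1]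
  have haW : a ∉ W := by
    intro hm
    apply ha
    rw [hW] at hm
    simp [fillPoolCmd, forUp, tryAddCmd, Cmd.wN, inc, rf0, rf1] at hm ⊢
    tauto
  obtain ⟨G, hG⟩ : ∃ G, σ.nat (4, 0, 0, 0) = G := ⟨_, rfl⟩
  obtain ⟨gl, hGL⟩ : ∃ gl : ℕ → ℕ, ∀ i, σ.nat (5, i, 0, 0) = gl i := ⟨_, fun _ => rfl⟩
  obtain ⟨fl, hFL⟩ : ∃ fl : ℕ → ℕ, ∀ i, σ.nat (6, i, 0, 0) = fl i := ⟨_, fun _ => rfl⟩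
  have hpos : ∀ i < G, 0 < fl (gl i) := by
    intro i hi
    obtain ⟨x, hx, hx'⟩ := hp.GL_mem i (hG ▸ hi)
    have := hp.FL_pos x hx
    rwa [hx', hGL, hFL] at this
  simp only [hG, hGL, hFL] at hn ⊢
  rw [fillPoolCmd, runs_seq, runs_setNat]
  refine (Runs.forUp_total G (fun i t σ' => t ≤ ∑ j ∈ Finset.range i, fl (gl j) * (800 * (k + 1)) ∧
    Frame W [] [1] σ σ' ∧ ∃ C', σ'.Out lab C' ∧ Grow lab cap k A C C' ∧ ∀ j < i, ∀ p < fl (gl j), ∀ x,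
      σ.pt (4, gl j, p, 0) = some x → Tried lab cap k C' x) ?_ ?_ ?_ ?_ ?_).mono ?_
  · simp [tryAddCmd, Cmd.wN, inc, rf0, rf1, forUp]
  · rintro i t σ' ⟨-, hF, -⟩
    rw [nv_eval, hF.nat 4 _ (by simp [hW]), hG]
  · rintro i t σ₁ hi h14 ⟨ht, hF₁, C₁, hC₁, hg₁, hd₁⟩
    have e5 : ∀ {σ' : Mem X}, Frame W [] [1] σ σ' → ∀ i, σ'.nat (5, i, 0, 0) = gl i :=
      fun hF i => (hF.nat 5 _ (by simp [hW])).trans (hGL i)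
    rw [runs_seq, runs_setNat]
    refine (Runs.forUp (fl (gl i)) (300 * (k + 1)) (fun p σ' => σ'.nat (14, 0, 0, 0) = i ∧
      Frame W [] [1] σ σ' ∧ ∃ C', σ'.Out lab C' ∧ Grow lab cap k A C₁ C' ∧ ∀ p' < p, ∀ x,
        σ.pt (4, gl i, p', 0) = some x → Tried lab cap k C' x) ?_ ?_ ?_ ?_ ?_).mono ?_
    · simp [tryAddCmd, Cmd.wN, inc, rf0, rf1]
    · rintro p σ' ⟨h14', hF', -⟩
      simp [h14', e5 hF', hF'.nat 6 _ (show 6 ∉ W by simp [hW]), hFL]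
    · rintro p σ₂ hp' h13 ⟨h14', hF₂, C₂, hC₂, hg₂, hd₂⟩
      obtain ⟨x, hxA, hx, -⟩ := hp.F_mem (gl i) p (by rw [hFL]; exact hp')
      have haddr : (rf2 4 (n1 5 (nv 14)) (nv 13)).addr lab σ₂ = (4, gl i, p, 0) := by
        simp [h14', e5 hF₂, h13]
      refine (tryAddCmd_spec (x := x) hC₂ (by rw [haddr, hF₂.pt 4 _ (by simp), hx]) (fun _ => by simp)
        (fun _ => by simp) (by simp [rf2]) (by simp)
        ((hF₂.nat 0 _ (by simp [hW])).trans hk) (fun g => (hF₂.nat a _ haW).trans (hc g))).mono_frame ?_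
      rintro t₃ σ₃ hF₃ ⟨ht₃, C₃, hC₃, hg₃, hd₃⟩
      have hF₃' : Frame W [] [1] σ₂ σ₃ := hF₃.mono hw (by
        simp [tryAddCmd, Cmd.wR, inc]) (by simp [tryAddCmd, Cmd.wP, inc, rf1])
      refine ⟨ht₃, ?_, (hF₂.self_trans hF₃').setNat (by simp [hW]) _ _, C₃,
        hC₃.congr (by simp) (by simp) (by simp), hg₂.trans (hg₃.mono (by simpa using hxA)), ?_⟩
      · rw [setNat_nat, if_neg (by simp), hF₃.nat 14 _ (by simp [tryAddCmd, Cmd.wN, inc, rf0, rf1]),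
          h14']
      · intro p' hp'' y hy
        rcases Nat.lt_succ_iff_lt_or_eq.1 hp'' with b | rfl
        · exact (hd₂ p' b y hy).mono hg₃.sub
        · rw [hx] at hy
          cases hy
          exact hd₃
    · simp
    · exact ⟨by simpa using h14, hF₁.setNat (by simp [hW, rf0]) _ _, C₁,
        hC₁.congr (by simp) (by simp) (by simp), .refl, by simp⟩
    · rintro t₂ σ₂ ⟨ht₂, -, h14', hF₂, C₂, hC₂, hg₂, hd₂⟩
      refine ⟨?_, hF₂.setNat (by simp [hW]) _ _, C₂, hC₂.congr (by simp) (by simp) (by simp),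
        hg₁.trans hg₂, ?_⟩
      · rw [Finset.sum_range_succ]
        -- The overhead of the inner loop is absorbed because each group seen has at least one point
        -- in the pool.
        have h1 : (fl (gl i) + 1) * (300 * (k + 1) + (n1 6 (n1 5 (nv 14))).time + 20) ≤
            (2 * fl (gl i)) * (390 * (k + 1)) := by
          have := hpos i hi
          simp only [n1_time, nv_time]
          apply Nat.mul_le_mul <;> omega
        have h2 : 1 * (k + 1) ≤ fl (gl i) * (k + 1) := Nat.mul_le_mul_right _ (hpos i hi)
        have h3 : (2 * fl (gl i)) * (390 * (k + 1)) = 780 * (fl (gl i) * (k + 1)) := by ring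
        have h4 : fl (gl i) * (800 * (k + 1)) = 800 * (fl (gl i) * (k + 1)) := by ring
        rw [h3] at h1
        rw [h4]
        simp only [rf0_time, const_time] at ht₂ ⊢
        omega
      · intro j hj p hp' y hy
        rcases Nat.lt_succ_iff_lt_or_eq.1 hj with b | rfl
        · exact (hd₁ j b p hp' y hy).mono hg₂.sub
        · exact hd₂ p hp' y hy
  · simp
  · exact ⟨by simp, (Frame.refl _).setNat (by simp [hW, rf0]) _ _, C,
      h.congr (by simp) (by simp) (by simp), .refl, by simp⟩
  · rintro t σ' ⟨t', ht, -, ht', hF, C', hC', hg, hd⟩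
    refine ⟨?_, C', hC', hg, hd⟩
    rw [← Finset.sum_mul] at ht'
    have h1 : G ≤ n := by
      refine le_trans ?_ hn
      calc G = ∑ i ∈ Finset.range G, 1 := by simp
        _ ≤ _ := Finset.sum_le_sum fun i hi => hpos i (Finset.mem_range.1 hi)
    have h2 := ht'.trans (Nat.mul_le_mul_right _ hn)
    have h3 : n * (800 * (k + 1)) ≤ 800 * ((k + 1) * (n + 1)) := by
      calc n * (800 * (k + 1)) = 800 * ((k + 1) * n) := by ring
        _ ≤ _ := by gcongr; omega
    have h4 : 1 * (n + 1) ≤ (k + 1) * (n + 1) := Nat.mul_le_mul_right _ (by omega)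
    simp only [nv_time, rf0_time, const_time] at ht ⊢
    omega

end
end FairStream

/-! ### Completion to a feasible solution -/

namespace FairStream

section
variable {X : Type*} {lab : X → ℕ} {cap l u : ℕ → ℕ} {k m n : ℕ} {A : Set X} {C : Finset X}
  {σ : Mem X}

/-- As long as `C` has fewer than `k` points and the group is below `cap`, every pool point of the
group must have been taken. The pool has either `k` of them, which is too many, or the whole group,
which has at least `cap g` points. -/
theorem Mem.Pool.le_groupCard (hp : σ.Pool lab A k m) (hC : ∀ i < σ.nat (4, 0, 0, 0),
      ∀ p < σ.nat (6, σ.nat (5, i, 0, 0), 0, 0), ∀ x,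
      σ.pt (4, σ.nat (5, i, 0, 0), p, 0) = some x → Tried lab cap k C x) (hk : C.card < k) {g : ℕ}
    (hg : ∀ D : Finset X, (∀ x ∈ A, lab x = g → x ∈ D) → cap g ≤ D.card) :
    cap g ≤ groupCard lab C g := by
  by_contra! hlt
  have hin : ∀ p < σ.nat (6, g, 0, 0), ∀ x ∈ A, lab x = g → σ.pt (4, g, p, 0) = some x → x ∈ C := by
    rintro p hpl x hx rfl hpx
    obtain ⟨i, hi, hi'⟩ := hp.seen x hx
    have := hC i hi p (by rwa [hi']) x (by rwa [hi'])
    rcases this with a | a | a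
    · exact a
    · omega
    · omega
  refine hlt.not_ge (hg _ fun x hx hxg => Finset.mem_filter.2 ⟨?_, hxg⟩)
  rcases hp.full x hx with hf | ⟨p, hpl, hpx⟩
  · exfalso
    rw [hxg] at hf
    refine hk.not_ge ?_
    have := Finset.card_le_card_of_injOn (s := Finset.range k)
      (t := C.map (Function.Embedding.some : X ↪ Option X)) (fun p => σ.pt (4, g, p, 0)) ?_ ?_
    · simpa using this
    · intro p hpk
      have hpk : p < σ.nat (6, g, 0, 0) := hf ▸ Finset.mem_range.1 (Finset.mem_coe.1 hpk)
      obtain ⟨y, hy, hpy, hyg⟩ := hp.F_mem g p hpk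
      simp [hpy, hin p hpk y hy hyg hpy]
    · intro p hpk q hqk he
      have hpk : p < σ.nat (6, g, 0, 0) := hf ▸ Finset.mem_range.1 (Finset.mem_coe.1 hpk)
      have hqk : q < σ.nat (6, g, 0, 0) := hf ▸ Finset.mem_range.1 (Finset.mem_coe.1 hqk)
      exact hp.F_inj g p hpk q hqk he
  · exact hin p (hxg ▸ hpl) x hx hxg (hxg ▸ hpx)

variable [MetricSpace X] {ε : ℝ}

/-- The chosen representatives are output first, then points up to the lower bounds, then points up
to the upper bounds until there are `k`. The condition on the surplus ensures that the second stage
never runs out of room, and `k ≤ ∑ u` that the third one reaches `k`. -/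
theorem fillCmd_spec (h : σ.Solved lab A l u k m ε) (h48 : σ.nat (48, 0, 0, 0) ≠ 0)
    (h50 : σ.nat (50, 0, 0, 0) = 0) (h51 : ∀ g, σ.nat (51, g, 0, 0) = 0)
    (hpt : ∀ j, σ.pt (1, j, 0, 0) = none) (hlab : ∀ x, lab x < m) (hlu : ∀ g, l g ≤ u g)
    (hu : k ≤ ∑ g ∈ Finset.range m, u g)
    (hA : ∀ g, ∀ D : Finset X, (∀ x ∈ A, lab x = g → x ∈ D) → u g ≤ D.card)
    (hA0 : A.Nonempty) {S : Finset X} (hS : ∀ x ∈ A, x ∈ S) :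
    Runs lab fillCmd σ fun t σ' => t ≤ 5000 * ((k + 1) * (S.card + k + 1)) ∧
      ∃ C, σ'.Out lab C ∧ FairSet lab A l u k C ∧ Covers A C (σ.real (6, 0, 0, 0)) := by
  classical
  have hout : σ.Out lab ∅ :=
    ⟨by simpa using h50, by intro x; simp, fun g => by simpa [groupCard] using h51 g, by simpa using hpt⟩
  obtain ⟨T, f, h49, hf, hfu, hfk, hcov⟩ := h.best h48
  have : Nonempty X := ⟨hA0.some⟩
  choose! b hbA hbp hbf using hf
  have hfm : ∀ v < T, f v < m := fun v hv => hbf v hv ▸ hlab _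
  have hTk : T ≤ k := by
    rw [← sum_mcount hfm]
    refine le_trans ?_ hfk
    unfold surplus
    rw [← Finset.sum_add_distrib]
    exact Finset.sum_le_sum fun g _ => by omega
  simp only [fillCmd, block_cons, block_singleton]
  rw [runs_seq, runs_setNat, runs_seq]
  simp only [rf0_addr, const_eval]
  have hF₀ : Frame [45, 46, 51, 50] [] [1] σ (σ.setNat (45, 0, 0, 0) 0) :=
    (Frame.refl _).setNat (by simp) _ _
  refine (Runs.forUp T (300 * (k + 1)) (fun i σ' => Frame [45, 46, 51, 50] [] [1] σ σ' ∧
    ∃ C, σ'.Out lab C ∧ Grow lab u k {x | ∃ v < T, b v = x} ∅ C ∧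
      ∀ v < i, Tried lab u k C (b v)) (by decide) ?_ ?_ (by simp)
      ⟨hF₀, ∅, hout.congr (by simp) (by simp) (by simp), .refl, by simp⟩).mono ?_
  · rintro i σ' ⟨hF, -⟩
    rw [nv_eval, hF.nat 49 _ (by simp), h49]
  · rintro i σ₁ hi h45 ⟨hF₁, C₁, hC₁, hg₁, hd₁⟩
    have haddr : (rf1 6 (nv 45)).addr lab σ₁ = (6, i, 0, 0) := by simp [h45]
    refine (tryAddCmd_spec (x := b i) (k := k) (cap := u) hC₁
      (by rw [haddr, hF₁.pt 6 _ (by simp), hbp i hi]) (fun _ => by simp) (fun _ => by simp)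
      (by simp [rf1]) (by simp) ((hF₁.nat 0 _ (by simp)).trans h.base.k_eq)
      (fun g => (hF₁.nat 2 _ (by simp)).trans (h.base.u_eq g))).mono_frame ?_
    rintro t₂ σ₂ hF₂ ⟨ht₂, C₂, hC₂, hg₂, hd₂⟩
    refine ⟨ht₂, (hF₁.self_trans (hF₂.mono (by simp [tryAddCmd, Cmd.wN, inc, rf0, rf1])
      (by simp [tryAddCmd, Cmd.wR, inc]) (by simp [tryAddCmd, Cmd.wP, inc, rf1]))).setNat (by simp) _ _,
      C₂, hC₂.congr (by simp) (by simp) (by simp), hg₁.trans (hg₂.mono ?_), ?_⟩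
    · rintro x rfl
      exact ⟨i, hi, rfl⟩
    · intro v hv
      rcases Nat.lt_succ_iff_lt_or_eq.1 hv with a | rfl
      · exact (hd₁ v a).mono hg₂.sub
      · exact hd₂
  rintro t₁ σ₁ ⟨ht₁, -, hF₁, C₁, hC₁, hg₁, hd₁⟩
  have hB : ∀ x ∈ C₁, ∃ v < T, b v = x := fun x hx => (hg₁.mem x hx).resolve_left (by simp)
  have hcount : ∀ g, groupCard lab C₁ g ≤ mcount f T g := by
    intro g
    have : (C₁.filter fun x => lab x = g) ⊆ ((Finset.range T).filter fun v => f v = g).image b := by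
      intro x hx
      obtain ⟨hx, hxg⟩ := Finset.mem_filter.1 hx
      obtain ⟨v, hv, rfl⟩ := hB x hx
      exact Finset.mem_image.2 ⟨v, Finset.mem_filter.2
        ⟨Finset.mem_range.2 hv, by rw [← hbf v hv, hxg]⟩, rfl⟩
    exact (Finset.card_le_card this).trans Finset.card_image_le
  -- A point left out would make the output a set of other chosen points, hence smaller than both
  -- limits, so it would have been added. This does not require the chosen points to be distinct.
  have hbC : ∀ v < T, b v ∈ C₁ := by
    intro v hv
    by_contra hvC
    have hlt : ∀ (p : ℕ → Prop) [DecidablePred p], p v → ∀ D ⊆ C₁, (∀ x ∈ D, ∀ w < T, b w = x → p w) →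
        D.card < ((Finset.range T).filter p).card := by
      intro p _ hpv D hD hp
      have : D ⊆ (((Finset.range T).filter p).erase v).image b := by
        intro x hx
        obtain ⟨w, hw, rfl⟩ := hB x (hD hx)
        refine Finset.mem_image.2 ⟨w, Finset.mem_erase.2 ⟨?_, Finset.mem_filter.2
          ⟨Finset.mem_range.2 hw, hp _ hx w hw rfl⟩⟩, rfl⟩
        rintro rfl
        exact hvC (hD hx)
      exact ((Finset.card_le_card this).trans Finset.card_image_le).trans_lt
        (Finset.card_erase_lt_of_mem (Finset.mem_filter.2 ⟨Finset.mem_range.2 hv, hpv⟩))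
    rcases hd₁ v hv with a | a | a
    · exact hvC a
    · have := hlt (fun _ => True) trivial C₁ subset_rfl fun _ _ _ _ _ => trivial
      simp at this
      omega
    · refine (hfu (lab (b v))).not_gt (a.trans_lt (hlt (fun w => f w = lab (b v)) (hbf v hv).symm _
        (Finset.filter_subset _ _) ?_))
      rintro x hx w hw rfl
      rw [← hbf w hw]
      exact (Finset.mem_filter.1 hx).2
  -- The room that the lower bounds need on top of the chosen points, provided by the surplus
  -- condition.
  have hsum : ∑ g ∈ Finset.range m, max (groupCard lab C₁ g) (l g) ≤ k := by
    refine le_trans ?_ hfk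
    unfold surplus
    rw [← Finset.sum_add_distrib]
    refine Finset.sum_le_sum fun g _ => ?_
    have := hcount g
    omega
  have hp₁ := hF₁.pool (by decide) (by decide) (by decide) (by decide) h.pool
  rw [runs_seq]
  refine (fillPoolCmd_spec hC₁ hp₁ ((hF₁.nat 0 _ (by simp)).trans h.base.k_eq)
    (fun g => (hF₁.nat 1 _ (by simp)).trans (h.base.l_eq g)) (by decide)
    (hp₁.sum_FL_le hS)).mono_frame ?_
  rintro t₂ σ₂ hF₂ ⟨ht₂, C₂, hC₂, hg₂, hd₂⟩
  have hp₂ := hF₂.pool (by decide) (by decide) (by decide) (by decide) hp₁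
  have hl₂ : ∀ g, l g ≤ groupCard lab C₂ g := by
    intro g
    by_contra! hlt
    refine hlt.not_ge (hp₁.le_groupCard hd₂ ?_ fun D hD => (hlu g).trans (hA g D hD))
    -- A group short of its lower bound makes the inequality of sums strict, so the output has fewer
    -- than `k` points and the pool was exhausted for this group.
    rw [← sum_groupCard hlab]
    refine lt_of_lt_of_le ?_ hsum
    refine Finset.sum_lt_sum (fun g _ => hg₂.count g) ⟨g, ?_, lt_max_of_lt_right hlt⟩
    by_contra hgm
    have := (hlu g).trans (hA g ∅ fun x _ hx => absurd (hx ▸ hlab x) (by simpa using hgm))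
    simp at this
    omega
  refine (fillPoolCmd_spec hC₂ hp₂ ((hF₂.nat 0 _ (by decide)).trans
    ((hF₁.nat 0 _ (by simp)).trans h.base.k_eq)) (fun g => (hF₂.nat 2 _ (by decide)).trans
    ((hF₁.nat 2 _ (by simp)).trans (h.base.u_eq g))) (by decide) (hp₂.sum_FL_le hS)).mono ?_
  rintro t₃ σ₃ ⟨ht₃, C₃, hC₃, hg₃, hd₃⟩
  have hu₃ : ∀ g, groupCard lab C₃ g ≤ u g := by
    intro g
    have a₁ := (hcount g).trans (hfu g)
    have a₂ := hg₂.count g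
    have a₃ := hg₃.count g
    have a₄ := hlu g
    omega
  refine ⟨?_, C₃, hC₃, ⟨?_, ?_, fun g => (hl₂ g).trans (groupCard_mono hg₃.sub g), hu₃⟩, ?_⟩
  · have e1 : (T + 1) * (300 * (k + 1) + (nv 49).time + 20) ≤ 400 * ((k + 1) * (S.card + k + 1)) := by
      calc _ ≤ (S.card + k + 1) * (400 * (k + 1)) := by
            simp only [nv_time]
            apply Nat.mul_le_mul <;> omega
        _ = _ := by ring
    have e2 : (k + 1) * (S.card + 1) ≤ (k + 1) * (S.card + k + 1) := by gcongr; omega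
    have e3 : 0 < (k + 1) * (S.card + k + 1) := Nat.mul_pos (by omega) (by omega)
    simp only [rf0_time, const_time]
    omega
  · intro x hx
    rcases hg₃.mem x hx with a | a
    · rcases hg₂.mem x a with a | a
      · obtain ⟨v, hv, rfl⟩ := hB x a
        exact hbA v hv
      · exact a
    · exact a
  · have c₁ := hg₁.card
    have c₂ := hg₂.card
    have c₃ := hg₃.card
    have c₀ : (∅ : Finset X).card = 0 := rfl
    by_contra hne
    have hlt : C₃.card < k := by omega
    refine hlt.not_ge (hu.trans ?_)
    rw [← sum_groupCard hlab C₃]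
    exact Finset.sum_le_sum fun g _ => hp₂.le_groupCard hd₃ hlt (hA g)
  · intro x hx
    obtain ⟨v, hv, hd⟩ := hcov x hx
    refine ⟨b v, hg₃.sub (hg₂.sub (hbC v hv)), ?_⟩
    rwa [hbp v hv, cellDist_some, dist_comm] at hd

end
end FairStream

namespace FairStream

/-! ### The cells in use -/

def NExp.isZero : NExp → Bool
  | const 0 => true
  | _ => false

/-- Points are stored only in the arrays `1` to `6`; the arrays `1` and `6` are one-dimensional and
the arrays `2`, `4`, `5` are two-dimensional. -/
def Cmd.flat : Cmd → Bool
  | setPoint r _ => (decide (r.arr ∈ [1, 6]) && r.j.isZero && r.h.isZero) ||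
      (decide (r.arr ∈ [2, 4, 5]) && r.h.isZero) || decide (r.arr = 3)
  | seq c d => c.flat && d.flat
  | ite _ c d => c.flat && d.flat
  | loop _ c => c.flat
  | _ => true

/-- The cells to which a flat command may write. -/
def Regular (a : Addr) : Prop :=
  (a.1 ∈ [1, 6] ∧ a.2.2.1 = 0 ∧ a.2.2.2 = 0) ∨ (a.1 ∈ [2, 4, 5] ∧ a.2.2.2 = 0) ∨ a.1 = 3

/-- The cells for points used by the algorithm. -/
def usedCells (k m J : ℕ) : Finset Addr :=
  {0} ×ˢ {0} ×ˢ {0} ×ˢ {0} ∪ {1} ×ˢ Finset.range k ×ˢ {0} ×ˢ {0} ∪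
  {2} ×ˢ Finset.range J ×ˢ Finset.range (2 * k) ×ˢ {0} ∪
  {3} ×ˢ Finset.range J ×ˢ Finset.range (2 * k) ×ˢ Finset.range m ∪
  {4} ×ˢ Finset.range m ×ˢ Finset.range k ×ˢ {0} ∪
  {5} ×ˢ Finset.range k ×ˢ Finset.range m ×ˢ {0} ∪ {6} ×ˢ Finset.range k ×ˢ {0} ×ˢ {0}

theorem NExp.eval_of_isZero {X : Type*} {lab : X → ℕ} {σ : Mem X} {e : NExp} (h : e.isZero = true) :
    e.eval lab σ = 0 := by
  match e, h with
  | .const 0, _ => rfl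

theorem card_usedCells {k m J : ℕ} (hk : 1 ≤ k) (hm : 1 ≤ m) :
    (usedCells k m J).card ≤ 5 * ((J + 1) * (k * m)) := by
  unfold usedCells
  refine (Finset.card_union_le _ _).trans ?_
  refine (Nat.add_le_add_right (Finset.card_union_le _ _) _).trans ?_
  refine (Nat.add_le_add_right (Nat.add_le_add_right (Finset.card_union_le _ _) _) _).trans ?_
  refine (Nat.add_le_add_right (Nat.add_le_add_right (Nat.add_le_add_right
    (Finset.card_union_le _ _) _) _) _).trans ?_
  refine (Nat.add_le_add_right (Nat.add_le_add_right (Nat.add_le_add_right (Nat.add_le_add_right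
    (Finset.card_union_le _ _) _) _) _) _).trans ?_
  refine (Nat.add_le_add_right (Nat.add_le_add_right (Nat.add_le_add_right (Nat.add_le_add_right
    (Nat.add_le_add_right (Finset.card_union_le _ _) _) _) _) _) _).trans ?_
  simp only [Finset.card_product, Finset.card_singleton, Finset.card_range]
  have h1 : k * 1 ≤ k * m := Nat.mul_le_mul_left _ hm
  have h2 : J * (k * 1) ≤ J * (k * m) := Nat.mul_le_mul_left _ h1
  have h3 : 1 * 1 ≤ k * m := Nat.mul_le_mul hk hm
  calc _ = 1 + 2 * (k * 1) + 2 * (J * (k * 1)) + 2 * (J * (k * m)) + 2 * (k * m) := by ring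
    _ ≤ 5 * (k * m) + 5 * (J * (k * m)) := by omega
    _ = _ := by ring

section
variable {X : Type*} [MetricSpace X] {lab : X → ℕ} {c : Cmd} {σ σ' : Mem X} {t : ℕ}

/-- The frames control whole arrays only; this rules out writes with nonzero trailing indices, so
that the cells in use can be counted. -/
theorem Exec.pt_of_not_regular (h : Exec lab c σ t σ') (hc : c.flat = true) {a : Addr}
    (ha : ¬ Regular a) : σ'.pt a = σ.pt a := by
  induction h with
  | skip => rfl
  | setNat => rfl
  | setReal => rfl
  | setPoint σ p q x hx =>
    rw [setPoint_pt, if_neg]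
    rintro rfl
    refine ha ?_
    simp only [Cmd.flat, Bool.or_eq_true, Bool.and_eq_true, decide_eq_true_eq] at hc
    rcases hc with (⟨⟨h1, h2⟩, h3⟩ | ⟨h1, h2⟩) | h1
    · exact .inl ⟨h1, NExp.eval_of_isZero h2, NExp.eval_of_isZero h3⟩
    · exact .inr (.inl ⟨h1, NExp.eval_of_isZero h2⟩)
    · exact .inr (.inr h1)
  | seq _ _ _ _ _ _ _ _ _ ih₁ ih₂ =>
    simp only [Cmd.flat, Bool.and_eq_true] at hc
    rw [ih₂ hc.2, ih₁ hc.1]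
  | iteTrue _ _ _ _ _ _ _ _ ih =>
    simp only [Cmd.flat, Bool.and_eq_true] at hc
    exact ih hc.1
  | iteFalse _ _ _ _ _ _ _ _ ih =>
    simp only [Cmd.flat, Bool.and_eq_true] at hc
    exact ih hc.2
  | loopDone => rfl
  | loopStep _ _ _ _ _ _ _ _ _ _ ih₁ ih₂ => rw [ih₂ hc, ih₁ hc]

theorem Feed.pt_of_not_regular {s : List X} (h : Feed lab c s σ t σ') (hc : c.flat = true) {a : Addr}
    (ha : ¬ Regular a) (ha' : a ≠ inputCell) : σ'.pt a = σ.pt a := by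
  induction h with
  | nil => rfl
  | cons x s σ σ' σ'' t t' hx hs ih =>
    rw [ih, hx.pt_of_not_regular hc ha, setPoint_pt, if_neg ha']

theorem Feed.frame {s : List X} (h : Feed lab c s σ t σ') : Frame c.wN c.wR (0 :: c.wP) σ σ' := by
  induction h with
  | nil => exact .refl _
  | cons x s σ σ' σ'' t t' hx hs ih =>
    exact (((Frame.refl _).setPoint (by simp) _ _).self_trans
      (hx.frame.mono (fun _ h => h) (fun _ h => h) (fun _ h => List.mem_cons_of_mem _ h))).self_trans ih

/-! ### The last phase -/

def finishCmd : Cmd := .seq solveCmd fillCmd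

variable {A : Set X} {l u : ℕ → ℕ} {k m J n : ℕ} {ε : ℝ}

theorem finishCmd_spec (hlab : ∀ x, lab x < m) (hg : Grid ε J) {S : Finset X}
    (h : σ.Stream lab A k m ε J S.card) (hlu : ∀ g, l g ≤ u g)
    (hl : ∑ g ∈ Finset.range m, l g ≤ k) (hu : k ≤ ∑ g ∈ Finset.range m, u g)
    (hAu : ∀ g, ∀ D : Finset X, (∀ x ∈ A, lab x = g → x ∈ D) → u g ≤ D.card)
    (h1 : ∀ g, σ.nat (1, g, 0, 0) = l g) (h2 : ∀ g, σ.nat (2, g, 0, 0) = u g)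
    (h50 : σ.nat (50, 0, 0, 0) = 0) (h51 : ∀ g, σ.nat (51, g, 0, 0) = 0)
    (hp1 : ∀ a, σ.pt (1, a) = none) (hp5 : ∀ a, σ.pt (5, a) = none) (hp6 : ∀ a, σ.pt (6, a) = none)
    (hS : ∀ x ∈ A, x ∈ S) {C₀ : Finset X} {r : ℝ} (hr : 0 ≤ r) (hC₀ : FairSet lab A l u k C₀)
    (hcov : Covers A C₀ r) (hkS : k ≤ S.card) (hA : A.Nonempty) :
    Runs lab finishCmd σ fun t σ' =>
      t ≤ σ.potential k J + (J + 1) * (2000000 * (k * S.card)) + 5001 * ((k + 1) * (S.card + k + 1)) ∧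
      (∀ a, Regular a → σ'.pt a ≠ none → a ∈ usedCells k m J) ∧
      ∃ C, σ'.Outputs k C ∧ FairSet lab A l u k C ∧ Covers A C ((13 + 41 * ε) * r) := by
  have hl0 : ∀ g, l g ≠ 0 → ∃ x ∈ A, lab x = g := by
    intro g hlg
    by_contra! hne
    have := (hlu g).trans (hAu g ∅ fun x hx hxg => absurd hxg (hne x hx))
    simp at this
    omega
  rw [finishCmd, runs_seq]
  refine (solveCmd_spec hlab hg h hlu hl hl0 h1 h2 hA hkS).mono_frame ?_
  rintro t₁ σ₁ hF₁ ⟨ht₁, h5₁, h6₁, hb₁, hb₁', hs₁⟩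
  obtain ⟨h48, h6r⟩ := hs₁.bestLE C₀ r hr hC₀ hcov
  have hp1' : ∀ j, σ₁.pt (1, j, 0, 0) = none := fun j => by
    rw [hF₁.pt 1 _ (by decide), hp1]
  refine (fillCmd_spec hs₁ h48 (by rw [hF₁.nat 50 _ (by decide), h50])
    (fun g => by rw [hF₁.nat 51 _ (by decide), h51]) hp1' hlab hlu hu hAu hA hS).mono_frame ?_
  rintro t₂ σ₂ hF₂ ⟨ht₂, C, hC, hfair, hcovC⟩
  refine ⟨?_, ?_, C, hfair.card ▸ hC.mem, hfair, fun x hx => ?_⟩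
  · have : 0 < (k + 1) * (S.card + k + 1) := Nat.mul_pos (by omega) (by omega)
    omega
  · have hv : ∀ j, (σ₁.view j).Box (2 * k) m ∧ ((∃ a, (σ₁.view j).piv a ≠ none) ∨
        (∃ a g, (σ₁.view j).rep a g ≠ none) → j < J) := by
      intro j
      by_cases hj : j < J
      · exact ⟨hb₁ j hj, fun _ => hj⟩
      · have hb := hb₁' j (not_lt.1 hj)
        refine ⟨⟨fun a ha => ?_, fun a g ha => ?_⟩, ?_⟩
        · have := hb.1 a ha; omega
        · have := hb.2 a g ha; omega
        · rintro (⟨a, ha⟩ | ⟨a, g, ha⟩)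
          · have := hb.1 a ha; omega
          · have := hb.2 a g ha; omega
    rintro ⟨b, i, j, h⟩ ha hne
    have hmem : ∀ b ∈ [2, 3, 4, 5, 6], ∀ a, σ₂.pt (b, a) = σ₁.pt (b, a) := by
      intro b hb a
      refine hF₂.pt b _ ?_
      revert b
      decide
    simp only [usedCells, Finset.mem_union, Finset.mem_product, Finset.mem_singleton,
      Finset.mem_range]
    simp only [Regular, List.mem_cons, List.not_mem_nil, or_false] at ha
    rcases ha with ⟨rfl | rfl, rfl, rfl⟩ | ⟨rfl | rfl | rfl, rfl⟩ | rfl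
    · have : i < k := by
        rw [← hfair.card]
        exact not_le.1 fun hi => hne ((hC.empty i).2 hi)
      simp [this]
    · rw [hmem 6 (by simp)] at hne
      have := (h6₁ i hne).resolve_left (by simp [hp6])
      simp [this]
    · rw [hmem 2 (by simp)] at hne
      have h' := (hv i).1.1 j hne
      have := (hv i).2 (.inl ⟨j, hne⟩)
      simp [this, h']
    · rw [hmem 4 (by simp)] at hne
      have := hs₁.pool.box i j hne
      simp [this]
    · rw [hmem 5 (by simp)] at hne
      have := (h5₁ i j hne).resolve_left (by simp [hp5])
      simp [this]
    · rw [hmem 3 (by simp)] at hne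
      have h' := (hv i).1.2 j h hne
      have := (hv i).2 (.inr ⟨j, h, hne⟩)
      simp [this, h']
  · obtain ⟨c, hc, hd⟩ := hcovC x hx
    exact ⟨c, hc, hd.trans h6r⟩

end

/-! ### Feasible solutions -/

/-- Choose `u g` points in each group and `l g` among them; a set of `k` points between the two
unions is fair, since its count in each group lies between the two. -/
theorem exists_fairSet {X : Type*} {lab : X → ℕ} {A : Set X} {l u : ℕ → ℕ} {k m : ℕ}
    (hlab : ∀ x, lab x < m) (hlu : ∀ g, l g ≤ u g)
    (hl : ∑ g ∈ Finset.range m, l g ≤ k) (hu : k ≤ ∑ g ∈ Finset.range m, u g)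
    (hAu : ∀ g, ∀ D : Finset X, (∀ x ∈ A, lab x = g → x ∈ D) → u g ≤ D.card)
    {S : Finset X} (hS : ∀ x, x ∈ S ↔ x ∈ A) : ∃ C, FairSet lab A l u k C := by
  classical
  have hU : ∀ g, ∃ U ⊆ S.filter fun x => lab x = g, U.card = u g := fun g =>
    Finset.exists_subset_card_eq (hAu g _ fun x hx hxg => Finset.mem_filter.2 ⟨(hS x).2 hx, hxg⟩)
  choose U hUS hUc using hU
  have hL : ∀ g, ∃ L ⊆ U g, L.card = l g := fun g =>
    Finset.exists_subset_card_eq ((hlu g).trans (hUc g).ge)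
  choose L hLU hLc using hL
  have hin : ∀ (V : ℕ → Finset X), (∀ g, V g ⊆ U g) → ∀ g,
      ((Finset.range m).biUnion V).filter (fun x => lab x = g) = V g := by
    intro V hV g
    have hVl : ∀ g, ∀ x ∈ V g, lab x = g := fun g x hx => (Finset.mem_filter.1 (hUS g (hV g hx))).2
    ext x
    simp only [Finset.mem_filter, Finset.mem_biUnion, Finset.mem_range]
    constructor
    · rintro ⟨⟨g', -, hx⟩, hxg⟩
      rwa [← hxg, hVl g' x hx]
    · intro hx
      exact ⟨⟨g, hVl g x hx ▸ hlab x, hx⟩, hVl g x hx⟩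
  have hcard : ∀ (V : ℕ → Finset X), (∀ g, V g ⊆ U g) →
      ((Finset.range m).biUnion V).card = ∑ g ∈ Finset.range m, (V g).card := by
    intro V hV
    rw [← sum_groupCard hlab]
    exact Finset.sum_congr rfl fun g _ => by rw [groupCard, hin V hV g]
  obtain ⟨C, h1, h2, h3⟩ := Finset.exists_subsuperset_card_eq (n := k)
    (Finset.biUnion_mono fun g (_ : g ∈ Finset.range m) => hLU g)
    (by rw [hcard L hLU]; simpa [hLc] using hl) (by rw [hcard U fun _ => subset_rfl]; simpa [hUc] using hu)
  refine ⟨C, fun x hx => ?_, h3, fun g => ?_, fun g => ?_⟩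
  · obtain ⟨g, -, hg⟩ := Finset.mem_biUnion.1 (h2 hx)
    exact (hS x).1 (Finset.mem_filter.1 (hUS g hg)).1
  · rw [← hLc g, ← hin L hLU g]
    exact groupCard_mono h1 g
  · rw [← hUc g, ← hin U (fun _ => subset_rfl) g]
    exact groupCard_mono h2 g

section
variable {X : Type*} [MetricSpace X] {s : List X} {C : Finset X} {r : ℝ}

theorem cost_le (hs : s ≠ []) (h : Covers {x | x ∈ s} C r) : cost s C ≤ r := by
  obtain ⟨y, hy⟩ := List.exists_mem_of_ne_nil s hs
  have : Nonempty {x : X // x ∈ s} := ⟨⟨y, hy⟩⟩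
  refine ciSup_le fun x => ?_
  obtain ⟨c, hc, hd⟩ := h x.1 x.2
  exact (ciInf_le (Set.finite_range _).bddBelow (⟨c, hc⟩ : {c : X // c ∈ C})).trans hd

theorem covers_cost (hC : C.Nonempty) : Covers {x | x ∈ s} C (cost s C) := by
  intro x hx
  have : Nonempty {c : X // c ∈ C} := ⟨⟨hC.choose, hC.choose_spec⟩⟩
  have : Finite {x : X // x ∈ s} := List.finite_toSet s
  obtain ⟨c, hc⟩ := exists_eq_ciInf_of_finite (f := fun c : {c : X // c ∈ C} => dist x c.1)
  refine ⟨c.1, c.2, hc.trans_le ?_⟩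
  exact le_ciSup (f := fun x : {x : X // x ∈ s} => ⨅ c : {c : X // c ∈ C}, dist x.1 c.1)
    (Set.finite_range _).bddAbove ⟨x, hx⟩

end
end FairStream

/-! ### Assembly of the algorithm and its guarantees -/

namespace FairStream

/-- The bounds for the groups as a function on the natural numbers. -/
def extendBound {m : ℕ} (l : Fin m → ℕ) (g : ℕ) : ℕ := if h : g < m then l ⟨g, h⟩ else 0

theorem sum_extendBound {m : ℕ} (l : Fin m → ℕ) :
    ∑ g ∈ Finset.range m, extendBound l g = ∑ i, l i := by
  rw [Finset.sum_range]
  simp [extendBound]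

theorem isFair_iff {X : Type*} {k m : ℕ} {group : X → Fin m} {l u : Fin m → ℕ} {s : List X}
    {C : Finset X} : IsFair k m group l u s C ↔
      FairSet (fun x => (group x : ℕ)) {x | x ∈ s} (extendBound l) (extendBound u) k C := by
  have hc : ∀ i : Fin m, {x | x ∈ C ∧ group x = i}.ncard =
      (C.filter fun x => (group x : ℕ) = i).card := by
    intro i
    rw [← Set.ncard_coe_finset]
    congr 1
    ext x
    simp [Fin.ext_iff]
  constructor
  · rintro ⟨h1, h2, h3⟩
    simp only [hc] at h3
    refine ⟨h1, h2, fun g => ?_, fun g => ?_⟩ <;> by_cases hg : g < m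
    · simpa [extendBound, hg] using (h3 ⟨g, hg⟩).1
    · simp [extendBound, hg]
    · simpa [extendBound, hg] using (h3 ⟨g, hg⟩).2
    · rw [Finset.card_eq_zero.2 (Finset.filter_eq_empty_iff.2 fun x _ (hx : (group x : ℕ) = g) =>
        hg (hx ▸ (group x).2))]
      exact Nat.zero_le _
  · rintro ⟨h1, h2, h3, h4⟩
    refine ⟨h1, h2, fun i => ?_⟩
    rw [hc]
    have a := h3 i
    have b := h4 i
    simp only [extendBound, Fin.is_lt, dite_true, Fin.eta] at a b
    exact ⟨a, b⟩

theorem IsInstance.le_card {X : Type*} {k m : ℕ} {group : X → Fin m} {l u : Fin m → ℕ} {s : List X}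
    (h : IsInstance k m group l u s) (g : ℕ) (D : Finset X)
    (hD : ∀ x ∈ {x | x ∈ s}, (group x : ℕ) = g → x ∈ D) : extendBound u g ≤ D.card := by
  unfold extendBound
  split_ifs with hg
  · refine (h.u_le_group _).trans ?_
    rw [← Set.ncard_coe_finset]
    refine Set.ncard_le_ncard (fun x hx => hD x hx.1 ?_) D.finite_toSet
    rw [hx.2]
  · exact Nat.zero_le _

/-- The optimal value is attained. -/
theorem exists_cost_eq_opt {X : Type*} [MetricSpace X] {k m : ℕ} {group : X → Fin m}
    {l u : Fin m → ℕ} {s : List X} (h : ∃ C, IsFair k m group l u s C) :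
    ∃ C, IsFair k m group l u s C ∧ cost s C = opt k m group l u s := by
  classical
  have hfin : {r | ∃ C : Finset X, IsFair k m group l u s C ∧ cost s C = r}.Finite := by
    refine ((s.toFinset.powerset.finite_toSet).image (cost s)).subset ?_
    rintro r ⟨C, hC, rfl⟩
    refine ⟨C, ?_, rfl⟩
    simp only [Finset.coe_powerset, Set.mem_preimage, Set.mem_powerset_iff]
    intro x hx
    simpa using hC.1 x hx
  obtain ⟨C, hC⟩ := h
  refine Set.Nonempty.csInf_mem (s := {r | ∃ C, IsFair k m group l u s C ∧ cost s C = r}) ?_ hfin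
  exact ⟨cost s C, C, hC, rfl⟩

/-- The streaming algorithm: it maintains a summary of the stream for each of `J` guesses of the
optimal value, and solves a bipartite matching problem on each summary after the stream. -/
def alg : StreamAlg := ⟨initCmd, stepCmd, finishCmd⟩

theorem alg_spec {X : Type*} [MetricSpace X] {k m : ℕ} {group : X → Fin m}
    {l u : Fin m → ℕ} {s : List X} {ε : ℝ} (h : IsInstance k m group l u s) (h0 : 0 < ε)
    (h1 : ε ≤ 1 / 2) : ∃ (t : ℕ) (σ : Mem X) (C : Finset X) (J : ℕ),
      alg.Run (fun x => (group x : ℕ)) s (initialMem X k m l u ε) t σ ∧ σ.Outputs k C ∧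
      IsFair k m group l u s C ∧ cost s C ≤ (13 + 41 * ε) * opt k m group l u s ∧
      σ.stored ⊆ usedCells k m J ∧ t ≤ 3000000 * ((J + 1) * (k * s.length)) ∧ 1 ≤ m ∧
      (J + 1 : ℝ) ≤ 4 * (Real.log (1 / ε) / ε) := by
  classical
  obtain ⟨J, hg, hmin, hJ⟩ := exists_grid h0 h1
  have hlab : ∀ x, ((group x : Fin m) : ℕ) < m := fun x => (group x).2
  have hlu : ∀ g, extendBound l g ≤ extendBound u g := fun g => by
    unfold extendBound
    split_ifs
    exacts [h.l_le_u _, le_rfl]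
  have hl : ∑ g ∈ Finset.range m, extendBound l g ≤ k := (sum_extendBound l).trans_le h.sum_l_le
  have hu : k ≤ ∑ g ∈ Finset.range m, extendBound u g := h.le_sum_u.trans (sum_extendBound u).ge
  have hS : ∀ x, x ∈ s.toFinset ↔ x ∈ {x | x ∈ s} := fun x => List.mem_toFinset
  have hSc : s.toFinset.card = s.length := List.toFinset_card_of_nodup h.nodup
  obtain ⟨C₁, hC₁⟩ := exists_fairSet hlab hlu hl hu h.le_card hS
  obtain ⟨C₀, hC₀, hopt⟩ := exists_cost_eq_opt ⟨C₁, isFair_iff.2 hC₁⟩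
  have hne₀ : C₀.Nonempty := Finset.card_pos.1 (by rw [hC₀.2.1]; exact h.one_le_k)
  obtain ⟨y, hy⟩ := hne₀
  have hys : y ∈ s := hC₀.1 y hy
  have hcov : Covers {x | x ∈ s} C₀ (opt k m group l u s) := hopt ▸ covers_cost ⟨y, hy⟩
  have hopt0 : 0 ≤ opt k m group l u s := by
    obtain ⟨c, -, hc⟩ := hcov y hys
    exact dist_nonneg.trans hc
  have hkS : k ≤ s.toFinset.card := by
    rw [← hC₀.2.1]
    exact Finset.card_le_card fun x hx => (hS x).2 (hC₀.1 x hx)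
  obtain ⟨t₁, σ₁, he₁, ht₁, hs₁, hpot₁⟩ := initCmd_spec (X := X) (lab := fun x => (group x : ℕ)) (m := m)
    hg hmin h.one_le_k (l := l) (u := u)
  obtain ⟨t₂, σ₂, he₂, hs₂, ht₂⟩ := feed_spec hlab hg s h.nodup (by simp) hs₁
  rw [Set.empty_union, Nat.zero_add, ← hSc] at hs₂
  have hF := he₁.frame
  have hF' := he₂.frame
  obtain ⟨t₃, σ₃, he₃, ht₃, hcell, C, hout, hfair, hcovC⟩ := finishCmd_spec hlab hg hs₂ hlu hl hu
    h.le_card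
    (fun g => by rw [hF'.nat 1 _ (by decide), hF.nat 1 _ (by decide)]; rfl)
    (fun g => by rw [hF'.nat 2 _ (by decide), hF.nat 2 _ (by decide)]; rfl)
    (by rw [hF'.nat 50 _ (by decide), hF.nat 50 _ (by decide)]; rfl)
    (fun g => by rw [hF'.nat 51 _ (by decide), hF.nat 51 _ (by decide)]; rfl)
    (fun a => by rw [hF'.pt 1 _ (by decide), hF.pt 1 _ (by decide)]; rfl)
    (fun a => by rw [hF'.pt 5 _ (by decide), hF.pt 5 _ (by decide)]; rfl)
    (fun a => by rw [hF'.pt 6 _ (by decide), hF.pt 6 _ (by decide)]; rfl)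
    (fun x hx => (hS x).2 hx) hopt0 (isFair_iff.1 hC₀) hcov hkS ⟨y, hys⟩
  refine ⟨t₁ + t₂ + t₃, σ₃, C, J, ⟨σ₁, σ₂, t₁, t₂, t₃, he₁, he₂, he₃, rfl⟩, hout,
    isFair_iff.2 hfair, cost_le (List.ne_nil_of_mem hys) hcovC, ?_, ?_,
    (Nat.zero_le _).trans_lt (group y).2, hJ⟩
  · intro a ha
    -- Apart from the input cell, only regular cells can ever be written, and those in use after the
    -- last phase have been counted.
    by_cases hr : Regular a
    · exact hcell a hr ha
    · by_cases hi : a = inputCell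
      · subst hi
        simp [usedCells, inputCell]
      · refine absurd ?_ ha
        rw [he₃.pt_of_not_regular (by decide) hr, he₂.pt_of_not_regular (by decide) hr hi,
          he₁.pt_of_not_regular (by decide) hr]
        rfl
  · rw [hSc] at hkS ht₃
    have hk := h.one_le_k
    have e1 : 1 * 1 ≤ k * s.length := Nat.mul_le_mul hk (hk.trans hkS)
    have e2 : (k + 1) * (s.length + k + 1) ≤ 6 * (k * s.length) := by
      calc (k + 1) * (s.length + k + 1) ≤ (2 * k) * (3 * s.length) := by
            apply Nat.mul_le_mul <;> omega
        _ = _ := by ring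
    have e3 : (J + 1) * 1 ≤ (J + 1) * (k * s.length) := Nat.mul_le_mul_left _ e1
    have e4 : 1 * (k * s.length) ≤ (J + 1) * (k * s.length) := Nat.mul_le_mul_right _ (by omega)
    have e5 : s.length * (500000 * ((J + 1) * k)) = 500000 * ((J + 1) * (k * s.length)) := by ring
    have e6 : (J + 1) * (2000000 * (k * s.length)) = 2000000 * ((J + 1) * (k * s.length)) := by ring
    rw [e5, hpot₁] at ht₂
    rw [e6] at ht₃
    omega

end FairStream

theorem mainTheorem2 :
    ∃ (A : FairStream.StreamAlg) (c₁ c₂ c₃ : ℝ),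
      ∀ (X : Type*) [MetricSpace X] (k m : ℕ) (group : X → Fin m) (l u : Fin m → ℕ)
        (s : List X) (ε : ℝ),
        FairStream.IsInstance k m group l u s → 0 < ε → ε ≤ 1 / 2 →
        ∃ (t : ℕ) (σ : FairStream.Mem X) (C : Finset X),
          A.Run (fun x => (group x : ℕ)) s (FairStream.initialMem X k m l u ε) t σ ∧
          σ.Outputs k C ∧
          FairStream.IsFair k m group l u s C ∧
          FairStream.cost s C ≤ (13 + c₁ * ε) * FairStream.opt k m group l u s ∧
          σ.stored.Finite ∧
          (σ.stored.ncard : ℝ) ≤ c₂ * (k * m * (Real.log (1 / ε) / ε)) ∧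
          (t : ℝ) ≤ c₃ * (s.length * k * (Real.log (1 / ε) / ε)) := by
  -- There are at most `5 * (J + 1) * k * m` cells and `3000000 * (J + 1) * k * n` units of time,
  -- where `n` is the length of the stream; `J + 1` contributes the factor `4`.
  refine ⟨FairStream.alg, 41, 20, 12000000, fun X _ k m group l u s ε h h0 h1 => ?_⟩
  obtain ⟨t, σ, C, J, hrun, hout, hfair, hcost, hst, ht, hm, hJ⟩ := FairStream.alg_spec h h0 h1
  refine ⟨t, σ, C, hrun, hout, hfair, hcost, (Finset.finite_toSet _).subset hst, ?_, ?_⟩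
  · have hc : σ.stored.ncard ≤ 5 * ((J + 1) * (k * m)) := by
      refine (Set.ncard_le_ncard hst (Finset.finite_toSet _)).trans ?_
      rw [Set.ncard_coe_finset]
      exact FairStream.card_usedCells h.one_le_k hm
    have hc' : (σ.stored.ncard : ℝ) ≤ 5 * ((J + 1) * (k * m)) := by exact_mod_cast hc
    refine hc'.trans ?_
    calc (5 : ℝ) * ((J + 1) * (k * m)) ≤ 5 * (4 * (Real.log (1 / ε) / ε) * (k * m)) := by gcongr
      _ = _ := by ring
  · have ht' : (t : ℝ) ≤ 3000000 * ((J + 1) * (k * s.length)) := by exact_mod_cast ht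
    refine ht'.trans ?_
    calc (3000000 : ℝ) * ((J + 1) * (k * s.length)) ≤
          3000000 * (4 * (Real.log (1 / ε) / ε) * (k * s.length)) := by gcongr
      _ = _ := by ring
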